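/- **Terms.** Terms are built over a countable set of names, variables, a set $\mathcal G$ of adversarial function symbols (with given arities and result sorts), and the symbols $\langle\_,\_\rangle,\pi_1,\pi_2,\mathsf{pk},\mathsf{sk},\{\_\}^{\_}_{\_}$ (encryption $\{u\}^{r}_{p}$ of $u$ with public key $p$ and randomness $r$), $\mathsf{dec}$, $\mathsf{if\ then\ else}$ (written $\mathsf{ite}$), $\mathsf{true},\mathsf{false},\mathsf{zero}(\_)$, $\mathsf{eq}(\_,\_)$. There are two sorts $\mathsf{bool}\subseteq\mathsf{term}$; the first argument of $\mathsf{ite}$ is boolean, and a conditional is boolean when its two branches are. A term is *if-free* if it contains no $\mathsf{ite}$. Auxiliary symbols are, for every if-free ground term $b$, the *box* $\boxed{a\mid c}_{\,b}$ with boolean arguments $a,c$ ($\mathrm{erase}$ replaces a box by its index $b$), and the freezing symbol $\overline{b}$. Subterms of a box are the box itself and the subterms of its two arguments. **Equations.** $=_R$ is the congruence on well-sorted ground terms (possibly with boxes) generated by: $\pi_i\langle x_1,x_2\rangle=x_i$; $\mathsf{eq}(x,x)=\mathsf{true}$; $\mathsf{dec}(\{x\}^z_{\mathsf{pk}(y)},\mathsf{sk}(y))=x$;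 $f(\vec u,\mathsf{ite}\,b\,x\,y,\vec v)=\mathsf{ite}\,b\,f(\vec u,x,\vec v)\,f(\vec u,y,\vec v)$ for function symbols $f\ne\mathsf{ite}$ (not for boxes); $\mathsf{ite}\,(\mathsf{ite}\,b\,a\,c)\,x\,y=\mathsf{ite}\,b\,(\mathsf{ite}\,a\,x\,y)\,(\mathsf{ite}\,c\,x\,y)$; $\mathsf{ite}\,b\,x\,x=x$; $\mathsf{ite}\,\mathsf{true}\,x\,y=x$; $\mathsf{ite}\,\mathsf{false}\,x\,y=y$; $\mathsf{ite}\,b\,(\mathsf{ite}\,b\,x\,y)\,z=\mathsf{ite}\,b\,x\,z$; $\mathsf{ite}\,b\,x\,(\mathsf{ite}\,b\,y\,z)=\mathsf{ite}\,b\,x\,z$; and the two equations $\mathsf{ite}\,b\,(\mathsf{ite}\,a\,x\,y)\,z=\mathsf{ite}\,a\,(\mathsf{ite}\,b\,x\,z)\,(\mathsf{ite}\,b\,y\,z)$, $\mathsf{ite}\,b\,x\,(\mathsf{ite}\,a\,y\,z)=\mathsf{ite}\,a\,(\mathsf{ite}\,b\,x\,y)\,(\mathsf{ite}\,b\,x\,z)$.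 A term is *in $R$-normal form* if no subterm is the left-hand side of one of the equations, where the last two are oriented by a fixed strict total order on terms (the exchange is a reduction when the outer test $b$ is larger than the inner test $a$). An $R$-normal form of $t$, written $t{\downarrow_R}$, is a term $=_R t$ in $R$-normal form. **Formulas and rules.** A formula $\vec u\sim\vec v$ has two vectors of ground terms of the same length; formulas are taken up to a common permutation of the two vectors. Rules are read from conclusion to premises. * $CS$: from $\vec w,b,(u_i)_i\sim\vec w',b',(u'_i)_i$ and $\vec w,b,(v_i)_i\sim\vec w',b',(v'_i)_i$ derive $\vec w,(\mathsf{ite}\,b\,u_i\,v_i)_i\sim\vec w',(\mathsf{ite}\,b'\,u'_i\,v'_i)_i$, with $b,b'$ if-free and without boxes. * $FA$: from $\vec x,\vec y\sim\vec x',\vec y'$ derive $f(\vec x),\vec y\sim f(\vec x'),\vec y'$, $f\neq\mathsf{zero}$. $FA_s$ is its restriction to $f\ne\mathsf{ite}$. * $R$: replace a component (on one side) by an $=_R$-equal box-free ground term. $Dup$: from $\vec u,t\sim\vec v,t'$ derive $\vec u,t,t\sim\vec v,t',t'$. * $2Box$: from $\vec u,C[\boxed{b\mid b}_{\,\mathrm{erase}(b){\downarrow_R}}]\sim\vec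 u',C'[\boxed{b'\mid b'}_{\,\mathrm{erase}(b'){\downarrow_R}}]$ derive $\vec u,C[b]\sim\vec u',C'[b']$, for if-free boolean $b,b'$, possibly with boxes, where the box indices are if-free. * $R^{\square}$: replace, inside a component $C[s]$ of one side, $s$ by some $t=_R s$, provided that the result is well sorted and that all boxes of $t$ occur in that side of the conclusion. * $CS^{\square}$: from $\vec w,b_1,(u_i)_i\sim\vec w',b'_1,(u'_i)_i$ and $\vec w,b_2,(v_i)_i\sim\vec w',b_2',(v_i')_i$ derive $\vec w,(\mathsf{ite}\,\boxed{b_1\mid b_2}_{\,b}\,u_i\,v_i)_i\sim\vec w',(\mathsf{ite}\,\boxed{b'_1\mid b'_2}_{\,b'}\,u_i'\,v_i')_i$, for a non-empty family and if-free box-free $b,b'$. * $BFA$: from $\vec w,\widehat{b},u,v\sim\vec w',\widehat{b'},u',v'$ derive $\vec w,\mathsf{ite}\,b\,u\,v\sim\vec w',\mathsf{ite}\,b'\,u'\,v'$, with $b,b'$ not of the form $\overline a$; here $\widehat{\mathsf{ite}\,c\,x\,y}=\mathsf{ite}\,\overline{c}\,x\,y$ and $\widehat t=t$ for other terms. $UnF$: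 from the formula where every $\overline b$ is replaced by $b$, derive the formula. * $CCA2$: the axioms below and all their sub-vectors. For a set $\mathcal L$ of words of rule names, $\mathfrak F(\mathcal L)$ is the set of formulas that have a proof all of whose branches, read from the root, spell a word of $\mathcal L$. **$CCA2$.** Let $\mathcal K$ be a finite set of names (the private keys are $\mathsf{sk}(n)$, $n\in\mathcal K$). $\mathsf{nodec}(\mathcal K,t)$ means that each $n\in\mathcal K$ occurs in $t$ only in subterms $\mathsf{pk}(n)$. Two executions $(\phi,X,Z,\rho,\sigma)$ and $(\psi,X,Z,\rho',\sigma')$ ($\phi,\psi$ vectors of ground terms; $X,Z$ disjoint finite sets of encryption and decryption handles; $\rho,\rho'$ give each $x\in X$ its randomness; $\sigma,\sigma'$ give each handle its oracle call) are *matching* when this follows from the clauses: 1. $(\phi,\emptyset,\emptyset,\emptyset,\emptyset)$ matches itself if $\phi$ has box-free ground terms with $\mathsf{nodec}(\mathcal K,\phi)$. 2. If the two executions match, $x$ is a new handle, $n\in\mathcal K$, $u=t\sigma$, $v=t'\sigma'$ with $t,t'$ box-free, without $\mathsf{zero}$, with variables in $Z$, $\mathsf{nodec}(\mathcal K;t,t')$,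 and $r,r'$ are names that do not occur in $\phi,u,\psi,v$, then one may append $\{u\}^r_{\mathsf{pk}(n)}$ to $\phi$ and $\{v\}^{r'}_{\mathsf{pk}(n)}$ to $\psi$, as the oracle calls of the encryption handle $x$, with randomness $r$, $r'$. 3. If the two executions match, $z$ is a new handle, $n\in\mathcal K$, $u=t\sigma$, $v=t\sigma'$ with $t$ box-free, if-free, without $\mathsf{zero}$, with variables in $X\cup Z$ and $\mathsf{nodec}(\mathcal K,t)$, then one may append $\mathsf{elses}(l,\mathsf{dec}(u,\mathsf{sk}(n)))$ to $\phi$ and $\mathsf{elses}(l',\mathsf{dec}(v,\mathsf{sk}(n)))$ to $\psi$, as the oracle calls of the decryption handle $z$. Here $\mathsf{elses}(\epsilon,s)=s$ and $\mathsf{elses}(g\cdot l,s)=\mathsf{ite}\,g\,\mathsf{zero}(s)\,\mathsf{elses}(l,s)$; $l$ is the list of guards $\mathsf{eq}(u,x\sigma)$, $x\in Y_u$, sorted by the ciphertexts $x\sigma$, and $l'$ the list of guards $\mathsf{eq}(v,x\sigma')$, $x\in Y_u$, sorted by the ciphertexts $x\sigma'$, for a fixed strict total order on terms; $Y_u$ is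 the set of the $x\in X$ such that $x\sigma$ is an encryption under $\mathsf{pk}(n)$ and $x\rho$ occurs in the $R$-normal form of $u$ where the plaintexts of the ciphertexts $X\sigma$ are replaced by $\mathsf{zero}(\mathsf{true})$. In clauses 2 and 3 all terms are well sorted, and moreover the names in $X\rho\cup X\rho'$ occur in $\phi,u$ (resp. in $\psi,v$) only as the randomness of the ciphertexts $X\sigma$ (resp. $X\sigma'$). The $CCA2$ axioms are the formulas $\phi\sim\psi\mu$ for matching executions and bijective renamings of names $\mu$. Length constraints are ignored. To one side of an instance we attach $\mathcal S=(\mathcal K,\mathcal R,\mathcal E,\mathcal D)$: the keys, the encryption randomness, the encryptions $x\sigma$ ($x\in X$) and the decryptions $z\sigma$ ($z\in Z$) of that side (renamed by $\mu$ on the right side). **Normalized terms.** The following notions are defined by mutual induction, for $\mathcal S=(\mathcal K,\mathcal R,\mathcal E,\mathcal D)$. * An *$\mathcal S$-encryption oracle call* is a term $\{u\}^r_{\mathsf{pk}(n)}\in\mathcal E$ with $r\in\mathcal R$, $n\in\mathcal K$, $u$ an $\mathcal S$-normalized simple term. * An *$\mathcal S$-decryption oracle call* is a term $\mathsf{elses}\big((\mathsf{eq}(t,\alpha_i))_i,\mathsf{dec}(t,\mathsf{sk}(n))\big)\in\mathcal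 D$ with $n\in\mathcal K$, $t=c[(\beta_j)_j]$ where $c$ is an if-free box-free context in $R$-normal form and the $\beta_j$ are pairwise distinct $\mathcal S$-encryption or $\mathcal S$-decryption oracle calls, and where the $\alpha_i$ are $\mathcal S$-encryption oracle calls that are subterms of $t$. * An *$\mathcal S$-normalized basic term* is a term $U[\vec w,(\alpha_j)_j,(\mathsf{d}_k)_k]$ where $U$ is an if-free context of function symbols other than $\mathsf{zero}$; the $\vec w$ are if-free box-free ground terms in which no name of $\mathcal R$ occurs and with $\mathsf{nodec}(\mathcal K,\vec w)$; the $\alpha_j=\{u_j\}^{r_j}_{\mathsf{pk}(n_j)}$ are $\mathcal S$-encryption oracle calls and the $\mathsf d_k=\mathsf{elses}(l_k,\mathsf{dec}(t_k,\mathsf{sk}(m_k)))$ are $\mathcal S$-decryption oracle calls, all pairwise distinct; and $U[\vec w,(\{[\,]_j\}^{r_j}_{\mathsf{pk}(n_j)})_j,(\mathsf{dec}([\,]_k,\mathsf{sk}(m_k)))_k]$, with distinct holes, is in $R$-normal form. * An *$\mathcal S$-normalized simple term* is an $\mathcal S$-normalized basic term, or $\mathsf{ite}\,b\,u\,v$ with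 $b$ a boolean $\mathcal S$-normalized basic term and $u,v$ $\mathcal S$-normalized simple terms. **Statement.** Every formula between well-sorted ground terms without boxes that belongs to $\mathfrak F((CS+FA+R+Dup+CCA2)^*)$ has a proof all of whose branches follow the ordered strategy $$\mathcal A_\succ=(2Box+R^{\square})^*\cdot (CS^{\square})^*\cdot BFA^*\cdot UnF\cdot FA_s^*\cdot Dup^*\cdot CCA2$$ and which is in *normalized proof form*, i.e. after its $(2Box+R^\square)^*$ prefix: * for each application of $CS^\square$, on boxes $\boxed{b_1\mid b_2}_{\,b}$ and $\boxed{b'_1\mid b'_2}_{\,b'}$ as above, $b$ is if-free and in $R$-normal form and $\mathrm{erase}(b_1)=_R\mathrm{erase}(b_2)=_R b$, and likewise for $b',b'_1,b'_2$; * for each branch $l$, let $\mathcal S_l$ and $\mathcal S'_l$ be attached to the left and the right side of the full $CCA2$ instance of which the leaf of the branch is a sub-vector. Then in the formula reached after the last $CS^\square$ step of the branch, all left components are $\mathcal S_l$-normalized simple terms and all right components are $\mathcal S'_l$-normalized simple terms; and in the formula reached after the step $UnF$, all left components are $\mathcal S_l$-normalized basic terms and all right components are $\mathcal S'_l$-normalized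 basic terms. -/

import Mathlib

namespace CCSA

open scoped Computability

/-- The adversarial function symbols, with their arities and result sorts. -/
structure Signature where
  Adv : Type
  arity : Adv → ℕ
  isBool : Adv → Bool

/-- All function symbols: pairs, projections, `zero`, public and private keys, encryption,
decryption, conditional, booleans, equality test, and the adversarial symbols. -/
inductive Sym (S : Signature) : Type
  | pair | pi1 | pi2 | zero | pk | sk | enc | dec | ite | tru | fls | eq
  | adv (g : S.Adv)

variable {S : Signature}

@[reducible] def Sym.arity : Sym S → ℕ
  | .pair => 2
  | .pi1 => 1
  | .pi2 => 1
  | .zero => 1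
  | .pk => 1
  | .sk => 1
  | .enc => 3
  | .dec => 2
  | .ite => 3
  | .tru => 0
  | .fls => 0
  | .eq => 2
  | .adv g => S.arity g

/-- The symbols other than `ite` whose result has sort `bool`. -/
def Sym.retBool : Sym S → Bool
  | .tru => true
  | .fls => true
  | .eq => true
  | .adv g => S.isBool g
  | _ => false

/-- Terms over names, variables (also used as holes of contexts), function symbols, the split
boxes and the freezing symbol. In `box a c b`, the symbol is the box indexed by the term `b`,
and `a`, `c` are its two arguments. -/
inductive Term (S : Signature) : Type
  | name (n : ℕ)
  | var (x : ℕ)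
  | app (f : Sym S) (args : Fin f.arity → Term S)
  | box (a c b : Term S)
  | frz (b : Term S)

namespace Term

abbrev pair (u v : Term S) : Term S := .app .pair ![u, v]
abbrev pi1 (u : Term S) : Term S := .app .pi1 ![u]
abbrev pi2 (u : Term S) : Term S := .app .pi2 ![u]
abbrev zero (u : Term S) : Term S := .app .zero ![u]
abbrev pk (u : Term S) : Term S := .app .pk ![u]
abbrev sk (u : Term S) : Term S := .app .sk ![u]
/-- Encryption of `u` with public key `p` and randomness `r`. -/
abbrev enc (u p r : Term S) : Term S := .app .enc ![u, p, r]
abbrev dec (u s : Term S) : Term S := .app .dec ![u, s]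
abbrev ite (b u v : Term S) : Term S := .app .ite ![b, u, v]
abbrev tru : Term S := .app .tru ![]
abbrev fls : Term S := .app .fls ![]
abbrev eq (u v : Term S) : Term S := .app .eq ![u, v]

/-- Subterms. The index of a box belongs to the symbol and is not a subterm. -/
def st : Term S → Set (Term S)
  | .name n => {.name n}
  | .var x => {.var x}
  | .app f a => {.app f a} ∪ ⋃ i, st (a i)
  | .box a c b => {.box a c b} ∪ st a ∪ st c
  | .frz b => {.frz b} ∪ st b

def names (t : Term S) : Set ℕ := {n | .name n ∈ t.st}

def vars (t : Term S) : Set ℕ := {x | .var x ∈ t.st}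

/-- The split boxes occurring in a term. -/
def boxes (t : Term S) : Set (Term S) := {s | s ∈ t.st ∧ ∃ a c b, s = .box a c b}

def IfFree (t : Term S) : Prop := ∀ a, .app .ite a ∉ t.st

def NoZero (t : Term S) : Prop := ∀ a, .app .zero a ∉ t.st

/-- No box and no frozen subterm. -/
def Pure (t : Term S) : Prop := (∀ a c b, .box a c b ∉ t.st) ∧ ∀ b, .frz b ∉ t.st

/-- Ground terms over the function symbols and the names. -/
def Plain (t : Term S) : Prop := t.Pure ∧ t.vars = ∅

/-- Ground terms over the function symbols, the names and the split boxes; the index of a box is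
an if-free ground term without boxes. -/
def Boxed (t : Term S) : Prop :=
  t.vars = ∅ ∧ (∀ b, .frz b ∉ t.st) ∧ ∀ a c b, .box a c b ∈ t.st → b.Plain ∧ b.IfFree

/-- Terms of sort `bool`; a conditional is boolean when both its branches are. -/
def IsBool : Term S → Prop
  | .name _ => False
  | .var _ => False
  | .app f a => f.retBool = true ∨ (f = .ite ∧ ∀ i, i.val ≠ 0 → IsBool (a i))
  | .box _ _ _ => True
  | .frz _ => True

/-- Well-sorted terms: the tests of conditionals, the arguments and indices of boxes and the
arguments of the freezing symbol are boolean. -/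
def WS : Term S → Prop
  | .name _ => True
  | .var _ => True
  | .app f a => (∀ i, WS (a i)) ∧ (f = .ite → ∀ i, i.val = 0 → IsBool (a i))
  | .box a c b => (WS a ∧ WS c ∧ WS b) ∧ IsBool a ∧ IsBool c ∧ IsBool b
  | .frz b => WS b ∧ IsBool b

def subst (σ : ℕ → Term S) : Term S → Term S
  | .name n => .name n
  | .var x => σ x
  | .app f a => .app f fun i => subst σ (a i)
  | .box a c b => .box (subst σ a) (subst σ c) (subst σ b)
  | .frz b => .frz (subst σ b)

/-- Injective renaming of names. -/
def rename (μ : Equiv.Perm ℕ) : Term S → Term S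
  | .name n => .name (μ n)
  | .var x => .var x
  | .app f a => .app f fun i => rename μ (a i)
  | .box a c b => .box (rename μ a) (rename μ c) (rename μ b)
  | .frz b => .frz (rename μ b)

/-- Replaces every outermost box by its index. -/
def erase : Term S → Term S
  | .name n => .name n
  | .var x => .var x
  | .app f a => .app f fun i => erase (a i)
  | .box _ _ b => erase b
  | .frz b => .frz (erase b)

/-- A conditional used as a test gets its own test frozen; other terms are unchanged. -/
def freeze : Term S → Term S
  | .app .ite a => .ite (.frz (a 0)) (a 1) (a 2)
  | t => t

def unfreeze : Term S → Term S
  | .name n => .name n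
  | .var x => .var x
  | .app f a => .app f fun i => unfreeze (a i)
  | .box a c b => .box (unfreeze a) (unfreeze c) (unfreeze b)
  | .frz b => unfreeze b

end Term

open Term

/-- `InCtx s t c c'`: there is a one-hole context `C` with `c = C[s]` and `c' = C[t]`. -/
inductive InCtx (s t : Term S) : Term S → Term S → Prop
  | hole : InCtx s t s t
  | app (f : Sym S) (a : Fin f.arity → Term S) (i : Fin f.arity) (r : Term S) :
      InCtx s t (a i) r → InCtx s t (.app f a) (.app f (Function.update a i r))
  | boxL {a a' c b : Term S} : InCtx s t a a' → InCtx s t (.box a c b) (.box a' c b)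
  | boxR {a c c' b : Term S} : InCtx s t c c' → InCtx s t (.box a c b) (.box a c' b)

/-! ### The equational theory `R` and its normal forms -/

inductive R1 : Term S → Term S → Prop
  | proj1 (x y) : R1 (pi1 (pair x y)) x
  | proj2 (x y) : R1 (pi2 (pair x y)) y
  | eq (x) : R1 (Term.eq x x) tru
  | dec (x y z) : R1 (Term.dec (enc x (pk y) z) (sk y)) x

inductive R2 : Term S → Term S → Prop
  | hom (f : Sym S) (hf : f ≠ .ite) (a : Fin f.arity → Term S) (i : Fin f.arity) (b x y : Term S)
      (h : a i = ite b x y) :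
      R2 (.app f a) (ite b (.app f (Function.update a i x)) (.app f (Function.update a i y)))
  | test (b a c x y) : R2 (ite (ite b a c) x y) (ite b (ite a x y) (ite c x y))

inductive R3 : Term S → Term S → Prop
  | same (b x) : R3 (ite b x x) x
  | tru (x y) : R3 (ite tru x y) x
  | fls (x y) : R3 (ite fls x y) y
  | left (b x y z) : R3 (ite b (ite b x y) z) (ite b x z)
  | right (b x y z) : R3 (ite b x (ite b y z)) (ite b x z)

/-- The permutation of two nested tests: `R4 b a s t` exchanges the outer test `b` of `s` and the
inner test `a`. -/
inductive R4 (b a : Term S) : Term S → Term S → Prop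
  | left (x y z) : R4 b a (ite b (ite a x y) z) (ite a (ite b x z) (ite b y z))
  | right (x y z) : R4 b a (ite b x (ite a y z)) (ite a (ite b x y) (ite b x z))

/-- One replacement of an instance of an equation of `R` inside a term. -/
def RStep (c c' : Term S) : Prop :=
  ∃ s t, (R1 s t ∨ R2 s t ∨ R3 s t ∨ ∃ b a, R4 b a s t) ∧ InCtx s t c c'

/-- `s =_R t`, on well-sorted ground terms possibly with boxes. -/
def REq : Term S → Term S → Prop :=
  Relation.EqvGen fun c c' => (c.Boxed ∧ c.WS) ∧ (c'.Boxed ∧ c'.WS) ∧ RStep c c'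

/-- Irreducibility for the rewriting system `R`: `R1`, `R2`, `R3` are oriented from left to
right, and nested tests are exchanged when the outer one is larger. -/
def RNormal (ltU : Term S → Term S → Prop) (t : Term S) : Prop :=
  ∀ s ∈ t.st, ∀ s', ¬ R1 s s' ∧ ¬ R2 s s' ∧ ¬ R3 s s' ∧ ∀ b a, R4 b a s s' → ¬ ltU a b

/-! ### The `CCA2` axioms -/

/-- Every occurrence of the name `n` is in a subterm `pk n`. -/
def NoDec (n : ℕ) : Term S → Prop
  | .name m => m ≠ n
  | .var _ => True
  | .app f a => .app f a = pk (name n) ∨ ∀ i, NoDec n (a i)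
  | .box a c _ => NoDec n a ∧ NoDec n c
  | .frz b => NoDec n b

/-- The names of `R` occur only as randomness of the ciphertexts of `C`. -/
def Hidden (R : Set ℕ) (C : Set (Term S)) : Term S → Prop
  | .name m => m ∉ R
  | .var _ => True
  | .app f a => ∀ i, Hidden R C (a i) ∨ (f = .enc ∧ i.val = 2 ∧ .app f a ∈ C)
  | .box a c _ => Hidden R C a ∧ Hidden R C c
  | .frz b => Hidden R C b

open Classical in
/-- Replaces by `zero true` the plaintext of every outermost occurrence of a ciphertext of `C`. -/
noncomputable def zeroOut (C : Set (Term S)) : Term S → Term S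
  | .name n => .name n
  | .var x => .var x
  | .app f a => .app f fun i =>
      if .app f a ∈ C ∧ i.val = 0 then zero tru else zeroOut C (a i)
  | .box a c b => .box (zeroOut C a) (zeroOut C c) b
  | .frz b => .frz (zeroOut C b)

/-- Nested conditionals on the guards `gs`, with `zero x` in the positive branches. -/
def elses (gs : List (Term S)) (x : Term S) : Term S :=
  gs.foldr (fun g acc => ite g (zero x) acc) x

/-- One side of an execution: the vector of terms, the randomness of each encryption handle, and
the oracle call (encryption or decryption) of each handle. -/
structure Exec (S : Signature) where
  phi : List (Term S)
  rnd : ℕ → ℕ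
  call : ℕ → Term S

/-- The ciphertexts returned by the left-right oracles. -/
def Exec.encs (E : Exec S) (X : Finset ℕ) : Set (Term S) := {c | ∃ x ∈ X, E.call x = c}

/-- The randomness used by the left-right oracles. -/
def Exec.rands (E : Exec S) (X : Finset ℕ) : Set ℕ := {r | ∃ x ∈ X, E.rnd x = r}

/-- The encryption handles under `pk n` whose randomness occurs in the normal form of `u` where
the plaintexts of the oracle ciphertexts have been erased. -/
def Exec.visible (ltU : Term S → Term S → Prop) (E : Exec S) (X : Finset ℕ) (n : ℕ)
    (u : Term S) : Set ℕ :=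
  {x | x ∈ X ∧ (∃ m r, E.call x = enc m (pk (name n)) r) ∧
    ∃ s, REq (zeroOut (E.encs X) u) s ∧ RNormal ltU s ∧ E.rnd x ∈ s.names}

/-- `l` is the increasing enumeration of the set `A`. -/
def IsSort (ltS : Term S → Term S → Prop) (A : Set (Term S)) (l : List (Term S)) : Prop :=
  l.Pairwise ltS ∧ ∀ y, y ∈ l ↔ y ∈ A

/-- The matching executions, for the set `K` of private keys `sk n`, `n ∈ K`. The finite sets
`X` and `Z` are the encryption and decryption handles, shared by both sides. -/
inductive CCARel (ltU ltS : Term S → Term S → Prop) (K : Finset ℕ) :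
    Finset ℕ → Finset ℕ → Exec S → Exec S → Prop
  | base (φ : List (Term S)) (h : ∀ t ∈ φ, t.Plain ∧ t.WS ∧ ∀ n ∈ K, NoDec n t) :
      CCARel ltU ltS K ∅ ∅ ⟨φ, fun _ => 0, Term.var⟩ ⟨φ, fun _ => 0, Term.var⟩
  | enc (X Z : Finset ℕ) (E E' : Exec S) (x n r r' : ℕ) (t t' u v : Term S)
      (rel : CCARel ltU ltS K X Z E E')
      (hx : x ∉ X ∧ x ∉ Z) (hn : n ∈ K)
      (ht : t.Pure ∧ t.NoZero ∧ t.vars ⊆ Z ∧ ∀ k ∈ K, NoDec k t)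
      (ht' : t'.Pure ∧ t'.NoZero ∧ t'.vars ⊆ Z ∧ ∀ k ∈ K, NoDec k t')
      (hu : u = t.subst E.call) (hv : v = t'.subst E'.call)
      (hws : u.WS ∧ v.WS)
      (fresh : ∀ s ∈ u :: v :: (E.phi ++ E'.phi), r ∉ s.names ∧ r' ∉ s.names)
      (hid : ∀ s ∈ u :: E.phi, Hidden (E.rands X ∪ E'.rands X) (E.encs X) s)
      (hid' : ∀ s ∈ v :: E'.phi, Hidden (E.rands X ∪ E'.rands X) (E'.encs X) s) :
      CCARel ltU ltS K (insert x X) Z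
        ⟨E.phi ++ [Term.enc u (pk (name n)) (name r)], Function.update E.rnd x r,
          Function.update E.call x (Term.enc u (pk (name n)) (name r))⟩
        ⟨E'.phi ++ [Term.enc v (pk (name n)) (name r')], Function.update E'.rnd x r',
          Function.update E'.call x (Term.enc v (pk (name n)) (name r'))⟩
  | dec (X Z : Finset ℕ) (E E' : Exec S) (z n : ℕ) (t u v : Term S) (l l' : List (Term S))
      (rel : CCARel ltU ltS K X Z E E')
      (hz : z ∉ X ∧ z ∉ Z) (hn : n ∈ K)
      (ht : t.Pure ∧ t.IfFree ∧ t.NoZero ∧ t.vars ⊆ X ∪ Z ∧ ∀ k ∈ K, NoDec k t)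
      (hu : u = t.subst E.call) (hv : v = t.subst E'.call)
      (hws : u.WS ∧ v.WS)
      (hl : IsSort ltS (E.call '' E.visible ltU X n u) l)
      (hl' : IsSort ltS (E'.call '' E.visible ltU X n u) l')
      (hid : ∀ s ∈ u :: E.phi, Hidden (E.rands X ∪ E'.rands X) (E.encs X) s)
      (hid' : ∀ s ∈ v :: E'.phi, Hidden (E.rands X ∪ E'.rands X) (E'.encs X) s) :
      CCARel ltU ltS K X (insert z Z)
        ⟨E.phi ++ [elses (l.map (Term.eq u)) (Term.dec u (sk (name n)))], E.rnd,
          Function.update E.call z (elses (l.map (Term.eq u)) (Term.dec u (sk (name n))))⟩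
        ⟨E'.phi ++ [elses (l'.map (Term.eq v)) (Term.dec v (sk (name n)))], E'.rnd,
          Function.update E'.call z (elses (l'.map (Term.eq v)) (Term.dec v (sk (name n))))⟩

/-- A formula `u₁, …, uₙ ∼ v₁, …, vₙ` is the multiset of the pairs `(uᵢ, vᵢ)`: formulas are taken
up to a simultaneous permutation of their two sides. -/
abbrev Formula (S : Signature) := Multiset (Term S × Term S)

/-- An instance of the `CCA2` axioms; the names of the right side may be renamed. -/
structure CCAInst (ltU ltS : Term S → Term S → Prop) where
  K : Finset ℕ
  X : Finset ℕ
  Z : Finset ℕ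
  E : Exec S
  E' : Exec S
  μ : Equiv.Perm ℕ
  rel : CCARel ltU ltS K X Z E E'

def CCAInst.formula {ltU ltS : Term S → Term S → Prop} (I : CCAInst ltU ltS) : Formula S :=
  ↑(List.zip I.E.phi (I.E'.phi.map (rename I.μ)))

/-! ### Proofs -/

inductive RuleName
  | cs | fa | R | dup | cca | twobox | rbox | csbox | bfa | unbox | fas

/-- The rules with one premise: `UStep ltU r Γ Δ` says that rule `r` derives `Γ` from `Δ`. -/
inductive UStep (ltU : Term S → Term S → Prop) : RuleName → Formula S → Formula S → Prop
  | fa (f : Sym S) (a a' : Fin f.arity → Term S) (Γ : Formula S) (hf : f ≠ .zero) :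
      UStep ltU .fa ((.app f a, .app f a') ::ₘ Γ)
        ((Finset.univ.val.map fun i => (a i, a' i)) + Γ)
  | fas (f : Sym S) (a a' : Fin f.arity → Term S) (Γ : Formula S) (hf : f ≠ .zero ∧ f ≠ .ite) :
      UStep ltU .fas ((.app f a, .app f a') ::ₘ Γ)
        ((Finset.univ.val.map fun i => (a i, a' i)) + Γ)
  | rLeft (s t v : Term S) (Γ : Formula S) (hst : s.Plain ∧ t.Plain) (h : REq s t) :
      UStep ltU .R ((s, v) ::ₘ Γ) ((t, v) ::ₘ Γ)
  | rRight (s t v : Term S) (Γ : Formula S) (hst : s.Plain ∧ t.Plain) (h : REq s t) :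
      UStep ltU .R ((v, s) ::ₘ Γ) ((v, t) ::ₘ Γ)
  | dup (p : Term S × Term S) (Γ : Formula S) : UStep ltU .dup (p ::ₘ p ::ₘ Γ) (p ::ₘ Γ)
  | twobox (b l c d b' l' c' d' : Term S) (Γ : Formula S)
      (hb : b.Boxed ∧ b.IfFree ∧ b.IsBool) (hb' : b'.Boxed ∧ b'.IfFree ∧ b'.IsBool)
      (hl : l.Plain ∧ l.IfFree ∧ REq b.erase l ∧ RNormal ltU l)
      (hl' : l'.Plain ∧ l'.IfFree ∧ REq b'.erase l' ∧ RNormal ltU l')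
      (h : InCtx b (.box b b l) c d) (h' : InCtx b' (.box b' b' l') c' d') :
      UStep ltU .twobox ((c, c') ::ₘ Γ) ((d, d') ::ₘ Γ)
  | rboxLeft (s t c d v : Term S) (Γ : Formula S) (h : InCtx s t c d) (hst : REq s t)
      (hd : d.Boxed ∧ d.WS)
      (side : ∀ β ∈ t.boxes, β ∈ c.boxes ∨ ∃ p ∈ Γ, β ∈ p.1.boxes) :
      UStep ltU .rbox ((c, v) ::ₘ Γ) ((d, v) ::ₘ Γ)
  | rboxRight (s t c d v : Term S) (Γ : Formula S) (h : InCtx s t c d) (hst : REq s t)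
      (hd : d.Boxed ∧ d.WS)
      (side : ∀ β ∈ t.boxes, β ∈ c.boxes ∨ ∃ p ∈ Γ, β ∈ p.2.boxes) :
      UStep ltU .rbox ((v, c) ::ₘ Γ) ((v, d) ::ₘ Γ)
  | bfa (b u v b' u' v' : Term S) (Γ : Formula S)
      (hb : ∀ a, b ≠ .frz a) (hb' : ∀ a, b' ≠ .frz a) :
      UStep ltU .bfa ((ite b u v, ite b' u' v') ::ₘ Γ)
        ((b.freeze, b'.freeze) ::ₘ (u, u') ::ₘ (v, v') ::ₘ Γ)
  | unbox (Γ : Formula S) : UStep ltU .unbox Γ (Γ.map fun p => (p.1.unfreeze, p.2.unfreeze))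

/-- The family `(ite b uᵢ vᵢ, ite b' u'ᵢ v'ᵢ)ᵢ` given by the family `((uᵢ, u'ᵢ), (vᵢ, v'ᵢ))ᵢ`. -/
def iteFamily (b b' : Term S) (L : Multiset ((Term S × Term S) × (Term S × Term S))) :
    Formula S :=
  L.map fun q => (ite b q.1.1 q.2.1, ite b' q.1.2 q.2.2)

/-- Proof trees. The `CCA2` axioms are closed under restriction of the vectors. -/
inductive Prf (ltU ltS : Term S → Term S → Prop) : Formula S → Type
  | unary {Γ Δ : Formula S} (r : RuleName) (h : UStep ltU r Γ Δ) (P : Prf ltU ltS Δ) :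
      Prf ltU ltS Γ
  | cs {Γ : Formula S} (W : Formula S) (b b' : Term S)
      (L : Multiset ((Term S × Term S) × (Term S × Term S)))
      (hb : b.Plain ∧ b.IfFree) (hb' : b'.Plain ∧ b'.IfFree)
      (h : Γ = W + iteFamily b b' L)
      (P : Prf ltU ltS (W + ((b, b') ::ₘ L.map Prod.fst)))
      (Q : Prf ltU ltS (W + ((b, b') ::ₘ L.map Prod.snd))) : Prf ltU ltS Γ
  | csbox {Γ : Formula S} (W : Formula S) (b₁ b₂ b b₁' b₂' b' : Term S)
      (L : Multiset ((Term S × Term S) × (Term S × Term S)))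
      (hL : L ≠ 0) (hb : b.Plain ∧ b.IfFree) (hb' : b'.Plain ∧ b'.IfFree)
      (h : Γ = W + iteFamily (.box b₁ b₂ b) (.box b₁' b₂' b') L)
      (P : Prf ltU ltS (W + ((b₁, b₁') ::ₘ L.map Prod.fst)))
      (Q : Prf ltU ltS (W + ((b₂, b₂') ::ₘ L.map Prod.snd))) : Prf ltU ltS Γ
  | cca {Γ : Formula S} (I : CCAInst ltU ltS) (h : Γ ≤ I.formula) : Prf ltU ltS Γ

variable {ltU ltS : Term S → Term S → Prop}

/-- The words of rule names along the branches of a proof, from the root to the leaves. -/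
def Prf.words : {Γ : Formula S} → Prf ltU ltS Γ → Language RuleName
  | _, .unary r _ P => {w | ∃ w' ∈ P.words, w = r :: w'}
  | _, .cs _ _ _ _ _ _ _ P Q => {w | ∃ w', (w' ∈ P.words ∨ w' ∈ Q.words) ∧ w = .cs :: w'}
  | _, .csbox _ _ _ _ _ _ _ _ _ _ _ _ P Q =>
      {w | ∃ w', (w' ∈ P.words ∨ w' ∈ Q.words) ∧ w = .csbox :: w'}
  | _, .cca _ _ => {[.cca]}

/-- The fragment of the logic given by a set of words of rule names. -/
def Fragment (ltU ltS : Term S → Term S → Prop) (A : Language RuleName) (Γ : Formula S) : Prop :=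
  ∃ P : Prf ltU ltS Γ, P.words ≤ A

/-- The language with the single one-letter word `r`. -/
def letter (r : RuleName) : Language RuleName := {[r]}

/-- `(CS + FA + R + Dup + CCA2)*`. -/
def sourceStrategy : Language RuleName :=
  (letter .cs + letter .fa + letter .R + letter .dup + letter .cca)∗

/-- `(2Box + R□)* · CS□* · {BFA}* · UnF · FAs* · Dup* · CCA2`. -/
def orderedStrategy : Language RuleName :=
  (letter .twobox + letter .rbox)∗ * (letter .csbox)∗ * (letter .bfa)∗ * letter .unbox *
    (letter .fas)∗ * (letter .dup)∗ * letter .cca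

/-! ### Normalized terms -/

/-- The keys, randomness, encryptions and decryptions of one side of a `CCA2` instance. -/
structure EK (S : Signature) where
  keys : Set ℕ
  rands : Set ℕ
  encs : Set (Term S)
  decs : Set (Term S)

def CCAInst.left (I : CCAInst ltU ltS) : EK S where
  keys := {n | n ∈ I.K}
  rands := {r | ∃ x ∈ I.X, r = I.E.rnd x}
  encs := {c | ∃ x ∈ I.X, c = I.E.call x}
  decs := {c | ∃ z ∈ I.Z, c = I.E.call z}

def CCAInst.right (I : CCAInst ltU ltS) : EK S where
  keys := {n | ∃ m ∈ I.K, n = I.μ m}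
  rands := {r | ∃ x ∈ I.X, r = I.μ (I.E'.rnd x)}
  encs := {c | ∃ x ∈ I.X, c = (I.E'.call x).rename I.μ}
  decs := {c | ∃ z ∈ I.Z, c = (I.E'.call z).rename I.μ}

/-- The holes of a context are filled with a term without oracle calls, with an encryption oracle
call or with a decryption oracle call. -/
inductive HoleKind
  | plain | enc | dec

/-- `Skel x k s t`: `t` is what remains of the term `s`, of kind `k`, when the plaintext of an
encryption or the argument of a (guarded) decryption is replaced by the hole `x`. -/
inductive Skel (x : ℕ) : HoleKind → Term S → Term S → Prop
  | plain (w) : Skel x .plain w w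
  | enc (u p r) : Skel x .enc (Term.enc u p r) (Term.enc (var x) p r)
  | dec (gs u s) : Skel x .dec (elses gs (Term.dec u s)) (Term.dec (var x) s)

mutual

/-- Encryption oracle calls. -/
inductive EncCall (ltU : Term S → Term S → Prop) (ek : EK S) : Term S → Prop
  | intro (u : Term S) (n r : ℕ) (h : enc u (pk (name n)) (name r) ∈ ek.encs)
      (hn : n ∈ ek.keys) (hr : r ∈ ek.rands) (hu : NSimple ltU ek u) :
      EncCall ltU ek (enc u (pk (name n)) (name r))

/-- Decryption oracle calls. -/
inductive DecCall (ltU : Term S → Term S → Prop) (ek : EK S) : Term S → Prop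
  | intro (c t : Term S) (σ : ℕ → Term S) (kind : ℕ → HoleKind) (αs : List (Term S)) (n : ℕ)
      (hc : c.Pure ∧ c.IfFree ∧ RNormal ltU c)
      (hkind : ∀ x ∈ c.vars, kind x ≠ .plain)
      (hinj : Set.InjOn σ c.vars)
      (hE : ∀ x ∈ c.vars, kind x = .enc → EncCall ltU ek (σ x))
      (hD : ∀ x ∈ c.vars, kind x = .dec → DecCall ltU ek (σ x))
      (ht : t = c.subst σ)
      (hα : ∀ α ∈ αs, EncCall ltU ek α) (hαt : ∀ α ∈ αs, α ∈ t.st)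
      (hn : n ∈ ek.keys)
      (h : elses (αs.map (Term.eq t)) (dec t (sk (name n))) ∈ ek.decs) :
      DecCall ltU ek (elses (αs.map (Term.eq t)) (dec t (sk (name n))))

/-- Normalized basic terms `U[w, α, dec]`. All names are in the terms `w`. -/
inductive NBasic (ltU : Term S → Term S → Prop) (ek : EK S) : Term S → Prop
  | intro (U : Term S) (σ τ : ℕ → Term S) (kind : ℕ → HoleKind)
      (hU : U.Pure ∧ U.IfFree ∧ U.NoZero ∧ U.names = ∅)
      (hw : ∀ x ∈ U.vars, kind x = .plain → (σ x).Plain ∧ (σ x).IfFree ∧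
        (∀ r ∈ ek.rands, r ∉ (σ x).names) ∧ ∀ n ∈ ek.keys, NoDec n (σ x))
      (hE : ∀ x ∈ U.vars, kind x = .enc → EncCall ltU ek (σ x))
      (hD : ∀ x ∈ U.vars, kind x = .dec → DecCall ltU ek (σ x))
      (hinj : Set.InjOn σ {x | x ∈ U.vars ∧ kind x ≠ .plain})
      (hskel : ∀ x ∈ U.vars, Skel x (kind x) (σ x) (τ x))
      (hnorm : RNormal ltU (U.subst τ)) :
      NBasic ltU ek (U.subst σ)

/-- Normalized simple terms: conditionals over normalized basic terms. -/
inductive NSimple (ltU : Term S → Term S → Prop) (ek : EK S) : Term S → Prop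
  | basic (t : Term S) (h : NBasic ltU ek t) : NSimple ltU ek t
  | ite (b u v : Term S) (hb : NBasic ltU ek b) (hbool : b.IsBool)
      (hu : NSimple ltU ek u) (hv : NSimple ltU ek v) : NSimple ltU ek (Term.ite b u v)

end

/-! ### Normalized proof form -/

/-- The proof does not branch and ends with the `CCA2` instance `I`. -/
inductive Prf.Leads : {Γ : Formula S} → Prf ltU ltS Γ → CCAInst ltU ltS → Prop
  | cca {Γ : Formula S} (I : CCAInst ltU ltS) (h : Γ ≤ I.formula) :
      Prf.Leads (.cca (Γ := Γ) I h) I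
  | unary {Γ Δ : Formula S} (r : RuleName) (h : UStep ltU r Γ Δ) (P : Prf ltU ltS Δ)
      (I : CCAInst ltU ltS) (hP : P.Leads I) : Prf.Leads (.unary r h P) I

/-- After steps of the rule `bfa`, the proof unfreezes, and the formula is then `Θ`. -/
inductive Prf.AfterUnbox : {Γ : Formula S} → Prf ltU ltS Γ → Formula S → Prop
  | unbox {Γ Θ : Formula S} (h : UStep ltU .unbox Γ Θ) (P : Prf ltU ltS Θ) :
      Prf.AfterUnbox (.unary .unbox h P) Θ
  | bfa {Γ Δ Θ : Formula S} (h : UStep ltU .bfa Γ Δ) (P : Prf ltU ltS Δ)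
      (hP : P.AfterUnbox Θ) : Prf.AfterUnbox (.unary .bfa h P) Θ

/-- Normalized proof form, for the proofs that follow the ordered strategy. -/
inductive Prf.NPF : {Γ : Formula S} → Prf ltU ltS Γ → Prop
  | rewrite {Γ Δ : Formula S} (r : RuleName) (hr : r = .twobox ∨ r = .rbox)
      (h : UStep ltU r Γ Δ) (P : Prf ltU ltS Δ) (hP : P.NPF) : Prf.NPF (.unary r h P)
  | split {Γ : Formula S} (W : Formula S) (b₁ b₂ b b₁' b₂' b' : Term S)
      (L : Multiset ((Term S × Term S) × (Term S × Term S)))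
      (hL : L ≠ 0) (hb : b.Plain ∧ b.IfFree) (hb' : b'.Plain ∧ b'.IfFree)
      (h : Γ = W + iteFamily (.box b₁ b₂ b) (.box b₁' b₂' b') L)
      (P : Prf ltU ltS (W + ((b₁, b₁') ::ₘ L.map Prod.fst)))
      (Q : Prf ltU ltS (W + ((b₂, b₂') ::ₘ L.map Prod.snd)))
      (hn : RNormal ltU b ∧ REq b₁.erase b ∧ REq b₂.erase b)
      (hn' : RNormal ltU b' ∧ REq b₁'.erase b' ∧ REq b₂'.erase b')
      (hP : P.NPF) (hQ : Q.NPF) :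
      Prf.NPF (.csbox W b₁ b₂ b b₁' b₂' b' L hL hb hb' h P Q)
  | branch {Γ Θ : Formula S} (P : Prf ltU ltS Γ) (I : CCAInst ltU ltS)
      (hI : P.Leads I) (hΘ : P.AfterUnbox Θ)
      (hΓ : ∀ p ∈ Γ, NSimple ltU I.left p.1 ∧ NSimple ltU I.right p.2)
      (hbasic : ∀ p ∈ Θ, NBasic ltU I.left p.1 ∧ NBasic ltU I.right p.2) :
      Prf.NPF P

end CCSA

namespace CCSA
open Term
variable {S : Signature}

/-! ### Subterms and structural predicates -/

namespace Term

-- Modulo `=_R`, a term is a decision tree whose tests and leaves are if-free terms irreducible for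
-- the projection, equality and decryption rules. A valuation fixes the truth value of every such
-- test, and `sem` evaluates a term under it to an irreducible if-free term. Soundness
-- (`REq.sem_eq`) also covers boxes. On well-sorted box-free ground terms, agreement under all
-- valuations conversely implies `=_R` (`REq.of_sem`), by Shannon expansion. Reduced ordered trees
-- are `R`-normal, so normal forms exist (`exists_rnormal`), and canonicity of these trees makes
-- them unique (`RNormal.unique`).
--
-- A proof of the initial fragment is then remembered only through its meaning. A tree `TT` keeps
-- the tests of `CS` and, at its leaves, `CCA2` instances. `Der` says that, in each case, the two
-- components of a pair have the values of the two instances of one symbolic term, that is, a term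
-- over the oracle handles in which private keys and encryption randomness do not appear. In this
-- reading `R` is invisible, `Dup` is trivial, `FA` acts on symbolic terms, and `CS` restricts the
-- valuations separately on the two sides (`Prf.exists_der`).
--
-- Two points need care. First, a `CCA2` instance is not normalized as given: its plaintexts may
-- contain conditionals and ciphertexts written in full, and decryptions may be repeated up to
-- `=_R`. `exists_abs` replaces it by a sequence of calls with symbolic normalized arguments,
-- identifying repeated decryptions; the guards survive because visibility is computed from normal
-- forms, hence from values. Secondly, a symbolic term used as a test may fail to have sort `bool`
-- although its values do. By secrecy of the keys and by the guards, the value of an if-free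
-- symbolic term is blocked or that of a syntactic head (`HG.of_handle`), and a boolean value comes
-- from a boolean head; the head depends neither on the side nor on the valuation, so it can replace
-- the term on both sides (`exists_bool`).
--
-- The normalized proof is rebuilt from the tree. A valid sequence of calls gives a `CCA2` instance
-- (`Valid.ccaRel`). Irreducible symbolic terms stay irreducible when the handles are instantiated,
-- since no redex can use a hidden key or a hidden randomness (`Sy.nleaf_subst`), and this yields
-- the normalized basic and simple terms (`NBasic.of_sy`, `NSimple.of_sy`) and the part of the proof
-- below `CS□` (`Valid.exists_prf`). For a case distinction on `b`, a component `s` is `=_R` to `ite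
-- b u v` with `u` and `v` correct in their own case only. `2Box` duplicates the test, and since
-- `CS` keeps its test in both premises, the test has a derivation in either case, which normalizes
-- the two arguments of the box separately (`TT.WF.exists_bt`). All components then carry the same
-- boxes, and `CS□` splits them all at once (`BT.WF.exists_prf`).

theorem mem_st_self (t : Term S) : t ∈ t.st := by
  cases t <;> simp [st]

theorem mem_st_app {f : Sym S} {a : Fin f.arity → Term S} {s : Term S} :
    s ∈ (app f a).st ↔ s = app f a ∨ ∃ i, s ∈ (a i).st := by
  simp [st]

theorem mem_st_box {a c b s : Term S} :
    s ∈ (box a c b).st ↔ s = box a c b ∨ s ∈ a.st ∨ s ∈ c.st := by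
  simp [st, or_assoc]

theorem st_trans {r s t : Term S} (h : r ∈ s.st) (h' : s ∈ t.st) : r ∈ t.st := by
  induction t with
  | name n => simp [st] at h'; subst h'; exact h
  | var n => simp [st] at h'; subst h'; exact h
  | app f a ih =>
    rcases mem_st_app.1 h' with rfl | ⟨i, hi⟩
    · exact h
    · exact mem_st_app.2 (.inr ⟨i, ih i hi⟩)
  | box a c b iha ihc ihb =>
    rcases mem_st_box.1 h' with rfl | hi | hi
    · exact h
    · exact mem_st_box.2 (.inr (.inl (iha hi)))
    · exact mem_st_box.2 (.inr (.inr (ihc hi)))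
  | frz b ih =>
    simp only [st, Set.mem_union, Set.mem_singleton_iff] at h' ⊢
    rcases h' with rfl | hi
    · simpa [st] using h
    · exact .inr (ih hi)

theorem mem_names_app {f : Sym S} {a : Fin f.arity → Term S} {n : ℕ} :
    n ∈ (app f a).names ↔ ∃ i, n ∈ (a i).names := by
  simp [names, mem_st_app]

theorem mem_vars_app {f : Sym S} {a : Fin f.arity → Term S} {n : ℕ} :
    n ∈ (app f a).vars ↔ ∃ i, n ∈ (a i).vars := by
  simp [vars, mem_st_app]

@[simp] theorem mem_names_name {m n : ℕ} : n ∈ (name m : Term S).names ↔ n = m := by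
  simp [names, st]
@[simp] theorem mem_names_var {m n : ℕ} : n ∉ (var m : Term S).names := by
  simp [names, st]
@[simp] theorem mem_vars_var {m n : ℕ} : n ∈ (var m : Term S).vars ↔ n = m := by
  simp [vars, st]
@[simp] theorem mem_vars_name {m n : ℕ} : n ∉ (name m : Term S).vars := by
  simp [vars, st]

theorem pure_app {f : Sym S} {a : Fin f.arity → Term S} :
    (app f a).Pure ↔ ∀ i, (a i).Pure := by
  simp only [Pure, mem_st_app, reduceCtorEq, false_or, not_exists]
  exact ⟨fun h i => ⟨fun x y z => h.1 x y z i, fun b => h.2 b i⟩,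
    fun h => ⟨fun x y z i => (h i).1 x y z, fun b i => (h i).2 b⟩⟩

theorem vars_app_eq_empty {f : Sym S} {a : Fin f.arity → Term S} :
    (app f a).vars = ∅ ↔ ∀ i, (a i).vars = ∅ := by
  simp only [Set.eq_empty_iff_forall_notMem, mem_vars_app, not_exists]
  exact forall_comm

theorem plain_app {f : Sym S} {a : Fin f.arity → Term S} :
    (app f a).Plain ↔ ∀ i, (a i).Plain := by
  simp only [Plain, pure_app, vars_app_eq_empty, forall_and]

@[simp] theorem plain_name {n : ℕ} : (name n : Term S).Plain := by
  simp [Plain, Pure, st, vars]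

theorem pure_name {n : ℕ} : (name n : Term S).Pure := plain_name.1

theorem pure_var {n : ℕ} : (var n : Term S).Pure := by simp [Pure, st]

theorem not_pure_box {a c b : Term S} : ¬ (box a c b).Pure :=
  fun h => h.1 a c b (mem_st_self _)

theorem not_pure_frz {b : Term S} : ¬ (frz b).Pure := fun h => h.2 b (mem_st_self _)

theorem not_plain_var {n : ℕ} : ¬ (var n : Term S).Plain := by
  simp [Plain, vars, st, Set.eq_empty_iff_forall_notMem]

theorem Plain.boxed {t : Term S} (h : t.Plain) : t.Boxed :=
  ⟨h.2, h.1.2, fun a c b hb => (h.1.1 a c b hb).elim⟩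

theorem boxed_app {f : Sym S} {a : Fin f.arity → Term S} :
    (app f a).Boxed ↔ ∀ i, (a i).Boxed := by
  simp only [Boxed, mem_st_app, reduceCtorEq, false_or, not_exists, vars_app_eq_empty]
  exact ⟨fun h i => ⟨h.1 i, fun b => h.2.1 b i, fun x y z hx => h.2.2 x y z ⟨i, hx⟩⟩,
    fun h => ⟨fun i => (h i).1, fun b i => (h i).2.1 b, fun x y z ⟨i, hi⟩ => (h i).2.2 x y z hi⟩⟩

theorem boxed_box {a c b : Term S} :
    (box a c b).Boxed ↔ a.Boxed ∧ c.Boxed ∧ b.Plain ∧ b.IfFree := by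
  constructor
  · rintro ⟨h1, h2, h3⟩
    have hv : ∀ t : Term S, t.st ⊆ (box a c b).st → t.vars = ∅ := fun t ht =>
      Set.eq_empty_iff_forall_notMem.2 fun x hx =>
        Set.eq_empty_iff_forall_notMem.1 h1 x (ht hx)
    have ha : a.st ⊆ (box a c b).st := fun s hs => mem_st_box.2 (.inr (.inl hs))
    have hc : c.st ⊆ (box a c b).st := fun s hs => mem_st_box.2 (.inr (.inr hs))
    exact ⟨⟨hv a ha, fun x hx => h2 x (ha hx), fun x y z hx => h3 x y z (ha hx)⟩,
      ⟨hv c hc, fun x hx => h2 x (hc hx), fun x y z hx => h3 x y z (hc hx)⟩,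
      h3 a c b (mem_st_self _)⟩
  · rintro ⟨⟨a1, a2, a3⟩, ⟨c1, c2, c3⟩, hb⟩
    refine ⟨Set.eq_empty_iff_forall_notMem.2 fun x hx => ?_, fun x hx => ?_, fun x y z hx => ?_⟩
    · rcases mem_st_box.1 hx with h | h | h
      · simp at h
      · exact Set.eq_empty_iff_forall_notMem.1 a1 x h
      · exact Set.eq_empty_iff_forall_notMem.1 c1 x h
    · rcases mem_st_box.1 hx with h | h | h
      · simp at h
      · exact a2 x h
      · exact c2 x h
    · rcases mem_st_box.1 hx with h | h | h
      · cases h; exact hb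
      · exact a3 _ _ _ h
      · exact c3 _ _ _ h

theorem ifFree_app {f : Sym S} {a : Fin f.arity → Term S} :
    (app f a).IfFree ↔ f ≠ .ite ∧ ∀ i, (a i).IfFree := by
  simp only [IfFree, mem_st_app, not_or, not_exists]
  constructor
  · refine fun h => ⟨?_, fun i b hb => (h b).2 i hb⟩
    rintro rfl
    exact (h a).1 rfl
  · rintro ⟨h1, h2⟩ b
    refine ⟨fun h => h1 ?_, fun i => h2 i b⟩
    cases h; rfl

theorem noZero_app {f : Sym S} {a : Fin f.arity → Term S} :
    (app f a).NoZero ↔ f ≠ .zero ∧ ∀ i, (a i).NoZero := by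
  simp only [NoZero, mem_st_app, not_or, not_exists]
  constructor
  · refine fun h => ⟨?_, fun i b hb => (h b).2 i hb⟩
    rintro rfl
    exact (h a).1 rfl
  · rintro ⟨h1, h2⟩ b
    refine ⟨fun h => h1 ?_, fun i => h2 i b⟩
    cases h; rfl

theorem ifFree_name {n : ℕ} : (name n : Term S).IfFree := by simp [IfFree, st]
theorem ifFree_var {n : ℕ} : (var n : Term S).IfFree := by simp [IfFree, st]
theorem noZero_name {n : ℕ} : (name n : Term S).NoZero := by simp [NoZero, st]
theorem noZero_var {n : ℕ} : (var n : Term S).NoZero := by simp [NoZero, st]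

theorem ws_app {f : Sym S} {a : Fin f.arity → Term S} :
    (app f a).WS ↔ (∀ i, (a i).WS) ∧ (f = .ite → ∀ i, i.val = 0 → (a i).IsBool) := Iff.rfl

theorem ws_ite {b u v : Term S} : (ite b u v).WS ↔ b.WS ∧ b.IsBool ∧ u.WS ∧ v.WS := by
  simp only [ws_app, Fin.forall_fin_succ]
  simp
  tauto

theorem isBool_ite {b u v : Term S} : (ite b u v).IsBool ↔ u.IsBool ∧ v.IsBool := by
  simp only [IsBool, Sym.retBool]
  constructor
  · rintro (h | ⟨_, h⟩)
    · simp at h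
    · exact ⟨h 1 Nat.one_ne_zero, h 2 two_ne_zero⟩
  · rintro ⟨h1, h2⟩
    refine .inr ⟨trivial, fun i hi => ?_⟩
    fin_cases i
    · simp at hi
    · exact h1
    · exact h2

theorem isBool_app_of_ne {f : Sym S} {a : Fin f.arity → Term S} (hf : f ≠ .ite) :
    (app f a).IsBool ↔ f.retBool = true := by
  simp [IsBool, hf]

theorem ite_eta (a : Fin (Sym.ite (S := S)).arity → Term S) :
    app .ite a = ite (a 0) (a 1) (a 2) := by
  congr 1; funext i; fin_cases i <;> rfl

theorem Pure.ws_of_ifFree {t : Term S} (hp : t.Pure) (hi : t.IfFree) : t.WS := by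
  induction t with
  | name n => trivial
  | var n => trivial
  | app f a ih =>
    rw [pure_app] at hp; rw [ifFree_app] at hi
    exact ⟨fun i => ih i (hp i) (hi.2 i), fun h => (hi.1 h).elim⟩
  | box a c b => exact (not_pure_box hp).elim
  | frz b => exact (not_pure_frz hp).elim

end Term

/-! ### Root reduction -/

theorem R1_iff {s t : Term S} : R1 s t ↔ (∃ x y, s = pi1 (pair x y) ∧ t = x) ∨
    (∃ x y, s = pi2 (pair x y) ∧ t = y) ∨ (∃ x, s = Term.eq x x ∧ t = tru) ∨
    ∃ x y z, s = Term.dec (enc x (pk y) z) (sk y) ∧ t = x := by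
  constructor
  · intro h
    cases h with
    | proj1 x y => exact .inl ⟨_, _, rfl, rfl⟩
    | proj2 x y => exact .inr (.inl ⟨_, _, rfl, rfl⟩)
    | eq x => exact .inr (.inr (.inl ⟨_, rfl, rfl⟩))
    | dec x y z => exact .inr (.inr (.inr ⟨_, _, _, rfl, rfl⟩))
  · rintro (⟨x, y, rfl, rfl⟩ | ⟨x, y, rfl, rfl⟩ | ⟨x, rfl, rfl⟩ | ⟨x, y, z, rfl, rfl⟩)
    · exact .proj1 _ _
    · exact .proj2 _ _
    · exact .eq _
    · exact .dec _ _ _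

theorem R1.det {s t t' : Term S} (h : R1 s t) (h' : R1 s t') : t = t' := by
  rw [R1_iff] at h h'
  rcases h with ⟨x, y, rfl, rfl⟩ | ⟨x, y, rfl, rfl⟩ | ⟨x, rfl, rfl⟩ | ⟨x, y, z, rfl, rfl⟩ <;>
  · simp at h'; grind

open Classical in
/-- The reduct by `R1` at the root of `f v`, or `f v` itself. -/
noncomputable def red (f : Sym S) (v : Fin f.arity → Term S) : Term S :=
  if h : ∃ t, R1 (.app f v) t then h.choose else .app f v

theorem red_of_R1 {f : Sym S} {v : Fin f.arity → Term S} {t : Term S} (h : R1 (.app f v) t) :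
    red f v = t := by
  have h' : ∃ t, R1 (.app f v) t := ⟨t, h⟩
  rw [red, dif_pos h']
  exact h'.choose_spec.det h

theorem red_of_not {f : Sym S} {v : Fin f.arity → Term S} (h : ∀ t, ¬ R1 (.app f v) t) :
    red f v = .app f v := by
  rw [red, dif_neg (by simpa using h)]

theorem red_cases (f : Sym S) (v : Fin f.arity → Term S) :
    (red f v = .app f v ∧ ∀ t, ¬ R1 (.app f v) t) ∨ R1 (.app f v) (red f v) := by
  by_cases h : ∃ t, R1 (.app f v) t
  · obtain ⟨t, ht⟩ := h
    exact .inr (by rwa [red_of_R1 ht])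
  · simp only [not_exists] at h
    exact .inl ⟨red_of_not h, h⟩

/-- What a root reduction can return: `true`, or an argument of an argument. -/
theorem R1.result {f : Sym S} {v : Fin f.arity → Term S} {t : Term S} (h : R1 (.app f v) t) :
    t = tru ∨ ∃ i g w j, v i = .app g w ∧ (g = .pair ∨ g = .enc ∧ j.val = 0) ∧ t = w j := by
  rw [R1_iff] at h
  rcases h with ⟨x, y, h, rfl⟩ | ⟨x, y, h, rfl⟩ | ⟨x, h, rfl⟩ | ⟨x, y, z, h, rfl⟩
  · cases h; exact .inr ⟨0, .pair, _, 0, rfl, .inl rfl, rfl⟩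
  · cases h; exact .inr ⟨0, .pair, _, 1, rfl, .inl rfl, rfl⟩
  · exact .inl rfl
  · cases h; exact .inr ⟨0, .enc, _, 0, rfl, .inr ⟨rfl, rfl⟩, rfl⟩

theorem R1.root_ne {f : Sym S} {v : Fin f.arity → Term S} {t : Term S} (h : R1 (.app f v) t) :
    f = .pi1 ∨ f = .pi2 ∨ f = .eq ∨ f = .dec := by
  rw [R1_iff] at h
  rcases h with ⟨x, y, h, rfl⟩ | ⟨x, y, h, rfl⟩ | ⟨x, h, rfl⟩ | ⟨x, y, z, h, rfl⟩ <;> cases h <;>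
    simp

theorem red_of_constr {f : Sym S} (v : Fin f.arity → Term S)
    (h : f ≠ .pi1 ∧ f ≠ .pi2 ∧ f ≠ .eq ∧ f ≠ .dec) : red f v = .app f v :=
  red_of_not fun t ht => by rcases ht.root_ne with h' | h' | h' | h' <;> simp_all

/-- Irreducible terms without conditionals (outside boxes). -/
def NLeaf : Term S → Prop
  | .name _ => True
  | .var _ => True
  | .app f a => f ≠ .ite ∧ (∀ t, ¬ R1 (.app f a) t) ∧ ∀ i, NLeaf (a i)
  | .box _ _ _ => True
  | .frz _ => False

theorem nleaf_app {f : Sym S} {a : Fin f.arity → Term S} :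
    NLeaf (.app f a) ↔ f ≠ .ite ∧ (∀ t, ¬ R1 (.app f a) t) ∧ ∀ i, NLeaf (a i) := Iff.rfl

theorem nleaf_tru : NLeaf (tru : Term S) :=
  ⟨by simp, fun t h => by rcases h.root_ne with h | h | h | h <;> simp at h, fun i => i.elim0⟩

/-- A property of terms is inherited by root reducts if it is by arguments. -/
theorem red_induction {Q : Term S → Prop} {f : Sym S} {v : Fin f.arity → Term S}
    (happ : (∀ t, ¬ R1 (.app f v) t) → Q (.app f v)) (htru : f = .eq → Q tru)
    (hv : ∀ i g w j, (g = .pair ∨ g = .enc ∧ j.val = 0) → v i = .app g w → Q (w j)) :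
    Q (red f v) := by
  rcases red_cases f v with ⟨h, h'⟩ | h
  · rw [h]; exact happ h'
  · by_cases hf : f = .eq
    · subst hf
      rw [R1_iff] at h
      rcases h with ⟨x, y, h, _⟩ | ⟨x, y, h, _⟩ | ⟨x, h, h'⟩ | ⟨x, y, z, h, _⟩
      · cases h
      · cases h
      · rw [h']; exact htru rfl
      · cases h
    · rcases h.result with h' | ⟨i, g, w, j, h1, h2, h3⟩
      · rw [R1_iff] at h
        rcases h with ⟨x, y, h, hx⟩ | ⟨x, y, h, hx⟩ | ⟨x, h, hx⟩ | ⟨x, y, z, h, hx⟩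
        · cases h; rw [hx]; exact hv 0 .pair ![x, y] 0 (.inl rfl) rfl
        · cases h; rw [hx]; exact hv 0 .pair ![x, y] 1 (.inl rfl) rfl
        · cases h; exact (hf rfl).elim
        · cases h; rw [hx]; exact hv 0 .enc ![x, pk y, z] 0 (.inr ⟨rfl, rfl⟩) rfl
      · rw [h3]; exact hv i g w j h2 h1

/-- One root step suffices and nothing cascades: a reduct is `true` or an argument of an argument,
and these are irreducible already. -/
theorem nleaf_red {f : Sym S} {v : Fin f.arity → Term S} (hf : f ≠ .ite)
    (hv : ∀ i, NLeaf (v i)) : NLeaf (red f v) := by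
  refine red_induction (fun h => ⟨hf, h, hv⟩) (fun _ => nleaf_tru) fun i g w j _ h => ?_
  have := hv i
  rw [h] at this
  exact this.2.2 j

/-! ### Semantics -/

/-- A valuation: a truth value for each test, and a representative for the arguments of boxes. -/
structure Val (S : Signature) where
  ρ : Term S → Prop
  ρ_tru : ρ tru
  ρ_fls : ¬ ρ fls
  ch : Term S → Term S
  inv : ∀ a a', REq a a' → ch a = ch a'

open Classical in
noncomputable def semApp (V : Val S) (f : Sym S) (v : Fin f.arity → Term S) : Term S :=
  match f, v with
  | .ite, v => if V.ρ (v 0) then v 1 else v 2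
  | f, v => red f v

/-- The value of a term. -/
noncomputable def sem (V : Val S) : Term S → Term S
  | .name n => .name n
  | .var x => .var x
  | .app f a => semApp V f fun i => sem V (a i)
  | .box a c b => .box (V.ch a) (V.ch c) b
  | .frz b => sem V b

variable {V : Val S}

theorem semApp_of_ne {f : Sym S} (hf : f ≠ .ite) (v : Fin f.arity → Term S) :
    semApp V f v = red f v := by
  cases f <;> first | rfl | exact (hf rfl).elim

open Classical in
theorem sem_ite (b u v : Term S) :
    sem V (ite b u v) = if V.ρ (sem V b) then sem V u else sem V v := rfl

open Classical in
theorem sem_app_ite (a : Fin (Sym.ite (S := S)).arity → Term S) :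
    sem V (.app .ite a) = if V.ρ (sem V (a 0)) then sem V (a 1) else sem V (a 2) := rfl

theorem sem_app {f : Sym S} (hf : f ≠ .ite) (a : Fin f.arity → Term S) :
    sem V (.app f a) = red f fun i => sem V (a i) := semApp_of_ne hf _

theorem sem_tru : sem V tru = tru := by
  rw [sem_app (by simp), red_of_constr _ (by simp)]
  congr 1; funext i; exact i.elim0

theorem sem_fls : sem V fls = fls := by
  rw [sem_app (by simp), red_of_constr _ (by simp)]
  congr 1; funext i; exact i.elim0

theorem nleaf_sem (t : Term S) : NLeaf (sem V t) := by
  induction t with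
  | name n => trivial
  | var n => trivial
  | app f a ih =>
    by_cases hf : f = .ite
    · subst hf
      rw [sem_app_ite]
      split_ifs
      · exact ih 1
      · exact ih 2
    · rw [sem_app hf]
      exact nleaf_red hf ih
  | box a c b => trivial
  | frz b ih => exact ih

theorem sem_of_nleaf {t : Term S} (hp : t.Pure) (h : NLeaf t) : sem V t = t := by
  induction t with
  | name n => rfl
  | var n => rfl
  | app f a ih =>
    rw [sem_app h.1, funext fun i => ih i (pure_app.1 hp i) (h.2.2 i), red_of_not h.2.1]
  | box a c b => exact (not_pure_box hp).elim
  | frz b ih => exact h.elim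

theorem sem_congr {f : Sym S} {a a' : Fin f.arity → Term S} (h : ∀ i, sem V (a i) = sem V (a' i)) :
    sem V (.app f a) = sem V (.app f a') := by
  change semApp V f _ = semApp V f _
  rw [funext h]

theorem sem_R1 {s t : Term S} (h : R1 s t) : sem V s = sem V t := by
  have hp : ∀ x y, sem V (pair x y) = pair (sem V x) (sem V y) := fun x y => by
    rw [sem_app (by simp), red_of_constr _ (by simp)]
    congr 1; funext i; fin_cases i <;> rfl
  rw [R1_iff] at h
  obtain ⟨x, y, rfl, ht⟩ | ⟨x, y, rfl, ht⟩ | ⟨x, rfl, ht⟩ | ⟨x, y, z, rfl, ht⟩ := h <;> rw [ht]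
  · rw [sem_app (by simp)]
    have : (fun i => sem V ((![pair x y] : Fin 1 → Term S) i)) = ![pair (sem V x) (sem V y)] := by
      funext i; fin_cases i; exact hp x y
    rw [this]; exact red_of_R1 (.proj1 _ _)
  · rw [sem_app (by simp)]
    have : (fun i => sem V ((![pair x y] : Fin 1 → Term S) i)) = ![pair (sem V x) (sem V y)] := by
      funext i; fin_cases i; exact hp x y
    rw [this]; exact red_of_R1 (.proj2 _ _)
  · rw [sem_app (by simp), sem_tru]
    have : (fun i => sem V ((![x, x] : Fin 2 → Term S) i)) = ![sem V x, sem V x] := by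
      funext i; fin_cases i <;> rfl
    rw [this]; exact red_of_R1 (.eq _)
  · rw [sem_app (by simp)]
    have h1 : sem V (pk y) = pk (sem V y) := by
      rw [sem_app (by simp), red_of_constr _ (by simp)]
      congr 1; funext i; fin_cases i; rfl
    have h2 : sem V (sk y) = sk (sem V y) := by
      rw [sem_app (by simp), red_of_constr _ (by simp)]
      congr 1; funext i; fin_cases i; rfl
    have h3 : sem V (enc x (pk y) z) = enc (sem V x) (pk (sem V y)) (sem V z) := by
      rw [sem_app (by simp), red_of_constr _ (by simp)]
      congr 1; funext i; fin_cases i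
      · rfl
      · exact h1
      · rfl
    have : (fun i => sem V ((![enc x (pk y) z, sk y] : Fin 2 → Term S) i))
        = ![enc (sem V x) (pk (sem V y)) (sem V z), sk (sem V y)] := by
      funext i; fin_cases i
      · exact h3
      · exact h2
    rw [this]; exact red_of_R1 (.dec _ _ _)

theorem sem_update {f : Sym S} (a : Fin f.arity → Term S) (i : Fin f.arity) (x y : Term S)
    (h : sem V x = sem V y) :
    sem V (.app f (Function.update a i x)) = sem V (.app f (Function.update a i y)) := by
  refine sem_congr fun j => ?_
  by_cases hj : j = i
  · subst hj; simpa using h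
  · simp [hj]

/-- The rules on conditionals hold by splitting on the truth values of the tests involved; only the
rules for `true` and `false` need the constraints on `ρ`. -/
theorem sem_rule {s t : Term S} (h : R1 s t ∨ R2 s t ∨ R3 s t ∨ ∃ b a, R4 b a s t) :
    sem V s = sem V t := by
  classical
  rcases h with h | h | h | ⟨b, a, h⟩
  · exact sem_R1 h
  · rcases h with ⟨f, hf, a, i, b, x, y, h⟩ | ⟨b, a, c, x, y⟩
    · rw [sem_ite]
      have : a = Function.update a i (ite b x y) := by rw [← h, Function.update_eq_self]
      conv_lhs => rw [this]
      split_ifs with hb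
      · exact sem_update _ _ _ _ (by rw [sem_ite, if_pos hb])
      · exact sem_update _ _ _ _ (by rw [sem_ite, if_neg hb])
    · simp only [sem_ite]; split_ifs <;> rfl
  · cases h <;> simp only [sem_ite, sem_tru, sem_fls, V.ρ_tru, V.ρ_fls] <;> split_ifs <;> first | rfl | contradiction
  · cases h <;> simp only [sem_ite] <;> split_ifs <;> rfl

/-- Outside boxes this is congruence. A step inside an argument of a box turns it into an
`=_R`-equal term, with the same representative `ch`; this is where both ends must be well-sorted
ground terms. -/
theorem sem_inCtx {s t c c' : Term S} (h : R1 s t ∨ R2 s t ∨ R3 s t ∨ ∃ b a, R4 b a s t)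
    (hc : InCtx s t c c') (h1 : c.Boxed ∧ c.WS) (h2 : c'.Boxed ∧ c'.WS) :
    sem V c = sem V c' := by
  induction hc with
  | hole => exact sem_rule h
  | app f a i r hr ih =>
    have e : a = Function.update a i (a i) := (Function.update_eq_self i a).symm
    conv_lhs => rw [e]
    refine sem_update _ _ _ _ (ih ⟨boxed_app.1 h1.1 i, h1.2.1 i⟩ ⟨?_, ?_⟩)
    · simpa using boxed_app.1 h2.1 i
    · simpa using h2.2.1 i
  | @boxL a a' c b hr ih =>
    have : REq a a' := .rel _ _ ⟨⟨(boxed_box.1 h1.1).1, h1.2.1.1⟩,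
      ⟨(boxed_box.1 h2.1).1, h2.2.1.1⟩, s, t, h, hr⟩
    simp only [sem, V.inv _ _ this]
  | @boxR a c c' b hr ih =>
    have : REq c c' := .rel _ _ ⟨⟨(boxed_box.1 h1.1).2.1, h1.2.1.2.1⟩,
      ⟨(boxed_box.1 h2.1).2.1, h2.2.1.2.1⟩, s, t, h, hr⟩
    simp only [sem, V.inv _ _ this]

theorem REq.sem_eq {s t : Term S} (h : REq s t) (V : Val S) : sem V s = sem V t := by
  induction h with
  | rel x y h =>
    obtain ⟨hx, hy, s, t, hr, hc⟩ := h
    exact sem_inCtx hr hc hx hy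
  | refl => rfl
  | symm _ _ _ ih => exact ih.symm
  | trans _ _ _ _ _ ih1 ih2 => exact ih1.trans ih2

end CCSA

namespace CCSA
open Term
variable {S : Signature} {V : Val S} {β β' : Prop}

/-! ### The congruence `R`, with intermediate terms of sort `bool` -/

/-- Well-sorted ground terms, of sort `bool` if `β` holds. -/
def Ok (β : Prop) (t : Term S) : Prop := t.Boxed ∧ t.WS ∧ (β → t.IsBool)

/-- `=_R`, where all the intermediate terms have sort `bool` if `β` holds. -/
def REqF (β : Prop) : Term S → Term S → Prop :=
  Relation.EqvGen fun c c' => Ok β c ∧ Ok β c' ∧ RStep c c'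

namespace REqF

theorem refl (x : Term S) : REqF β x x := Relation.EqvGen.refl x
theorem symm {x y : Term S} (h : REqF β x y) : REqF β y x := Relation.EqvGen.symm _ _ h
theorem trans {x y z : Term S} (h : REqF β x y) (h' : REqF β y z) : REqF β x z := Relation.EqvGen.trans _ _ _ h h'

theorem map {C : Term S → Term S} (hC : ∀ x, Ok β' x → Ok β (C x))
    (hs : ∀ x y, RStep x y → RStep (C x) (C y)) {x y : Term S} (h : REqF β' x y) :
    REqF β (C x) (C y) := by
  induction h with
  | rel x y h => exact .rel _ _ ⟨hC _ h.1, hC _ h.2.1, hs _ _ h.2.2⟩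
  | refl x => exact .refl _
  | symm _ _ _ ih => exact ih.symm
  | trans _ _ _ _ _ ih1 ih2 => exact ih1.trans ih2

theorem toREq {x y : Term S} (h : REqF β x y) : REq x y := by
  induction h with
  | rel x y h => exact .rel _ _ ⟨⟨h.1.1, h.1.2.1⟩, ⟨h.2.1.1, h.2.1.2.1⟩, h.2.2⟩
  | refl x => exact .refl _
  | symm _ _ _ ih => exact .symm _ _ ih
  | trans _ _ _ _ _ ih1 ih2 => exact .trans _ _ _ ih1 ih2

theorem ok_iff {x y : Term S} (h : REqF β x y) : Ok β x ↔ Ok β y := by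
  induction h with
  | rel x y h => exact ⟨fun _ => h.2.1, fun _ => h.1⟩
  | refl x => rfl
  | symm _ _ _ ih => exact ih.symm
  | trans _ _ _ _ _ ih1 ih2 => exact ih1.trans ih2

theorem rule {s t : Term S} (h : R1 s t ∨ R2 s t ∨ R3 s t ∨ ∃ b a, R4 b a s t) (hs : Ok β s)
    (ht : Ok β t) : REqF β s t := .rel _ _ ⟨hs, ht, s, t, h, .hole⟩

end REqF

/-- The arguments that have to be boolean. -/
def ArgB (β : Prop) (f : Sym S) (i : Fin f.arity) : Prop := f = .ite ∧ (i.val = 0 ∨ β)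

theorem ok_app {f : Sym S} {a : Fin f.arity → Term S} :
    Ok β (.app f a) ↔ (∀ i, Ok (ArgB β f i) (a i)) ∧ (β → f = .ite ∨ f.retBool = true) := by
  simp only [Ok, boxed_app, ws_app, ArgB, IsBool]
  constructor
  · rintro ⟨h1, ⟨h2, h3⟩, h4⟩
    refine ⟨fun i => ⟨h1 i, h2 i, ?_⟩, fun hβ => ?_⟩
    · rintro ⟨rfl, hi⟩
      by_cases h0 : i.val = 0
      · exact h3 rfl i h0
      · rcases h4 (hi.resolve_left h0) with h | h
        · simp [Sym.retBool] at h
        · exact h.2 i h0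
    · rcases h4 hβ with h | h
      · exact .inr h
      · exact .inl h.1
  · rintro ⟨h1, h2⟩
    refine ⟨fun i => (h1 i).1, ⟨fun i => (h1 i).2.1, fun hf i hi => (h1 i).2.2 ⟨hf, .inl hi⟩⟩,
      fun hβ => ?_⟩
    rcases h2 hβ with h | h
    · exact .inr ⟨h, fun i _ => (h1 i).2.2 ⟨h, .inr hβ⟩⟩
    · exact .inl h

theorem ok_ite {b x y : Term S} : Ok β (ite b x y) ↔ Ok True b ∧ Ok β x ∧ Ok β y := by
  simp only [Ok, boxed_app, ws_ite, isBool_ite, Fin.forall_fin_succ]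
  simp
  tauto

theorem Ok.update {f : Sym S} {a : Fin f.arity → Term S} (h : Ok β (.app f a)) {i : Fin f.arity}
    {x : Term S} (hx : Ok (ArgB β f i) x) : Ok β (.app f (Function.update a i x)) := by
  rw [ok_app] at h ⊢
  refine ⟨fun j => ?_, h.2⟩
  by_cases hj : j = i
  · subst hj; simpa using hx
  · simpa [hj] using h.1 j

theorem RStep.app {f : Sym S} (a : Fin f.arity → Term S) (i : Fin f.arity) {x y : Term S}
    (h : RStep x y) :
    RStep (.app f (Function.update a i x)) (.app f (Function.update a i y)) := by
  obtain ⟨s, t, hr, hc⟩ := h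
  refine ⟨s, t, hr, ?_⟩
  have := InCtx.app f (Function.update a i x) i y (s := s) (t := t) (by simpa using hc)
  simpa using this

theorem REqF.update {f : Sym S} {a : Fin f.arity → Term S} (h : Ok β (.app f a))
    (i : Fin f.arity) {x y : Term S} (hxy : REqF (ArgB β f i) x y) :
    REqF β (.app f (Function.update a i x)) (.app f (Function.update a i y)) :=
  hxy.map (C := fun x => .app f (Function.update a i x)) (fun _ hx => h.update hx)
    fun _ _ hs => hs.app a i

theorem REqF.args {f : Sym S} {a a' : Fin f.arity → Term S} (h : Ok β (.app f a))
    (haa : ∀ i, REqF (ArgB β f i) (a i) (a' i)) : REqF β (.app f a) (.app f a') := by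
  -- The arguments are replaced one index at a time; the intermediate hybrid term is well sorted
  -- because `REqF` preserves `Ok`.
  have key : ∀ s : Finset (Fin f.arity), REqF β (.app f a) (.app f (s.piecewise a' a)) := by
    intro s
    induction s using Finset.induction_on with
    | empty => rw [Finset.piecewise_empty]; exact .refl _
    | insert i s hi ih =>
      rw [Finset.piecewise_insert]
      have h2 := (haa i).update (a := s.piecewise a' a) (ih.ok_iff.1 h) i
      refine ih.trans ?_
      have e : Function.update (s.piecewise a' a) i (a i) = s.piecewise a' a := by
        rw [Function.update_eq_iff]
        simp [hi]
      rwa [e] at h2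
  simpa using key Finset.univ

theorem REqF.ite {b x x' y y' : Term S} (hb : Ok True b) (hx : REqF β x x') (hy : REqF β y y')
    (okx : Ok β x) (oky : Ok β y) : REqF β (Term.ite b x y) (Term.ite b x' y') := by
  refine REqF.args (f := .ite) (ok_ite.2 ⟨hb, okx, oky⟩) fun i => ?_
  have e : ∀ i : Fin 3, i.val ≠ 0 → ArgB β (Sym.ite (S := S)) i = β := fun i hi => by
    simp [ArgB, hi]
  fin_cases i
  · exact .refl _
  · change REqF (ArgB β Sym.ite 1) x x'
    rw [e 1 Nat.one_ne_zero]; exact hx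
  · change REqF (ArgB β Sym.ite 2) y y'
    rw [e 2 two_ne_zero]; exact hy

theorem fin3_cases (i : Fin 3) : i = 0 ∨ i = 1 ∨ i = 2 := by
  fin_cases i <;> simp

/-- A conditional can be pulled to the root from any argument: by homomorphism below a symbol other
than `ite`, by the nested-test rule in the test of a conditional, and by an exchange of tests in its
branches. -/
theorem REqF.hom {f : Sym S} {a : Fin f.arity → Term S} (h : Ok β (.app f a)) (i : Fin f.arity)
    {c x y : Term S} (hi : a i = Term.ite c x y) :
    REqF β (.app f a) (Term.ite c (.app f (Function.update a i x))
      (.app f (Function.update a i y))) := by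
  have hi' := (ok_app.1 h).1 i
  rw [hi, ok_ite] at hi'
  have ok2 : Ok β (Term.ite c (.app f (Function.update a i x)) (.app f (Function.update a i y))) :=
    ok_ite.2 ⟨hi'.1, h.update hi'.2.1, h.update hi'.2.2⟩
  refine .rule ?_ h ok2
  by_cases hf : f = .ite
  · subst hf
    have e : a = ![a 0, a 1, a 2] := by funext j; fin_cases j <;> rfl
    have hu : ∀ u v w z : Term S, Function.update (![u, v, w] : Fin 3 → Term S) 0 z = ![z, v, w] ∧
        Function.update (![u, v, w] : Fin 3 → Term S) 1 z = ![u, z, w] ∧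
        Function.update (![u, v, w] : Fin 3 → Term S) 2 z = ![u, v, z] := by
      intro u v w z
      refine ⟨?_, ?_, ?_⟩ <;> funext j <;> fin_cases j <;> rfl
    generalize a 0 = u at e
    generalize a 1 = v at e
    generalize a 2 = w at e
    subst e
    rcases fin3_cases i with rfl | rfl | rfl
    · rw [(hu u v w x).1, (hu u v w y).1]
      have hi : u = _ := hi
      subst hi
      exact .inr (.inl (.test _ _ _ _ _))
    · rw [(hu u v w x).2.1, (hu u v w y).2.1]
      have hi : v = _ := hi
      subst hi
      exact .inr (.inr (.inr ⟨_, _, .left _ _ _⟩))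
    · rw [(hu u v w x).2.2, (hu u v w y).2.2]
      have hi : w = _ := hi
      subst hi
      exact .inr (.inr (.inr ⟨_, _, .right _ _ _⟩))
  · exact .inr (.inl (.hom f hf a i c x y hi))

/-! ### Decision trees -/

/-- Binary decision trees. -/
inductive DT (S : Signature) : Type
  | leaf (t : Term S)
  | node (b : Term S) (l r : DT S)

namespace DT

def toTerm : DT S → Term S
  | leaf t => t
  | node b l r => Term.ite b l.toTerm r.toTerm

open Classical in
noncomputable def sem (V : Val S) : DT S → Term S
  | leaf t => t
  | node b l r => if V.ρ b then l.sem V else r.sem V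

def bind : DT S → (Term S → DT S) → DT S
  | leaf t, k => k t
  | node b l r, k => node b (l.bind k) (r.bind k)

def All (P Q : Term S → Prop) : DT S → Prop
  | leaf t => Q t
  | node b l r => P b ∧ l.All P Q ∧ r.All P Q

/-- The trees of the arguments are grafted one below the other, the first argument on top; the
continuation receives one leaf for each argument. -/
def bindAll : (n : ℕ) → (Fin n → DT S) → ((Fin n → Term S) → DT S) → DT S
  | 0, _, k => k Fin.elim0
  | n + 1, D, k => (D 0).bind fun x => bindAll n (fun i => D i.succ) fun v => k (Fin.cons x v)

theorem bind_sem (D : DT S) (k : Term S → DT S) : (D.bind k).sem V = (k (D.sem V)).sem V := by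
  induction D with
  | leaf t => rfl
  | node b l r ihl ihr => simp only [bind, sem]; split_ifs <;> assumption

theorem bindAll_sem (n : ℕ) (D : Fin n → DT S) (k : (Fin n → Term S) → DT S) :
    (bindAll n D k).sem V = (k fun i => (D i).sem V).sem V := by
  induction n with
  | zero => simp only [bindAll]; congr 2; funext i; exact i.elim0
  | succ n ih =>
    simp only [bindAll, bind_sem, ih]
    congr 2; funext i
    refine Fin.cases ?_ (fun j => ?_) i <;> simp

theorem bind_all {P Q Q' : Term S → Prop} {D : DT S} {k : Term S → DT S} (h : D.All P Q)
    (hk : ∀ x, Q x → (k x).All P Q') : (D.bind k).All P Q' := by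
  induction D with
  | leaf t => exact hk t h
  | node b l r ihl ihr => exact ⟨h.1, ihl h.2.1, ihr h.2.2⟩

theorem bindAll_all {P Q' : Term S → Prop} (n : ℕ) {Q : Fin n → Term S → Prop} {D : Fin n → DT S}
    {k : (Fin n → Term S) → DT S} (h : ∀ i, (D i).All P (Q i))
    (hk : ∀ v, (∀ i, Q i (v i)) → (k v).All P Q') : (bindAll n D k).All P Q' := by
  induction n with
  | zero => exact hk _ fun i => i.elim0
  | succ n ih =>
    refine bind_all (h 0) fun x hx => ih (Q := fun i => Q i.succ) (fun i => h i.succ) fun v hv => ?_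
    exact hk _ fun i => by refine Fin.cases ?_ (fun j => ?_) i <;> simp [hx, hv]

theorem All.mono {P P' Q Q' : Term S → Prop} {D : DT S} (h : D.All P Q) (hP : ∀ t, P t → P' t)
    (hQ : ∀ t, Q t → Q' t) : D.All P' Q' := by
  induction D with
  | leaf t => exact hQ _ h
  | node b l r ihl ihr => exact ⟨hP _ h.1, ihl h.2.1, ihr h.2.2⟩

theorem All.and {P P' Q Q' : Term S → Prop} {D : DT S} (h : D.All P Q) (h' : D.All P' Q') :
    D.All (fun t => P t ∧ P' t) (fun t => Q t ∧ Q' t) := by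
  induction D with
  | leaf t => exact ⟨h, h'⟩
  | node b l r ihl ihr => exact ⟨⟨h.1, h'.1⟩, ihl h.2.1 h'.2.1, ihr h.2.2 h'.2.2⟩

theorem All.ok {D : DT S} (h : D.All (Ok True) (Ok β)) : Ok β D.toTerm := by
  induction D with
  | leaf t => exact h
  | node b l r ihl ihr => exact ok_ite.2 ⟨h.1, ihl h.2.1, ihr h.2.2⟩

theorem sem_all {P Q : Term S → Prop} {D : DT S} (h : D.All P Q) : Q (D.sem V) := by
  induction D with
  | leaf t => exact h
  | node b l r ihl ihr =>
    simp only [sem]; split_ifs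
    · exact ihl h.2.1
    · exact ihr h.2.2

theorem sem_toTerm {D : DT S} (h : D.All (fun t => NLeaf t ∧ t.Pure) fun t => NLeaf t ∧ t.Pure) :
    CCSA.sem V D.toTerm = D.sem V := by
  induction D with
  | leaf t => exact sem_of_nleaf h.2 h.1
  | node b l r ihl ihr =>
    have hb : CCSA.sem V b = b := sem_of_nleaf h.1.2 h.1.1
    simp only [toTerm, sem_ite, sem, ihl h.2.1, ihr h.2.2]
    rw [hb]

-- The tests `true` and `false` are resolved at once, so that every test left in a tree can be given
-- an arbitrary truth value.
open Classical in
noncomputable def op (f : Sym S) (v : Fin f.arity → Term S) : DT S :=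
  match f, v with
  | .ite, v => if v 0 = tru then leaf (v 1) else if v 0 = fls then leaf (v 2) else
      node (v 0) (leaf (v 1)) (leaf (v 2))
  | f, v => leaf (red f v)

theorem op_of_ne {f : Sym S} (hf : f ≠ .ite) (v : Fin f.arity → Term S) :
    op f v = leaf (red f v) := by
  cases f <;> first | rfl | exact (hf rfl).elim

open Classical in
theorem op_ite (v : Fin (Sym.ite (S := S)).arity → Term S) :
    op .ite v = if v 0 = tru then leaf (v 1) else if v 0 = fls then leaf (v 2) else
      node (v 0) (leaf (v 1)) (leaf (v 2)) := rfl

theorem op_sem (f : Sym S) (v : Fin f.arity → Term S) : (op f v).sem V = semApp V f v := by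
  by_cases hf : f = .ite
  · subst hf
    rw [op_ite]
    split_ifs with h1 h2
    · simp [sem, semApp, h1, V.ρ_tru]
    · simp [sem, semApp, h2, V.ρ_fls]
    · simp [sem, semApp]
  · rw [op_of_ne hf, semApp_of_ne hf]; rfl

/-- Induction on the number of arguments, and for the first of them on its tree: `hhom` pulls the
root test out of the first argument. The function `g` is arbitrary so that the induction can go on
with the first argument fixed to a leaf. -/
theorem bindAll_REqF (n : ℕ) (B : Fin n → Prop) (g : (Fin n → Term S) → Term S)
    (D : Fin n → DT S) (k : (Fin n → Term S) → DT S)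
    (hg : ∀ v, (∀ i, Ok (B i) (v i)) → Ok β (g v))
    (hhom : ∀ v i c x y, (∀ j, Ok (B j) (v j)) → v i = Term.ite c x y → REqF β (g v)
      (Term.ite c (g (Function.update v i x)) (g (Function.update v i y))))
    (hD : ∀ i, Ok (B i) (D i).toTerm)
    (hk : ∀ v, (∀ i, Ok (B i) (v i)) → REqF β (g v) (k v).toTerm) :
    REqF β (g fun i => (D i).toTerm) (bindAll n D k).toTerm := by
  induction n with
  | zero =>
    have := hk Fin.elim0 fun i => i.elim0
    simp only [bindAll]
    convert this using 2
  | succ n ih =>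
    have main : ∀ D0 : DT S, Ok (B 0) D0.toTerm →
        REqF β (g (Fin.cons D0.toTerm fun i => (D i.succ).toTerm))
          (D0.bind fun x => bindAll n (fun i => D i.succ) fun v => k (Fin.cons x v)).toTerm := by
      intro D0 h0
      have hcons : ∀ (t : Term S) (v : Fin n → Term S), Ok (B 0) t →
          (∀ i, Ok (B (Fin.succ i)) (v i)) →
          ∀ i, Ok (B i) ((Fin.cons t v : Fin (n + 1) → Term S) i) := by
        intro t v ht hv i
        refine Fin.cases ?_ (fun j => ?_) i
        · simpa using ht
        · simpa using hv j
      induction D0 with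
      | leaf t =>
        refine ih (fun i => B i.succ) (fun v => g (Fin.cons t v)) _ _
          (fun v hv => hg _ (hcons t v h0 hv)) (fun v i c x y hv hi => ?_) (fun i => hD i.succ)
          fun v hv => hk _ (hcons t v h0 hv)
        simp only [Fin.cons_update]
        exact hhom _ i.succ c x y (hcons t v h0 hv) (by simpa using hi)
      | node b l r ihl ihr =>
        have h0' := ok_ite.1 h0
        have h1 := hhom (Fin.cons (node b l r).toTerm fun i => (D i.succ).toTerm) 0 b l.toTerm
          r.toTerm (hcons _ _ h0 fun i => hD i.succ) rfl
        rw [Fin.update_cons_zero, Fin.update_cons_zero] at h1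
        exact h1.trans (.ite h0'.1 (ihl h0'.2.1) (ihr h0'.2.2)
          (hg _ (hcons _ _ h0'.2.1 fun i => hD i.succ)) (hg _ (hcons _ _ h0'.2.2 fun i => hD i.succ)))
    have e : (fun i => (D i).toTerm) = Fin.cons (D 0).toTerm fun i => (D i.succ).toTerm := by
      funext i
      exact Fin.cases rfl (fun j => rfl) i
    rw [e]
    exact main (D 0) (hD 0)

end DT

/-- The decision tree of a term. -/
noncomputable def dt : Term S → DT S
  | .name n => .leaf (.name n)
  | .var x => .leaf (.var x)
  | .app f a => DT.bindAll f.arity (fun i => dt (a i)) (DT.op f)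
  | .box a c b => .leaf (.box a c b)
  | .frz b => .leaf (.frz b)

theorem dt_sem {t : Term S} (ht : t.Pure) : (dt t).sem V = sem V t := by
  induction t with
  | name n => rfl
  | var n => rfl
  | app f a ih =>
    simp only [dt, DT.bindAll_sem, fun i => ih i (pure_app.1 ht i), DT.op_sem, sem]
  | box a c b => exact (not_pure_box ht).elim
  | frz b => exact (not_pure_frz ht).elim

/-- Tests of decision trees in normal form. -/
def GoodTest (b : Term S) : Prop := NLeaf b ∧ b ≠ tru ∧ b ≠ fls

/-- All tests and leaves of the tree arise from the names and variables of the term by root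
reductions, so an invariant needs to be checked only there. It is used for irreducibility, for the
absence of boxes and variables, and for bounds on the names. -/
theorem dt_all_of_red {Q : Term S → Prop} {t : Term S} (ht : t.Pure)
    (hred : ∀ f (v : Fin f.arity → Term S), f ≠ .ite → (∀ i, Q (v i)) → Q (red f v))
    (hn : ∀ n ∈ t.names, Q (.name n)) (hx : ∀ x ∈ t.vars, Q (.var x)) :
    (dt t).All (fun b => Q b ∧ b ≠ tru ∧ b ≠ fls) Q := by
  induction t with
  | name n => exact hn n (by simp)
  | var n => exact hx n (by simp)
  | app f a ih =>
    refine DT.bindAll_all _ (fun i => ih i (pure_app.1 ht i)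
      (fun n h => hn n (mem_names_app.2 ⟨i, h⟩)) fun n h => hx n (mem_vars_app.2 ⟨i, h⟩))
      fun v hv => ?_
    by_cases hf : f = .ite
    · subst hf
      rw [DT.op_ite]
      split_ifs with h1 h2
      · exact hv 1
      · exact hv 2
      · exact ⟨⟨hv 0, h1, h2⟩, hv 1, hv 2⟩
    · rw [DT.op_of_ne hf]
      exact hred f v hf hv
  | box a c b => exact (not_pure_box ht).elim
  | frz b => exact (not_pure_frz ht).elim

theorem dt_all_nleaf {t : Term S} (ht : t.Pure) : (dt t).All GoodTest NLeaf :=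
  dt_all_of_red ht (fun _ _ hf hv => nleaf_red hf hv) (fun _ _ => trivial) fun _ _ => trivial

theorem plain_red {f : Sym S} {v : Fin f.arity → Term S} (hv : ∀ i, (v i).Plain) :
    (red f v).Plain := by
  refine red_induction (fun _ => plain_app.2 hv) (fun _ => plain_app.2 fun i => i.elim0)
    fun i g w j _ h => ?_
  have := hv i
  rw [h] at this
  exact plain_app.1 this j

theorem pure_red {f : Sym S} {v : Fin f.arity → Term S} (hv : ∀ i, (v i).Pure) :
    (red f v).Pure := by
  refine red_induction (fun _ => pure_app.2 hv) (fun _ => pure_app.2 fun i => i.elim0)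
    fun i g w j _ h => ?_
  have := hv i
  rw [h] at this
  exact pure_app.1 this j

theorem dt_all_pure {t : Term S} (ht : t.Pure) : (dt t).All Pure Pure :=
  (dt_all_of_red (Q := Pure) ht (fun _ _ _ hv => pure_red hv) (fun _ _ => pure_name)
    fun _ _ => pure_var).mono (fun _ h => h.1) fun _ h => h

theorem sem_dt_toTerm {t : Term S} (ht : t.Pure) : sem V (dt t).toTerm = sem V t := by
  rw [DT.sem_toTerm (((dt_all_nleaf ht).and (dt_all_pure ht)).mono (fun _ h => ⟨h.1.1, h.2⟩)
    fun _ h => h), dt_sem ht]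

theorem dt_all_plain {t : Term S} (ht : t.Plain) : (dt t).All Plain Plain :=
  (dt_all_of_red (Q := Plain) ht.1 (fun _ _ _ hv => plain_red hv) (fun _ _ => plain_name)
    fun x hx => by rw [ht.2] at hx; exact hx.elim).mono (fun _ h => h.1) fun _ h => h

theorem names_red {f : Sym S} {v : Fin f.arity → Term S} {N : Set ℕ}
    (hv : ∀ i, (v i).names ⊆ N) : (red f v).names ⊆ N := by
  refine red_induction (Q := fun t => t.names ⊆ N)
    (fun _ n hn => by obtain ⟨i, hi⟩ := mem_names_app.1 hn; exact hv i hi)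
    (fun _ n hn => by obtain ⟨i, hi⟩ := mem_names_app.1 hn; exact i.elim0) fun i g w j _ h => ?_
  have := hv i
  rw [h] at this
  exact fun n hn => this (mem_names_app.2 ⟨j, hn⟩)

theorem dt_all_names {t : Term S} (ht : t.Pure) :
    (dt t).All (fun b => b.names ⊆ t.names) fun b => b.names ⊆ t.names :=
  (dt_all_of_red (Q := fun b => b.names ⊆ t.names) ht (fun _ _ _ hv => names_red hv)
    (fun n hn m hm => by rw [mem_names_name] at hm; exact hm ▸ hn)
    fun x _ m hm => (mem_names_var hm).elim).mono (fun _ h => h.1) fun _ h => h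

/-- Well-sorted terms, of sort `bool` if `β` holds. -/
def Srt (β : Prop) (t : Term S) : Prop := t.WS ∧ (β → t.IsBool)

theorem srt_app {f : Sym S} {a : Fin f.arity → Term S} :
    Srt β (.app f a) ↔ (∀ i, Srt (ArgB β f i) (a i)) ∧ (β → f = .ite ∨ f.retBool = true) := by
  simp only [Srt, ws_app, ArgB, IsBool]
  constructor
  · rintro ⟨⟨h2, h3⟩, h4⟩
    refine ⟨fun i => ⟨h2 i, ?_⟩, fun hβ => ?_⟩
    · rintro ⟨rfl, hi⟩
      by_cases h0 : i.val = 0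
      · exact h3 rfl i h0
      · rcases h4 (hi.resolve_left h0) with h | h
        · simp [Sym.retBool] at h
        · exact h.2 i h0
    · rcases h4 hβ with h | h
      · exact .inr h
      · exact .inl h.1
  · rintro ⟨h1, h2⟩
    refine ⟨⟨fun i => (h1 i).1, fun hf i hi => (h1 i).2 ⟨hf, .inl hi⟩⟩, fun hβ => ?_⟩
    rcases h2 hβ with h | h
    · exact .inr ⟨h, fun i _ => (h1 i).2 ⟨h, .inr hβ⟩⟩
    · exact .inl h

theorem srt_ite {b x y : Term S} : Srt β (ite b x y) ↔ Srt True b ∧ Srt β x ∧ Srt β y := by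
  simp only [Srt, ws_ite, isBool_ite]
  tauto

/-- Reduction may gain the sort `bool`, as in `π₁⟨true, x⟩ = true`, but never loses it: the only
reducing symbol of sort `bool` is `eq`, whose reduct is `true`. The gain is the reason why boolean
heads are needed later. -/
theorem srt_red {f : Sym S} {v : Fin f.arity → Term S} (hf : f ≠ .ite)
    (h : Srt β (.app f v)) : Srt β (red f v) := by
  rcases red_cases f v with ⟨h', _⟩ | h'
  · rwa [h']
  · have hv := srt_app.1 h
    by_cases he : f = .eq
    · subst he
      rcases red_cases .eq v with ⟨h', _⟩ | h''
      · rwa [h']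
      · rw [R1_iff] at h''
        rcases h'' with ⟨x, y, h, _⟩ | ⟨x, y, h, _⟩ | ⟨x, h, h'⟩ | ⟨x, y, z, h, _⟩
        · cases h
        · cases h
        · rw [h']; exact srt_app.2 ⟨fun i => i.elim0, fun _ => .inr rfl⟩
        · cases h
    · have hβ : ¬ β := fun hβ => by
        rcases hv.2 hβ with h1 | h1
        · exact hf h1
        · rcases h'.root_ne with rfl | rfl | rfl | rfl <;> simp [Sym.retBool] at h1 he
      refine ⟨?_, fun h => (hβ h).elim⟩
      refine red_induction (Q := WS) (fun _ => h.1) (fun h => (he h).elim) fun i g w j _ hi => ?_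
      have := (hv.1 i).1
      rw [hi] at this
      exact this.1 j

theorem dt_all_srt {t : Term S} (hp : t.Pure) (ht : Srt β t) :
    (dt t).All (Srt True) (Srt β) := by
  induction t generalizing β with
  | name n => exact ht
  | var n => exact ht
  | app f a ih =>
    have ht' := srt_app.1 ht
    refine DT.bindAll_all _ (fun i => ih i (pure_app.1 hp i) (ht'.1 i)) fun v hv => ?_
    by_cases hf : f = .ite
    · subst hf
      have e : ∀ i : Fin 3, i.val ≠ 0 → ArgB β (Sym.ite (S := S)) i = β := fun i hi => by
        simp [ArgB, hi]
      have e0 : ArgB β (Sym.ite (S := S)) 0 = True := by simp [ArgB]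
      have h0 := hv 0
      have h1 := hv 1
      have h2 := hv 2
      rw [e0] at h0
      rw [e 1 Nat.one_ne_zero] at h1
      rw [e 2 two_ne_zero] at h2
      rw [DT.op_ite]
      split_ifs
      · exact h1
      · exact h2
      · exact ⟨h0, h1, h2⟩
    · rw [DT.op_of_ne hf]
      exact srt_red hf (srt_app.2 ⟨hv, ht'.2⟩)
  | box a c b => exact (not_pure_box hp).elim
  | frz b => exact (not_pure_frz hp).elim

theorem ok_of_plain {t : Term S} (hp : t.Plain) (ht : Srt β t) : Ok β t :=
  ⟨hp.boxed, ht.1, ht.2⟩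

theorem dt_all_ok {t : Term S} (hp : t.Plain) (ht : Srt β t) :
    (dt t).All (Ok True) (Ok β) :=
  ((dt_all_plain hp).and (dt_all_srt hp.1 ht)).mono (fun _ h => ok_of_plain h.1 h.2)
    fun _ h => ok_of_plain h.1 h.2

theorem REqF.red {f : Sym S} {v : Fin f.arity → Term S} (hf : f ≠ .ite) (h : Ok β (.app f v)) :
    REqF β (.app f v) (red f v) := by
  have hs : Srt β (CCSA.red f v) := srt_red hf ⟨h.2.1, h.2.2⟩
  rcases red_cases f v with ⟨h', _⟩ | h'
  · rw [h']; exact .refl _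
  · refine .rule (.inl h') h ⟨?_, hs.1, hs.2⟩
    refine red_induction (fun _ => h.1) (fun _ => boxed_app.2 fun i => i.elim0)
      fun i g w j _ hi => ?_
    have := boxed_app.1 h.1 i
    rw [hi] at this
    exact boxed_app.1 this j

/-- The arguments are replaced by their trees, the tests are pulled to the root, and each
combination of leaves is reduced at the root; every intermediate term keeps the sort. -/
theorem REqF.dt {t : Term S} (hp : t.Plain) (ht : Srt β t) : REqF β t (dt t).toTerm := by
  induction t generalizing β with
  | name n => exact .refl _
  | var n => exact .refl _
  | app f a ih =>
    have ht' := srt_app.1 ht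
    have ok : Ok β (.app f a) := ok_of_plain hp ht
    have h1 : REqF β (.app f a) (.app f fun i => (CCSA.dt (a i)).toTerm) :=
      .args ok fun i => ih i (plain_app.1 hp i) (ht'.1 i)
    refine h1.trans ?_
    refine DT.bindAll_REqF f.arity (ArgB β f) (fun v => .app f v) _ _
      (fun v hv => ok_app.2 ⟨hv, ht'.2⟩)
      (fun v i c x y hv hi => REqF.hom (ok_app.2 ⟨hv, ht'.2⟩) i hi)
      (fun i => (dt_all_ok (plain_app.1 hp i) (ht'.1 i)).ok) fun v hv => ?_
    have okv : Ok β (.app f v) := ok_app.2 ⟨hv, ht'.2⟩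
    by_cases hf : f = .ite
    · subst hf
      have okv' := okv
      rw [ite_eta v] at okv' ⊢
      have hv' := ok_ite.1 okv'
      rw [DT.op_ite]
      split_ifs with e1 e2
      · rw [e1] at okv' ⊢
        exact .rule (.inr (.inr (.inl (.tru _ _)))) okv' hv'.2.1
      · rw [e2] at okv' ⊢
        exact .rule (.inr (.inr (.inl (.fls _ _)))) okv' hv'.2.2
      · exact .refl _
    · rw [DT.op_of_ne hf]
      exact .red hf okv
  | box a c b => exact (not_pure_box hp.1).elim
  | frz b => exact (not_pure_frz hp.1).elim

/-! ### Completeness of the semantics -/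

namespace DT

open Classical in
noncomputable def restr (b : Term S) (v : Bool) : DT S → DT S
  | leaf t => leaf t
  | node c l r => if c = b then (if v then l.restr b v else r.restr b v) else
      node c (l.restr b v) (r.restr b v)

def size : DT S → ℕ
  | leaf _ => 0
  | node _ l r => l.size + r.size + 1

theorem size_restr (b : Term S) (v : Bool) (D : DT S) : (D.restr b v).size ≤ D.size := by
  induction D with
  | leaf t => rfl
  | node c l r ihl ihr =>
    simp only [restr]; split_ifs <;> simp only [size] <;> omega

theorem size_restr_node (b : Term S) (v : Bool) (l r : DT S) :
    ((node b l r).restr b v).size < (node b l r).size := by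
  have h1 := size_restr b v l
  have h2 := size_restr b v r
  simp only [restr, if_true]; split_ifs <;> simp only [size] <;> omega

theorem All.restr {P Q : Term S → Prop} {D : DT S} (h : D.All P Q) (b : Term S) (v : Bool) :
    (D.restr b v).All P Q := by
  induction D with
  | leaf t => exact h
  | node c l r ihl ihr =>
    simp only [DT.restr]; split_ifs
    · exact ihl h.2.1
    · exact ihr h.2.2
    · exact ⟨h.1, ihl h.2.1, ihr h.2.2⟩

theorem exchange_same {b u v x y : Term S} (hb : Ok True b) (hu : Ok β u) (hv : Ok β v)
    (hx : Ok β x) (hy : Ok β y) :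
    REqF β (Term.ite b (Term.ite b u v) (Term.ite b x y)) (Term.ite b u y) := by
  have okl := ok_ite.2 ⟨hb, hu, hv⟩
  have okr := ok_ite.2 ⟨hb, hx, hy⟩
  refine (REqF.rule (.inr (.inr (.inl (.left _ _ _ _)))) (ok_ite.2 ⟨hb, okl, okr⟩)
    (ok_ite.2 ⟨hb, hu, okr⟩)).trans ?_
  exact REqF.rule (.inr (.inr (.inl (.right _ _ _ _)))) (ok_ite.2 ⟨hb, hu, okr⟩)
    (ok_ite.2 ⟨hb, hu, hy⟩)

/-- One exchange lifts `b` over the first branch, a second one lifts it over the other branch within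
each case, and the repeated tests on `b` then collapse. -/
theorem exchange {b c u v x y : Term S} (hb : Ok True b) (hc : Ok True c) (hu : Ok β u)
    (hv : Ok β v) (hx : Ok β x) (hy : Ok β y) :
    REqF β (Term.ite c (Term.ite b u v) (Term.ite b x y))
      (Term.ite b (Term.ite c u x) (Term.ite c v y)) := by
  have okl := ok_ite.2 ⟨hb, hu, hv⟩
  have okr := ok_ite.2 ⟨hb, hx, hy⟩
  have c11 := ok_ite.2 ⟨hc, hu, hx⟩
  have c10 := ok_ite.2 ⟨hc, hu, hy⟩
  have c01 := ok_ite.2 ⟨hc, hv, hx⟩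
  have c00 := ok_ite.2 ⟨hc, hv, hy⟩
  have cl1 := ok_ite.2 ⟨hc, hu, okr⟩
  have cl0 := ok_ite.2 ⟨hc, hv, okr⟩
  refine (REqF.rule (.inr (.inr (.inr ⟨_, _, .left _ _ _⟩))) (ok_ite.2 ⟨hc, okl, okr⟩)
    (ok_ite.2 ⟨hb, cl1, cl0⟩)).trans ?_
  refine (REqF.ite hb (REqF.rule (.inr (.inr (.inr ⟨_, _, .right _ _ _⟩))) cl1
    (ok_ite.2 ⟨hb, c11, c10⟩)) (REqF.rule (.inr (.inr (.inr ⟨_, _, .right _ _ _⟩))) cl0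
    (ok_ite.2 ⟨hb, c01, c00⟩)) cl1 cl0).trans ?_
  exact exchange_same hb c11 c10 c01 c00

/-- Shannon expansion holds for any test, even one absent from the tree: at a leaf it is `ite b x x
= x` read backwards, and at a node it is an exchange of tests. -/
theorem shannon {b : Term S} {D : DT S} (hb : Ok True b) (h : D.All (Ok True) (Ok β)) :
    REqF β D.toTerm (Term.ite b (D.restr b true).toTerm (D.restr b false).toTerm) := by
  induction D with
  | leaf t =>
    exact (REqF.rule (.inr (.inr (.inl (.same _ _)))) (ok_ite.2 ⟨hb, h, h⟩) h).symm
  | node c l r ihl ihr =>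
    have l1 := (h.2.1.restr b true).ok
    have l0 := (h.2.1.restr b false).ok
    have r1 := (h.2.2.restr b true).ok
    have r0 := (h.2.2.restr b false).ok
    refine (REqF.ite h.1 (ihl h.2.1) (ihr h.2.2) h.2.1.ok h.2.2.ok).trans ?_
    by_cases hcb : c = b
    · subst hcb
      simp only [restr, if_true, Bool.false_eq_true, if_false]
      exact exchange_same hb l1 l0 r1 r0
    · simp only [restr, if_neg hcb]
      exact exchange hb h.1 l1 l0 r1 r0

end DT

open Classical in
/-- The valuation `V` with the value of the test `b` changed to `v`. -/
noncomputable def Val.set (V : Val S) (b : Term S) (v : Bool) (h1 : b ≠ tru) (h0 : b ≠ fls) :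
    Val S where
  ρ t := if t = b then v = true else V.ρ t
  ρ_tru := by rw [if_neg h1.symm]; exact V.ρ_tru
  ρ_fls := by rw [if_neg h0.symm]; exact V.ρ_fls
  ch := V.ch
  inv := V.inv

instance : Nonempty (Val S) := ⟨⟨fun t => t = tru, rfl, by simp, fun _ => tru, fun _ _ _ => rfl⟩⟩

namespace DT

theorem sem_restr {b : Term S} (h1 : b ≠ tru) (h0 : b ≠ fls) (v : Bool) (D : DT S) :
    (D.restr b v).sem V = D.sem (V.set b v h1 h0) := by
  induction D with
  | leaf t => rfl
  | node c l r ihl ihr =>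
    simp only [restr]
    by_cases hc : c = b
    · subst hc
      cases v <;> simp [sem, Val.set, ihl, ihr]
    · rw [if_neg hc]
      have e : (V.set b v h1 h0).ρ c ↔ V.ρ c := by simp [Val.set, hc]
      simp only [sem, ihl, ihr]
      by_cases hV : V.ρ c
      · rw [if_pos hV, if_pos (e.2 hV)]
      · rw [if_neg hV, if_neg (mt e.1 hV)]

/-- Both trees are expanded on the root test of one of them. Cofactors are the same trees read under
a modified valuation, hence still agree; the tree with that root becomes strictly smaller and the
other does not grow. When no test is left, the trees are their own values. -/
theorem complete {D D' : DT S} (h : D.All (fun t => Ok True t ∧ GoodTest t) (Ok β))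
    (h' : D'.All (fun t => Ok True t ∧ GoodTest t) (Ok β))
    (e : ∀ V, D.sem V = D'.sem V) : REqF β D.toTerm D'.toTerm := by
  induction hn : D.size + D'.size using Nat.strong_induction_on generalizing D D' with
  | _ n ih =>
    have key : ∀ b, Ok True b → GoodTest b →
        (∀ v, (D.restr b v).size + (D'.restr b v).size < n) →
        REqF β D.toTerm D'.toTerm := by
      intro b hb hg hlt
      have e' : ∀ v V, (D.restr b v).sem V = (D'.restr b v).sem V := fun v V => by
        rw [sem_restr hg.2.1 hg.2.2, sem_restr hg.2.1 hg.2.2, e]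
      have hD := h.mono (fun _ h => h.1) fun _ h => h
      have hD' := h'.mono (fun _ h => h.1) fun _ h => h
      have i1 := ih _ (hlt true) (h.restr b true) (h'.restr b true) (e' true) rfl
      have i0 := ih _ (hlt false) (h.restr b false) (h'.restr b false) (e' false) rfl
      exact (shannon hb hD).trans ((REqF.ite hb i1 i0 (hD.restr b true).ok
        (hD.restr b false).ok).trans (shannon hb hD').symm)
    cases D with
    | node b l r =>
      refine key b h.1.1 h.1.2 fun v => ?_
      have := size_restr_node b v l r
      have := size_restr b v D'
      omega
    | leaf t =>
      cases D' with
      | node b l r =>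
        refine key b h'.1.1 h'.1.2 fun v => ?_
        have := size_restr_node b v l r
        have := size_restr b v (leaf t)
        omega
      | leaf t' =>
        obtain ⟨V⟩ : Nonempty (Val S) := inferInstance
        have := e V
        simp only [sem] at this
        subst this
        exact .refl _

end DT

theorem REqF.of_sem {s t : Term S} (hs : s.Plain) (ht : t.Plain) (hs' : Srt β s) (ht' : Srt β t)
    (h : ∀ V, sem V s = sem V t) : REqF β s t :=
  (REqF.dt hs hs').trans ((DT.complete ((dt_all_ok hs hs').and (dt_all_nleaf hs.1) |>.mono
    (fun _ h => h) fun _ h => h.1) ((dt_all_ok ht ht').and (dt_all_nleaf ht.1) |>.mono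
    (fun _ h => h) fun _ h => h.1) fun V => by rw [dt_sem hs.1, dt_sem ht.1, h]).trans
    (REqF.dt ht ht').symm)

/-- Two well-sorted ground terms without boxes that have the same values are equal modulo `R`. -/
theorem REq.of_sem {s t : Term S} (hs : s.Plain) (ht : t.Plain) (hs' : s.WS) (ht' : t.WS)
    (h : ∀ V, sem V s = sem V t) : REq s t :=
  (REqF.of_sem (β := False) hs ht ⟨hs', False.elim⟩ ⟨ht', False.elim⟩ h).toREq

end CCSA

namespace CCSA
open Term
variable {S : Signature} {V : Val S} {β β' : Prop} {ltU ltS : Term S → Term S → Prop}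

/-! ### Normal forms -/

theorem NLeaf.st {t s : Term S} (hp : t.Pure) (h : NLeaf t) (hs : s ∈ t.st) :
    NLeaf s ∧ s.Pure := by
  induction t with
  | name n => simp [Term.st] at hs; subst hs; exact ⟨h, hp⟩
  | var n => simp [Term.st] at hs; subst hs; exact ⟨h, hp⟩
  | app f a ih =>
    rcases mem_st_app.1 hs with rfl | ⟨i, hi⟩
    · exact ⟨h, hp⟩
    · exact ih i (pure_app.1 hp i) (h.2.2 i) hi
  | box a c b => exact (not_pure_box hp).elim
  | frz b => exact (not_pure_frz hp).elim

theorem NLeaf.ne_ite {t b x y : Term S} (h : NLeaf t) : t ≠ ite b x y := by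
  rintro rfl; exact h.1 rfl

theorem NLeaf.ifFree {t : Term S} (hp : t.Pure) (h : NLeaf t) : t.IfFree :=
  fun _ ha => (h.st hp ha).1.1 rfl

theorem NLeaf.not_rule {t : Term S} (h : NLeaf t) (s : Term S) :
    ¬ R1 t s ∧ ¬ R2 t s ∧ ¬ R3 t s ∧ ∀ b a, ¬ R4 b a t s := by
  refine ⟨fun hr => ?_, fun hr => ?_, fun hr => ?_, fun b a hr => ?_⟩
  · cases t with
    | app f a => exact h.2.1 _ hr
    | _ => rw [R1_iff] at hr; simp at hr
  · cases hr with
    | hom f hf a i b x y hi => exact (h.2.2 i).ne_ite hi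
    | test => exact h.1 rfl
  · cases hr <;> exact h.1 rfl
  · cases hr <;> exact h.1 rfl

theorem NLeaf.rnormal {t : Term S} (hp : t.Pure) (h : NLeaf t) : RNormal ltU t := by
  intro s hs s'
  have := (h.st hp hs).1.not_rule s'
  exact ⟨this.1, this.2.1, this.2.2.1, fun b a hr => (this.2.2.2 b a hr).elim⟩

namespace DT

/-- Reduced ordered decision trees. -/
def RO (ltU : Term S → Term S → Prop) : DT S → Prop
  | leaf t => NLeaf t
  | node b l r => GoodTest b ∧ l ≠ r ∧ l.All (ltU b) (fun _ => True) ∧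
      r.All (ltU b) (fun _ => True) ∧ l.RO ltU ∧ r.RO ltU

theorem toTerm_inj {D D' : DT S} (h : D.RO ltU) (h' : D'.RO ltU) (e : D.toTerm = D'.toTerm) :
    D = D' := by
  induction D generalizing D' with
  | leaf t =>
    cases D' with
    | leaf t' => exact congrArg _ e
    | node b l r => exact (NLeaf.ne_ite (t := t) h e).elim
  | node b l r ihl ihr =>
    cases D' with
    | leaf t' => exact (NLeaf.ne_ite (t := t') h' e.symm).elim
    | node b' l' r' =>
      simp only [toTerm, app.injEq, heq_eq_eq, true_and] at e
      have e0 : b = b' := congrFun e 0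
      have e1 : l.toTerm = l'.toTerm := congrFun e 1
      have e2 : r.toTerm = r'.toTerm := congrFun e 2
      rw [e0, ihl h.2.2.2.2.1 h'.2.2.2.2.1 e1, ihr h.2.2.2.2.2 h'.2.2.2.2.2 e2]

theorem ite_inj {b x y b' x' y' : Term S} (e : ite b x y = ite b' x' y') :
    b = b' ∧ x = x' ∧ y = y' := by
  simp only [app.injEq, heq_eq_eq, true_and] at e
  exact ⟨congrFun e 0, congrFun e 1, congrFun e 2⟩

theorem mem_st_ite {s b x y : Term S} :
    s ∈ (ite b x y).st ↔ s = ite b x y ∨ s ∈ b.st ∨ s ∈ x.st ∨ s ∈ y.st := by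
  rw [mem_st_app]
  simp [Fin.exists_fin_succ]

/-- Each rule is blocked by one clause of `RO`: the homomorphism and nested-test rules by if-free
tests, the rule for equal branches by `l ≠ r`, the rules for a repeated test by irreflexivity of the
order, and the exchanges by its asymmetry. -/
theorem RO.rnormal [hU : IsStrictTotalOrder (Term S) ltU] {D : DT S} (h : D.RO ltU)
    (hp : D.All Pure Pure) : RNormal ltU D.toTerm := by
  induction D with
  | leaf t => exact NLeaf.rnormal hp h
  | node b l r ihl ihr =>
    obtain ⟨hb, hne, hl, hr, rl, rr⟩ := h
    have irr : ∀ x, ¬ ltU x x := fun x => irrefl_of ltU x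
    have asym : ∀ x y, ltU x y → ¬ ltU y x := fun x y h h' => irr x (trans_of ltU h h')
    intro s hs s'
    rcases mem_st_ite.1 hs with rfl | h1 | h1 | h1
    · refine ⟨fun hr => ?_, fun hr => ?_, fun h3 => ?_, fun c a h4 => ?_⟩
      · simp [R1_iff] at hr
      · generalize he : ite b l.toTerm r.toTerm = e at hr
        cases hr with
        | hom f hf a i c x y hi => simp only [app.injEq] at he; exact hf he.1.symm
        | test c a d x y => exact hb.1.ne_ite (ite_inj he).1
      · generalize he : ite b l.toTerm r.toTerm = e at h3
        cases h3 with
        | same c x =>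
          obtain ⟨-, h1, h2⟩ := ite_inj he
          exact hne (toTerm_inj rl rr (h1.trans h2.symm))
        | tru x y => exact hb.2.1 (ite_inj he).1
        | fls x y => exact hb.2.2 (ite_inj he).1
        | left c x y z =>
          obtain ⟨rfl, h1, h2⟩ := ite_inj he
          cases l with
          | leaf t => exact NLeaf.ne_ite (t := t) rl h1
          | node b' l' r' =>
            obtain ⟨rfl, _⟩ := ite_inj h1
            exact irr _ hl.1
        | right c x y z =>
          obtain ⟨rfl, h1, h2⟩ := ite_inj he
          cases r with
          | leaf t => exact NLeaf.ne_ite (t := t) rr h2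
          | node b' l' r' =>
            obtain ⟨rfl, _⟩ := ite_inj h2
            exact irr _ hr.1
      · generalize he : ite b l.toTerm r.toTerm = e at h4
        cases h4 with
        | left x y z =>
          obtain ⟨rfl, h1, h2⟩ := ite_inj he
          cases l with
          | leaf t => exact (NLeaf.ne_ite (t := t) rl h1).elim
          | node b' l' r' =>
            obtain ⟨rfl, _⟩ := ite_inj h1
            exact asym _ _ hl.1
        | right x y z =>
          obtain ⟨rfl, h1, h2⟩ := ite_inj he
          cases r with
          | leaf t => exact (NLeaf.ne_ite (t := t) rr h2).elim
          | node b' l' r' =>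
            obtain ⟨rfl, _⟩ := ite_inj h2
            exact asym _ _ hr.1
    · exact hb.1.rnormal hp.1 s h1 s'
    · exact ihl rl hp.2.1 s h1 s'
    · exact ihr rr hp.2.2 s h1 s'

open Classical in
/-- The reduced tree that tests the elements of `L` in order. -/
noncomputable def build : List (Term S) → DT S → DT S
  | [], leaf t => leaf t
  -- A default value that never matters: the list is always taken to contain all tests of the tree.
  | [], node _ l _ => build [] l
  | a :: L, D => if build L (D.restr a true) = build L (D.restr a false) then
      build L (D.restr a true) else node a (build L (D.restr a true)) (build L (D.restr a false))
termination_by L D => (L.length, D.size)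
decreasing_by all_goals (simp_wf; simp [size, Prod.lex_def]; try omega)

theorem restr_all_ne {P Q : Term S → Prop} {b : Term S} {v : Bool} {D : DT S} (h : D.All P Q) :
    (D.restr b v).All (fun c => P c ∧ c ≠ b) Q := by
  induction D with
  | leaf t => exact h
  | node c l r ihl ihr =>
    simp only [DT.restr]; split_ifs with h1 h2
    · exact ihl h.2.1
    · exact ihr h.2.2
    · exact ⟨⟨h.1, h1⟩, ihl h.2.1, ihr h.2.2⟩

theorem sem_restr_of {b : Term S} {v : Bool} (hv : V.ρ b ↔ v = true) (D : DT S) :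
    (D.restr b v).sem V = D.sem V := by
  induction D with
  | leaf t => rfl
  | node c l r ihl ihr =>
    simp only [restr]
    split_ifs with h1 h2
    · subst h1; rw [ihl]; simp only [sem]; rw [if_pos (hv.2 h2)]
    · subst h1; rw [ihr]; simp only [sem]; rw [if_neg (mt hv.1 h2)]
    · simp only [sem, ihl, ihr]

theorem build_nil_leaf (t : Term S) : build [] (leaf t) = leaf t := by rw [build]

theorem build_cons (a : Term S) (L : List (Term S)) (D : DT S) :
    (build L (D.restr a true) = build L (D.restr a false) ∧
      build (a :: L) D = build L (D.restr a true)) ∨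
    (build L (D.restr a true) ≠ build L (D.restr a false) ∧
      build (a :: L) D = node a (build L (D.restr a true)) (build L (D.restr a false))) := by
  by_cases h : build L (D.restr a true) = build L (D.restr a false)
  · exact .inl ⟨h, by rw [build, if_pos h]⟩
  · exact .inr ⟨h, by rw [build, if_neg h]⟩

theorem build_sem {Q : Term S → Prop} {L : List (Term S)} {D : DT S}
    (h : D.All (fun b => b ∈ L) Q) : (build L D).sem V = D.sem V := by
  induction L generalizing D with
  | nil =>
    cases D with
    | leaf t => rw [build_nil_leaf]
    | node b l r => simp [All] at h
  | cons a L ih =>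
    have hall : ∀ v, (D.restr a v).All (fun b => b ∈ L) Q := fun v =>
      (restr_all_ne h).mono (fun c hc => (List.mem_cons.1 hc.1).resolve_left hc.2) fun _ h => h
    rcases build_cons a L D with ⟨h1, h2⟩ | ⟨h1, h2⟩
    · rw [h2]
      by_cases hV : V.ρ a
      · rw [ih (hall _), sem_restr_of (by simpa using hV)]
      · rw [h1, ih (hall _), sem_restr_of (by simpa using hV)]
    · rw [h2]; simp only [sem]
      split_ifs with hV
      · rw [ih (hall _), sem_restr_of (by simpa using hV)]
      · rw [ih (hall _), sem_restr_of (by simpa using hV)]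

theorem build_all {P Q : Term S → Prop} {L : List (Term S)} {D : DT S}
    (h : D.All (fun b => b ∈ L) Q) (hL : ∀ b ∈ L, P b) : (build L D).All P Q := by
  induction L generalizing D with
  | nil =>
    cases D with
    | leaf t => rw [build_nil_leaf]; exact h
    | node b l r => simp [All] at h
  | cons a L ih =>
    have hall : ∀ v, (D.restr a v).All (fun b => b ∈ L) Q := fun v =>
      (restr_all_ne h).mono (fun c hc => (List.mem_cons.1 hc.1).resolve_left hc.2) fun _ h => h
    have hL' := fun b hb => hL b (List.mem_cons_of_mem _ hb)
    rcases build_cons a L D with ⟨h1, h2⟩ | ⟨h1, h2⟩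
    · rw [h2]; exact ih (hall _) hL'
    · rw [h2]; exact ⟨hL a (by simp), ih (hall _) hL', ih (hall _) hL'⟩

/-- Tests are met in increasing order along every branch because the list is sorted, and a node is
created only when its two subtrees differ. -/
theorem build_ro {L : List (Term S)} {D : DT S} (h : D.All (fun b => b ∈ L) NLeaf)
    (hL : ∀ b ∈ L, GoodTest b) (hs : L.Pairwise ltU) : (build L D).RO ltU := by
  induction L generalizing D with
  | nil =>
    cases D with
    | leaf t => rw [build_nil_leaf]; exact h
    | node b l r => simp [All] at h
  | cons a L ih =>
    have hall : ∀ v, (D.restr a v).All (fun b => b ∈ L) NLeaf := fun v =>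
      (restr_all_ne h).mono (fun c hc => (List.mem_cons.1 hc.1).resolve_left hc.2) fun _ h => h
    have hL' := fun b hb => hL b (List.mem_cons_of_mem _ hb)
    rw [List.pairwise_cons] at hs
    have hlt : ∀ v, (build L (D.restr a v)).All (ltU a) fun _ => True := fun v =>
      build_all ((hall v).mono (fun _ h => h) fun _ _ => trivial) hs.1
    rcases build_cons a L D with ⟨h1, h2⟩ | ⟨h1, h2⟩
    · rw [h2]; exact ih (hall _) hL' hs.2
    · rw [h2]
      exact ⟨hL a (by simp), h1, hlt _, hlt _, ih (hall _) hL' hs.2, ih (hall _) hL' hs.2⟩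

def tests : DT S → List (Term S)
  | leaf _ => []
  | node b l r => b :: (l.tests ++ r.tests)

theorem all_tests (D : DT S) {Q : Term S → Prop} (L : List (Term S)) (hL : ∀ b ∈ D.tests, b ∈ L)
    {P : Term S → Prop} (h : D.All P Q) : D.All (fun b => b ∈ L) Q := by
  induction D with
  | leaf t => exact h
  | node b l r ihl ihr =>
    simp only [tests, List.mem_cons, List.mem_append] at hL
    exact ⟨hL b (.inl rfl), ihl (fun c hc => hL c (.inr (.inl hc))) h.2.1,
      ihr (fun c hc => hL c (.inr (.inr hc))) h.2.2⟩

theorem tests_all {P Q : Term S → Prop} {D : DT S} (h : D.All P Q) : ∀ b ∈ D.tests, P b := by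
  induction D with
  | leaf t => simp [tests]
  | node b l r ihl ihr =>
    simp only [tests, List.mem_cons, List.mem_append]
    rintro c (rfl | hc | hc)
    · exact h.1
    · exact ihl h.2.1 c hc
    · exact ihr h.2.2 c hc

end DT

theorem exists_sort {α : Type*} (r : α → α → Prop) [IsStrictTotalOrder α r] (A : Set α)
    (hA : A.Finite) : ∃ l : List α, l.Pairwise r ∧ ∀ y, y ∈ l ↔ y ∈ A := by
  classical
  let _ := linearOrderOfSTO r
  refine ⟨hA.toFinset.sort (· ≤ ·), ?_, by simp⟩
  exact (Finset.sortedLT_sort _).pairwise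

/-- Every well-sorted ground term without boxes has an `R`-normal form. -/
theorem exists_rnormal [IsStrictTotalOrder (Term S) ltU] {t : Term S} (ht : t.Plain)
    (hs : t.WS) : ∃ s, REq t s ∧ RNormal ltU s ∧ s.Plain ∧ s.WS ∧ s.names ⊆ t.names := by
  obtain ⟨L, hL, hL'⟩ := exists_sort ltU {b | b ∈ (dt t).tests} (List.finite_toSet _)
  have h0 : (dt t).All (fun b => (Ok True b ∧ b.Plain) ∧ GoodTest b ∧ b.names ⊆ t.names)
      fun b => (Ok False b ∧ b.Plain) ∧ NLeaf b ∧ b.names ⊆ t.names :=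
    ((dt_all_ok (β := False) ht ⟨hs, False.elim⟩).and (dt_all_plain ht)).and
      ((dt_all_nleaf ht.1).and (dt_all_names ht.1))
  have h1 := (dt t).all_tests L (fun b hb => (hL' b).2 hb) h0
  have hP := fun b hb => DT.tests_all h0 b ((hL' b).1 hb)
  have h2 := DT.build_all h1 hP
  have h3 : (DT.build L (dt t)).RO ltU :=
    DT.build_ro (h1.mono (fun _ h => h) fun _ h => h.2.1) (fun b hb => (hP b hb).2.1) hL
  have hok : Ok False (DT.build L (dt t)).toTerm :=
    (h2.mono (fun _ h => h.1.1) fun _ h => h.1.1).ok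
  have hQ : ∀ Q : Term S → Prop, (∀ f (a : Fin (Sym.arity f) → Term S), (∀ i, Q (a i)) →
      Q (.app f a)) → ∀ D : DT S, D.All Q Q → Q D.toTerm := by
    intro Q hQ D hD
    induction D with
    | leaf t => exact hD
    | node b l r ihl ihr =>
      refine hQ .ite _ fun i => ?_
      rcases fin3_cases i with rfl | rfl | rfl
      · exact hD.1
      · exact ihl hD.2.1
      · exact ihr hD.2.2
  have hplain : (DT.build L (dt t)).toTerm.Plain :=
    hQ Plain (fun f a h => plain_app.2 h) _ (h2.mono (fun _ h => h.1.2) fun _ h => h.1.2)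
  refine ⟨_, ?_, h3.rnormal (h2.mono (fun _ h => h.1.2.1) fun _ h => h.1.2.1), hplain, hok.2.1, ?_⟩
  · refine REq.of_sem ht hplain hs hok.2.1 fun V => ?_
    rw [DT.sem_toTerm (h2.mono (fun _ h => ⟨h.2.1.1, h.1.2.1⟩) fun _ h => ⟨h.2.1, h.1.2.1⟩),
      DT.build_sem (h1.mono (fun _ h => h) fun _ h => h), dt_sem ht.1]
  · refine hQ (fun s => s.names ⊆ t.names) (fun f a h n hn => ?_) _
      (h2.mono (fun _ h => h.2.2) fun _ h => h.2.2)
    obtain ⟨i, hi⟩ := mem_names_app.1 hn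
    exact h i hi

/-! ### Uniqueness of normal forms -/

namespace DT

theorem sem_set {b : Term S} {v : Bool} (h1 : b ≠ tru) (h0 : b ≠ fls) {D : DT S}
    {Q : Term S → Prop} (h : D.All (fun c => c ≠ b) Q) :
    D.sem (V.set b v h1 h0) = D.sem V := by
  induction D with
  | leaf t => rfl
  | node c l r ihl ihr =>
    have e : (V.set b v h1 h0).ρ c ↔ V.ρ c := by simp [Val.set, h.1]
    simp only [sem, ihl h.2.1, ihr h.2.2]
    by_cases hV : V.ρ c
    · rw [if_pos hV, if_pos (e.2 hV)]
    · rw [if_neg hV, if_neg (mt e.1 hV)]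

theorem sem_node_set {b : Term S} {v : Bool} (h1 : b ≠ tru) (h0 : b ≠ fls) {l r : DT S} :
    (node b l r).sem (V.set b v h1 h0) =
      if v then l.sem (V.set b v h1 h0) else r.sem (V.set b v h1 h0) := by
  simp only [sem, Val.set, if_true]

/-- This is canonicity of reduced ordered decision diagrams. Only valuations with a prescribed `ch`
are compared, because a normal form with boxes is read as its tree only for a `ch` that fixes the
arguments of these boxes. -/
theorem RO.unique [hU : IsStrictTotalOrder (Term S) ltU] {c : Term S → Term S}
    (hc : ∃ V : Val S, V.ch = c) {D D' : DT S} (h : D.RO ltU)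
    (h' : D'.RO ltU) (e : ∀ V : Val S, V.ch = c → D.sem V = D'.sem V) : D = D' := by
  have irr : ∀ x, ¬ ltU x x := fun x => irrefl_of ltU x
  induction hn : D.size + D'.size using Nat.strong_induction_on generalizing D D' with
  | _ n ih =>
    -- A test absent from `D'` is irrelevant to its value; setting it to true and then to false
    -- shows that both branches equal `D'`, against `l ≠ r`.
    have key : ∀ (b : Term S) (l r D' : DT S), (node b l r).RO ltU → D'.RO ltU →
        (D'.All (fun c => c ≠ b) fun _ => True) → (node b l r).size + D'.size ≤ n →
        (∀ V : Val S, V.ch = c → (node b l r).sem V = D'.sem V) → False := by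
      intro b l r D' h h' hb hlt e
      obtain ⟨hg, hne, hl, hr, rl, rr⟩ := h
      have nel : l.All (fun c => c ≠ b) fun _ => True :=
        hl.mono (fun c hc => by rintro rfl; exact irr _ hc) fun _ h => h
      have ner : r.All (fun c => c ≠ b) fun _ => True :=
        hr.mono (fun c hc => by rintro rfl; exact irr _ hc) fun _ h => h
      simp only [size] at hlt
      have e1 : l = D' := ih _ (by omega) rl h' (fun V hV => by
        have := e (V.set b true hg.2.1 hg.2.2) hV
        rwa [sem_node_set, if_pos rfl, sem_set _ _ nel, sem_set _ _ hb] at this) rfl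
      have e2 : r = D' := ih _ (by omega) rr h' (fun V hV => by
        have := e (V.set b false hg.2.1 hg.2.2) hV
        rwa [sem_node_set, if_neg (by simp), sem_set _ _ ner, sem_set _ _ hb] at this) rfl
      exact hne (e1.trans e2.symm)
    have ne_of_lt : ∀ b b' l' r', ltU b b' → (node b' l' r').RO ltU →
        (node b' l' r').All (fun c => c ≠ b) fun _ => True := by
      intro b b' l' r' hlt ⟨_, _, hl, hr, _, _⟩
      refine ⟨by rintro rfl; exact irr _ hlt, hl.mono (fun c hc => ?_) fun _ h => h,
        hr.mono (fun c hc => ?_) fun _ h => h⟩ <;>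
      · rintro rfl; exact irr _ (trans_of ltU hlt hc)
    cases D with
    | leaf t =>
      cases D' with
      | leaf t' => obtain ⟨V, hV⟩ := hc; exact congrArg _ (e V hV)
      | node b l r =>
        exact (key b l r (leaf t) h' h trivial (by omega) fun V hV => (e V hV).symm).elim
    | node b l r =>
      cases D' with
      | leaf t' => exact (key b l r (leaf t') h h' trivial (by omega) e).elim
      | node b' l' r' =>
        rcases trichotomous_of ltU b b' with hlt | rfl | hlt
        · exact (key b l r _ h h' (ne_of_lt _ _ _ _ hlt h') (by omega) e).elim
        · obtain ⟨hg, hne, hl, hr, rl, rr⟩ := h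
          obtain ⟨-, -, hl', hr', rl', rr'⟩ := h'
          have ne : ∀ D : DT S, D.All (ltU b) (fun _ => True) →
              D.All (fun c => c ≠ b) fun _ => True := fun D hD =>
            hD.mono (fun c hc => by rintro rfl; exact irr _ hc) fun _ h => h
          simp only [size] at hn
          have e1 : l = l' := ih _ (by omega) rl rl' (fun V hV => by
            have := e (V.set b true hg.2.1 hg.2.2) hV
            rwa [sem_node_set, sem_node_set, if_pos rfl, if_pos rfl, sem_set _ _ (ne _ hl),
              sem_set _ _ (ne _ hl')] at this) rfl
          have e2 : r = r' := ih _ (by omega) rr rr' (fun V hV => by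
            have := e (V.set b false hg.2.1 hg.2.2) hV
            rwa [sem_node_set, sem_node_set, if_neg (by simp), if_neg (by simp),
              sem_set _ _ (ne _ hr), sem_set _ _ (ne _ hr')] at this) rfl
          rw [e1, e2]
        · exact (key b' l' r' _ h' h (ne_of_lt _ _ _ _ hlt h) (by omega)
            fun V hV => (e V hV).symm).elim

end DT

theorem RNormal.st {s t : Term S} (h : RNormal ltU t) (hs : s ∈ t.st) : RNormal ltU s :=
  fun r hr => h r (st_trans hr hs)

theorem mem_st_arg {f : Sym S} {a : Fin f.arity → Term S} (i : Fin f.arity) :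
    a i ∈ (Term.app f a).st := mem_st_app.2 (.inr ⟨i, mem_st_self _⟩)

/-- Normal forms are decision trees; their leaves are subterms. -/
theorem RNormal.exists_ro [hU : IsStrictTotalOrder (Term S) ltU] {t : Term S} (h : RNormal ltU t)
    (hf : ∀ b, .frz b ∉ t.st) :
    ∃ D : DT S, D.toTerm = t ∧ D.RO ltU ∧ D.All (fun s => s ∈ t.st) fun s => s ∈ t.st := by
  induction t with
  | name n => exact ⟨.leaf _, rfl, trivial, mem_st_self _⟩
  | var n => exact ⟨.leaf _, rfl, trivial, mem_st_self _⟩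
  | box a c b => exact ⟨.leaf _, rfl, trivial, mem_st_self _⟩
  | frz b => exact (hf b (mem_st_self _)).elim
  | app f a ih =>
    have ih' := fun i => ih i (h.st (mem_st_arg i)) fun b hb => hf b (mem_st_app.2 (.inr ⟨i, hb⟩))
    have hself := h _ (mem_st_self _)
    by_cases hite : f = .ite
    · subst hite
      rw [ite_eta a] at *
      generalize ha0 : a 0 = b at *
      generalize ha1 : a 1 = u at *
      generalize ha2 : a 2 = v at *
      have hb := ih' 0
      have hu := ih' 1
      have hv := ih' 2
      rw [ha0] at hb; rw [ha1] at hu; rw [ha2] at hv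
      obtain ⟨D0, rfl, ro0, _⟩ := hb
      obtain ⟨D1, rfl, ro1, m1⟩ := hu
      obtain ⟨D2, rfl, ro2, m2⟩ := hv
      cases D0 with
      | node c l r => exact ((hself _).2.1 (.test _ _ _ _ _)).elim
      | leaf b =>
        simp only [DT.toTerm] at *
        have lt_of : ∀ c, c ≠ b → ¬ ltU c b → ltU b c := fun c h1 h2 =>
          ((trichotomous_of ltU b c).resolve_right fun h => by
            rcases h with h | h
            · exact h1 h.symm
            · exact h2 h)
        have all_lt : ∀ D : DT S, D.RO ltU → (∀ c l r, D = .node c l r → ltU b c) →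
            D.All (ltU b) fun _ => True := by
          intro D hD hlt
          cases D with
          | leaf t => trivial
          | node c l r =>
            have h0 := hlt c l r rfl
            exact ⟨h0, hD.2.2.1.mono (fun _ h => trans_of ltU h0 h) fun _ h => h,
              hD.2.2.2.1.mono (fun _ h => trans_of ltU h0 h) fun _ h => h⟩
        refine ⟨.node b D1 D2, rfl, ⟨⟨ro0, ?_, ?_⟩, ?_, all_lt D1 ro1 ?_, all_lt D2 ro2 ?_, ro1, ro2⟩,
          ?_, ?_, ?_⟩
        · rintro rfl; exact (hself _).2.2.1 (.tru _ _)
        · rintro rfl; exact (hself _).2.2.1 (.fls _ _)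
        · rintro rfl; exact (hself _).2.2.1 (.same _ _)
        · rintro c l r rfl
          refine lt_of c ?_ ?_
          · rintro rfl; exact (hself _).2.2.1 (.left _ _ _ _)
          · exact (hself _).2.2.2 _ _ (.left _ _ _)
        · rintro c l r rfl
          refine lt_of c ?_ ?_
          · rintro rfl; exact (hself _).2.2.1 (.right _ _ _ _)
          · exact (hself _).2.2.2 _ _ (.right _ _ _)
        · exact DT.mem_st_ite.2 (.inr (.inl (mem_st_self _)))
        · exact m1.mono (fun s hs => DT.mem_st_ite.2 (.inr (.inr (.inl hs))))
            fun s hs => DT.mem_st_ite.2 (.inr (.inr (.inl hs)))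
        · exact m2.mono (fun s hs => DT.mem_st_ite.2 (.inr (.inr (.inr hs))))
            fun s hs => DT.mem_st_ite.2 (.inr (.inr (.inr hs)))
    · refine ⟨.leaf _, rfl, ⟨hite, fun t ht => (hself t).1 ht, fun i => ?_⟩, mem_st_self _⟩
      obtain ⟨D, hD, ro, _⟩ := ih' i
      cases D with
      | leaf t => rw [← hD]; exact ro
      | node b l r => exact ((hself _).2.1 (.hom f hite a i _ _ _ hD.symm)).elim

-- Size of terms and uniqueness of normal forms in the presence of boxes.

def tsize : Term S → ℕ
  | .name _ => 1
  | .var _ => 1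
  | .app _ a => 1 + ∑ i, tsize (a i)
  | .box a c _ => 1 + tsize a + tsize c
  | .frz b => 1 + tsize b

theorem tsize_le_of_mem {s t : Term S} (h : s ∈ t.st) : tsize s ≤ tsize t := by
  induction t with
  | name n => simp [Term.st] at h; subst h; rfl
  | var n => simp [Term.st] at h; subst h; rfl
  | app f a ih =>
    rcases mem_st_app.1 h with rfl | ⟨i, hi⟩
    · rfl
    · have h1 := ih i hi
      have h2 : tsize (a i) ≤ ∑ j, tsize (a j) :=
        Finset.single_le_sum (f := fun j => tsize (a j)) (fun _ _ => Nat.zero_le _)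
          (Finset.mem_univ i)
      simp only [tsize]; omega
  | box a c b iha ihc =>
    rcases mem_st_box.1 h with rfl | hi | hi
    · rfl
    · have := iha hi; simp only [tsize]; omega
    · have := ihc hi; simp only [tsize]; omega
  | frz b ih =>
    simp only [Term.st, Set.mem_union, Set.mem_singleton_iff] at h
    rcases h with rfl | hi
    · rfl
    · have := ih hi; simp only [tsize]; omega

open Classical in
/-- A smallest element of a set of terms. -/
noncomputable def smallest (A : Set (Term S)) : Term S :=
  if h : A.Nonempty then Function.argminOn tsize A h else tru

theorem smallest_spec {A : Set (Term S)} {a : Term S} (ha : a ∈ A) :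
    smallest A ∈ A ∧ tsize (smallest A) ≤ tsize a := by
  have hA : A.Nonempty := ⟨a, ha⟩
  rw [smallest, dif_pos hA]
  exact ⟨Function.argminOn_mem _ _ hA, Function.argminOn_le _ _ ha⟩

theorem sem_of_nleaf_boxes {t : Term S} (h : NLeaf t)
    (hb : ∀ a c b, .box a c b ∈ t.st → V.ch a = a ∧ V.ch c = c) : sem V t = t := by
  induction t with
  | name n => rfl
  | var n => rfl
  | app f a ih =>
    rw [sem_app h.1, funext fun i => ih i (h.2.2 i) fun x y z hx =>
      hb x y z (mem_st_app.2 (.inr ⟨i, hx⟩)), red_of_not h.2.1]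
  | box a c b =>
    obtain ⟨h1, h2⟩ := hb a c b (mem_st_self _)
    simp only [sem, h1, h2]
  | frz b ih => exact h.elim

theorem Ok.st {s t : Term S} (h : Ok False t) (hs : s ∈ t.st) : Ok False s := by
  induction t with
  | name n => simp [Term.st] at hs; subst hs; exact h
  | var n => simp [Term.st] at hs; subst hs; exact h
  | app f a ih =>
    rcases mem_st_app.1 hs with rfl | ⟨i, hi⟩
    · exact h
    · exact ih i ⟨boxed_app.1 h.1 i, h.2.1.1 i, False.elim⟩ hi
  | box a c b iha ihc =>
    have h1 := boxed_box.1 h.1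
    rcases mem_st_box.1 hs with rfl | hi | hi
    · exact h
    · exact iha ⟨h1.1, h.2.1.1.1, False.elim⟩ hi
    · exact ihc ⟨h1.2.1, h.2.1.1.2.1, False.elim⟩ hi
  | frz b ih => exact (h.1.2.1 b (mem_st_self _)).elim

theorem REq.ok_iff {s t : Term S} (h : REq s t) : Ok False s ↔ Ok False t := by
  induction h with
  | rel x y h => exact ⟨fun _ => ⟨h.2.1.1, h.2.1.2, False.elim⟩, fun _ => ⟨h.1.1, h.1.2, False.elim⟩⟩
  | refl x => rfl
  | symm _ _ _ ih => exact ih.symm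
  | trans _ _ _ _ _ ih1 ih2 => exact ih1.trans ih2

/-- `R`-normal forms are unique. -/
theorem RNormal.unique [hU : IsStrictTotalOrder (Term S) ltU] {s t : Term S} (hs : RNormal ltU s)
    (ht : RNormal ltU t) (oks : Ok False s) (h : REq s t) : s = t := by
  -- The representative of a class is one of its smallest normal forms. By induction on the size it
  -- fixes the arguments of the boxes of `s` and `t`, which are themselves normal, so that both
  -- terms have the values of their decision trees.
  let ch : Term S → Term S := fun a => smallest {s | RNormal ltU s ∧ REq a s}
  have hinv : ∀ a a', REq a a' → ch a = ch a' := by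
    intro a a' haa
    have : {s | RNormal ltU s ∧ REq a s} = {s | RNormal ltU s ∧ REq a' s} := by
      ext s
      exact ⟨fun h => ⟨h.1, .trans _ _ _ (.symm _ _ haa) h.2⟩, fun h => ⟨h.1, .trans _ _ _ haa h.2⟩⟩
    simp only [ch, this]
  have hV : ∃ V : Val S, V.ch = ch := ⟨⟨fun t => t = tru, rfl, by simp, ch, hinv⟩, rfl⟩
  induction hn : max (tsize s) (tsize t) using Nat.strong_induction_on generalizing s t with
  | _ n ih =>
    have fixed : ∀ u, RNormal ltU u → Ok False u → tsize u ≤ n → ∀ a c b, .box a c b ∈ u.st →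
        ch a = a ∧ ch c = c := by
      intro u hu oku hsz a c b hb
      have hb' := tsize_le_of_mem hb
      simp only [tsize] at hb'
      have key : ∀ x, x ∈ (Term.box a c b).st → tsize x < n → ch x = x := by
        intro x hx hlt
        have hx' := st_trans hx hb
        have nx := hu.st hx'
        obtain ⟨h1, h2⟩ := smallest_spec (A := {s | RNormal ltU s ∧ REq x s}) (a := x)
          ⟨nx, .refl _⟩
        -- The representative is no larger than `x`, so the pair consisting of `x` and its
        -- representative is covered by the induction hypothesis.
        exact (ih _ (by
          have : max (tsize x) (tsize (ch x)) ≤ tsize x := max_le le_rfl h2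
          omega) nx h1.1 (oku.st hx') h1.2 rfl).symm
      exact ⟨key a (mem_st_box.2 (.inr (.inl (mem_st_self _)))) (by omega),
        key c (mem_st_box.2 (.inr (.inr (mem_st_self _)))) (by omega)⟩
    have okt := h.ok_iff.1 oks
    have fs := fixed s hs oks (by omega)
    have ft := fixed t ht okt (by omega)
    obtain ⟨D, rfl, roD, mD⟩ := hs.exists_ro oks.1.2.1
    obtain ⟨D', rfl, roD', mD'⟩ := ht.exists_ro okt.1.2.1
    have semD : ∀ (D : DT S) (V : Val S), V.ch = ch → D.RO ltU → ∀ u : Term S,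
        (∀ a c b, .box a c b ∈ u.st → ch a = a ∧ ch c = c) →
        D.All (fun s => s ∈ u.st) (fun s => s ∈ u.st) → sem V D.toTerm = D.sem V := by
      intro D V hVc ro u hu hm
      induction D with
      | leaf t =>
        refine sem_of_nleaf_boxes (t := t) ro fun a c b hb => ?_
        rw [hVc]; exact hu a c b (st_trans hb hm)
      | node b l r ihl ihr =>
        have hb : sem V b = b := sem_of_nleaf_boxes ro.1.1 fun x y z hx => by
          rw [hVc]; exact hu x y z (st_trans hx hm.1)
        simp only [DT.toTerm, sem_ite, DT.sem, ihl ro.2.2.2.2.1 hm.2.1, ihr ro.2.2.2.2.2 hm.2.2]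
        rw [hb]
    have : D = D' := DT.RO.unique hV roD roD' fun V hVc => by
      rw [← semD D V hVc roD _ fs mD, ← semD D' V hVc roD' _ ft mD', h.sem_eq V]
    rw [this]

theorem names_sem (V : Val S) {t : Term S} (ht : t.Pure) : (sem V t).names ⊆ t.names := by
  rw [← dt_sem ht]
  exact DT.sem_all (dt_all_names ht)

/-- Names of the normal form of a term without boxes occur in the term. -/
theorem names_rnormal [hU : IsStrictTotalOrder (Term S) ltU] {s t : Term S} (ht : t.Plain)
    (hw : t.WS) (hs : RNormal ltU s) (h : REq t s) : s.names ⊆ t.names := by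
  obtain ⟨s', h1, h2, h3, h4, h5⟩ := exists_rnormal (ltU := ltU) ht hw
  have : s' = s := h2.unique hs ⟨h3.boxed, h4, False.elim⟩ (.trans _ _ _ (.symm _ _ h1) h)
  rwa [← this]

end CCSA

namespace CCSA
open Term
variable {S : Signature} {V : Val S} {β β' : Prop} {ltU ltS : Term S → Term S → Prop}

/-! ### Substitutions and renamings -/

theorem subst_congr {σ σ' : ℕ → Term S} {t : Term S} (hp : t.Pure)
    (h : ∀ x ∈ t.vars, σ x = σ' x) : t.subst σ = t.subst σ' := by
  induction t with
  | name n => rfl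
  | var n => exact h n (by simp)
  | app f a ih =>
    simp only [subst]
    congr 1; funext i
    exact ih i (pure_app.1 hp i) fun x hx => h x (mem_vars_app.2 ⟨i, hx⟩)
  | box a c b => exact (not_pure_box hp).elim
  | frz b => exact (not_pure_frz hp).elim

theorem subst_var_self {t : Term S} : t.subst Term.var = t := by
  induction t with
  | name n => rfl
  | var n => rfl
  | app f a ih => simp only [subst, ih]
  | box a c b iha ihc ihb => simp only [subst, iha, ihc, ihb]
  | frz b ih => simp only [subst, ih]

theorem subst_of_ground {σ : ℕ → Term S} {t : Term S} (h : t.Plain) : t.subst σ = t := by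
  rw [subst_congr (σ' := Term.var) h.1 fun x hx => by rw [h.2] at hx; exact hx.elim,
    subst_var_self]

theorem subst_subst {σ τ : ℕ → Term S} {t : Term S} :
    (t.subst σ).subst τ = t.subst fun x => (σ x).subst τ := by
  induction t with
  | name n => rfl
  | var n => rfl
  | app f a ih => simp only [subst, ih]
  | box a c b iha ihc ihb => simp only [subst, iha, ihc, ihb]
  | frz b ih => simp only [subst, ih]

theorem subst_ite {σ : ℕ → Term S} {b u v : Term S} :
    (ite b u v).subst σ = ite (b.subst σ) (u.subst σ) (v.subst σ) := by
  simp only [subst]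
  congr 1; funext i; fin_cases i <;> rfl

theorem R1.subst {s t : Term S} (h : R1 s t) (σ : ℕ → Term S) : R1 (s.subst σ) (t.subst σ) := by
  have e0 : ∀ f : Fin 0 → Term S, f = ![] := fun f => Subsingleton.elim _ _
  rw [R1_iff] at h ⊢
  obtain ⟨x, y, rfl, ht⟩ | ⟨x, y, rfl, ht⟩ | ⟨x, rfl, ht⟩ | ⟨x, y, z, rfl, ht⟩ := h <;> rw [ht]
  · refine .inl ⟨x.subst σ, y.subst σ, ?_, rfl⟩
    simp only [Term.subst]
    congr 1; funext i; fin_cases i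
    change (pair x y).subst σ = pair (x.subst σ) (y.subst σ)
    simp only [Term.subst]
    congr 1; funext i; fin_cases i <;> rfl
  · refine .inr (.inl ⟨x.subst σ, y.subst σ, ?_, rfl⟩)
    simp only [Term.subst]
    congr 1; funext i; fin_cases i
    change _ = pair _ _
    change (pair x y).subst σ = _
    simp only [Term.subst]
    congr 1; funext i; fin_cases i <;> rfl
  · refine .inr (.inr (.inl ⟨x.subst σ, ?_, ?_⟩))
    · simp only [Term.subst]
      congr 1; funext i; fin_cases i <;> rfl
    · simp only [Term.subst]
      congr 1; exact e0 _
  · refine .inr (.inr (.inr ⟨x.subst σ, y.subst σ, z.subst σ, ?_, rfl⟩))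
    have h1 : (pk y).subst σ = pk (y.subst σ) := by
      simp only [Term.subst]; congr 1; funext i; fin_cases i; rfl
    have h2 : (sk y).subst σ = sk (y.subst σ) := by
      simp only [Term.subst]; congr 1; funext i; fin_cases i; rfl
    have h3 : (enc x (pk y) z).subst σ = enc (x.subst σ) (pk (y.subst σ)) (z.subst σ) := by
      rw [← h1]; simp only [Term.subst]; congr 1; funext i; fin_cases i <;> rfl
    rw [← h2, ← h3]
    change (Term.dec (enc x (pk y) z) (sk y)).subst σ = _
    generalize enc x (pk y) z = e
    generalize sk y = k
    simp only [Term.subst]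
    congr 1; funext i; fin_cases i <;> rfl

/-- The valuation of the tests of `t` given by the values of the tests of `t.subst σ`. -/
noncomputable def Val.pull (V : Val S) (σ : ℕ → Term S) : Val S where
  ρ b := V.ρ (sem V (b.subst σ))
  ρ_tru := by
    have : (tru : Term S).subst σ = tru := by
      simp only [Term.subst]; congr 1; exact Subsingleton.elim _ _
    rw [this, sem_tru]; exact V.ρ_tru
  ρ_fls := by
    have : (fls : Term S).subst σ = fls := by
      simp only [Term.subst]; congr 1; exact Subsingleton.elim _ _
    rw [this, sem_fls]; exact V.ρ_fls
  ch := fun _ => tru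
  inv := fun _ _ _ => rfl

/-- The term may be evaluated before it is instantiated: the pulled-back valuation chooses the same
branches by definition, and root reductions are stable under substitution. -/
theorem sem_subst (V : Val S) (σ : ℕ → Term S) {t : Term S} (ht : t.Pure) :
    sem V (t.subst σ) = sem V ((sem (V.pull σ) t).subst σ) := by
  induction t with
  | name n => rfl
  | var n => rfl
  | app f a ih =>
    have ih' := fun i => ih i (pure_app.1 ht i)
    by_cases hf : f = .ite
    · subst hf
      simp only [Term.subst, sem_app_ite]
      have e : (V.pull σ).ρ (sem (V.pull σ) (a 0)) ↔ V.ρ (sem V ((a 0).subst σ)) := by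
        rw [ih' 0]; rfl
      by_cases h : V.ρ (sem V ((a 0).subst σ))
      · rw [if_pos h, if_pos (e.2 h)]; exact ih' 1
      · rw [if_neg h, if_neg (mt e.1 h)]; exact ih' 2
    · have e1 : sem V ((Term.app f a).subst σ) =
          sem V ((Term.app f fun i => sem (V.pull σ) (a i)).subst σ) := by
        simp only [Term.subst]
        exact sem_congr fun i => ih' i
      rw [e1, sem_app hf]
      rcases red_cases f fun i => sem (V.pull σ) (a i) with ⟨h, _⟩ | h
      · rw [h]
      · exact sem_R1 (h.subst σ)
  | box a c b => exact (not_pure_box ht).elim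
  | frz b => exact (not_pure_frz ht).elim

/-- Terms with the same values have instances with the same values. -/
theorem sem_subst_of_eq {σ σ' : ℕ → Term S} {s t : Term S} (hs : s.Pure) (ht : t.Pure)
    (h : ∀ V, sem V s = sem V t) (hσ : ∀ x ∈ t.vars, ∀ V, sem V (σ x) = sem V (σ' x)) (V : Val S) :
    sem V (s.subst σ) = sem V (t.subst σ') := by
  have h1 : sem V (s.subst σ) = sem V (t.subst σ) := by
    rw [sem_subst V σ hs, sem_subst V σ ht, h]
  rw [h1]
  clear h1 h
  induction t with
  | name n => rfl
  | var n => exact hσ n (by simp) V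
  | app f a ih =>
    simp only [Term.subst]
    exact sem_congr fun i => ih i (pure_app.1 ht i) fun x hx => hσ x (mem_vars_app.2 ⟨i, hx⟩)
  | box a c b => exact (not_pure_box ht).elim
  | frz b => exact (not_pure_frz ht).elim

theorem rename_symm_apply (μ : Equiv.Perm ℕ) (t : Term S) : (t.rename μ).rename μ.symm = t := by
  induction t with
  | name n => simp [rename]
  | var n => rfl
  | app f a ih => simp only [rename, ih]
  | box a c b iha ihc ihb => simp only [rename, iha, ihc, ihb]
  | frz b ih => simp only [rename, ih]

theorem rename_injective (μ : Equiv.Perm ℕ) : Function.Injective (rename (S := S) μ) :=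
  Function.LeftInverse.injective (rename_symm_apply μ)

theorem rename_enc (μ : Equiv.Perm ℕ) (u p r : Term S) :
    (enc u p r).rename μ = enc (u.rename μ) (p.rename μ) (r.rename μ) := by
  simp only [rename]; congr 1; funext i; fin_cases i <;> rfl
theorem rename_pk (μ : Equiv.Perm ℕ) (u : Term S) : (pk u).rename μ = pk (u.rename μ) := by
  simp only [rename]; congr 1; funext i; fin_cases i; rfl
theorem rename_sk (μ : Equiv.Perm ℕ) (u : Term S) : (sk u).rename μ = sk (u.rename μ) := by
  simp only [rename]; congr 1; funext i; fin_cases i; rfl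
theorem rename_zero (μ : Equiv.Perm ℕ) (u : Term S) : (zero u).rename μ = zero (u.rename μ) := by
  simp only [rename]; congr 1; funext i; fin_cases i; rfl
theorem rename_eq (μ : Equiv.Perm ℕ) (u v : Term S) :
    (Term.eq u v).rename μ = Term.eq (u.rename μ) (v.rename μ) := by
  simp only [rename]; congr 1; funext i; fin_cases i <;> rfl
theorem rename_dec (μ : Equiv.Perm ℕ) (u v : Term S) :
    (Term.dec u v).rename μ = Term.dec (u.rename μ) (v.rename μ) := by
  simp only [rename]; congr 1; funext i; fin_cases i <;> rfl
theorem rename_pair (μ : Equiv.Perm ℕ) (u v : Term S) :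
    (pair u v).rename μ = pair (u.rename μ) (v.rename μ) := by
  simp only [rename]; congr 1; funext i; fin_cases i <;> rfl
theorem rename_pi1 (μ : Equiv.Perm ℕ) (u : Term S) : (pi1 u).rename μ = pi1 (u.rename μ) := by
  simp only [rename]; congr 1; funext i; fin_cases i; rfl
theorem rename_pi2 (μ : Equiv.Perm ℕ) (u : Term S) : (pi2 u).rename μ = pi2 (u.rename μ) := by
  simp only [rename]; congr 1; funext i; fin_cases i; rfl
theorem rename_tru (μ : Equiv.Perm ℕ) : (tru : Term S).rename μ = tru := by
  simp only [rename]; congr 1; exact Subsingleton.elim _ _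
theorem rename_fls (μ : Equiv.Perm ℕ) : (fls : Term S).rename μ = fls := by
  simp only [rename]; congr 1; exact Subsingleton.elim _ _
theorem rename_ite (μ : Equiv.Perm ℕ) (b u v : Term S) :
    (ite b u v).rename μ = ite (b.rename μ) (u.rename μ) (v.rename μ) := by
  simp only [rename]; congr 1; funext i; fin_cases i <;> rfl
theorem rename_elses (μ : Equiv.Perm ℕ) (gs : List (Term S)) (x : Term S) :
    (elses gs x).rename μ = elses (gs.map (rename μ)) (x.rename μ) := by
  induction gs with
  | nil => rfl
  | cons g gs ih =>
    simp only [elses, List.foldr_cons, List.map_cons, rename_ite, rename_zero] at ih ⊢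
    rw [ih]

theorem rename_subst (μ : Equiv.Perm ℕ) (σ : ℕ → Term S) (t : Term S) :
    (t.subst σ).rename μ = (t.rename μ).subst fun x => (σ x).rename μ := by
  induction t with
  | name n => rfl
  | var n => rfl
  | app f a ih => simp only [subst, rename, ih]
  | box a c b iha ihc ihb => simp only [subst, rename, iha, ihc, ihb]
  | frz b ih => simp only [subst, rename, ih]

theorem R1.rename {s t : Term S} (h : R1 s t) (μ : Equiv.Perm ℕ) :
    R1 (s.rename μ) (t.rename μ) := by
  rw [R1_iff] at h
  obtain ⟨x, y, rfl, ht⟩ | ⟨x, y, rfl, ht⟩ | ⟨x, rfl, ht⟩ | ⟨x, y, z, rfl, ht⟩ := h <;> rw [ht]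
  · rw [rename_pi1, rename_pair]; exact .proj1 _ _
  · rw [rename_pi2, rename_pair]; exact .proj2 _ _
  · rw [rename_eq, rename_tru]; exact .eq _
  · rw [rename_dec, rename_enc, rename_pk, rename_sk]; exact .dec _ _ _

theorem rename_app (μ : Equiv.Perm ℕ) (f : Sym S) (a : Fin f.arity → Term S) :
    (Term.app f a).rename μ = .app f fun i => (a i).rename μ := rfl

theorem red_rename (μ : Equiv.Perm ℕ) (f : Sym S) (v : Fin f.arity → Term S) :
    red f (fun i => (v i).rename μ) = (red f v).rename μ := by
  rcases red_cases f v with ⟨h, h'⟩ | h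
  · rw [h, rename_app, red_of_not]
    intro t ht
    refine h' (t.rename μ.symm) ?_
    have := ht.rename μ.symm
    rw [← rename_app, rename_symm_apply] at this
    exact this
  · exact red_of_R1 (h.rename μ)

noncomputable def Val.ren (V : Val S) (μ : Equiv.Perm ℕ) : Val S where
  ρ b := V.ρ (b.rename μ)
  ρ_tru := by rw [rename_tru]; exact V.ρ_tru
  ρ_fls := by rw [rename_fls]; exact V.ρ_fls
  ch := fun _ => tru
  inv := fun _ _ _ => rfl

theorem sem_rename (V : Val S) (μ : Equiv.Perm ℕ) {t : Term S} (ht : t.Pure) :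
    sem V (t.rename μ) = (sem (V.ren μ) t).rename μ := by
  induction t with
  | name n => rfl
  | var n => rfl
  | app f a ih =>
    have ih' := fun i => ih i (pure_app.1 ht i)
    rw [rename_app]
    by_cases hf : f = .ite
    · subst hf
      rw [sem_app_ite, sem_app_ite, ih' 0, ih' 1, ih' 2]
      by_cases h : (V.ren μ).ρ (sem (V.ren μ) (a 0))
      · rw [if_pos h, if_pos (show V.ρ _ from h)]
      · rw [if_neg h, if_neg (show ¬ V.ρ _ from h)]
    · rw [sem_app hf, sem_app hf, ← red_rename]
      congr 1; funext i; exact ih' i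
  | box a c b => exact (not_pure_box ht).elim
  | frz b => exact (not_pure_frz ht).elim

theorem nleaf_rename {t : Term S} (μ : Equiv.Perm ℕ) (h : NLeaf t) : NLeaf (t.rename μ) := by
  induction t with
  | name n => trivial
  | var n => trivial
  | app f a ih =>
    refine ⟨h.1, fun t ht => ?_, fun i => ih i (h.2.2 i)⟩
    have := ht.rename μ.symm
    rw [← rename_app, rename_symm_apply] at this
    exact h.2.1 _ this
  | box a c b => trivial
  | frz b => exact h.elim

theorem isBool_rename {t : Term S} (μ : Equiv.Perm ℕ) : (t.rename μ).IsBool ↔ t.IsBool := by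
  induction t with
  | name n => rfl
  | var n => rfl
  | app f a ih => simp only [rename, IsBool, ih]
  | box a c b => rfl
  | frz b => rfl

theorem ws_rename {t : Term S} (μ : Equiv.Perm ℕ) : (t.rename μ).WS ↔ t.WS := by
  induction t with
  | name n => rfl
  | var n => rfl
  | app f a ih => simp only [rename, WS, ih, isBool_rename]
  | box a c b iha ihc ihb => simp only [rename, WS, iha, ihc, ihb, isBool_rename]
  | frz b ih => simp only [rename, WS, ih, isBool_rename]

theorem pure_rename {t : Term S} (μ : Equiv.Perm ℕ) (h : t.Pure) : (t.rename μ).Pure := by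
  induction t with
  | name n => exact pure_name
  | var n => exact pure_var
  | app f a ih => exact pure_app.2 fun i => ih i (pure_app.1 h i)
  | box a c b => exact (not_pure_box h).elim
  | frz b => exact (not_pure_frz h).elim

theorem vars_rename {t : Term S} (μ : Equiv.Perm ℕ) (h : t.Pure) : (t.rename μ).vars = t.vars := by
  induction t with
  | name n => ext; simp [rename]
  | var n => rfl
  | app f a ih => ext x; simp only [rename, mem_vars_app, fun i => ih i (pure_app.1 h i)]
  | box a c b => exact (not_pure_box h).elim
  | frz b => exact (not_pure_frz h).elim

theorem plain_rename {t : Term S} (μ : Equiv.Perm ℕ) (h : t.Plain) : (t.rename μ).Plain :=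
  ⟨pure_rename μ h.1, by rw [vars_rename μ h.1, h.2]⟩

theorem pure_subst {σ : ℕ → Term S} {t : Term S} (ht : t.Pure) (hσ : ∀ x ∈ t.vars, (σ x).Pure) :
    (t.subst σ).Pure := by
  induction t with
  | name n => exact ht
  | var n => exact hσ n (by simp)
  | app f a ih =>
    exact pure_app.2 fun i => ih i (pure_app.1 ht i) fun x hx => hσ x (mem_vars_app.2 ⟨i, hx⟩)
  | box a c b => exact (not_pure_box ht).elim
  | frz b => exact (not_pure_frz ht).elim

theorem plain_subst {σ : ℕ → Term S} {t : Term S} (ht : t.Pure) (hσ : ∀ x ∈ t.vars, (σ x).Plain) :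
    (t.subst σ).Plain := by
  induction t with
  | name n => exact plain_name
  | var n => exact hσ n (by simp)
  | app f a ih =>
    exact plain_app.2 fun i => ih i (pure_app.1 ht i) fun x hx => hσ x (mem_vars_app.2 ⟨i, hx⟩)
  | box a c b => exact (not_pure_box ht).elim
  | frz b => exact (not_pure_frz ht).elim

theorem mem_names_subst {σ : ℕ → Term S} {t : Term S} (ht : t.Pure) {n : ℕ} :
    n ∈ (t.subst σ).names ↔ n ∈ t.names ∨ ∃ x ∈ t.vars, n ∈ (σ x).names := by
  induction t with
  | name m => simp [subst]
  | var m => simp [subst]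
  | app f a ih =>
    simp only [subst, mem_names_app, mem_vars_app, fun i => ih i (pure_app.1 ht i)]
    constructor
    · rintro ⟨i, h | ⟨x, hx, h⟩⟩
      · exact .inl ⟨i, h⟩
      · exact .inr ⟨x, ⟨i, hx⟩, h⟩
    · rintro (⟨i, h⟩ | ⟨x, ⟨i, hx⟩, h⟩)
      · exact ⟨i, .inl h⟩
      · exact ⟨i, .inr ⟨x, hx, h⟩⟩
  | box a c b => exact (not_pure_box ht).elim
  | frz b => exact (not_pure_frz ht).elim

theorem st_subst_of_mem_vars {σ : ℕ → Term S} {t : Term S} (ht : t.Pure) {x : ℕ}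
    (hx : x ∈ t.vars) : σ x ∈ (t.subst σ).st := by
  induction t with
  | name m => simp at hx
  | var m => simp at hx; subst hx; exact mem_st_self _
  | app f a ih =>
    obtain ⟨i, hi⟩ := mem_vars_app.1 hx
    exact mem_st_app.2 (.inr ⟨i, ih i (pure_app.1 ht i) hi⟩)
  | box a c b => exact (not_pure_box ht).elim
  | frz b => exact (not_pure_frz ht).elim

/-- Subterms of an instance. -/
theorem mem_st_subst {σ : ℕ → Term S} {t s : Term S} (ht : t.Pure) (hs : s ∈ (t.subst σ).st) :
    (∃ s' ∈ t.st, (∀ x, s' ≠ .var x) ∧ s = s'.subst σ) ∨ ∃ x ∈ t.vars, s ∈ (σ x).st := by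
  induction t with
  | name m =>
    refine .inl ⟨.name m, mem_st_self _, by simp, ?_⟩
    simpa [subst, st] using hs
  | var m => exact .inr ⟨m, by simp, hs⟩
  | app f a ih =>
    rcases mem_st_app.1 hs with rfl | ⟨i, hi⟩
    · exact .inl ⟨_, mem_st_self _, by simp, rfl⟩
    · rcases ih i (pure_app.1 ht i) hi with ⟨s', h1, h2⟩ | ⟨x, h1, h2⟩
      · exact .inl ⟨s', mem_st_app.2 (.inr ⟨i, h1⟩), h2⟩
      · exact .inr ⟨x, mem_vars_app.2 ⟨i, h1⟩, h2⟩
  | box a c b => exact (not_pure_box ht).elim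
  | frz b => exact (not_pure_frz ht).elim

theorem names_st {s t : Term S} (hs : s ∈ t.st) : s.names ⊆ t.names := fun _ hx => st_trans hx hs

/-- Substitution is injective on terms whose subterms other than variables are not mapped to the
image of a variable. -/
theorem subst_inj {σ : ℕ → Term S} {H : Set ℕ} (hσ : Set.InjOn σ H) {s t : Term S} (hs : s.Pure)
    (ht : t.Pure) (hsH : s.vars ⊆ H) (htH : t.vars ⊆ H)
    (hs' : ∀ r ∈ s.st, (∀ x, r ≠ .var x) → ∀ x ∈ H, r.subst σ ≠ σ x)
    (ht' : ∀ r ∈ t.st, (∀ x, r ≠ .var x) → ∀ x ∈ H, r.subst σ ≠ σ x)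
    (e : s.subst σ = t.subst σ) : s = t := by
  induction s generalizing t with
  | name n =>
    cases t with
    | var x => exact (hs' _ (mem_st_self _) (by simp) x (htH (by simp)) e).elim
    | name m => simpa [subst] using e
    | app g b => simp [subst] at e
    | box a c b => exact (not_pure_box ht).elim
    | frz b => exact (not_pure_frz ht).elim
  | var x =>
    cases t with
    | var y => rw [hσ (hsH (by simp)) (htH (by simp)) e]
    | name m => exact (ht' _ (mem_st_self _) (by simp) x (hsH (by simp)) e.symm).elim
    | app g b => exact (ht' _ (mem_st_self _) (by simp) x (hsH (by simp)) e.symm).elim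
    | box a c b => exact (not_pure_box ht).elim
    | frz b => exact (not_pure_frz ht).elim
  | app f a ih =>
    cases t with
    | var x => exact (hs' _ (mem_st_self _) (by simp) x (htH (by simp)) e).elim
    | name m => simp [subst] at e
    | app g b =>
      simp only [subst, app.injEq] at e
      obtain ⟨rfl, e⟩ := e
      rw [heq_eq_eq] at e
      congr 1; funext i
      exact ih i (pure_app.1 hs i) (pure_app.1 ht i)
        (fun x hx => hsH (mem_vars_app.2 ⟨i, hx⟩)) (fun x hx => htH (mem_vars_app.2 ⟨i, hx⟩))
        (fun r hr => hs' r (mem_st_app.2 (.inr ⟨i, hr⟩)))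
        (fun r hr => ht' r (mem_st_app.2 (.inr ⟨i, hr⟩))) (congrFun e i)
    | box a c b => exact (not_pure_box ht).elim
    | frz b => exact (not_pure_frz ht).elim
  | box a c b => exact (not_pure_box hs).elim
  | frz b => exact (not_pure_frz hs).elim

/-! ### Symbolic terms -/

/-- Terms over the handles `H` in which the keys `K` occur only as public keys, the names of `R` do
not occur, and `zero` is applied, if `zok` holds, to terms without handles only. -/
def Sy (K R H : Set ℕ) (zok : Prop) : Term S → Prop
  | .name m => m ∉ K ∧ m ∉ R
  | .var x => x ∈ H
  | .app f a => (∃ n ∈ K, n ∉ R ∧ Term.app f a = pk (.name n)) ∨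
      ((f = .zero → zok ∧ (Term.app f a).vars = ∅) ∧ ∀ i, Sy K R H zok (a i))
  | .box _ _ _ => False
  | .frz _ => False

section Sy
variable {K R H R' H' : Set ℕ} {zok zok' : Prop}

theorem Sy.pure {t : Term S} (h : Sy K R H zok t) : t.Pure := by
  induction t with
  | name n => exact pure_name
  | var n => exact pure_var
  | app f a ih =>
    rcases h with ⟨n, _, _, h⟩ | h
    · rw [h]; exact pure_app.2 fun i => by fin_cases i; exact pure_name
    · exact pure_app.2 fun i => ih i (h.2 i)
  | box a c b => exact h.elim
  | frz b => exact h.elim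

theorem vars_pk_name {n : ℕ} : (pk (.name n) : Term S).vars = ∅ :=
  vars_app_eq_empty.2 fun i => by fin_cases i; exact plain_name.2

theorem Sy.vars {t : Term S} (h : Sy K R H zok t) : t.vars ⊆ H := by
  induction t with
  | name n => simp [Term.vars, st]
  | var n => intro x hx; simp at hx; subst hx; exact h
  | app f a ih =>
    rcases h with ⟨n, _, _, h⟩ | h
    · rw [h, vars_pk_name]; exact Set.empty_subset _
    · intro x hx
      obtain ⟨i, hi⟩ := mem_vars_app.1 hx
      exact ih i (h.2 i) hi
  | box a c b => exact h.elim
  | frz b => exact h.elim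

theorem Sy.names {t : Term S} (h : Sy K R H zok t) : ∀ n ∈ t.names, n ∉ R := by
  induction t with
  | name n => intro m hm; simp at hm; subst hm; exact h.2
  | var n => simp
  | app f a ih =>
    intro m hm
    rcases h with ⟨n, _, hn, h⟩ | h
    · rw [h] at hm
      obtain ⟨i, hi⟩ := mem_names_app.1 hm
      fin_cases i
      simp at hi; subst hi; exact hn
    · obtain ⟨i, hi⟩ := mem_names_app.1 hm
      exact ih i (h.2 i) m hi
  | box a c b => exact h.elim
  | frz b => exact h.elim

theorem Sy.noDec {t : Term S} (h : Sy K R H zok t) : ∀ n ∈ K, NoDec n t := by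
  induction t with
  | name m => intro n hn e; exact h.1 (e ▸ hn)
  | var n => exact fun _ _ => trivial
  | app f a ih =>
    intro n hn
    rcases h with ⟨m, _, _, h⟩ | h
    · rw [h]
      by_cases e : m = n
      · subst e; exact .inl rfl
      · exact .inr fun i => by fin_cases i; exact e
    · exact .inr fun i => ih i (h.2 i) n hn
  | box a c b => exact h.elim
  | frz b => exact h.elim

theorem Sy.noZero {t : Term S} (h : Sy K R H zok t) (hz : ¬ zok) : t.NoZero := by
  induction t with
  | name m => exact noZero_name
  | var n => exact noZero_var
  | app f a ih =>
    rcases h with ⟨m, _, _, h⟩ | h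
    · rw [h]
      exact noZero_app.2 ⟨by simp, fun i => by fin_cases i; exact noZero_name⟩
    · exact noZero_app.2 ⟨fun hf => hz (h.1 hf).1, fun i => ih i (h.2 i)⟩
  | box a c b => exact h.elim
  | frz b => exact h.elim

theorem Sy.mono {t : Term S} (h : Sy K R H zok t) (hH : t.vars ⊆ H')
    (hR : ∀ n ∈ t.names, n ∉ R') (hz : zok → zok') : Sy K R' H' zok' t := by
  induction t with
  | name m => exact ⟨h.1, hR m (by simp)⟩
  | var n => exact hH (by simp)
  | app f a ih =>
    rcases h with ⟨m, h1, h2, h⟩ | h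
    · refine .inl ⟨m, h1, hR m ?_, h⟩
      rw [h]; exact mem_names_app.2 ⟨0, mem_names_name.2 rfl⟩
    · exact .inr ⟨fun hf => ⟨hz (h.1 hf).1, (h.1 hf).2⟩, fun i => ih i (h.2 i)
        (fun x hx => hH (mem_vars_app.2 ⟨i, hx⟩)) fun x hx => hR x (mem_names_app.2 ⟨i, hx⟩)⟩
  | box a c b => exact h.elim
  | frz b => exact h.elim

theorem Sy.mono_H {t : Term S} (h : Sy K R H zok t) (hH : H ⊆ H') : Sy K R H' zok t :=
  h.mono (h.vars.trans hH) h.names id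

theorem Sy.of {t : Term S} (hp : t.Pure) (hH : t.vars ⊆ H) (hR : ∀ n ∈ t.names, n ∉ R)
    (hK : ∀ n ∈ K, NoDec n t) (hz : t.NoZero ∨ zok ∧ t.vars = ∅) : Sy K R H zok t := by
  induction t with
  | name m => exact ⟨fun hm => hK m hm rfl, hR m (by simp)⟩
  | var n => exact hH (by simp)
  | app f a ih =>
    by_cases hpk : ∃ n ∈ K, Term.app f a = pk (.name n)
    · obtain ⟨n, hn, h⟩ := hpk
      refine .inl ⟨n, hn, hR n ?_, h⟩
      rw [h]; exact mem_names_app.2 ⟨0, mem_names_name.2 rfl⟩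
    · refine .inr ⟨fun hf => ?_, fun i => ih i (pure_app.1 hp i)
        (fun x hx => hH (mem_vars_app.2 ⟨i, hx⟩)) (fun x hx => hR x (mem_names_app.2 ⟨i, hx⟩))
        (fun n hn => ?_) ?_⟩
      · rcases hz with hz | hz
        · exact ((noZero_app.1 hz).1 hf).elim
        · exact hz
      · exact ((hK n hn).resolve_left fun h => hpk ⟨n, hn, h⟩) i
      · exact hz.imp (fun hz => (noZero_app.1 hz).2 i) fun hz => ⟨hz.1, vars_app_eq_empty.1 hz.2 i⟩
  | box a c b => exact (not_pure_box hp).elim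
  | frz b => exact (not_pure_frz hp).elim

theorem Sy.st {s t : Term S} (h : Sy K R H zok t) (hs : s ∈ t.st) :
    Sy K R H zok s ∨ ∃ n ∈ K, s = .name n := by
  induction t with
  | name n => simp [Term.st] at hs; subst hs; exact .inl h
  | var n => simp [Term.st] at hs; subst hs; exact .inl h
  | app f a ih =>
    rcases mem_st_app.1 hs with rfl | ⟨i, hi⟩
    · exact .inl h
    · rcases h with ⟨n, h1, h2, h⟩ | h
      · cases h
        have e : i = 0 := Subsingleton.elim (α := Fin 1) _ _
        subst e
        simp [Term.st] at hi
        exact .inr ⟨n, h1, hi⟩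
      · exact ih i (h.2 i) hi
  | box a c b => exact h.elim
  | frz b => exact h.elim

theorem Sy.red {f : Sym S} {v : Fin f.arity → Term S} (hv : ∀ i, Sy K R H zok (v i))
    (hz : f = .zero → zok ∧ (Term.app f v).vars = ∅) : Sy K R H zok (red f v) := by
  refine red_induction (fun _ => .inr ⟨hz, hv⟩) (fun _ => .inr ⟨by simp, fun i => i.elim0⟩)
    fun i g w j hg h => ?_
  have := hv i
  rw [h] at this
  rcases this with ⟨n, _, _, h⟩ | h
  · cases h; rcases hg with h | h <;> simp at h
  · exact h.2 j

/-- Two cases escape the generic induction: `pk n` with `n` a key, whose argument is not symbolic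
but which is irreducible as a whole, and `zero`, whose argument has to stay without handles and is
therefore treated with an empty set of handles. -/
theorem Sy.dt {t : Term S} (h : Sy K R H zok t) :
    (dt t).All (Sy K R H zok) (Sy K R H zok) := by
  induction t generalizing H with
  | name n => exact h
  | var n => exact h
  | app f a ih =>
    rcases h with ⟨n, h1, h2, h⟩ | h
    · cases h
      have e : CCSA.dt (pk (.name n) : Term S) = .leaf (pk (.name n)) := by
        simp only [CCSA.dt, DT.bindAll]
        simp only [Matrix.cons_val_zero, CCSA.dt, DT.bind]
        rw [DT.op_of_ne (by simp), red_of_constr _ (by simp)]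
        congr 2
      rw [e]
      exact .inl ⟨n, h1, h2, rfl⟩
    · by_cases hf : f = .zero
      · have hv := (h.1 hf).2
        have h' : ∀ i, Sy K R ∅ zok (a i) := fun i => (h.2 i).mono
          (by rw [vars_app_eq_empty.1 hv i]) (h.2 i).names id
        subst hf
        refine DT.bindAll_all (Q := fun _ => Sy K R ∅ zok) _
          (fun i => (ih i (h' i)).mono (fun _ h => h.mono_H (Set.empty_subset _)) fun _ h => h)
          fun v hv => ?_
        rw [DT.op_of_ne (by simp)]
        refine Sy.red (fun i => (hv i).mono_H (Set.empty_subset _)) fun _ => ⟨(h.1 rfl).1, ?_⟩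
        exact vars_app_eq_empty.2 fun i => Set.subset_empty_iff.1 (hv i).vars
      · refine DT.bindAll_all _ (fun i => ih i (h.2 i)) fun v hv => ?_
        by_cases hf' : f = .ite
        · subst hf'
          rw [DT.op_ite]
          split_ifs with h1 h2
          · exact hv 1
          · exact hv 2
          · exact ⟨hv 0, hv 1, hv 2⟩
        · rw [DT.op_of_ne hf']
          exact Sy.red hv fun h => (hf h).elim
  | box a c b => exact h.elim
  | frz b => exact h.elim

theorem Sy.rename {t : Term S} (h : Sy K R H zok t) (μ : Equiv.Perm ℕ) :
    Sy (μ '' K) (μ '' R) H zok (t.rename μ) := by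
  induction t with
  | name n => exact ⟨fun ⟨m, hm, e⟩ => h.1 (μ.injective e ▸ hm), fun ⟨m, hm, e⟩ =>
      h.2 (μ.injective e ▸ hm)⟩
  | var n => exact h
  | app f a ih =>
    rcases h with ⟨n, h1, h2, h⟩ | h
    · rw [h, rename_pk]
      exact .inl ⟨μ n, ⟨n, h1, rfl⟩, fun ⟨m, hm, e⟩ => h2 (μ.injective e ▸ hm), rfl⟩
    · refine .inr ⟨fun hf => ⟨(h.1 hf).1, ?_⟩, fun i => ih i (h.2 i)⟩
      have hp : (Term.app f a).Pure := pure_app.2 fun i => (h.2 i).pure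
      rw [← rename_app, vars_rename _ hp]; exact (h.1 hf).2
  | box a c b => exact h.elim
  | frz b => exact h.elim

end Sy

end CCSA

namespace CCSA
open Term
variable {S : Signature} {V : Val S} {β β' : Prop} {ltU ltS : Term S → Term S → Prop}

/-! ### Oracle calls of one side -/

/-- The call of an encryption oracle, for the handle `x`, the key `n`, the randomness `r` and the
plaintext `t`, or of a decryption oracle, for the handle `z`, the key `n`, the ciphertext `c` and
the encryption handles `l` of the guards. -/
inductive OStep (S : Signature)
  | enc (x n r : ℕ) (t : Term S)
  | dec (z n : ℕ) (c : Term S) (l : List ℕ)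

namespace OStep

def h : OStep S → ℕ
  | enc x _ _ _ => x
  | dec z _ _ _ => z

def body : OStep S → Term S
  | enc _ _ _ t => t
  | dec _ _ c _ => c

def guards : OStep S → List ℕ
  | enc _ _ _ _ => []
  | dec _ _ _ l => l

def out (σ : ℕ → Term S) : OStep S → Term S
  | enc _ n r t => Term.enc (t.subst σ) (pk (name n)) (name r)
  | dec _ n c l =>
    elses (l.map fun y => Term.eq (c.subst σ) (σ y)) (Term.dec (c.subst σ) (sk (name n)))

/-- The call with the plaintext erased. -/
def blank : OStep S → OStep S
  | enc x n r _ => enc x n r (zero tru)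
  | dec z n c l => dec z n c l

def rename (μ : Equiv.Perm ℕ) : OStep S → OStep S
  | enc x n r t => enc x (μ n) (μ r) (t.rename μ)
  | dec z n c l => dec z (μ n) (c.rename μ) l

theorem out_congr {σ σ' : ℕ → Term S} {s : OStep S} (hp : s.body.Pure)
    (h : ∀ x ∈ s.body.vars, σ x = σ' x) (hl : ∀ x ∈ s.guards, σ x = σ' x) :
    s.out σ = s.out σ' := by
  cases s with
  | enc x n r t => simp only [out, subst_congr (t := t) hp h]
  | dec z n c l =>
    simp only [out, subst_congr (t := c) hp h]
    congr 1
    exact List.map_congr_left fun y hy => by rw [hl y hy]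

end OStep

/-- The values of the handles; the last call comes first in the list. -/
def ocall : List (OStep S) → ℕ → Term S
  | [] => var
  | s :: q => Function.update (ocall q) s.h (s.out (ocall q))

def oh (q : List (OStep S)) : Set ℕ := {h | ∃ s ∈ q, s.h = h}

theorem oh_cons (s : OStep S) (q : List (OStep S)) : oh (s :: q) = insert s.h (oh q) := by
  ext h; simp [oh, eq_comm]

/-- Each handle is new and the calls use earlier handles only. -/
def Scoped : List (OStep S) → Prop
  | [] => True
  | s :: q => s.h ∉ oh q ∧ s.body.Pure ∧ s.body.vars ⊆ oh q ∧ (∀ y ∈ s.guards, y ∈ oh q) ∧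
      Scoped q

theorem ocall_cons_of_mem {s : OStep S} {q : List (OStep S)} (hs : Scoped (s :: q)) {h : ℕ}
    (hh : h ∈ oh q) : ocall (s :: q) h = ocall q h :=
  Function.update_of_ne (fun e : h = s.h => hs.1 (e ▸ hh)) _ _

/-- A handle is never reassigned, so a call computed from the handles available at its time is also
the call computed from the final assignment. -/
theorem Scoped.ocall_eq {q : List (OStep S)} (hq : Scoped q) {s : OStep S} (hs : s ∈ q) :
    s.body.Pure ∧ s.body.vars ⊆ oh q ∧ (∀ y ∈ s.guards, y ∈ oh q) ∧
      ocall q s.h = s.out (ocall q) := by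
  induction q with
  | nil => simp at hs
  | cons s' q ih =>
    have sub : oh q ⊆ oh (s' :: q) := by rw [oh_cons]; exact Set.subset_insert _ _
    have key : ∀ s'' : OStep S, s''.body.Pure → s''.body.vars ⊆ oh q →
        (∀ y ∈ s''.guards, y ∈ oh q) → s''.out (ocall q) = s''.out (ocall (s' :: q)) :=
      fun s'' h1 h2 h3 => OStep.out_congr h1 (fun x hx => (ocall_cons_of_mem hq (h2 hx)).symm)
        fun x hx => (ocall_cons_of_mem hq (h3 x hx)).symm
    rcases List.mem_cons.1 hs with rfl | hm
    · refine ⟨hq.2.1, hq.2.2.1.trans sub, fun y hy => sub (hq.2.2.2.1 y hy), ?_⟩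
      rw [← key s hq.2.1 hq.2.2.1 hq.2.2.2.1]
      exact Function.update_self _ _ _
    · obtain ⟨h1, h2, h3, h4⟩ := ih hq.2.2.2.2 hm
      refine ⟨h1, h2.trans sub, fun y hy => sub (h3 y hy), ?_⟩
      rw [ocall_cons_of_mem hq ⟨s, hm, rfl⟩, h4, key s h1 h2 h3]

theorem Scoped.inj {q : List (OStep S)} (hq : Scoped q) {s s' : OStep S} (hs : s ∈ q)
    (hs' : s' ∈ q) (e : s.h = s'.h) : s = s' := by
  induction q with
  | nil => simp at hs
  | cons a q ih =>
    rcases List.mem_cons.1 hs with rfl | hm <;> rcases List.mem_cons.1 hs' with rfl | hm'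
    · rfl
    · exact (hq.1 ⟨s', hm', e.symm⟩).elim
    · exact (hq.1 ⟨s, hm, e⟩).elim
    · exact ih hq.2.2.2.2 hm hm'

theorem oh_blank (q : List (OStep S)) : oh (q.map OStep.blank) = oh q := by
  have : ∀ s : OStep S, s.blank.h = s.h := fun s => by cases s <;> rfl
  ext h; simp [oh, this]

theorem plain_zero_tru : (zero tru : Term S).Plain :=
  plain_app.2 fun i => by fin_cases i; exact plain_app.2 fun i => i.elim0

theorem Scoped.blank {q : List (OStep S)} (hq : Scoped q) : Scoped (q.map OStep.blank) := by
  induction q with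
  | nil => trivial
  | cons s q ih =>
    obtain ⟨h1, h2, h3, h4, h5⟩ := hq
    rw [List.map_cons, Scoped, oh_blank]
    cases s with
    | enc x n r t =>
      refine ⟨h1, plain_zero_tru.1, ?_, h4, ih h5⟩
      change (zero tru : Term S).vars ⊆ _
      rw [plain_zero_tru.2]; exact Set.empty_subset _
    | dec z n c l => exact ⟨h1, h2, h3, h4, ih h5⟩

theorem oh_rename (μ : Equiv.Perm ℕ) (q : List (OStep S)) : oh (q.map (OStep.rename μ)) = oh q := by
  have : ∀ s : OStep S, (s.rename μ).h = s.h := fun s => by cases s <;> rfl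
  ext h; simp [oh, this]

theorem ocall_rename (μ : Equiv.Perm ℕ) (q : List (OStep S)) (h : ℕ) :
    ocall (q.map (OStep.rename μ)) h = (ocall q h).rename μ := by
  induction q generalizing h with
  | nil => rfl
  | cons s q ih =>
    have e : ocall (q.map (OStep.rename μ)) = fun h => (ocall q h).rename μ := funext ih
    simp only [List.map_cons, ocall, e]
    have e1 : (s.rename μ).h = s.h := by cases s <;> rfl
    rw [e1]
    by_cases hh : h = s.h
    · subst hh
      rw [Function.update_self, Function.update_self]
      cases s with
      | enc x n r t =>
        simp only [OStep.rename, OStep.out, rename_enc, rename_pk, rename_subst]; rfl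
      | dec z n c l =>
        simp only [OStep.rename, OStep.out, rename_elses, rename_dec, rename_sk, rename_subst,
          List.map_map]
        congr 1
        refine List.map_congr_left fun y _ => ?_
        simp only [Function.comp, rename_eq, rename_subst]
    · rw [Function.update_of_ne hh, Function.update_of_ne hh]

/-- The shape of the oracle calls for the keys `K` and the randomness `R`. -/
def OShape (K R : Set ℕ) (s : Term S) : Prop :=
  (∃ u, ∃ n ∈ K, ∃ r ∈ R, s = enc u (pk (name n)) (name r)) ∨
    ∃ gs u, ∃ n ∈ K, s = elses gs (dec u (sk (name n)))

section
variable {K R H R' H' : Set ℕ} {zok zok' : Prop}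

theorem OShape.root {s : Term S} (h : OShape K R s) :
    ∃ f a, s = .app f a ∧ (f = .enc ∨ f = .dec ∨ f = .ite) := by
  obtain ⟨u, n, _, r, _, rfl⟩ | ⟨gs, u, n, _, rfl⟩ := h
  · exact ⟨_, _, rfl, .inl rfl⟩
  · cases gs with
    | nil => exact ⟨_, _, rfl, .inr (.inl rfl)⟩
    | cons g gs => exact ⟨_, _, rfl, .inr (.inr rfl)⟩

theorem OShape.not_isBool {s : Term S} (h : OShape K R s) : ¬ s.IsBool := by
  obtain ⟨u, n, _, r, _, rfl⟩ | ⟨gs, u, n, _, rfl⟩ := h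
  · rw [isBool_app_of_ne (by simp)]; simp [Sym.retBool]
  · cases gs with
    | nil =>
      change ¬ (dec _ _).IsBool
      rw [isBool_app_of_ne (by simp)]; simp [Sym.retBool]
    | cons g gs =>
      change ¬ (ite _ (zero _) _).IsBool
      rw [isBool_ite, isBool_app_of_ne (by simp)]; simp [Sym.retBool]

/-- The guards may differ: the positive branch of the first guard already shows the decryption under
`zero`. -/
theorem elses_dec_inj {gs gs' : List (Term S)} {u s u' s' : Term S}
    (e : elses gs (dec u s) = elses gs' (dec u' s')) : u = u' ∧ s = s' := by
  have key : dec u s = dec u' s' := by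
    cases gs with
    | nil =>
      cases gs' with
      | nil => exact e
      | cons g' gs' => cases e
    | cons g gs =>
      cases gs' with
      | nil => cases e
      | cons g' gs' =>
        have := (DT.ite_inj (b := g) (b' := g') e).2.1
        simp only [zero, app.injEq, heq_eq_eq, true_and] at this
        exact congrFun this 0
  simp only [dec, app.injEq, heq_eq_eq, true_and] at key
  exact ⟨congrFun key 0, congrFun key 1⟩

theorem Sy.arg {f : Sym S} {a : Fin f.arity → Term S} (h : Sy K R H zok (.app f a)) (hf : f ≠ .pk)
    (i : Fin f.arity) : Sy K R H zok (a i) := by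
  rcases h with ⟨n, _, _, h⟩ | h
  · cases h; exact (hf rfl).elim
  · exact h.2 i

/-- An encryption call carries a name of `R` as randomness and an unguarded decryption call carries
a name of `K` under `sk`. Neither can come from a symbolic term, in which these names are absent and
handles have no name as value. A guarded decryption is a conditional at the root. -/
theorem Sy.subst_ne {σ : ℕ → Term S} (hσ : ∀ h ∈ H, OShape K R (σ h)) {r s : Term S}
    (hr : Sy K R H zok r) (hif : r.IfFree) (hv : ∀ x, r ≠ var x) (hs : OShape K R s) :
    r.subst σ ≠ s := by
  intro e
  have noname : ∀ {w : Term S} {m : ℕ}, Sy K R H zok w → w.subst σ = name m → m ∉ K ∧ m ∉ R := by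
    intro w m hw hm
    cases w with
    | name n => simp [subst] at hm; subst hm; exact hw
    | var x =>
      obtain ⟨f, a, h, _⟩ := (hσ x hw).root
      simp only [subst] at hm
      rw [h] at hm; cases hm
    | app f a => simp [subst] at hm
    | box a c b => exact hw.elim
    | frz b => exact hw.elim
  cases r with
  | name n =>
    obtain ⟨f, a, h, _⟩ := hs.root
    rw [h] at e; cases e
  | var x => exact hv x rfl
  | app f a =>
    obtain ⟨u, n, hn, r, hr', rfl⟩ | ⟨gs, u, n, hn, rfl⟩ := hs
    · simp only [subst, app.injEq] at e
      obtain ⟨rfl, e⟩ := e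
      rw [heq_eq_eq] at e
      exact (noname (hr.arg (by simp) 2) (congrFun e 2)).2 hr'
    · cases gs with
      | nil =>
        change _ = dec u (sk (name n)) at e
        simp only [subst, app.injEq] at e
        obtain ⟨rfl, e⟩ := e
        rw [heq_eq_eq] at e
        have h1 := hr.arg (by simp) 1
        have e1 : (a 1).subst σ = sk (name n) := congrFun e 1
        generalize a 1 = w at h1 e1
        cases w with
        | name n => cases e1
        | var x =>
          obtain ⟨f, b, h, hf⟩ := (hσ x h1).root
          simp only [subst] at e1
          rw [h] at e1; cases e1; simp at hf
        | app f b =>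
          simp only [subst, app.injEq] at e1
          obtain ⟨rfl, e1⟩ := e1
          rw [heq_eq_eq] at e1
          exact (noname (h1.arg (by simp) 0) (congrFun e1 0)).1 hn
        | box a c b => exact h1.elim
        | frz b => exact h1.elim
      | cons g gs =>
        simp only [subst, elses, List.foldr_cons, app.injEq] at e
        obtain ⟨rfl, e⟩ := e
        exact hif _ (mem_st_self _)
  | box a c b => exact hr.elim
  | frz b => exact hr.elim

theorem ifFree_st {s t : Term S} (h : t.IfFree) (hs : s ∈ t.st) : s.IfFree :=
  fun a ha => h a (st_trans ha hs)

/-- For if-free symbolic terms the handles behave like free constants: by `Sy.subst_ne`, no compound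
part can imitate the value of a handle. -/
theorem Sy.subst_injective {σ : ℕ → Term S} (hσ : ∀ h ∈ H, OShape K R (σ h))
    (hi : Set.InjOn σ H) {s t : Term S} (hs : Sy K R H zok s) (ht : Sy K R H zok t)
    (hs' : s.IfFree) (ht' : t.IfFree) (e : s.subst σ = t.subst σ) : s = t := by
  have key : ∀ {w : Term S}, Sy K R H zok w → w.IfFree → ∀ r ∈ w.st, (∀ x, r ≠ .var x) →
      ∀ x ∈ H, r.subst σ ≠ σ x := by
    intro w hw hw' r hr hv x hx
    rcases hw.st hr with h | ⟨n, _, rfl⟩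
    · exact h.subst_ne hσ (ifFree_st hw' hr) hv (hσ x hx)
    · obtain ⟨f, a, h, _⟩ := (hσ x hx).root
      rw [h]; simp [subst]
  exact subst_inj hi hs.pure ht.pure hs.vars ht.vars (key hs hs') (key ht ht') e

/-- Instances of irreducible terms by oracle calls are irreducible. -/
theorem Sy.nleaf_subst {σ : ℕ → Term S} (hσ : ∀ h ∈ H, OShape K R (σ h) ∧ NLeaf (σ h))
    (hi : Set.InjOn σ H) {t : Term S} (ht : Sy K R H zok t) (hn : NLeaf t) :
    NLeaf (t.subst σ) := by
  induction t with
  | name n => trivial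
  | var x => exact (hσ x ht).2
  | app f a ih =>
    have hσ1 := fun h hh => (hσ h hh).1
    have hif := hn.ifFree ht.pure
    rcases id ht with ⟨n, _, _, h⟩ | h
    · rw [h, subst_of_ground (plain_app.2 fun i => by fin_cases i; exact plain_name)]
      rw [h] at hn; exact hn
    refine ⟨hn.1, fun s hs => ?_, fun i => ih i (h.2 i) (hn.2.2 i)⟩
    -- Oracle calls have root `enc`, `dec` or `ite`; any other root of an instance is present in the
    -- symbolic term already.
    have root : ∀ {w : Term S} {g : Sym S} {b : Fin g.arity → Term S}, Sy K R H zok w →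
        w.subst σ = .app g b → g ≠ .enc → g ≠ .dec → g ≠ .ite →
        ∃ b', w = .app g b' ∧ ∀ i, (b' i).subst σ = b i := by
      intro w g b hw e h1 h2 h3
      cases w with
      | name n => cases e
      | var x =>
        obtain ⟨f, c, h, hf⟩ := (hσ1 x hw).root
        simp only [subst] at e
        rw [h] at e; cases e; simp_all
      | app f c =>
        simp only [subst, app.injEq] at e
        obtain ⟨rfl, e⟩ := e
        rw [heq_eq_eq] at e
        exact ⟨c, rfl, congrFun e⟩
      | box a c b => exact hw.elim
      | frz b => exact hw.elim
    rw [R1_iff] at hs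
    obtain ⟨x, y, e, -⟩ | ⟨x, y, e, -⟩ | ⟨x, e, -⟩ | ⟨x, y, z, e, -⟩ := hs <;>
      simp only [app.injEq] at e <;> obtain ⟨rfl, e⟩ := e <;> rw [heq_eq_eq] at e
    · obtain ⟨b, hb, -⟩ := root (h.2 0) (congrFun e 0) (by simp) (by simp) (by simp)
      refine hn.2.1 (b 0) (R1_iff.2 (.inl ⟨b 0, b 1, ?_, rfl⟩))
      congr 1; funext i; fin_cases i
      refine hb.trans ?_
      congr 1; funext i; fin_cases i <;> rfl
    · obtain ⟨b, hb, -⟩ := root (h.2 0) (congrFun e 0) (by simp) (by simp) (by simp)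
      refine hn.2.1 (b 1) (R1_iff.2 (.inr (.inl ⟨b 0, b 1, ?_, rfl⟩)))
      congr 1; funext i; fin_cases i
      refine hb.trans ?_
      congr 1; funext i; fin_cases i <;> rfl
    · have e' : a 0 = a 1 := Sy.subst_injective hσ1 hi (h.2 0) (h.2 1)
        ((ifFree_app.1 hif).2 0) ((ifFree_app.1 hif).2 1)
        ((congrFun e 0).trans (congrFun e 1).symm)
      refine hn.2.1 tru (R1_iff.2 (.inr (.inr (.inl ⟨a 0, ?_, rfl⟩))))
      congr 1; funext i; fin_cases i
      · rfl
      · exact e'.symm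
    · obtain ⟨k, hk, hk'⟩ := root (h.2 1) (congrFun e 1) (by simp) (by simp) (by simp)
      have hk0 : Sy K R H zok (k 0) := by
        have := h.2 1; rw [hk] at this; exact this.arg (by simp) 0
      have hkif : (k 0).IfFree := by
        have := (ifFree_app.1 hif).2 1; rw [hk] at this; exact (ifFree_app.1 this).2 0
      have hk'' : (k 0).subst σ = y := hk' 0
      have h0 := h.2 0
      have e0 : (a 0).subst σ = enc x (pk y) z := congrFun e 0
      have hif0 := (ifFree_app.1 hif).2 0
      -- If the decrypted ciphertext is a handle, the decryption key would be the instance of a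
      -- symbolic term equal to `sk n` with `n` in `K`, which is impossible. Otherwise the
      -- ciphertext is built by the symbolic term, whose key agrees with the decryption key by
      -- injectivity, and the redex existed before the instantiation.
      rcases eq_or_ne (∃ x, a 0 = var x) True with hv | hv
      · obtain ⟨w, hw⟩ := of_eq_true hv
        rw [hw] at h0 e0
        obtain ⟨u, n, hn', r, hr, h'⟩ | ⟨gs, u, n, hn', h'⟩ := hσ1 w h0
        · simp only [subst] at e0
          rw [h'] at e0
          have : y = name n := by
            simp only [enc, app.injEq, heq_eq_eq, true_and] at e0
            have := congrFun e0 1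
            simp only [Matrix.cons_val_one, Matrix.cons_val_zero, pk, app.injEq, heq_eq_eq,
              true_and] at this
            exact (congrFun this 0).symm
          rw [this] at hk''
          generalize k 0 = k0 at hk'' hk0
          cases k0 with
          | name m => simp [subst] at hk''; subst hk''; exact hk0.1 hn'
          | var x =>
            obtain ⟨f, a, h, _⟩ := (hσ1 x hk0).root
            simp only [subst] at hk''
            rw [h] at hk''; cases hk''
          | app f a => simp [subst] at hk''
          | box a c b => exact hk0.elim
          | frz b => exact hk0.elim
        · simp only [subst] at e0
          rw [h'] at e0
          cases gs <;> cases e0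
      · have hv' : ∀ x, a 0 ≠ var x := fun x hx => hv (eq_true ⟨x, hx⟩)
        have : ∃ b : Fin (Sym.enc (S := S)).arity → Term S, a 0 = .app .enc b ∧
            ∀ i, (b i).subst σ = ![x, pk y, z] i := by
          generalize a 0 = w at h0 e0 hv'
          cases w with
          | name n => cases e0
          | var x => exact (hv' x rfl).elim
          | app f c =>
            simp only [subst, app.injEq] at e0
            obtain ⟨rfl, e⟩ := e0
            rw [heq_eq_eq] at e
            exact ⟨c, rfl, congrFun e⟩
          | box a c b => exact h0.elim
          | frz b => exact h0.elim
        obtain ⟨b, hb, hb'⟩ := this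
        rw [hb] at h0 hif0
        obtain ⟨p, hp, hp'⟩ := root (h0.arg (by simp) 1) (hb' 1) (by simp) (by simp) (by simp)
        have hpif := (ifFree_app.1 hif0).2 1
        rw [hp] at hpif
        have hp0 : (p 0).subst σ = y := hp' 0
        have ek : p 0 = k 0 := by
          rcases h0.arg (by simp) 1 with hh
          rw [hp] at hh
          rcases hh with ⟨n, hnK, hnR, hh⟩ | hh
          · cases hh
            have : y = name n := hp0.symm
            rw [this] at hk''
            generalize k 0 = k0 at hk'' hk0
            cases k0 with
            | name m => simp [subst] at hk''; subst hk''; rfl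
            | var x =>
              obtain ⟨f, a, h, _⟩ := (hσ1 x hk0).root
              simp only [subst] at hk''
              rw [h] at hk''; cases hk''
            | app f a => simp [subst] at hk''
            | box a c b => exact hk0.elim
            | frz b => exact hk0.elim
          · exact Sy.subst_injective hσ1 hi (hh.2 0) hk0 ((ifFree_app.1 hpif).2 0) hkif
              (hp0.trans hk''.symm)
        refine hn.2.1 (b 0) (R1_iff.2 (.inr (.inr (.inr ⟨b 0, k 0, b 2, ?_, rfl⟩))))
        congr 1; funext i; fin_cases i
        · refine hb.trans ?_
          congr 1; funext i; fin_cases i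
          · rfl
          · refine hp.trans ?_
            congr 1; funext i; fin_cases i; exact ek
          · rfl
        · refine hk.trans ?_
          congr 1; funext i; fin_cases i; rfl
  | box a c b => exact ht.elim
  | frz b => exact ht.elim

end

end CCSA

namespace CCSA
open Term
variable {S : Signature} {V : Val S} {β β' : Prop} {ltU ltS : Term S → Term S → Prop}

/-! ### Oracle calls are normalized -/

/-- Decision trees over irreducible terms. -/
inductive Tr : Term S → Prop
  | leaf (t : Term S) (h : NLeaf t) : Tr t
  | node (b u v : Term S) (hb : NLeaf b) (hbool : b.IsBool) (hu : Tr u) (hv : Tr v) :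
      Tr (ite b u v)

/-- Valid sequences of oracle calls for the keys `K` and the randomness `R`. -/
def OV (K R : Set ℕ) : List (OStep S) → Prop
  | [] => True
  | .enc x n r t :: q => (x ∉ oh q ∧ n ∈ K ∧ r ∈ R ∧ (∀ x n t, OStep.enc x n r t ∉ q) ∧ Tr t ∧
      Sy K R (oh q) False t) ∧ OV K R q
  | .dec z n c l :: q => (z ∉ oh q ∧ n ∈ K ∧ NLeaf c ∧ Sy K R (oh q) False c ∧
      (∀ y ∈ l, (∃ n r t, OStep.enc y n r t ∈ q) ∧ ocall q y ∈ (c.subst (ocall q)).st) ∧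
      ∀ z l, OStep.dec z n c l ∉ q) ∧ OV K R q

section
variable {K R : Set ℕ}

theorem OV.tail {s : OStep S} {q : List (OStep S)} (h : OV K R (s :: q)) : OV K R q := by
  cases s <;> exact h.2

theorem OV.scoped {q : List (OStep S)} (h : OV K R q) : Scoped q := by
  induction q with
  | nil => trivial
  | cons s q ih =>
    cases s with
    | enc x n r t =>
      obtain ⟨⟨h1, h2, h3, h4, h5, h6⟩, h7⟩ := h
      exact ⟨h1, h6.pure, h6.vars, by simp [OStep.guards], ih h7⟩
    | dec z n c l =>
      obtain ⟨⟨h1, h2, h3, h4, h5, h6⟩, h7⟩ := h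
      refine ⟨h1, h4.pure, h4.vars, fun y hy => ?_, ih h7⟩
      obtain ⟨n, r, t, h⟩ := (h5 y hy).1
      exact ⟨_, h, rfl⟩

theorem OStep.shape {s : OStep S} {q : List (OStep S)} (h : OV K R (s :: q)) (σ : ℕ → Term S) :
    OShape K R (s.out σ) := by
  cases s with
  | enc x n r t => exact .inl ⟨_, n, h.1.2.1, r, h.1.2.2.1, rfl⟩
  | dec z n c l => exact .inr ⟨_, _, n, h.1.2.1, rfl⟩

theorem OV.shape {q : List (OStep S)} (h : OV K R q) : ∀ x ∈ oh q, OShape K R (ocall q x) := by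
  induction q with
  | nil => simp [oh]
  | cons s q ih =>
    intro x hx
    rw [oh_cons] at hx
    by_cases e : x = s.h
    · subst e; rw [ocall, Function.update_self]; exact s.shape h _
    · rw [ocall, Function.update_of_ne e]; exact ih h.tail x (hx.resolve_left e)

theorem mem_oh {q : List (OStep S)} {x : ℕ} (hx : x ∈ oh q) :
    (∃ n r t, OStep.enc x n r t ∈ q) ∨ ∃ n c l, OStep.dec x n c l ∈ q := by
  obtain ⟨s, hs, rfl⟩ := hx
  cases s with
  | enc x n r t => exact .inl ⟨n, r, t, hs⟩
  | dec z n c l => exact .inr ⟨n, c, l, hs⟩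

theorem mem_oh_enc {q : List (OStep S)} {x n r : ℕ} {t : Term S} (h : OStep.enc x n r t ∈ q) :
    x ∈ oh q := ⟨_, h, rfl⟩

theorem mem_oh_dec {q : List (OStep S)} {z n : ℕ} {c : Term S} {l : List ℕ}
    (h : OStep.dec z n c l ∈ q) : z ∈ oh q := ⟨_, h, rfl⟩

theorem OV.steps {q : List (OStep S)} (h : OV K R q) {s : OStep S} (hs : s ∈ q) :
    Sy K R (oh q) False s.body ∧ ((∃ x n r t, s = .enc x n r t ∧ n ∈ K ∧ r ∈ R ∧ Tr t) ∨
      ∃ z n c l, s = .dec z n c l ∧ n ∈ K ∧ NLeaf c) := by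
  induction q with
  | nil => simp at hs
  | cons s' q ih =>
    have sub : oh q ⊆ oh (s' :: q) := by rw [oh_cons]; exact Set.subset_insert _ _
    rcases List.mem_cons.1 hs with rfl | hm
    · cases s with
      | enc x n r t =>
        exact ⟨h.1.2.2.2.2.2.mono_H sub, .inl ⟨x, n, r, t, rfl, h.1.2.1, h.1.2.2.1, h.1.2.2.2.2.1⟩⟩
      | dec z n c l =>
        exact ⟨h.1.2.2.2.1.mono_H sub, .inr ⟨z, n, c, l, rfl, h.1.2.1, h.1.2.2.1⟩⟩
    · exact ⟨(ih h.tail hm).1.mono_H sub, (ih h.tail hm).2⟩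

/-- Different handles have different calls. -/
theorem OV.inj {q : List (OStep S)} (h : OV K R q) : Set.InjOn (ocall q) (oh q) := by
  induction q with
  | nil => simp [oh]
  | cons s q ih =>
    -- A new encryption has a fresh randomness. A new decryption has a ciphertext or a key different
    -- from those of earlier decryptions, and equal instances of ciphertexts would come from equal
    -- symbolic ciphertexts.
    have key : ∀ x ∈ oh q, ocall q x ≠ s.out (ocall q) := by
      intro x hx e
      obtain ⟨n', r', t', hx'⟩ | ⟨n', c', l', hx'⟩ := mem_oh hx
      · have e' := (h.tail.scoped.ocall_eq hx').2.2.2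
        change ocall q x = _ at e'
        rw [e'] at e
        cases s with
        | enc y n r t =>
          simp only [OStep.out, enc, app.injEq, heq_eq_eq, true_and] at e
          have := congrFun e 2
          simp only [Matrix.cons_val, name.injEq] at this
          exact h.1.2.2.2.1 x n' t' (this ▸ hx')
        | dec z n c l => cases l <;> cases e
      · have e' := (h.tail.scoped.ocall_eq hx').2.2.2
        change ocall q x = _ at e'
        rw [e'] at e
        cases s with
        | enc y n r t => cases l' <;> cases e
        | dec z n c l =>
          obtain ⟨e1, e2⟩ := elses_dec_inj e
          have hc' := h.tail.steps hx'
          have e3 : n' = n := by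
            simp only [sk, app.injEq, heq_eq_eq, true_and] at e2
            simpa using congrFun e2 0
          have hcl : NLeaf c' := by
            obtain ⟨_, _, _, _, h, _⟩ | ⟨_, _, _, _, h, _, hc⟩ := hc'.2
            · cases h
            · cases h; exact hc
          have e4 : c' = c := Sy.subst_injective h.tail.shape (ih h.tail) hc'.1 h.1.2.2.2.1
            (hcl.ifFree hc'.1.pure) (h.1.2.2.1.ifFree h.1.2.2.2.1.pure) e1
          exact h.1.2.2.2.2.2 x l' (by rw [← e3, ← e4]; exact hx')
    intro x hx y hy e
    rw [oh_cons] at hx hy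
    simp only [ocall] at e
    by_cases ex : x = s.h <;> by_cases ey : y = s.h
    · rw [ex, ey]
    · rw [ex, Function.update_self, Function.update_of_ne ey] at e
      exact (key y (hy.resolve_left ey) e.symm).elim
    · rw [ey, Function.update_self, Function.update_of_ne ex] at e
      exact (key x (hx.resolve_left ex) e).elim
    · rw [Function.update_of_ne ex, Function.update_of_ne ey] at e
      exact ih h.tail (hx.resolve_left ex) (hy.resolve_left ey) e

-- Instances of symbolic terms as normalized basic and simple terms.

theorem st_finite {t : Term S} (h : t.Pure) : t.st.Finite := by
  induction t with
  | name n => simp [st]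
  | var n => simp [st]
  | app f a ih =>
    exact (Set.finite_singleton _).union (Set.finite_iUnion fun i => ih i (pure_app.1 h i))
  | box a c b => exact (not_pure_box h).elim
  | frz b => exact (not_pure_frz h).elim

open Classical in
/-- The context obtained from `t` by abstracting the names, the public keys of `K` and the subterms
starting with `zero`; the holes of these atoms are odd and given by `code`, the holes of the
variables are even. -/
noncomputable def ctxOf (K : Set ℕ) (code : Term S → ℕ) : Term S → Term S
  | .name n => .var (2 * code (.name n) + 1)
  | .var x => .var (2 * x)
  | .app f a => if (∃ n ∈ K, Term.app f a = pk (.name n)) ∨ f = .zero then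
      .var (2 * code (.app f a) + 1) else .app f fun i => ctxOf K code (a i)
  | .box a c b => .box a c b
  | .frz b => .frz b

theorem ctxOf_spec {H : Set ℕ} {zok : Prop} {code : Term S → ℕ} {t : Term S}
    (h : Sy K R H zok t) (hif : t.IfFree) :
    (ctxOf K code t).Pure ∧ (ctxOf K code t).IfFree ∧ (ctxOf K code t).NoZero ∧
    (ctxOf K code t).names = ∅ ∧
    (∀ y ∈ (ctxOf K code t).vars, (∃ x ∈ t.vars, y = 2 * x) ∨ ∃ w ∈ t.st, y = 2 * code w + 1 ∧
      w.Plain ∧ w.IfFree ∧ (∀ r ∈ R, r ∉ w.names) ∧ ∀ n ∈ K, NoDec n w) ∧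
    ∀ σ : ℕ → Term S, (∀ w ∈ t.st, σ (2 * code w + 1) = w) →
      (ctxOf K code t).subst σ = t.subst fun x => σ (2 * x) := by
  induction t with
  | name n =>
    refine ⟨pure_var, ifFree_var, noZero_var, by simp [ctxOf, Term.names, st], fun y hy => ?_,
      fun σ hσ => ?_⟩
    · simp [ctxOf] at hy
      exact .inr ⟨_, mem_st_self _, hy, plain_name, ifFree_name, fun r hr e => h.names r e hr,
        h.noDec⟩
    · exact hσ _ (mem_st_self _)
  | var x =>
    refine ⟨pure_var, ifFree_var, noZero_var, by simp [ctxOf, Term.names, st], fun y hy => ?_,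
      fun σ hσ => rfl⟩
    simp [ctxOf] at hy
    exact .inl ⟨x, by simp, hy⟩
  | app f a ih =>
    rw [ctxOf]
    split_ifs with hc
    · have hp : (Term.app f a).Plain := by
        refine ⟨h.pure, ?_⟩
        rcases hc with ⟨n, _, e⟩ | e
        · rw [e]; exact vars_pk_name
        · rcases id h with ⟨n, _, _, e⟩ | h
          · rw [e]; exact vars_pk_name
          · exact (h.1 e).2
      refine ⟨pure_var, ifFree_var, noZero_var, by simp [Term.names, st], fun y hy => ?_,
        fun σ hσ => ?_⟩
      · simp at hy
        exact .inr ⟨_, mem_st_self _, hy, hp, hif, fun r hr e => h.names r e hr, h.noDec⟩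
      · rw [subst_of_ground hp]; exact hσ _ (mem_st_self _)
    · push Not at hc
      rcases id h with ⟨n, hn, _, e⟩ | hh
      · exact (hc.1 n hn e).elim
      have ih' := fun i => ih i (hh.2 i) ((ifFree_app.1 hif).2 i)
      refine ⟨pure_app.2 fun i => (ih' i).1, ifFree_app.2 ⟨(ifFree_app.1 hif).1, fun i => (ih' i).2.1⟩,
        noZero_app.2 ⟨hc.2, fun i => (ih' i).2.2.1⟩, ?_, fun y hy => ?_, fun σ hσ => ?_⟩
      · ext n
        simp only [mem_names_app, (ih' _).2.2.2.1]; simp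
      · obtain ⟨i, hi⟩ := mem_vars_app.1 hy
        rcases (ih' i).2.2.2.2.1 y hi with ⟨x, hx, e⟩ | ⟨w, hw, e⟩
        · exact .inl ⟨x, mem_vars_app.2 ⟨i, hx⟩, e⟩
        · exact .inr ⟨w, mem_st_app.2 (.inr ⟨i, hw⟩), e⟩
      · simp only [subst]
        congr 1; funext i
        exact (ih' i).2.2.2.2.2 σ fun w hw => hσ w (mem_st_app.2 (.inr ⟨i, hw⟩))
  | box a c b => exact h.elim
  | frz b => exact h.elim

/-- The symbolic term is a context of function symbols filled with atoms and handles, and the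
handles are replaced by their calls. For the normality condition, each call is replaced by its
skeleton. Skeletons are again of the shape of oracle calls, irreducible and pairwise distinct, so
`Sy.nleaf_subst` applies to them as it does to the calls themselves. -/
theorem NBasic.of_sy {ek : EK S} {q : List (OStep S)} (hq : OV K R q) (hK : ek.keys ⊆ K)
    (hR : ek.rands ⊆ R) {H : Set ℕ} (hH : H ⊆ oh q)
    (hE : ∀ x n r t, OStep.enc x n r t ∈ q → x ∈ H → EncCall ltU ek (ocall q x))
    (hD : ∀ z n c l, OStep.dec z n c l ∈ q → z ∈ H → DecCall ltU ek (ocall q z))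
    {zok : Prop} {t : Term S} (ht : Sy K R H zok t) (hn : NLeaf t) :
    NBasic ltU ek (t.subst (ocall q)) := by
  classical
  have : Nonempty (Term S) := ⟨tru⟩
  obtain ⟨code, hcode⟩ := Set.countable_iff_exists_injOn.1 (st_finite ht.pure).countable
  have hif := hn.ifFree ht.pure
  obtain ⟨h1, h2, h3, h4, h5, h6⟩ := ctxOf_spec (code := code) ht hif
  -- the term with a given code
  have hdec : ∃ d : ℕ → Term S, ∀ w ∈ t.st, d (code w) = w :=
    ⟨Function.invFunOn code t.st, fun w hw => hcode.leftInvOn_invFunOn hw⟩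
  obtain ⟨d, hd⟩ := hdec
  have hstep : ∀ x : ℕ, ∃ k : HoleKind × Term S, x ∈ H →
      ((k.1 = .enc ∧ EncCall ltU ek (ocall q x)) ∨ (k.1 = .dec ∧ DecCall ltU ek (ocall q x))) ∧
      Skel (2 * x) k.1 (ocall q x) k.2 ∧ OShape K R k.2 ∧ NLeaf k.2 ∧
      ((∃ n r, k.2 = enc (var (2 * x)) (pk (name n)) (name r)) ∨
        ∃ n, k.2 = dec (var (2 * x)) (sk (name n))) := by
    intro x
    by_cases hx : x ∈ H
    · obtain ⟨n, r, u, hs⟩ | ⟨n, c, l, hs⟩ := mem_oh (hH hx)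
      · refine ⟨⟨.enc, enc (var (2 * x)) (pk (name n)) (name r)⟩, fun _ =>
          ⟨.inl ⟨rfl, hE x n r u hs hx⟩, ?_, ?_, ?_, .inl ⟨n, r, rfl⟩⟩⟩
        · rw [show ocall q x = _ from (hq.scoped.ocall_eq hs).2.2.2]
          exact .enc _ _ _
        · obtain ⟨_, _, _, _, e, h1, h2, _⟩ | ⟨_, _, _, _, e, _⟩ := (hq.steps hs).2 <;> cases e
          exact .inl ⟨_, n, h1, r, h2, rfl⟩
        · refine nleaf_app.2 ⟨by simp, fun s hs => ?_, fun i => ?_⟩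
          · rw [R1_iff] at hs; simp at hs
          · fin_cases i
            · trivial
            · refine nleaf_app.2 ⟨by simp, fun s hs => ?_, fun i => ?_⟩
              · rw [R1_iff] at hs; simp at hs
              · fin_cases i; trivial
            · trivial
      · refine ⟨⟨.dec, dec (var (2 * x)) (sk (name n))⟩, fun _ =>
          ⟨.inr ⟨rfl, hD x n c l hs hx⟩, ?_, ?_, ?_, .inr ⟨n, rfl⟩⟩⟩
        · rw [show ocall q x = _ from (hq.scoped.ocall_eq hs).2.2.2]
          exact .dec _ _ _
        · obtain ⟨_, _, _, _, e, _⟩ | ⟨_, _, _, _, e, h1, _⟩ := (hq.steps hs).2 <;> cases e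
          exact .inr ⟨[], _, n, h1, rfl⟩
        · refine nleaf_app.2 ⟨by simp, fun s hs => ?_, fun i => ?_⟩
          · rw [R1_iff] at hs
            simp only [app.injEq, reduceCtorEq, false_and, exists_false, false_or, heq_eq_eq,
              true_and] at hs
            obtain ⟨x, y, z, e, _⟩ := hs
            have := congrFun e 0
            simp at this
          · fin_cases i
            · trivial
            · refine nleaf_app.2 ⟨by simp, fun s hs => ?_, fun i => ?_⟩
              · rw [R1_iff] at hs; simp at hs
              · fin_cases i; trivial
    · exact ⟨⟨.plain, var 0⟩, fun h => (hx h).elim⟩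
  choose k hk using hstep
  have div1 : ∀ x : ℕ, (2 * x + 1) / 2 = x := fun x => by omega
  have div0 : ∀ x : ℕ, (2 * x) / 2 = x := fun x => by omega
  have mod1 : ∀ x : ℕ, ¬ (2 * x + 1) % 2 = 0 := fun x => by omega
  have mod0 : ∀ x : ℕ, (2 * x) % 2 = 0 := fun x => by omega
  let σ : ℕ → Term S := fun y => if y % 2 = 0 then ocall q (y / 2) else d (y / 2)
  let τ : ℕ → Term S := fun y => if y % 2 = 0 then (k (y / 2)).2 else d (y / 2)
  let kind : ℕ → HoleKind := fun y => if y % 2 = 0 then (k (y / 2)).1 else .plain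
  have σ1 : ∀ x, σ (2 * x + 1) = d x := fun x => by simp only [σ, if_neg (mod1 x), div1]
  have σ0 : ∀ x, σ (2 * x) = ocall q x := fun x => by simp only [σ, if_pos (mod0 x), div0]
  have τ1 : ∀ x, τ (2 * x + 1) = d x := fun x => by simp only [τ, if_neg (mod1 x), div1]
  have τ0 : ∀ x, τ (2 * x) = (k x).2 := fun x => by simp only [τ, if_pos (mod0 x), div0]
  have k1 : ∀ x, kind (2 * x + 1) = .plain := fun x => by simp only [kind, if_neg (mod1 x)]
  have k0 : ∀ x, kind (2 * x) = (k x).1 := fun x => by simp only [kind, if_pos (mod0 x), div0]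
  have eσ := h6 σ fun w hw => by rw [σ1, hd w hw]
  have eτ := h6 τ fun w hw => by rw [τ1, hd w hw]
  have fold : t.subst (ocall q) = (ctxOf K code t).subst σ := by
    rw [eσ]; congr 1; funext x; rw [σ0]
  have hv : ∀ y ∈ (ctxOf K code t).vars, (∃ x ∈ H, y = 2 * x) ∨ ∃ w ∈ t.st, y = 2 * code w + 1 ∧
      w.Plain ∧ w.IfFree ∧ (∀ r ∈ R, r ∉ w.names) ∧ ∀ n ∈ K, NoDec n w := fun y hy =>
    (h5 y hy).imp (fun ⟨x, hx, e⟩ => ⟨x, ht.vars hx, e⟩) id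
  rw [fold]
  refine .intro _ σ τ kind ⟨h1, h2, h3, h4⟩ ?_ ?_ ?_ ?_ ?_ ?_
  · intro y hy e
    rcases hv y hy with ⟨x, hx, rfl⟩ | ⟨w, hw, rfl, g1, g2, g3, g4⟩
    · rw [k0] at e
      rcases (hk x hx).1 with ⟨h, _⟩ | ⟨h, _⟩ <;> rw [h] at e <;> cases e
    · rw [σ1, hd w hw]
      exact ⟨g1, g2, fun r hr => g3 r (hR hr), fun n hn => g4 n (hK hn)⟩
  · intro y hy e
    rcases hv y hy with ⟨x, hx, rfl⟩ | ⟨w, hw, rfl, -⟩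
    · rw [k0] at e; rw [σ0]
      rcases (hk x hx).1 with ⟨h, h'⟩ | ⟨h, _⟩
      · exact h'
      · rw [h] at e; cases e
    · rw [k1] at e; cases e
  · intro y hy e
    rcases hv y hy with ⟨x, hx, rfl⟩ | ⟨w, hw, rfl, -⟩
    · rw [k0] at e; rw [σ0]
      rcases (hk x hx).1 with ⟨h, _⟩ | ⟨h, h'⟩
      · rw [h] at e; cases e
      · exact h'
    · rw [k1] at e; cases e
  · rintro y ⟨hy, e⟩ y' ⟨hy', e'⟩ ee
    rcases hv y hy with ⟨x, hx, rfl⟩ | ⟨w, hw, rfl, -⟩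
    · rcases hv y' hy' with ⟨x', hx', rfl⟩ | ⟨w, hw, rfl, -⟩
      · rw [σ0, σ0] at ee
        rw [hq.inj (hH hx) (hH hx') ee]
      · exact (e' (k1 _)).elim
    · exact (e (k1 _)).elim
  · intro y hy
    rcases hv y hy with ⟨x, hx, rfl⟩ | ⟨w, hw, rfl, -⟩
    · rw [σ0, τ0, k0]; exact (hk x hx).2.1
    · rw [σ1, τ1, k1]; exact .plain _
  · rw [eτ]
    have hτ : ∀ x ∈ H, OShape K R (τ (2 * x)) ∧ NLeaf (τ (2 * x)) := fun x hx => by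
      rw [τ0]; exact ⟨(hk x hx).2.2.1, (hk x hx).2.2.2.1⟩
    refine (Sy.nleaf_subst (σ := fun x => τ (2 * x)) hτ ?_ ht hn).rnormal
      (pure_subst ht.pure fun x hx => ?_)
    -- Distinct handles have distinct skeletons because the hole of a skeleton records its handle.
    · intro x hx x' hx' e
      simp only [τ0] at e
      obtain ⟨n, r, h⟩ | ⟨n, h⟩ := (hk x hx).2.2.2.2 <;>
        obtain ⟨n', r', h'⟩ | ⟨n', h'⟩ := (hk x' hx').2.2.2.2 <;> rw [h, h'] at e
      · simp only [enc, app.injEq, heq_eq_eq, true_and] at e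
        simpa using congrFun e 0
      · cases e
      · cases e
      · simp only [dec, app.injEq, heq_eq_eq, true_and] at e
        simpa using congrFun e 0
    · rw [τ0]
      obtain ⟨n, r, h⟩ | ⟨n, h⟩ := (hk x (ht.vars hx)).2.2.2.2 <;> rw [h]
      · refine pure_app.2 fun i => ?_
        fin_cases i
        · exact pure_var
        · exact pure_app.2 fun i => by fin_cases i; exact pure_name
        · exact pure_name
      · refine pure_app.2 fun i => ?_
        fin_cases i
        · exact pure_var
        · exact pure_app.2 fun i => by fin_cases i; exact pure_name

theorem NSimple.of_sy {ek : EK S} {q : List (OStep S)} (hq : OV K R q) (hK : ek.keys ⊆ K)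
    (hR : ek.rands ⊆ R) {H : Set ℕ} (hH : H ⊆ oh q)
    (hE : ∀ x n r t, OStep.enc x n r t ∈ q → x ∈ H → EncCall ltU ek (ocall q x))
    (hD : ∀ z n c l, OStep.dec z n c l ∈ q → z ∈ H → DecCall ltU ek (ocall q z))
    {zok : Prop} {t : Term S} (ht : Sy K R H zok t) (hn : Tr t) :
    NSimple ltU ek (t.subst (ocall q)) := by
  induction hn with
  | leaf t h => exact .basic _ (NBasic.of_sy hq hK hR hH hE hD ht h)
  | node b u v hb hbool _ _ ihu ihv =>
    rw [subst_ite]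
    refine .ite _ _ _ (NBasic.of_sy hq hK hR hH hE hD (ht.arg (by simp) 0) hb) ?_
      (ihu (ht.arg (by simp) 1)) (ihv (ht.arg (by simp) 2))
    cases b with
    | app f a =>
      rw [isBool_app_of_ne (nleaf_app.1 hb).1] at hbool
      exact (isBool_app_of_ne (nleaf_app.1 hb).1).2 hbool
    | name n => exact hbool.elim
    | var n => exact hbool.elim
    | box a c b => exact (ht.arg (by simp) 0).elim
    | frz b => exact (ht.arg (by simp) 0).elim

/-- Induction along the sequence: the argument of a call is a normalized symbolic term over earlier
handles, and these are oracle calls by induction, so the argument meets the mutual definition of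
oracle calls and normalized terms. -/
theorem OV.calls {ek : EK S} (hK : ek.keys = K) (hR : ek.rands = R) {q : List (OStep S)}
    (hq : OV K R q)
    (hE : ∀ x n r t, OStep.enc x n r t ∈ q → ocall q x ∈ ek.encs)
    (hD : ∀ z n c l, OStep.dec z n c l ∈ q → ocall q z ∈ ek.decs) :
    (∀ x n r t, OStep.enc x n r t ∈ q → EncCall ltU ek (ocall q x)) ∧
      ∀ z n c l, OStep.dec z n c l ∈ q → DecCall ltU ek (ocall q z) := by
  induction q with
  | nil => simp
  | cons s q ih =>
    have up : ∀ {x}, x ∈ oh q → ocall (s :: q) x = ocall q x := fun h =>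
      ocall_cons_of_mem hq.scoped h
    have ih' := ih hq.tail (fun x n r t h => by
        have := hE x n r t (List.mem_cons_of_mem _ h)
        rwa [up (mem_oh_enc h)] at this)
      (fun x n r t h => by
        have := hD x n r t (List.mem_cons_of_mem _ h)
        rwa [up (mem_oh_dec h)] at this)
    have hE' : ∀ x n r t, OStep.enc x n r t ∈ q → x ∈ oh q → EncCall ltU ek (ocall q x) :=
      fun x n r t h _ => ih'.1 x n r t h
    have hD' : ∀ z n c l, OStep.dec z n c l ∈ q → z ∈ oh q → DecCall ltU ek (ocall q z) :=
      fun x n r t h _ => ih'.2 x n r t h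
    constructor
    · intro x n r t h
      rcases List.mem_cons.1 h with rfl | h'
      · have hm := hE x n r t h
        have e : ocall (OStep.enc x n r t :: q) x = _ := Function.update_self _ _ _
        rw [e] at hm ⊢
        exact .intro _ n r hm (hK ▸ hq.1.2.1) (hR ▸ hq.1.2.2.1)
          (NSimple.of_sy hq.tail hK.le hR.le le_rfl hE' hD' hq.1.2.2.2.2.2 hq.1.2.2.2.2.1)
      · rw [up (mem_oh_enc h')]; exact ih'.1 x n r t h'
    · intro z n c l h
      rcases List.mem_cons.1 h with rfl | h'
      · have hm := hD z n c l h
        have e : ocall (OStep.dec z n c l :: q) z = _ := Function.update_self _ _ _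
        obtain ⟨⟨h1, h2, h3, h4, h5, h6⟩, h7⟩ := hq
        have e' : ocall (OStep.dec z n c l :: q) z = elses ((l.map (ocall q)).map
            (Term.eq (c.subst (ocall q)))) (Term.dec (c.subst (ocall q)) (sk (name n))) := by
          rw [e, List.map_map]; rfl
        rw [e'] at hm ⊢
        have hx : ∀ x : ℕ, ∃ k : HoleKind, x ∈ oh q →
            (k = .enc ∧ EncCall ltU ek (ocall q x)) ∨ (k = .dec ∧ DecCall ltU ek (ocall q x)) := by
          intro x
          by_cases hx : x ∈ oh q
          · obtain ⟨n, r, t, hs⟩ | ⟨n, c, l, hs⟩ := mem_oh hx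
            · exact ⟨.enc, fun _ => .inl ⟨rfl, ih'.1 x n r t hs⟩⟩
            · exact ⟨.dec, fun _ => .inr ⟨rfl, ih'.2 x n c l hs⟩⟩
          · exact ⟨.plain, fun h => (hx h).elim⟩
        choose k hk using hx
        refine .intro c _ (ocall q) k (l.map (ocall q)) n ⟨h4.pure, h3.ifFree h4.pure,
          h3.rnormal h4.pure⟩ ?_ (h7.inj.mono h4.vars) ?_ ?_ rfl ?_ ?_ (hK ▸ h2) hm
        · intro x hx e
          rcases hk x (h4.vars hx) with ⟨h, _⟩ | ⟨h, _⟩ <;> rw [h] at e <;> cases e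
        · intro x hx e
          rcases hk x (h4.vars hx) with ⟨h, h'⟩ | ⟨h, _⟩
          · exact h'
          · rw [h] at e; cases e
        · intro x hx e
          rcases hk x (h4.vars hx) with ⟨h, _⟩ | ⟨h, h'⟩
          · rw [h] at e; cases e
          · exact h'
        · intro α hα
          obtain ⟨y, hy, rfl⟩ := List.mem_map.1 hα
          obtain ⟨n, r, t, hs⟩ := (h5 y hy).1
          exact ih'.1 y n r t hs
        · intro α hα
          obtain ⟨y, hy, rfl⟩ := List.mem_map.1 hα
          exact (h5 y hy).2
      · rw [up (mem_oh_dec h')]; exact ih'.2 z n c l h'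

theorem tr_rename {t : Term S} (μ : Equiv.Perm ℕ) (h : Tr t) : Tr (t.rename μ) := by
  induction h with
  | leaf t h => exact .leaf _ (nleaf_rename μ h)
  | node b u v hb hbool _ _ ihu ihv =>
    rw [rename_ite]
    exact .node _ _ _ (nleaf_rename μ hb) ((isBool_rename μ).2 hbool) ihu ihv

theorem st_rename {s t : Term S} (μ : Equiv.Perm ℕ) (ht : t.Pure) (hs : s ∈ t.st) :
    s.rename μ ∈ (t.rename μ).st := by
  induction t with
  | name n => simp [st] at hs; subst hs; exact mem_st_self _
  | var n => simp [st] at hs; subst hs; exact mem_st_self _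
  | app f a ih =>
    rcases mem_st_app.1 hs with rfl | ⟨i, hi⟩
    · exact mem_st_self _
    · exact mem_st_app.2 (.inr ⟨i, ih i (pure_app.1 ht i) hi⟩)
  | box a c b => exact (not_pure_box ht).elim
  | frz b => exact (not_pure_frz ht).elim

theorem OV.pure {q : List (OStep S)} (h : OV K R q) (x : ℕ) : (ocall q x).Pure := by
  induction q generalizing x with
  | nil => exact pure_var
  | cons s q ih =>
    have ih' := ih h.tail
    by_cases e : x = s.h
    · subst e
      rw [ocall, Function.update_self]
      have hb := (h.scoped).2.1
      have hbσ := pure_subst (σ := ocall q) hb fun x _ => ih' x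
      cases s with
      | enc x n r t =>
        refine pure_app.2 fun i => ?_
        fin_cases i
        · exact hbσ
        · exact pure_app.2 fun i => by fin_cases i; exact pure_name
        · exact pure_name
      | dec z n c l =>
        simp only [OStep.out]
        have hdec : (dec (c.subst (ocall q)) (sk (name n))).Pure := by
          refine pure_app.2 fun i => ?_
          fin_cases i
          · exact hbσ
          · exact pure_app.2 fun i => by fin_cases i; exact pure_name
        generalize l.map _ = gs, (show ∀ g ∈ l.map fun y => Term.eq (c.subst (ocall q)) (ocall q y),
          g.Pure from fun g hg => by
            obtain ⟨y, _, rfl⟩ := List.mem_map.1 hg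
            refine pure_app.2 fun i => ?_
            fin_cases i
            · exact hbσ
            · exact ih' y) = hgs
        clear ih'
        induction gs with
        | nil => exact hdec
        | cons g gs ih2 =>
          refine pure_app.2 fun i => ?_
          fin_cases i
          · exact hgs g (by simp)
          · exact pure_app.2 fun i => by fin_cases i; exact hdec
          · exact ih2 fun g hg => hgs g (by simp [hg])
    · rw [ocall, Function.update_of_ne e]; exact ih' x

theorem OV.rename {q : List (OStep S)} (h : OV K R q) (μ : Equiv.Perm ℕ) :
    OV (μ '' K) (μ '' R) (q.map (OStep.rename μ)) := by
  induction q with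
  | nil => trivial
  | cons s q ih =>
    have hmem : ∀ {s : OStep S}, s ∈ q → s.rename μ ∈ q.map (OStep.rename μ) :=
      fun h => List.mem_map_of_mem h
    cases s with
    | enc x n r t =>
      obtain ⟨⟨h1, h2, h3, h4, h5, h6⟩, h7⟩ := h
      refine ⟨⟨by rwa [oh_rename], ⟨n, h2, rfl⟩, ⟨r, h3, rfl⟩, ?_, tr_rename μ h5, ?_⟩, ih h7⟩
      · intro x' n' t' hm
        obtain ⟨s, hs, e⟩ := List.mem_map.1 hm
        cases s with
        | enc x1 n1 r1 t1 =>
          simp only [OStep.rename, OStep.enc.injEq] at e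
          exact h4 x1 n1 t1 ((μ.injective e.2.2.1) ▸ hs)
        | dec z1 n1 c1 l1 => simp [OStep.rename] at e
      · rw [oh_rename]; exact h6.rename μ
    | dec z n c l =>
      obtain ⟨⟨h1, h2, h3, h4, h5, h6⟩, h7⟩ := h
      refine ⟨⟨by rwa [oh_rename], ⟨n, h2, rfl⟩, nleaf_rename μ h3, ?_, fun y hy => ?_, ?_⟩, ih h7⟩
      · rw [oh_rename]; exact h4.rename μ
      · obtain ⟨⟨n', r', t', hs⟩, hst⟩ := h5 y hy
        refine ⟨⟨_, _, _, hmem hs⟩, ?_⟩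
        have e : ocall (q.map (OStep.rename μ)) = fun h => (ocall q h).rename μ :=
          funext (ocall_rename μ q)
        rw [e, ← rename_subst]
        exact st_rename μ (pure_subst h4.pure fun x _ => h7.pure x) hst
      · intro z' l' hm
        obtain ⟨s, hs, e⟩ := List.mem_map.1 hm
        cases s with
        | enc x1 n1 r1 t1 => simp [OStep.rename] at e
        | dec z1 n1 c1 l1 =>
          simp only [OStep.rename, OStep.dec.injEq] at e
          obtain ⟨_, e2, e3, _⟩ := e
          exact h6 z1 l1 (μ.injective e2 ▸ rename_injective μ e3 ▸ hs)

end

end CCSA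

namespace CCSA
open Term
variable {S : Signature} {V : Val S} {β β' : Prop} {ltU ltS : Term S → Term S → Prop}

/-! ### Values of projections and decryptions -/

theorem sem_pi1 (a : Fin (Sym.pi1 (S := S)).arity → Term S) :
    (∃ b, sem V (a 0) = .app .pair b ∧ sem V (.app .pi1 a) = b 0) ∨
    ((∀ b, sem V (a 0) ≠ .app .pair b) ∧
      sem V (.app .pi1 a) = .app .pi1 fun i => sem V (a i)) := by
  rw [sem_app (by simp)]
  rcases red_cases .pi1 fun i => sem V (a i) with ⟨h, h'⟩ | h
  · refine .inr ⟨fun b hb => h' (b 0) (R1_iff.2 (.inl ⟨b 0, b 1, ?_, rfl⟩)), h⟩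
    congr 1; funext i; fin_cases i
    refine hb.trans ?_
    congr 1; funext i; fin_cases i <;> rfl
  · left
    rw [R1_iff] at h
    obtain ⟨x, y, e, h⟩ | ⟨x, y, e, h⟩ | ⟨x, e, h⟩ | ⟨x, y, z, e, h⟩ := h <;>
      simp only [app.injEq, reduceCtorEq, false_and, heq_eq_eq, true_and] at e
    exact ⟨![x, y], congrFun e 0, h⟩

theorem sem_pi2 (a : Fin (Sym.pi2 (S := S)).arity → Term S) :
    (∃ b, sem V (a 0) = .app .pair b ∧ sem V (.app .pi2 a) = b 1) ∨
    ((∀ b, sem V (a 0) ≠ .app .pair b) ∧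
      sem V (.app .pi2 a) = .app .pi2 fun i => sem V (a i)) := by
  rw [sem_app (by simp)]
  rcases red_cases .pi2 fun i => sem V (a i) with ⟨h, h'⟩ | h
  · refine .inr ⟨fun b hb => h' (b 1) (R1_iff.2 (.inr (.inl ⟨b 0, b 1, ?_, rfl⟩))), h⟩
    congr 1; funext i; fin_cases i
    refine hb.trans ?_
    congr 1; funext i; fin_cases i <;> rfl
  · left
    rw [R1_iff] at h
    obtain ⟨x, y, e, h⟩ | ⟨x, y, e, h⟩ | ⟨x, e, h⟩ | ⟨x, y, z, e, h⟩ := h <;>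
      simp only [app.injEq, reduceCtorEq, false_and, heq_eq_eq, true_and] at e
    exact ⟨![x, y], congrFun e 0, h⟩

theorem sem_dec (a : Fin (Sym.dec (S := S)).arity → Term S) :
    (∃ b y, sem V (a 0) = .app .enc b ∧ b 1 = pk y ∧ sem V (a 1) = sk y ∧
      sem V (.app .dec a) = b 0) ∨ sem V (.app .dec a) = .app .dec fun i => sem V (a i) := by
  rw [sem_app (by simp)]
  rcases red_cases .dec fun i => sem V (a i) with ⟨h, h'⟩ | h
  · exact .inr h
  · left
    rw [R1_iff] at h
    obtain ⟨x, y, e, h⟩ | ⟨x, y, e, h⟩ | ⟨x, e, h⟩ | ⟨x, y, z, e, h⟩ := h <;>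
      simp only [app.injEq, reduceCtorEq, false_and, heq_eq_eq, true_and] at e
    exact ⟨![x, pk y, z], y, congrFun e 0, rfl, congrFun e 1, h⟩

theorem sem_eq (a : Fin (Sym.eq (S := S)).arity → Term S) :
    sem V (.app .eq a) = tru ∨ sem V (.app .eq a) = .app .eq fun i => sem V (a i) := by
  rw [sem_app (by simp)]
  rcases red_cases .eq fun i => sem V (a i) with ⟨h, h'⟩ | h
  · exact .inr h
  · left
    rw [R1_iff] at h
    obtain ⟨x, y, e, h⟩ | ⟨x, y, e, h⟩ | ⟨x, e, h⟩ | ⟨x, y, z, e, h⟩ := h <;>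
      simp only [app.injEq, reduceCtorEq, false_and, heq_eq_eq, true_and] at e
    exact h

theorem sem_constr {f : Sym S} (hf : f ≠ .pi1 ∧ f ≠ .pi2 ∧ f ≠ .dec ∧ f ≠ .ite ∧ f ≠ .eq)
    (a : Fin f.arity → Term S) : sem V (.app f a) = .app f fun i => sem V (a i) := by
  rw [sem_app hf.2.2.2.1, red_of_constr _ ⟨hf.1, hf.2.1, hf.2.2.2.2, hf.2.2.1⟩]

open Classical in
theorem sem_elses (gs : List (Term S)) (x : Term S) :
    sem V (elses gs x) = if ∃ g ∈ gs, V.ρ (sem V g) then zero (sem V x) else sem V x := by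
  induction gs with
  | nil => simp [elses]
  | cons g gs ih =>
    rw [show elses (g :: gs) x = ite g (zero x) (elses gs x) from rfl, sem_ite]
    by_cases h : V.ρ (sem V g)
    · rw [if_pos h, if_pos ⟨g, by simp, h⟩, sem_constr (by simp)]
      congr 1; funext i; fin_cases i; rfl
    · rw [if_neg h, ih]
      simp [h]

theorem sem_eq_of_eq {u v : Term S} (h : sem V u = sem V v) : sem V (Term.eq u v) = tru := by
  rw [sem_app (by simp)]
  refine red_of_R1 (R1_iff.2 (.inr (.inr (.inl ⟨sem V u, ?_, rfl⟩))))
  congr 1; funext i; fin_cases i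
  · rfl
  · exact h.symm

/-! ### Heads -/

/-- `Head A y h`: the head symbol of `y`, if it reduces to a constructor, is that of `h`. Here
`A z c` says that the handle `z` is the decryption of `c`. -/
inductive Head (A : ℕ → Term S → Prop) : Term S → Term S → Prop
  | name (n : ℕ) : Head A (name n) (name n)
  | var (x : ℕ) (h : ∀ c, ¬ A x c) : Head A (var x) (var x)
  | app (f : Sym S) (a : Fin f.arity → Term S)
      (hf : f ≠ .pi1 ∧ f ≠ .pi2 ∧ f ≠ .dec ∧ f ≠ .ite ∧ f ≠ .zero) :
      Head A (.app f a) (.app f a)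
  | pi1 (a) (b) (h : Term S) (h1 : Head A (a 0) (.app .pair b)) (h2 : Head A (b 0) h) :
      Head A (.app .pi1 a) h
  | pi2 (a) (b) (h : Term S) (h1 : Head A (a 0) (.app .pair b)) (h2 : Head A (b 1) h) :
      Head A (.app .pi2 a) h
  | dec (a) (b) (h : Term S) (h1 : Head A (a 0) (.app .enc b)) (h2 : Head A (b 0) h) :
      Head A (.app .dec a) h
  | dvar (z : ℕ) (c : Term S) (b) (h : Term S) (hA : A z c) (h1 : Head A c (.app .enc b))
      (h2 : Head A (b 0) h) : Head A (.var z) h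

section
variable {A : ℕ → Term S → Prop} {K R H : Set ℕ}

theorem Head.det (hA : ∀ z c c', A z c → A z c' → c = c') {y h h' : Term S} (h1 : Head A y h)
    (h2 : Head A y h') : h = h' := by
  induction h1 generalizing h' with
  | name n => cases h2; rfl
  | var x h =>
    cases h2 with
    | var => rfl
    | dvar _ c _ _ hc => exact (h c hc).elim
  | app f a hf => cases h2 <;> simp_all
  | pi1 a b h h1 h2 ih1 ih2 =>
    cases h2 with
    | app => simp_all
    | pi1 _ b' _ h1' h2' => cases ih1 h1'; exact ih2 h2'
  | pi2 a b h h1 h2 ih1 ih2 =>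
    cases h2 with
    | app => simp_all
    | pi2 _ b' _ h1' h2' => cases ih1 h1'; exact ih2 h2'
  | dec a b h h1 h2 ih1 ih2 =>
    cases h2 with
    | app => simp_all
    | dec _ b' _ h1' h2' => cases ih1 h1'; exact ih2 h2'
  | dvar z c b h hc h1 h2 ih1 ih2 =>
    cases h2 with
    | var _ h => exact (h c hc).elim
    | dvar _ c' b' _ hc' h1' h2' => cases hA z c c' hc hc'; cases ih1 h1'; exact ih2 h2'

theorem Head.sy {zok : Prop} (hA : ∀ z c, A z c → Sy K R H zok c ∧ c.IfFree) {y h : Term S}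
    (hh : Head A y h) (hy : Sy K R H zok y) (hif : y.IfFree) : Sy K R H zok h ∧ h.IfFree := by
  induction hh with
  | name n => exact ⟨hy, hif⟩
  | var x h => exact ⟨hy, hif⟩
  | app f a hf => exact ⟨hy, hif⟩
  | pi1 a b h h1 h2 ih1 ih2 =>
    have := ih1 (hy.arg (by simp) 0) ((ifFree_app.1 hif).2 0)
    exact ih2 (this.1.arg (by simp) 0) ((ifFree_app.1 this.2).2 0)
  | pi2 a b h h1 h2 ih1 ih2 =>
    have := ih1 (hy.arg (by simp) 0) ((ifFree_app.1 hif).2 0)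
    exact ih2 (this.1.arg (by simp) 1) ((ifFree_app.1 this.2).2 1)
  | dec a b h h1 h2 ih1 ih2 =>
    have := ih1 (hy.arg (by simp) 0) ((ifFree_app.1 hif).2 0)
    exact ih2 (this.1.arg (by simp) 0) ((ifFree_app.1 this.2).2 0)
  | dvar z c b h hc h1 h2 ih1 ih2 =>
    have := ih1 (hA z c hc).1 (hA z c hc).2
    exact ih2 (this.1.arg (by simp) 0) ((ifFree_app.1 this.2).2 0)

/-- The value is a blocked projection or decryption, or the result of a positive guard. -/
def Blk (t : Term S) : Prop :=
  ∃ f a, t = .app f a ∧ (f = .pi1 ∨ f = .pi2 ∨ f = .dec ∨ f = .zero)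

/-- A head is, semantically, a subterm. -/
theorem Head.sem_mem {σ : ℕ → Term S}
    (hA : ∀ z c, A z c → ∃ gs k, σ z = elses gs (Term.dec (c.subst σ) k)) {y h : Term S}
    (hh : Head A y h) : sem V (y.subst σ) = sem V (h.subst σ) ∨
      Blk (sem V (y.subst σ)) ∧ sem V (h.subst σ) ∈ (sem V (y.subst σ)).st := by
  have arg : ∀ {f : Sym S} {a : Fin f.arity → Term S} {t : Term S} (i : Fin f.arity)
      {s : Term S}, t = .app f a → s ∈ (a i).st → s ∈ t.st := by
    rintro f a t i s rfl hs; exact mem_st_app.2 (.inr ⟨i, hs⟩)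
  have hdec : ∀ {u k : Term S} {b : Fin (Sym.enc (S := S)).arity → Term S} {h : Term S},
      (sem V u = sem V ((Term.app .enc b).subst σ) ∨
        Blk (sem V u) ∧ sem V ((Term.app .enc b).subst σ) ∈ (sem V u).st) →
      (sem V ((b 0).subst σ) = sem V (h.subst σ) ∨ Blk (sem V ((b 0).subst σ)) ∧
        sem V (h.subst σ) ∈ (sem V ((b 0).subst σ)).st) →
      ∀ a : Fin (Sym.dec (S := S)).arity → Term S, a 0 = u →
      sem V (.app .dec a) = sem V (h.subst σ) ∨
        Blk (sem V (.app .dec a)) ∧ sem V (h.subst σ) ∈ (sem V (.app .dec a)).st := by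
    intro u k b h h1 h2 a ha
    have e : sem V ((Term.app .enc b).subst σ) =
        .app .enc fun i => sem V ((b i).subst σ) := sem_constr (by simp) _
    rw [e] at h1
    have h2' : sem V (h.subst σ) ∈ (sem V ((b 0).subst σ)).st := by
      rcases h2 with h2 | h2
      · rw [h2]; exact mem_st_self _
      · exact h2.2
    rcases sem_dec (V := V) a with ⟨b', y, g1, g2, g3, g4⟩ | g
    · rw [ha] at g1
      rcases h1 with h1 | ⟨⟨f, w, hb, hf⟩, _⟩
      · rw [h1] at g1
        cases g1
        rw [g4]; exact h2
      · rw [g1] at hb; cases hb; simp at hf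
    · refine .inr ⟨⟨_, _, g, by simp⟩, ?_⟩
      refine arg 0 g ?_
      rw [ha]
      rcases h1 with h1 | ⟨_, h1⟩
      · rw [h1]; exact arg 0 rfl h2'
      · exact st_trans (arg 0 rfl h2') h1
  induction hh with
  | name n => exact .inl rfl
  | var x h => exact .inl rfl
  | app f a hf => exact .inl rfl
  | pi1 a b h _ _ ih1 ih2 =>
    have e : sem V ((Term.app .pair b).subst σ) =
        .app .pair fun i => sem V ((b i).subst σ) := sem_constr (by simp) _
    rw [e] at ih1
    have h2' : sem V (h.subst σ) ∈ (sem V ((b 0).subst σ)).st := by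
      rcases ih2 with h2 | h2
      · rw [h2]; exact mem_st_self _
      · exact h2.2
    simp only [subst]
    rcases sem_pi1 (V := V) (fun i => (a i).subst σ) with ⟨b', g1, g2⟩ | ⟨g1, g⟩
    · rcases ih1 with h1 | ⟨⟨f, w, hb, hf⟩, _⟩
      · rw [h1] at g1
        cases g1
        rw [g2]; exact ih2
      · rw [g1] at hb; cases hb; simp at hf
    · refine .inr ⟨⟨_, _, g, by simp⟩, arg 0 g ?_⟩
      rcases ih1 with h1 | ⟨_, h1⟩
      · rw [h1]; exact arg 0 rfl h2'
      · exact st_trans (arg 0 rfl h2') h1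
  | pi2 a b h _ _ ih1 ih2 =>
    have e : sem V ((Term.app .pair b).subst σ) =
        .app .pair fun i => sem V ((b i).subst σ) := sem_constr (by simp) _
    rw [e] at ih1
    have h2' : sem V (h.subst σ) ∈ (sem V ((b 1).subst σ)).st := by
      rcases ih2 with h2 | h2
      · rw [h2]; exact mem_st_self _
      · exact h2.2
    simp only [subst]
    rcases sem_pi2 (V := V) (fun i => (a i).subst σ) with ⟨b', g1, g2⟩ | ⟨g1, g⟩
    · rcases ih1 with h1 | ⟨⟨f, w, hb, hf⟩, _⟩
      · rw [h1] at g1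
        cases g1
        rw [g2]; exact ih2
      · rw [g1] at hb; cases hb; simp at hf
    · refine .inr ⟨⟨_, _, g, by simp⟩, arg 0 g ?_⟩
      rcases ih1 with h1 | ⟨_, h1⟩
      · rw [h1]; exact arg 1 rfl h2'
      · exact st_trans (arg 1 rfl h2') h1
  | dec a b h _ _ ih1 ih2 => exact hdec (k := tru) ih1 ih2 _ rfl
  | dvar z c b h hc _ _ ih1 ih2 =>
    obtain ⟨gs, k, e⟩ := hA z c hc
    have h3 := hdec (k := tru) ih1 ih2 ![c.subst σ, k] rfl
    simp only [subst]
    rw [e, sem_elses]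
    split_ifs with hg
    · refine .inr ⟨⟨_, _, rfl, by simp⟩, arg 0 rfl ?_⟩
      rcases h3 with h3 | h3
      · rw [← h3]; exact mem_st_self _
      · exact h3.2
    · exact h3

/-- Terms whose value is blocked, or is that of a head. -/
inductive HG (A : ℕ → Term S → Prop) (K : Set ℕ) (V : Val S) (σ : ℕ → Term S)
    (q : List (OStep S)) : Term S → Prop
  | blk (y : Term S) (h : Blk (sem V (y.subst σ))) : HG A K V σ q y
  | name (y : Term S) (n : ℕ) (hn : n ∉ K) (h : Head A y (name n))
      (e : sem V (y.subst σ) = .name n) : HG A K V σ q y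
  | enc (y : Term S) (x n r : ℕ) (t : Term S) (h : Head A y (var x)) (hx : OStep.enc x n r t ∈ q)
      (e : sem V (y.subst σ) = sem V (σ x)) : HG A K V σ q y
  | pk (y : Term S) (n : ℕ) (h : Head A y (pk (.name n)))
      (e : sem V (y.subst σ) = Term.pk (.name n)) : HG A K V σ q y
  | app (y : Term S) (f : Sym S) (a : Fin f.arity → Term S)
      (hf : f ≠ .pi1 ∧ f ≠ .pi2 ∧ f ≠ .dec ∧ f ≠ .ite ∧ f ≠ .zero) (h : Head A y (.app f a))
      (e : sem V (y.subst σ) = sem V ((Term.app f a).subst σ)) (ha : ∀ i, HG A K V σ q (a i)) :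
      HG A K V σ q y

variable {q : List (OStep S)} {σ : ℕ → Term S}

theorem HG.transfer {y b : Term S} (hb : HG A K V σ q b)
    (hh : ∀ h, Head A b h → Head A y h) (e : sem V (y.subst σ) = sem V (b.subst σ)) :
    HG A K V σ q y := by
  cases hb with
  | blk _ h => exact .blk _ (e ▸ h)
  | name _ n hn h e' => exact .name _ n hn (hh _ h) (e.trans e')
  | enc _ x n r t h hx e' => exact .enc _ x n r t (hh _ h) hx (e.trans e')
  | pk _ n h e' => exact .pk _ n (hh _ h) (e.trans e')
  | app _ f a hf h e' ha => exact .app _ f a hf (hh _ h) (e.trans e') ha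

theorem not_blk_app {f : Sym S} {a : Fin f.arity → Term S}
    (hf : f ≠ .pi1 ∧ f ≠ .pi2 ∧ f ≠ .dec ∧ f ≠ .zero) : ¬ Blk (.app f a) := by
  rintro ⟨g, b, e, h⟩
  cases e; simp_all

theorem sem_constr' {f : Sym S} (hf : f ≠ .pi1 ∧ f ≠ .pi2 ∧ f ≠ .dec ∧ f ≠ .ite ∧ f ≠ .zero)
    (a : Fin f.arity → Term S) {g : Sym S} {b : Fin g.arity → Term S} (hg : g.retBool = false)
    (e : sem V (.app f a) = .app g b) : sem V (.app f a) = .app f fun i => sem V (a i) := by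
  by_cases he : f = .eq
  · subst he
    rcases sem_eq (V := V) a with h | h
    · rw [h] at e; cases e; simp [Sym.retBool] at hg
    · exact h
  · exact sem_constr ⟨hf.1, hf.2.1, hf.2.2.1, hf.2.2.2.1, he⟩ _

theorem sem_ocall_enc (hq : Scoped q) {x n r : ℕ} {t : Term S} (hx : OStep.enc x n r t ∈ q) :
    sem V (ocall q x) = Term.enc (sem V (t.subst (ocall q))) (pk (name n)) (name r) := by
  rw [show ocall q x = _ from (hq.ocall_eq hx).2.2.2]
  simp only [OStep.out]
  rw [sem_constr (by simp)]
  congr 1; funext i; fin_cases i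
  · rfl
  · change sem V (pk (name n)) = _
    rw [sem_constr (by simp)]; congr 1; funext i; fin_cases i; rfl
  · rfl

theorem HG.pair {u : Term S} (hq : Scoped q) (hu : HG A K V (ocall q) q u) {b}
    (e : sem V (u.subst (ocall q)) = .app .pair b) : ∃ a, Head A u (.app .pair a) ∧
      (∀ i, b i = sem V ((a i).subst (ocall q))) ∧ ∀ i, HG A K V (ocall q) q (a i) := by
  cases hu with
  | blk _ h => rw [e] at h; exact (not_blk_app (by simp) h).elim
  | name _ n hn h e' => rw [e] at e'; cases e'
  | enc _ x n r t h hx e' => rw [e, sem_ocall_enc hq hx] at e'; cases e'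
  | pk _ n h e' => rw [e] at e'; cases e'
  | app _ f a hf h e' ha =>
    rw [e] at e'
    simp only [subst] at e'
    have := sem_constr' hf _ (by rfl) e'.symm
    rw [this] at e'
    cases e'
    exact ⟨a, h, fun _ => rfl, ha⟩

/-- Secrecy of the keys: a value `sk n` would have to come from a head `sk a` with `a` of value `n`,
but the only names that heads of symbolic terms produce are outside `K`. -/
theorem HG.not_sk {k : Term S} (hq : Scoped q) (hk : HG A K V (ocall q) q k) {n : ℕ} (hn : n ∈ K) :
    sem V (k.subst (ocall q)) ≠ Term.sk (Term.name n) := by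
  intro e
  cases hk with
  | blk _ h => rw [e] at h; exact not_blk_app (by simp) h
  | name _ n hn h e' => rw [e] at e'; cases e'
  | enc _ x n r t h hx e' => rw [e, sem_ocall_enc hq hx] at e'; cases e'
  | pk _ n h e' => rw [e] at e'; cases e'
  | app _ f a hf h e' ha =>
    rw [e] at e'
    simp only [subst] at e'
    have := sem_constr' hf _ (by rfl) e'.symm
    rw [this] at e'
    simp only [app.injEq] at e'
    obtain ⟨rfl, e'⟩ := e'
    rw [heq_eq_eq] at e'
    have e0 : Term.name n = sem V ((a 0).subst (ocall q)) := congrFun e' 0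
    cases ha 0 with
    | blk _ h => rw [← e0] at h; obtain ⟨_, _, h, _⟩ := h; cases h
    | name _ m hm h e' => rw [← e0] at e'; cases e'; exact hm hn
    | enc _ x n r t h hx e' => rw [← e0, sem_ocall_enc hq hx] at e'; cases e'
    | pk _ n h e' => rw [← e0] at e'; cases e'
    | app _ f a hf h e' ha =>
      rw [← e0] at e'
      simp only [subst] at e'
      by_cases he : f = .eq
      · subst he
        rcases sem_eq (V := V) (fun i => (a i).subst (ocall q)) with h | h <;> rw [h] at e' <;> cases e'
      · rw [sem_constr ⟨hf.1, hf.2.1, hf.2.2.1, hf.2.2.2.1, he⟩] at e'; cases e'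

/-- A ciphertext is either built by the symbolic term itself, in which case its arguments are again
controlled, or is the value of an encryption handle, in which case its plaintext is not accessible.
-/
theorem HG.enc_cases {u : Term S} (hu : HG A K V (ocall q) q u) {b}
    (e : sem V (u.subst (ocall q)) = .app .enc b) : (∃ a, Head A u (.app .enc a) ∧
      (∀ i, b i = sem V ((a i).subst (ocall q))) ∧ ∀ i, HG A K V (ocall q) q (a i)) ∨
      ∃ x n r t, Head A u (var x) ∧ OStep.enc x n r t ∈ q ∧
        sem V (u.subst (ocall q)) = sem V (ocall q x) := by
  cases hu with
  | blk _ h => rw [e] at h; exact (not_blk_app (by simp) h).elim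
  | name _ n hn h e' => rw [e] at e'; cases e'
  | enc _ x n r t h hx e' => exact .inr ⟨x, n, r, t, h, hx, e'⟩
  | pk _ n h e' => rw [e] at e'; cases e'
  | app _ f a hf h e' ha =>
    rw [e] at e'
    simp only [subst] at e'
    have := sem_constr' hf _ (by rfl) e'.symm
    rw [this] at e'
    cases e'
    exact .inl ⟨a, h, fun _ => rfl, ha⟩

/-- The critical case is a decryption written inside the term. If its ciphertext is an oracle
ciphertext, a successful decryption would require `sk n` for a key `n` of `K` as the value of a
symbolic term, against `HG.not_sk`. Other ciphertexts and pairs are opened syntactically along the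
head. -/
theorem HG.of_vars {R : Set ℕ} {zok : Prop} (hq : OV K R q) (hH : ∀ x ∈ H, HG A K V (ocall q) q (var x))
    {y : Term S} (hy : Sy K R H zok y) (hif : y.IfFree) : HG A K V (ocall q) q y := by
  induction y with
  | name n => exact .name _ n hy.1 (.name n) rfl
  | var x => exact hH x hy
  | app f a ih =>
    rcases id hy with ⟨n, hn, _, h⟩ | h
    · rw [h]
      refine .pk _ n (.app _ _ (by simp)) ?_
      have : (Term.pk (Term.name n) : Term S).Plain :=
        plain_app.2 fun i => by fin_cases i; exact plain_name
      rw [subst_of_ground this, sem_constr (by simp)]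
      congr 1; funext i; fin_cases i; rfl
    have ih' := fun i => ih i (h.2 i) ((ifFree_app.1 hif).2 i)
    by_cases h1 : f = .pi1
    · subst h1
      rcases sem_pi1 (V := V) (fun i => (a i).subst (ocall q)) with ⟨b, e1, e2⟩ | ⟨_, e⟩
      · obtain ⟨w, hw, hb, hg⟩ := (ih' 0).pair hq.scoped e1
        exact (hg 0).transfer (fun h hh => .pi1 _ _ _ hw hh) (e2.trans (hb 0))
      · exact .blk _ ⟨_, _, e, by simp⟩
    by_cases h2 : f = .pi2
    · subst h2
      rcases sem_pi2 (V := V) (fun i => (a i).subst (ocall q)) with ⟨b, e1, e2⟩ | ⟨_, e⟩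
      · obtain ⟨w, hw, hb, hg⟩ := (ih' 0).pair hq.scoped e1
        exact (hg 1).transfer (fun h hh => .pi2 _ _ _ hw hh) (e2.trans (hb 1))
      · exact .blk _ ⟨_, _, e, by simp⟩
    by_cases h3 : f = .dec
    · subst h3
      rcases sem_dec (V := V) (fun i => (a i).subst (ocall q)) with ⟨b, y, e1, e2, e3, e4⟩ | e
      · rcases (ih' 0).enc_cases e1 with ⟨w, hw, hb, hg⟩ | ⟨x, n, r, t, -, hx, e⟩
        · exact (hg 0).transfer (fun h hh => .dec _ _ _ hw hh) (e4.trans (hb 0))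
        · rw [e1, sem_ocall_enc hq.scoped hx] at e
          cases e
          have ey : y = Term.name n := by
            simp only [Matrix.cons_val_one, Matrix.cons_val_zero, Term.pk, app.injEq, heq_eq_eq,
              true_and] at e2
            exact (congrFun e2 0).symm
          subst ey
          obtain ⟨_, _, _, _, e, hn, _⟩ | ⟨_, _, _, _, e, _⟩ := (hq.steps hx).2 <;> cases e
          exact ((ih' 1).not_sk hq.scoped hn e3).elim
      · exact .blk _ ⟨_, _, e, by simp⟩
    by_cases h4 : f = .ite
    · subst h4; exact (hif a (mem_st_self _)).elim
    by_cases h5 : f = .zero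
    · subst h5
      exact .blk _ ⟨_, _, sem_constr (V := V) (by simp) _, by simp⟩
    · exact .app _ f a ⟨h1, h2, h3, h4, h5⟩ (.app _ _ ⟨h1, h2, h3, h4, h5⟩) rfl ih'
  | box a c b => exact hy.elim
  | frz b => exact hy.elim

theorem OV.of_append {q1 q2 : List (OStep S)} (h : OV K R (q1 ++ q2)) : OV K R q2 := by
  induction q1 with
  | nil => exact h
  | cons s q ih => exact ih h.tail

/-- The guards are essential here. A decryption handle opens an oracle ciphertext only if its
argument has an encryption handle under the same key as head; `hvis` then puts that handle among the
guards, and its guard is true, so the value is a blocked `zero`. When no guard is true, the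
decryption is blocked or opens a ciphertext built syntactically. -/
theorem HG.of_handle (hq : OV K R q) (hA : ∀ z c, A z c ↔ ∃ n l, OStep.dec z n c l ∈ q)
    (hvis : ∀ z n c l, OStep.dec z n c l ∈ q → ∀ x r t, OStep.enc x n r t ∈ q →
      Head A c (var x) → x ∈ l) (q1 q2 : List (OStep S)) (e : q = q1 ++ q2) :
    ∀ x ∈ oh q2, HG A K V (ocall q) q (var x) := by
  induction q2 generalizing q1 with
  | nil => simp [oh]
  | cons s q2 ih =>
    have ih' := ih (q1 ++ [s]) (by simp [e])
    intro x hx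
    rw [oh_cons] at hx
    rcases hx with rfl | hx
    · have hs : s ∈ q := by simp [e]
      have hov : OV K R (s :: q2) := by rw [e] at hq; exact hq.of_append
      cases s with
      | enc x n r t =>
        refine .enc _ x n r t (.var x fun c hc => ?_) hs rfl
        obtain ⟨n', l', hc⟩ := (hA x c).1 hc
        have := hq.scoped.inj hs hc rfl
        cases this
      | dec z n c l =>
        obtain ⟨⟨h1, h2, h3, h4, h5, h6⟩, h7⟩ := hov
        have hc := HG.of_vars (A := A) (V := V) hq ih' h4 (h3.ifFree h4.pure)
        change HG A K V (ocall q) q (var z)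
        have eq := (hq.scoped.ocall_eq hs).2.2.2
        change ocall q z = elses _ _ at eq
        have eqs := sem_elses (V := V) (l.map fun y => Term.eq (c.subst (ocall q)) (ocall q y))
          (Term.dec (c.subst (ocall q)) (Term.sk (Term.name n)))
        rw [← eq] at eqs
        split_ifs at eqs with hg
        · exact .blk _ ⟨_, _, eqs, by simp⟩
        · rcases sem_dec (V := V) ![c.subst (ocall q), Term.sk (Term.name n)] with ⟨b, y, e1, e2, e3, e4⟩ | e
          · have ey : y = Term.name n := by
              change sem V (Term.sk (Term.name n)) = _ at e3
              rw [sem_constr (by simp)] at e3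
              simp only [app.injEq, heq_eq_eq, true_and] at e3
              exact (congrFun e3 0).symm
            rcases hc.enc_cases e1 with ⟨w, hw, hb, hg'⟩ | ⟨x, n', r, t, hh, hx, he⟩
            · exact (hg' 0).transfer (fun h hh => .dvar _ c _ _ ((hA z c).2 ⟨n, l, hs⟩) hw hh)
                (eqs.trans (e4.trans (hb 0)))
            · exfalso
              have e' := he
              rw [show sem V (c.subst (ocall q)) = _ from e1, sem_ocall_enc hq.scoped hx] at e'
              cases e'
              rw [ey] at e2
              simp only [Matrix.cons_val_one, Matrix.cons_val_zero, Term.pk, app.injEq, heq_eq_eq, true_and] at e2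
              have en : n' = n := by simpa using congrFun e2 0
              subst en
              refine hg ⟨_, List.mem_map_of_mem (hvis z n' c l hs x r t hx hh), ?_⟩
              rw [sem_eq_of_eq he]; exact V.ρ_tru
          · exact .blk _ ⟨_, _, eqs.trans e, by simp⟩
    · exact ih' x hx

/-- A symbolic term of boolean value has a boolean head with the same value. -/
theorem exists_head (hq : OV K R q) (hA : ∀ z c, A z c ↔ ∃ n l, OStep.dec z n c l ∈ q)
    (hvis : ∀ z n c l, OStep.dec z n c l ∈ q → ∀ x r t, OStep.enc x n r t ∈ q →
      Head A c (var x) → x ∈ l) {zok : Prop} {y : Term S} (hy : Sy K R (oh q) zok y)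
    (hif : y.IfFree) (hb : (sem V (y.subst (ocall q))).IsBool) :
    ∃ f a, Head A y (.app f a) ∧ f.retBool = true ∧
      sem V (y.subst (ocall q)) = sem V ((Term.app f a).subst (ocall q)) := by
  have h := HG.of_vars (A := A) (V := V) hq (HG.of_handle hq hA hvis [] q rfl) hy hif
  cases h with
  | blk _ h =>
    obtain ⟨f, a, e, h⟩ := h
    rw [e, isBool_app_of_ne (by rintro rfl; simp at h)] at hb
    rcases h with rfl | rfl | rfl | rfl <;> simp [Sym.retBool] at hb
  | name _ n hn h e => rw [e] at hb; exact hb.elim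
  | enc _ x n r t h hx e =>
    rw [e, sem_ocall_enc hq.scoped hx, isBool_app_of_ne (by simp)] at hb
    simp [Sym.retBool] at hb
  | pk _ n h e =>
    rw [e, isBool_app_of_ne (by simp)] at hb
    simp [Sym.retBool] at hb
  | app _ f a hf h e ha =>
    refine ⟨f, a, h, ?_, e⟩
    rw [e] at hb
    simp only [subst] at hb
    by_cases he : f = .eq
    · subst he; rfl
    · rw [sem_constr ⟨hf.1, hf.2.1, hf.2.2.1, hf.2.2.2.1, he⟩,
        isBool_app_of_ne hf.2.2.2.1] at hb
      exact hb

open Classical in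
/-- The boolean head of a term, or `true`. -/
noncomputable def boolHead (A : ℕ → Term S → Prop) (y : Term S) : Term S :=
  if h : ∃ f a, Head A y (.app f a) ∧ f.retBool = true then .app h.choose h.choose_spec.choose
  else tru

theorem boolHead_spec (hA : ∀ z c c', A z c → A z c' → c = c') {y : Term S} {f : Sym S}
    {a : Fin f.arity → Term S} (h : Head A y (.app f a)) (hf : f.retBool = true) :
    boolHead A y = .app f a := by
  have h' : ∃ f a, Head A y (.app f a) ∧ f.retBool = true := ⟨f, a, h, hf⟩
  rw [boolHead, dif_pos h']
  exact h'.choose_spec.choose_spec.1.det hA h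

theorem boolHead_good {zok : Prop} (hA : ∀ z c, A z c → Sy K R H zok c ∧ c.IfFree) {y : Term S}
    (hy : Sy K R H zok y) (hif : y.IfFree) :
    Sy K R H zok (boolHead A y) ∧ (boolHead A y).IfFree ∧ (boolHead A y).IsBool := by
  rw [boolHead]
  split_ifs with h
  · have := h.choose_spec.choose_spec
    refine ⟨(this.1.sy hA hy hif).1, (this.1.sy hA hy hif).2, .inl this.2⟩
  · exact ⟨.inr ⟨by simp, fun i => i.elim0⟩, ifFree_app.2 ⟨by simp, fun i => i.elim0⟩, .inl rfl⟩

/-- A boolean term with the same value as `t` when this value is boolean. -/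
noncomputable def boolify (A : ℕ → Term S → Prop) (t : Term S) : Term S :=
  ((dt t).bind fun y => .leaf (boolHead A y)).toTerm

theorem DT.toTerm_srt {D : DT S} (h : D.All (Srt True) (Srt β)) : Srt β D.toTerm := by
  induction D with
  | leaf t => exact h
  | node b l r ihl ihr => exact srt_ite.2 ⟨h.1, ihl h.2.1, ihr h.2.2⟩

theorem Sy.ite {zok : Prop} {b u v : Term S} (hb : Sy K R H zok b) (hu : Sy K R H zok u)
    (hv : Sy K R H zok v) : Sy K R H zok (Term.ite b u v) :=
  .inr ⟨by simp, fun i => by fin_cases i <;> assumption⟩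

theorem Sy.toTerm {zok : Prop} {D : DT S} (h : D.All (Sy K R H zok) (Sy K R H zok)) :
    Sy K R H zok D.toTerm := by
  induction D with
  | leaf t => exact h
  | node b l r ihl ihr => exact .ite h.1 (ihl h.2.1) (ihr h.2.2)

theorem boolify_good {zok : Prop} (hA : ∀ z c, A z c → Sy K R H zok c ∧ c.IfFree) {t : Term S}
    (ht : Sy K R H zok t) (hws : t.WS) :
    Sy K R H zok (boolify A t) ∧ (boolify A t).WS ∧ (boolify A t).IsBool := by
  have h1 := ht.dt
  have h2 := dt_all_nleaf ht.pure
  have h3 := dt_all_srt (β := False) ht.pure ⟨hws, False.elim⟩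
  have h12 := (h1.and h2).and h3
  have key : Sy K R H zok (boolify A t) ∧ Srt True (boolify A t) := by
    constructor
    · refine Sy.toTerm (DT.bind_all (h12.mono (fun _ h => h.1.1) fun _ h => h) fun y hy => ?_)
      exact (boolHead_good hA hy.1.1 (hy.1.2.ifFree hy.1.1.pure)).1
    · refine DT.toTerm_srt (DT.bind_all (h12.mono (fun _ h => h.2) fun _ h => h) fun y hy => ?_)
      obtain ⟨g1, g2, g3⟩ := boolHead_good hA hy.1.1 (hy.1.2.ifFree hy.1.1.pure)
      exact ⟨g1.pure.ws_of_ifFree g2, fun _ => g3⟩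
  exact ⟨key.1, key.2.1, key.2.2 trivial⟩

/-- Only the leaf selected by the valuation matters: its value is boolean, so it has a boolean head
with the same value, while the other leaves may be replaced by anything. Heads are purely syntactic,
so a single replacement serves all valuations and both sides. -/
theorem boolify_sem (hq : OV K R q) (hA : ∀ z c, A z c ↔ ∃ n l, OStep.dec z n c l ∈ q)
    (hvis : ∀ z n c l, OStep.dec z n c l ∈ q → ∀ x r t, OStep.enc x n r t ∈ q →
      Head A c (var x) → x ∈ l) {zok : Prop} {t : Term S} (ht : Sy K R (oh q) zok t)
    (hb : (sem V (t.subst (ocall q))).IsBool) :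
    sem V ((boolify A t).subst (ocall q)) = sem V (t.subst (ocall q)) := by
  have hdet : ∀ z c c', A z c → A z c' → c = c' := by
    intro z c c' h h'
    obtain ⟨n, l, h⟩ := (hA _ _).1 h
    obtain ⟨n', l', h'⟩ := (hA _ _).1 h'
    have := hq.scoped.inj h h' rfl
    simp only [OStep.dec.injEq] at this
    exact this.2.2.1
  have e : sem V (t.subst (ocall q)) = sem V ((dt t).toTerm.subst (ocall q)) := by
    refine (sem_subst_of_eq ?_ ht.pure (fun V => sem_dt_toTerm ht.pure) (fun _ _ _ => rfl) V).symm
    exact (Sy.toTerm ht.dt).pure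
  rw [e] at hb ⊢
  have h12 := ht.dt.and (dt_all_nleaf ht.pure)
  rw [boolify]
  generalize dt t = D at hb h12
  induction D with
  | leaf y =>
    obtain ⟨f, a, h1, h2, h3⟩ := exists_head hq hA hvis h12.1 (h12.2.ifFree h12.1.pure) hb
    change sem V ((boolHead A y).subst _) = _
    rw [boolHead_spec hdet h1 h2]
    exact h3.symm
  | node b l r ihl ihr =>
    simp only [DT.bind, DT.toTerm, subst_ite, sem_ite] at hb ⊢
    split_ifs with h
    · rw [if_pos h] at hb; exact ihl hb h12.2.1
    · rw [if_neg h] at hb; exact ihr hb h12.2.2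

end

end CCSA

namespace CCSA
open Term
variable {S : Signature} {V : Val S} {β β' : Prop} {ltU ltS : Term S → Term S → Prop}

/-! ### One-sided facts about oracle calls -/

section
variable {K R H : Set ℕ} {zok : Prop}

theorem isBool_subst {σ : ℕ → Term S} {t : Term S} (hp : t.Pure) (h : t.IsBool) :
    (t.subst σ).IsBool := by
  induction t with
  | name n => exact h.elim
  | var n => exact h.elim
  | app f a ih =>
    exact h.imp id fun ⟨hf, h⟩ => ⟨hf, fun i hi => ih i (pure_app.1 hp i) (h i hi)⟩
  | box a c b => exact (not_pure_box hp).elim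
  | frz b => exact (not_pure_frz hp).elim

theorem ws_subst {σ : ℕ → Term S} {t : Term S} (hp : t.Pure) (h : t.WS)
    (hσ : ∀ x ∈ t.vars, (σ x).WS) : (t.subst σ).WS := by
  induction t with
  | name n => trivial
  | var n => exact hσ n (by simp)
  | app f a ih =>
    exact ⟨fun i => ih i (pure_app.1 hp i) (h.1 i) fun x hx => hσ x (mem_vars_app.2 ⟨i, hx⟩),
      fun hf i hi => isBool_subst (pure_app.1 hp i) (h.2 hf i hi)⟩
  | box a c b => exact (not_pure_box hp).elim
  | frz b => exact (not_pure_frz hp).elim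

theorem Tr.ws {t : Term S} (h : Tr t) (hp : t.Pure) : t.WS := by
  induction h with
  | leaf t h => exact hp.ws_of_ifFree (h.ifFree hp)
  | node b u v hb hbool _ _ ihu ihv =>
    have := pure_app.1 hp
    exact ws_ite.2 ⟨(this 0).ws_of_ifFree (hb.ifFree (this 0)), hbool, ihu (this 1), ihv (this 2)⟩

theorem elses_induction {Q : Term S → Prop} {gs : List (Term S)} {x : Term S} (hx : Q x)
    (hg : ∀ g ∈ gs, ∀ w, Q w → Q (ite g (zero x) w)) : Q (elses gs x) := by
  induction gs with
  | nil => exact hx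
  | cons g gs ih => exact hg g (by simp) _ (ih fun g h => hg g (by simp [h]))

theorem OStep.out_induction {Q : Term S → Prop} {σ : ℕ → Term S} (s : OStep S)
    (henc : ∀ x n r t, s = .enc x n r t → Q (Term.enc (t.subst σ) (pk (.name n)) (.name r)))
    (hdec : ∀ z n c l, s = .dec z n c l → Q (Term.dec (c.subst σ) (sk (.name n))))
    (hite : ∀ z n c l, s = .dec z n c l → ∀ y ∈ l, ∀ w, Q w → Q (Term.ite
      (Term.eq (c.subst σ) (σ y)) (Term.zero (Term.dec (c.subst σ) (sk (.name n)))) w)) :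
    Q (s.out σ) := by
  cases s with
  | enc x n r t => exact henc x n r t rfl
  | dec z n c l =>
    refine elses_induction (hdec z n c l rfl) fun g hg w hw => ?_
    obtain ⟨y, hy, rfl⟩ := List.mem_map.1 hg
    exact hite z n c l rfl y hy w hw

/-- Induction along the oracle calls. -/
theorem OV.induction {q : List (OStep S)} (hq : OV K R q) {Q : ℕ → Prop}
    (h : ∀ s ∈ q, (∀ x ∈ s.body.vars, Q x) → (∀ y ∈ s.guards, Q y) → Q s.h) :
    ∀ x ∈ oh q, Q x := by
  induction q with
  | nil => simp [oh]
  | cons s q ih =>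
    have ih' := ih hq.tail fun s hs => h s (List.mem_cons_of_mem _ hs)
    intro x hx
    rw [oh_cons] at hx
    rcases hx with rfl | hx
    · have := hq.scoped
      exact h s (by simp) (fun x hx => ih' x (this.2.2.1 hx)) fun y hy => ih' y (this.2.2.2.1 y hy)
    · exact ih' x hx

theorem names_elses {gs : List (Term S)} {x : Term S} {n : ℕ} (h : n ∈ (elses gs x).names) :
    n ∈ x.names ∨ ∃ g ∈ gs, n ∈ g.names := by
  refine elses_induction (Q := fun t => n ∈ t.names → n ∈ x.names ∨ ∃ g ∈ gs, n ∈ g.names)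
    .inl (fun g hg w hw h => ?_) h
  obtain ⟨i, hi⟩ := mem_names_app.1 h
  fin_cases i
  · exact .inr ⟨g, hg, hi⟩
  · obtain ⟨i, hi⟩ := mem_names_app.1 hi
    fin_cases i
    exact .inl hi
  · exact hw hi

theorem mem_names_enc {u p r : Term S} {n : ℕ} :
    n ∈ (enc u p r).names ↔ n ∈ u.names ∨ n ∈ p.names ∨ n ∈ r.names := by
  rw [mem_names_app]
  exact ⟨fun ⟨i, hi⟩ => by fin_cases i <;> simp_all,
    fun h => by rcases h with h | h | h; exacts [⟨0, h⟩, ⟨1, h⟩, ⟨2, h⟩]⟩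

theorem mem_names_pk {u : Term S} {n : ℕ} : n ∈ (pk u).names ↔ n ∈ u.names := by
  rw [mem_names_app]
  exact ⟨fun ⟨i, hi⟩ => by fin_cases i; simp_all, fun h => ⟨0, h⟩⟩

theorem mem_names_sk {u : Term S} {n : ℕ} : n ∈ (sk u).names ↔ n ∈ u.names := by
  rw [mem_names_app]
  exact ⟨fun ⟨i, hi⟩ => by fin_cases i; simp_all, fun h => ⟨0, h⟩⟩

theorem mem_names_dec {u k : Term S} {n : ℕ} :
    n ∈ (dec u k).names ↔ n ∈ u.names ∨ n ∈ k.names := by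
  rw [mem_names_app]
  exact ⟨fun ⟨i, hi⟩ => by fin_cases i <;> simp_all,
    fun h => by rcases h with h | h; exacts [⟨0, h⟩, ⟨1, h⟩]⟩

theorem mem_names_eq {u k : Term S} {n : ℕ} :
    n ∈ (Term.eq u k).names ↔ n ∈ u.names ∨ n ∈ k.names := by
  rw [mem_names_app]
  exact ⟨fun ⟨i, hi⟩ => by fin_cases i <;> simp_all,
    fun h => by rcases h with h | h; exacts [⟨0, h⟩, ⟨1, h⟩]⟩

/-- The names of an oracle call, apart from its randomness. -/
def OStep.Nm (N : Set ℕ) : OStep S → Prop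
  | .enc _ n r t => n ∈ N ∧ r ∈ N ∧ t.names ⊆ N
  | .dec _ n c _ => n ∈ N ∧ c.names ⊆ N

theorem OV.names {N : Set ℕ} {q : List (OStep S)} (hq : OV K R q) (hN : ∀ s ∈ q, s.Nm N) :
    ∀ x ∈ oh q, (ocall q x).names ⊆ N := by
  refine hq.induction fun s hs hb hg => ?_
  obtain ⟨h1, h2, h3, h4⟩ := hq.scoped.ocall_eq hs
  rw [h4]
  have hbody : s.body.names ⊆ N := by
    have := hN s hs
    cases s
    · exact this.2.2
    · exact this.2
  have hbσ : (s.body.subst (ocall q)).names ⊆ N := fun m hm => by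
    rcases (mem_names_subst h1).1 hm with h | ⟨x, hx, h⟩
    · exact hbody h
    · exact hb x hx h
  cases s with
  | enc x n r t =>
    intro m hm
    have := hN _ hs
    simp only [OStep.out, mem_names_enc, mem_names_pk, mem_names_name] at hm
    rcases hm with hm | rfl | rfl
    · exact hbσ hm
    · exact this.1
    · exact this.2.1
  | dec z n c l =>
    intro m hm
    have := hN _ hs
    have hd : m ∈ (dec (c.subst (ocall q)) (sk (name n))).names → m ∈ N := fun hm => by
      simp only [mem_names_dec, mem_names_sk, mem_names_name] at hm
      rcases hm with hm | rfl
      · exact hbσ hm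
      · exact this.1
    rcases names_elses hm with hm | ⟨g, hg', hm⟩
    · exact hd hm
    · obtain ⟨y, hy, rfl⟩ := List.mem_map.1 hg'
      rcases mem_names_eq.1 hm with hm | hm
      · exact hbσ hm
      · exact hg y hy hm

theorem OV.body_ws {q : List (OStep S)} (hq : OV K R q) {s : OStep S} (hs : s ∈ q) :
    s.body.WS := by
  have h := hq.steps hs
  obtain ⟨x, n, r, t, rfl, _, _, h'⟩ | ⟨z, n, c, l, rfl, _, h'⟩ := h.2
  · exact h'.ws h.1.pure
  · exact h.1.pure.ws_of_ifFree (h'.ifFree h.1.pure)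

theorem plain_pk_name {n : ℕ} : (pk (name n) : Term S).Plain :=
  plain_app.2 fun i => by fin_cases i; exact plain_name

theorem plain_sk_name {n : ℕ} : (sk (name n) : Term S).Plain :=
  plain_app.2 fun i => by fin_cases i; exact plain_name

theorem ws_pk_name {n : ℕ} : (pk (name n) : Term S).WS :=
  ws_app.2 ⟨fun i => by fin_cases i; trivial, by simp⟩

theorem ws_sk_name {n : ℕ} : (sk (name n) : Term S).WS :=
  ws_app.2 ⟨fun i => by fin_cases i; trivial, by simp⟩

theorem OV.plain_ws {q : List (OStep S)} (hq : OV K R q) :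
    ∀ x ∈ oh q, (ocall q x).Plain ∧ (ocall q x).WS := by
  refine hq.induction fun s hs hb hg => ?_
  obtain ⟨h1, h2, h3, h4⟩ := hq.scoped.ocall_eq hs
  rw [h4]
  have hbσ : (s.body.subst (ocall q)).Plain ∧ (s.body.subst (ocall q)).WS :=
    ⟨plain_subst h1 fun x hx => (hb x hx).1, ws_subst h1 (hq.body_ws hs) fun x hx => (hb x hx).2⟩
  refine s.out_induction (Q := fun t => t.Plain ∧ t.WS) ?_ ?_ ?_
  · rintro x n r t rfl
    refine ⟨plain_app.2 fun i => ?_, ws_app.2 ⟨fun i => ?_, by simp⟩⟩ <;> fin_cases i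
    exacts [hbσ.1, plain_pk_name, plain_name, hbσ.2, ws_pk_name, trivial]
  · rintro z n c l rfl
    refine ⟨plain_app.2 fun i => ?_, ws_app.2 ⟨fun i => ?_, by simp⟩⟩ <;> fin_cases i
    exacts [hbσ.1, plain_sk_name, hbσ.2, ws_sk_name]
  · rintro z n c l rfl y hy w hw
    refine ⟨plain_app.2 fun i => ?_, ws_ite.2 ⟨ws_app.2 ⟨fun i => ?_, by simp⟩, .inl rfl,
      ws_app.2 ⟨fun i => ?_, by simp⟩, hw.2⟩⟩ <;> fin_cases i
    · exact plain_app.2 fun i => by fin_cases i; exacts [hbσ.1, (hg y hy).1]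
    · exact plain_app.2 fun i => by
        fin_cases i
        exact plain_app.2 fun i => by fin_cases i; exacts [hbσ.1, plain_sk_name]
    · exact hw.1
    · exact hbσ.2
    · exact (hg y hy).2
    · exact ws_app.2 ⟨fun i => by fin_cases i; exacts [hbσ.2, ws_sk_name], by simp⟩

theorem hidden_subst {C : Set (Term S)} {σ : ℕ → Term S} {t : Term S} (ht : Sy K R H zok t)
    (hσ : ∀ x ∈ t.vars, Hidden R C (σ x)) : Hidden R C (t.subst σ) := by
  induction t with
  | name n => exact ht.2
  | var x => exact hσ x (by simp)
  | app f a ih =>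
    rcases ht with ⟨n, _, hn, h⟩ | h
    · rw [h, subst_of_ground plain_pk_name]
      exact fun i => .inl (by fin_cases i; exact hn)
    · exact fun i => .inl (ih i (h.2 i) fun x hx => hσ x (mem_vars_app.2 ⟨i, hx⟩))
  | box a c b => exact ht.elim
  | frz b => exact ht.elim

theorem OV.hidden {C : Set (Term S)} {q : List (OStep S)} (hq : OV K R q)
    (hkey : ∀ s ∈ q, match s with | .enc _ n _ _ => n ∉ R | .dec _ n _ _ => n ∉ R)
    (hC : ∀ x n r t, OStep.enc x n r t ∈ q → ocall q x ∈ C) :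
    ∀ x ∈ oh q, Hidden R C (ocall q x) := by
  refine hq.induction fun s hs hb hg => ?_
  obtain ⟨h1, h2, h3, h4⟩ := hq.scoped.ocall_eq hs
  have hbσ : Hidden R C (s.body.subst (ocall q)) := hidden_subst (hq.steps hs).1 hb
  have hk := hkey s hs
  cases s with
  | enc x n r t =>
    have hc := hC x n r t hs
    change Hidden R C (ocall q x)
    change ocall q x = _ at h4
    rw [h4] at hc ⊢
    intro i
    fin_cases i
    · exact .inl hbσ
    · exact .inl fun i => .inl (by fin_cases i; exact hk)
    · exact .inr ⟨rfl, rfl, hc⟩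
  | dec z n c l =>
    rw [h4]
    have hd : Hidden R C (dec (c.subst (ocall q)) (sk (name n))) := by
      intro i
      fin_cases i
      · exact .inl hbσ
      · exact .inl fun i => .inl (by fin_cases i; exact hk)
    refine OStep.out_induction _ (by simp) ?_ ?_
    · intro z' n' c' l' e; cases e; exact hd
    · intro z' n' c' l' e y hy w hw
      cases e
      intro i
      fin_cases i
      · exact .inl fun i => .inl (by fin_cases i; exacts [hbσ, hg y hy])
      · exact .inl fun i => .inl (by fin_cases i; exact hd)
      · exact .inl hw

-- Erasure of the plaintexts of the oracle ciphertexts, and inlining of these ciphertexts.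

theorem zeroOut_app {C : Set (Term S)} {f : Sym S} {a : Fin f.arity → Term S}
    (h : Term.app f a ∉ C) : zeroOut C (.app f a) = .app f fun i => zeroOut C (a i) := by
  simp only [zeroOut, h, false_and, if_false]

/-- The ciphertexts of a set, with known shape. -/
def EncSet (R : Set ℕ) (C : Set (Term S)) : Prop :=
  ∀ s ∈ C, ∃ u n, ∃ r ∈ R, s = enc u (pk (name n)) (name r)

theorem EncSet.ne {C : Set (Term S)} (hC : EncSet R C) {f : Sym S} {a : Fin f.arity → Term S}
    (hf : f ≠ .enc) : Term.app f a ∉ C := by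
  intro h
  obtain ⟨u, n, r, _, e⟩ := hC _ h
  cases e; exact hf rfl

/-- The symbols of the symbolic term never form a ciphertext of `C` themselves: the randomness would
be a name of `R` in the term, or a handle whose value is a name. Erasure therefore acts only on the
values of the handles. -/
theorem zeroOut_subst {C : Set (Term S)} (hC : EncSet R C) {σ : ℕ → Term S}
    (hσ : ∀ x ∈ H, ∀ n, σ x ≠ name n) {t : Term S} (ht : Sy K R H zok t) :
    zeroOut C (t.subst σ) = t.subst fun x => zeroOut C (σ x) := by
  induction t with
  | name n => rfl
  | var x => rfl
  | app f a ih =>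
    rcases ht with ⟨n, _, hn, h⟩ | h
    · rw [h, subst_of_ground plain_pk_name, subst_of_ground plain_pk_name]
      rw [pk, zeroOut_app (hC.ne (by simp))]
      congr 1; funext i; fin_cases i; rfl
    · simp only [subst]
      rw [zeroOut_app]
      · congr 1; funext i; exact ih i (h.2 i)
      · intro hm
        obtain ⟨u, n, r, hr, e⟩ := hC _ hm
        simp only [app.injEq] at e
        obtain ⟨rfl, e⟩ := e
        rw [heq_eq_eq] at e
        have e2 : (a 2).subst σ = name r := congrFun e 2
        have h2 := h.2 2
        generalize a 2 = w at e2 h2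
        cases w with
        | name m => simp [subst] at e2; subst e2; exact h2.2 hr
        | var x => exact hσ x h2 r e2
        | app f a => simp [subst] at e2
        | box a c b => exact h2.elim
        | frz b => exact h2.elim
  | box a c b => exact ht.elim
  | frz b => exact ht.elim

theorem OV.ne_name {q : List (OStep S)} (hq : OV K R q) : ∀ x ∈ oh q, ∀ n, ocall q x ≠ name n := by
  intro x hx n e
  obtain ⟨f, a, h, _⟩ := (hq.shape x hx).root
  rw [h] at e; cases e

theorem zeroOut_elses {C : Set (Term S)} (hC : EncSet R C) (gs : List (Term S)) (x : Term S) :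
    zeroOut C (elses gs x) = elses (gs.map (zeroOut C)) (zeroOut C x) := by
  induction gs with
  | nil => rfl
  | cons g gs ih =>
    change zeroOut C (ite g (zero x) (elses gs x)) =
      ite (zeroOut C g) (zero (zeroOut C x)) (elses (gs.map (zeroOut C)) (zeroOut C x))
    rw [← ih, Term.ite, zeroOut_app (hC.ne (by simp))]
    congr 1; funext i; fin_cases i
    · rfl
    · change zeroOut C (zero x) = _
      rw [zero, zeroOut_app (hC.ne (by simp))]
      congr 1; funext i; fin_cases i; rfl
    · rfl

theorem zeroOut_dec {C : Set (Term S)} (hC : EncSet R C) (u : Term S) (n : ℕ) :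
    zeroOut C (dec u (sk (name n))) = dec (zeroOut C u) (sk (name n)) := by
  rw [dec, zeroOut_app (hC.ne (by simp))]
  congr 1; funext i; fin_cases i
  · rfl
  · change zeroOut C (sk (name n)) = _
    rw [sk, zeroOut_app (hC.ne (by simp))]
    congr 1; funext i; fin_cases i; rfl

theorem zeroOut_eq {C : Set (Term S)} (hC : EncSet R C) (u v : Term S) :
    zeroOut C (Term.eq u v) = Term.eq (zeroOut C u) (zeroOut C v) := by
  rw [Term.eq, zeroOut_app (hC.ne (by simp))]
  congr 1; funext i; fin_cases i <;> rfl

theorem zeroOut_enc {C : Set (Term S)} (hC : EncSet R C) {u : Term S} {n r : ℕ}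
    (h : enc u (pk (name n)) (name r) ∈ C) :
    zeroOut C (enc u (pk (name n)) (name r)) = enc (zero tru) (pk (name n)) (name r) := by
  simp only [zeroOut, h, true_and]
  congr 1; funext i; fin_cases i
  · rfl
  · change zeroOut C (pk (name n)) = _
    rw [pk, zeroOut_app (hC.ne (by simp))]
    congr 1; funext i; fin_cases i; rfl
  · rfl

/-- Erasing the calls amounts to running the same sequence with all plaintexts blank, so erased
values are again instances of symbolic terms. -/
theorem OV.zeroOut {C : Set (Term S)} (hC : EncSet R C) {q : List (OStep S)} (hq : OV K R q)
    (hqC : ∀ x n r t, OStep.enc x n r t ∈ q → ocall q x ∈ C) :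
    ∀ x ∈ oh q, zeroOut C (ocall q x) = ocall (q.map OStep.blank) x := by
  refine hq.induction fun s hs hb hg => ?_
  obtain ⟨h1, h2, h3, h4⟩ := hq.scoped.ocall_eq hs
  have h4' := (hq.scoped.blank.ocall_eq (List.mem_map_of_mem (f := OStep.blank) hs)).2.2.2
  cases s with
  | enc x n r t =>
    have hc := hqC x n r t hs
    change ocall q x = enc (t.subst _) _ _ at h4
    change ocall _ x = enc ((zero tru).subst _) _ _ at h4'
    change CCSA.zeroOut C (ocall q x) = ocall _ x
    rw [subst_of_ground plain_zero_tru] at h4'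
    rw [h4']
    rw [h4] at hc ⊢
    exact zeroOut_enc hC hc
  | dec z n c l =>
    change ocall q z = elses _ _ at h4
    change ocall _ z = elses _ _ at h4'
    change CCSA.zeroOut C (ocall q z) = ocall _ z
    have hc : CCSA.zeroOut C (c.subst (ocall q)) = c.subst (ocall (q.map OStep.blank)) := by
      rw [zeroOut_subst hC hq.ne_name (hq.steps hs).1 (t := c)]
      exact subst_congr h1 hb
    rw [h4, h4', zeroOut_elses hC, zeroOut_dec hC, hc, List.map_map]
    congr 1
    refine List.map_congr_left fun y hy => ?_
    simp only [Function.comp]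
    rw [zeroOut_eq hC, hc, hg y hy]

/-- The encryption handles are replaced by their ciphertexts. -/
def inl : List (OStep S) → ℕ → Term S
  | [] => var
  | .enc x n r t :: q => Function.update (inl q) x (Term.enc (t.subst (inl q)) (pk (name n)) (name r))
  | .dec z _ _ _ :: q => Function.update (inl q) z (var z)

/-- The ciphertexts in the plaintexts do not use the keys as randomness. -/
def RK (K : Set ℕ) : List (OStep S) → Prop
  | [] => True
  | .enc _ _ _ t :: q => (∀ y ∈ t.vars, ∀ n r u, OStep.enc y n r u ∈ q → r ∉ K) ∧ RK K q
  | .dec _ _ _ _ :: q => RK K q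

/-- What clause 2 of the matching executions wants of a plaintext. -/
def EncArg (K Z : Set ℕ) (t : Term S) : Prop :=
  t.Pure ∧ t.NoZero ∧ t.vars ⊆ Z ∧ ∀ k ∈ K, NoDec k t

theorem encArg_subst {Z : Set ℕ} {σ : ℕ → Term S} {t : Term S} (ht : Sy K R H False t)
    (hσ : ∀ x ∈ t.vars, EncArg K Z (σ x)) : EncArg K Z (t.subst σ) := by
  induction t with
  | name n => exact ⟨pure_name, noZero_name, by simp [subst, Term.vars, st], ht.noDec⟩
  | var x => exact hσ x (by simp)
  | app f a ih =>
    rcases id ht with ⟨n, _, _, h⟩ | h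
    · rw [h] at ht ⊢
      rw [subst_of_ground plain_pk_name]
      exact ⟨ht.pure, ht.noZero id, by rw [vars_pk_name]; exact Set.empty_subset _, ht.noDec⟩
    · have ih' := fun i => ih i (h.2 i) fun x hx => hσ x (mem_vars_app.2 ⟨i, hx⟩)
      refine ⟨pure_app.2 fun i => (ih' i).1, noZero_app.2 ⟨fun hf => (h.1 hf).1, fun i => (ih' i).2.1⟩,
        fun x hx => ?_, fun k hk => .inr fun i => (ih' i).2.2.2 k hk⟩
      obtain ⟨i, hi⟩ := mem_vars_app.1 hx
      exact (ih' i).2.2.1 hi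
  | box a c b => exact ht.elim
  | frz b => exact ht.elim

theorem encArg_enc {Z : Set ℕ} {u : Term S} {n r : ℕ} (hu : EncArg K Z u)
    (hr : r ∉ K) : EncArg K Z (enc u (pk (name n)) (name r)) := by
  refine ⟨pure_app.2 fun i => ?_, noZero_app.2 ⟨by simp, fun i => ?_⟩, fun x hx => ?_,
    fun k hk => .inr fun i => ?_⟩
  · fin_cases i; exacts [hu.1, plain_pk_name.1, pure_name]
  · fin_cases i
    exacts [hu.2.1, noZero_app.2 ⟨by simp, fun i => by fin_cases i; exact noZero_name⟩, noZero_name]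
  · obtain ⟨i, hi⟩ := mem_vars_app.1 hx
    fin_cases i
    · exact hu.2.2.1 hi
    · change x ∈ (pk (name n)).vars at hi
      rw [vars_pk_name] at hi; exact hi.elim
    · change x ∈ (name r).vars at hi
      rw [plain_name.2] at hi; exact hi.elim
  · fin_cases i
    · exact hu.2.2.2 k hk
    · by_cases e : n = k
      · subst e; exact .inl rfl
      · exact .inr fun i => by fin_cases i; exact e
    · exact fun e => hr (e ▸ hk)

/-- Clause 2 of the matching executions allows only decryption handles in a plaintext, whereas
symbolic plaintexts may use encryption handles too; writing these out in full bridges the gap. An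
inlined ciphertext then has to satisfy `nodec`, so its randomness must not be a private key: this is
the purpose of `RK`. -/
theorem OV.inl_spec {q : List (OStep S)} (hq : OV K R q) (hr : RK K q) : ∀ x ∈ oh q,
    (inl q x).Pure ∧ (inl q x).vars ⊆ oh q ∧ (inl q x).subst (ocall q) = ocall q x ∧
    ((∀ n r t, OStep.enc x n r t ∈ q → r ∉ K) →
      EncArg K {z | ∃ n c l, OStep.dec z n c l ∈ q} (inl q x)) := by
  induction q with
  | nil => simp [oh]
  | cons s q ih =>
    have hr' : RK K q := by
      cases s
      · exact hr.2
      · exact hr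
    have ih' := ih hq.tail hr'
    have sub : oh q ⊆ oh (s :: q) := by rw [oh_cons]; exact Set.subset_insert _ _
    have up : ∀ t : Term S, t.Pure → t.vars ⊆ oh q →
        t.subst (ocall (s :: q)) = t.subst (ocall q) := fun t hp hv =>
      subst_congr hp fun x hx => ocall_cons_of_mem hq.scoped (hv hx)
    intro x hx
    by_cases e : x = s.h
    · subst e
      cases s with
      | enc x n r t =>
        have e : inl (.enc x n r t :: q) x =
          enc (t.subst (inl q)) (pk (name n)) (name r) := Function.update_self _ _ _
        obtain ⟨⟨h1, h2, h3, h4, h5, h6⟩, h7⟩ := hq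
        have hbp : (t.subst (inl q)).Pure := pure_subst h6.pure fun y hy => (ih' y (h6.vars hy)).1
        have hbv : (t.subst (inl q)).vars ⊆ oh q := by
          intro y hy
          rcases mem_st_subst h6.pure hy with ⟨s', _, hv, e⟩ | ⟨w, hw, hy⟩
          · cases s' <;> simp_all [subst]
          · exact (ih' w (h6.vars hw)).2.1 hy
        have hp : (enc (t.subst (inl q)) (pk (name n)) (name r)).Pure :=
          pure_app.2 fun i => by fin_cases i; exacts [hbp, plain_pk_name.1, pure_name]
        have hv : (enc (t.subst (inl q)) (pk (name n)) (name r)).vars ⊆ oh q := by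
          intro y hy
          obtain ⟨i, hi⟩ := mem_vars_app.1 hy
          fin_cases i
          · exact hbv hi
          · change y ∈ (pk (name n)).vars at hi
            rw [vars_pk_name] at hi; exact hi.elim
          · change y ∈ (name r).vars at hi
            rw [plain_name.2] at hi; exact hi.elim
        change (inl (.enc x n r t :: q) x).Pure ∧ (inl (.enc x n r t :: q) x).vars ⊆ _ ∧
          (inl (.enc x n r t :: q) x).subst _ = _ ∧ (_ → EncArg K _ (inl (.enc x n r t :: q) x))
        rw [e]
        refine ⟨hp, hv.trans sub, ?_, fun hr0 => ?_⟩
        · rw [up _ hp hv]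
          change _ = Function.update (ocall q) x _ x
          rw [Function.update_self, OStep.out]
          simp only [subst]
          congr 1; funext i; fin_cases i
          · change (t.subst (inl q)).subst _ = t.subst _
            rw [subst_subst]
            exact subst_congr h6.pure fun y hy => (ih' y (h6.vars hy)).2.2.1
          · exact subst_of_ground plain_pk_name
          · rfl
        · refine encArg_enc (encArg_subst h6 fun y hy => ?_) (hr0 n r t (List.mem_cons_self ..))
          have := (ih' y (h6.vars hy)).2.2.2 fun n r u hu => hr.1 y hy n r u hu
          refine ⟨this.1, this.2.1, this.2.2.1.trans ?_, this.2.2.2⟩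
          rintro z ⟨n, c, l, h⟩; exact ⟨n, c, l, by simp [h]⟩
      | dec z n c l =>
        have e : inl (.dec z n c l :: q) z = var z := Function.update_self _ _ _
        change (inl (.dec z n c l :: q) z).Pure ∧ (inl (.dec z n c l :: q) z).vars ⊆ _ ∧
          (inl (.dec z n c l :: q) z).subst _ = _ ∧ (_ → EncArg K _ (inl (.dec z n c l :: q) z))
        rw [e]
        refine ⟨pure_var, ?_, rfl, fun _ => ⟨pure_var, noZero_var, ?_, fun _ _ => trivial⟩⟩
        · intro y hy; simp at hy; subst hy; exact ⟨.dec y n c l, by simp, rfl⟩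
        · intro y hy; simp at hy; subst hy; exact ⟨n, c, l, by simp⟩
    · have hx' : x ∈ oh q := by rw [oh_cons] at hx; exact hx.resolve_left e
      have e' : inl (s :: q) x = inl q x := by
        cases s <;> exact Function.update_of_ne e _ _
      obtain ⟨h1, h2, h3, h4⟩ := ih' x hx'
      rw [e']
      refine ⟨h1, h2.trans sub, ?_, fun hr0 => ?_⟩
      · rw [up _ h1 h2, h3, ocall_cons_of_mem hq.scoped hx']
      · have := h4 fun n r t h => hr0 n r t (by simp [h])
        refine ⟨this.1, this.2.1, this.2.2.1.trans ?_, this.2.2.2⟩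
        rintro z ⟨n, c, l, h⟩; exact ⟨n, c, l, by simp [h]⟩

end

end CCSA

namespace CCSA
open Term
variable {S : Signature} {V : Val S} {β β' : Prop} {ltU ltS : Term S → Term S → Prop}

/-! ### Matching sequences of oracle calls -/

/-- An oracle call of both sides; the left side is `false`. -/
inductive HStep (S : Signature)
  | enc (x n : ℕ) (r : Bool → ℕ) (t : Bool → Term S)
  | dec (z n : ℕ) (c : Term S) (l : Bool → List ℕ)

namespace HStep

def h : HStep S → ℕ
  | enc x _ _ _ => x
  | dec z _ _ _ => z

def key : HStep S → ℕ
  | enc _ n _ _ => n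
  | dec _ n _ _ => n

def side (i : Bool) : HStep S → OStep S
  | enc x n r t => .enc x n (r i) (t i)
  | dec z n c l => .dec z n c (l i)

def names : HStep S → Set ℕ
  | enc _ n r t => {m | m = n ∨ ∃ i, m = r i ∨ m ∈ (t i).names}
  | dec _ n c _ => {m | m = n ∨ m ∈ c.names}

theorem side_h (i : Bool) (s : HStep S) : (s.side i).h = s.h := by cases s <;> rfl

end HStep

abbrev sd (i : Bool) (p : List (HStep S)) : List (OStep S) := p.map (HStep.side i)

abbrev call (i : Bool) (p : List (HStep S)) : ℕ → Term S := ocall (sd i p)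

/-- The calls of the left side with erased plaintexts. -/
abbrev zcall (p : List (HStep S)) : ℕ → Term S := ocall ((sd false p).map OStep.blank)

def hh (p : List (HStep S)) : Set ℕ := {h | ∃ s ∈ p, s.h = h}

def encH : List (HStep S) → Finset ℕ
  | [] => ∅
  | .enc x _ _ _ :: p => insert x (encH p)
  | .dec _ _ _ _ :: p => encH p

def decH : List (HStep S) → Finset ℕ
  | [] => ∅
  | .enc _ _ _ _ :: p => decH p
  | .dec z _ _ _ :: p => insert z (decH p)

def rnd (i : Bool) : List (HStep S) → ℕ → ℕ
  | [] => fun _ => 0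
  | .enc x _ r _ :: p => Function.update (rnd i p) x (r i)
  | .dec _ _ _ _ :: p => rnd i p

/-- The randomness of both sides. -/
def rds (p : List (HStep S)) : Set ℕ := {m | ∃ x n r t i, HStep.enc x n r t ∈ p ∧ m = r i}

/-- The names used by the calls. -/
def fn (p : List (HStep S)) : Set ℕ := {m | ∃ s ∈ p, m ∈ s.names}

/-- A key that was also a randomness would occur in the open inside `pk` or `sk`, which the
condition `Hidden` forbids. -/
def KeysOK (p : List (HStep S)) : Prop := ∀ s ∈ p, s.key ∉ rds p

/-- The visible encryption handles of the ciphertext `c`. -/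
def vis (ltU : Term S → Term S → Prop) (p : List (HStep S)) (n : ℕ) (c : Term S) : Set ℕ :=
  {x | ∃ r t, HStep.enc x n r t ∈ p ∧
    ∃ s, REq (c.subst (zcall p)) s ∧ RNormal ltU s ∧ r false ∈ s.names}

/-- Valid sequences of oracle calls, for the keys `K`. -/
def Valid (ltU ltS : Term S → Term S → Prop) (K : Finset ℕ) : List (HStep S) → Prop
  | [] => True
  | .enc x n r t :: q => (x ∉ hh q ∧ n ∈ K ∧ KeysOK q ∧ ∀ i, Tr (t i) ∧
      Sy {k | k ∈ K} (rds q) (hh q) False (t i) ∧ r i ∉ fn q ∧ (∀ j, r i ∉ (t j).names) ∧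
      ∀ y ∈ (t i).vars, ∀ n r u, HStep.enc y n r u ∈ q → r i ∉ K) ∧ Valid ltU ltS K q
  | .dec z n c l :: q => (z ∉ hh q ∧ n ∈ K ∧ KeysOK q ∧ NLeaf c ∧
      Sy {k | k ∈ K} (rds q) (hh q) False c ∧ (∀ i,
        IsSort ltS (call i q '' vis ltU q n c) ((l i).map (call i q)) ∧
        ∀ y ∈ l i, (∃ n r t, HStep.enc y n r t ∈ q) ∧
          ∀ j, call j q y ∈ (c.subst (call j q)).st) ∧
      ∀ z l, HStep.dec z n c l ∉ q) ∧ Valid ltU ltS K q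

variable {K : Finset ℕ} {p : List (HStep S)}

theorem oh_sd (i : Bool) (p : List (HStep S)) : oh (sd i p) = hh p := by
  ext h; simp [oh, hh, HStep.side_h]

theorem hh_cons (s : HStep S) (p : List (HStep S)) : hh (s :: p) = insert s.h (hh p) := by
  ext h; simp [hh, eq_comm]

theorem enc_mem_sd {i : Bool} {x n r : ℕ} {t : Term S} : OStep.enc x n r t ∈ sd i p ↔
    ∃ r' t', HStep.enc x n r' t' ∈ p ∧ r = r' i ∧ t = t' i := by
  rw [List.mem_map]
  constructor
  · rintro ⟨s, hs, e⟩
    cases s with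
    | enc x n r t => cases e; exact ⟨r, t, hs, rfl, rfl⟩
    | dec => cases e
  · rintro ⟨r, t, hs, rfl, rfl⟩; exact ⟨_, hs, rfl⟩

theorem dec_mem_sd {i : Bool} {z n : ℕ} {c : Term S} {l : List ℕ} : OStep.dec z n c l ∈ sd i p ↔
    ∃ l', HStep.dec z n c l' ∈ p ∧ l = l' i := by
  rw [List.mem_map]
  constructor
  · rintro ⟨s, hs, e⟩
    cases s with
    | enc => cases e
    | dec z n c l => cases e; exact ⟨l, hs, rfl⟩
  · rintro ⟨l, hs, rfl⟩; exact ⟨_, hs, rfl⟩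

theorem Valid.tail {s : HStep S} (h : Valid ltU ltS K (s :: p)) : Valid ltU ltS K p := by
  cases s <;> exact h.2

theorem rds_cons_subset (s : HStep S) : rds p ⊆ rds (s :: p) := by
  rintro m ⟨x, n, r, t, i, h, e⟩; exact ⟨x, n, r, t, i, by simp [h], e⟩

theorem rds_dec {z n : ℕ} {c : Term S} {l} : rds (.dec z n c l :: p) = rds p := by
  ext m; simp [rds]

/-- The names of the plaintexts and ciphertexts are not randomness. -/
theorem Valid.body_names (hp : Valid ltU ltS K p) : ∀ s ∈ p, ∀ i, ∀ m ∈ (s.side i).body.names,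
    m ∉ rds p := by
  induction p with
  | nil => simp
  | cons a p ih =>
    intro s hs i m hm
    have ih' := ih hp.tail
    have hfn : ∀ s ∈ p, m ∈ (s.side i).body.names → m ∈ fn p := by
      intro s hs hm
      refine ⟨s, hs, ?_⟩
      cases s with
      | enc x n r t => exact .inr ⟨i, .inr hm⟩
      | dec z n c l => exact .inr hm
    have h1 : m ∉ rds p := by
      rcases List.mem_cons.1 hs with rfl | hs
      · cases s with
        | enc x n r t => exact (hp.1.2.2.2 i).2.1.names m hm
        | dec z n c l => exact hp.1.2.2.2.2.1.names m hm
      · exact ih' s hs i m hm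
    cases a with
    | dec z n c l => rw [rds_dec]; exact h1
    | enc x n r t =>
      rintro ⟨x', n', r', t', j, h, rfl⟩
      rcases List.mem_cons.1 h with e | h
      · cases e
        rcases List.mem_cons.1 hs with rfl | hs
        · exact (hp.1.2.2.2 j).2.2.2.1 i hm
        · exact (hp.1.2.2.2 j).2.2.1 (hfn s hs hm)
      · exact h1 ⟨x', n', r', t', j, h, rfl⟩

theorem hh_blank (p : List (HStep S)) : oh ((sd false p).map OStep.blank) = hh p := by
  rw [oh_blank, oh_sd]

/-- The set `R` may exceed the randomness of `p`: in the induction, the earlier calls have to avoid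
the randomness of the whole sequence. -/
theorem Valid.ov' (hp : Valid ltU ltS K p) {R : Set ℕ} (hR : rds p ⊆ R) (i : Bool)
    (hb : ∀ s ∈ p, ∀ m ∈ (s.side i).body.names, m ∉ R) : OV {k | k ∈ K} R (sd i p) := by
  induction p with
  | nil => trivial
  | cons s p ih =>
    have ih' := ih hp.tail ((rds_cons_subset s).trans hR) fun s hs => hb s (by simp [hs])
    have hbs := hb s (by simp)
    cases s with
    | enc x n r t =>
      obtain ⟨⟨h1, h2, h3, h4⟩, h5⟩ := hp
      obtain ⟨g1, g2, g3, g4, g5⟩ := h4 i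
      refine ⟨⟨by rwa [oh_sd], h2, hR ⟨x, n, r, t, i, by simp, rfl⟩, ?_, g1, ?_⟩, ih'⟩
      · intro x' n' t' hm
        obtain ⟨r', t'', hm, e, -⟩ := enc_mem_sd.1 hm
        exact g3 ⟨_, hm, .inr ⟨i, .inl e⟩⟩
      · rw [oh_sd]; exact g2.mono g2.vars hbs id
    | dec z n c l =>
      obtain ⟨⟨h1, h2, h3, h4, h5, h6, h7⟩, h8⟩ := hp
      refine ⟨⟨by rwa [oh_sd], h2, h4, ?_, fun y hy => ?_, fun z' l' hm => ?_⟩, ih'⟩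
      · rw [oh_sd]; exact h5.mono h5.vars hbs id
      · obtain ⟨⟨n, r, t, h⟩, h'⟩ := (h6 i).2 y hy
        exact ⟨⟨_, _, _, enc_mem_sd.2 ⟨r, t, h, rfl, rfl⟩⟩, h' i⟩
      · obtain ⟨l'', hm, -⟩ := dec_mem_sd.1 hm
        exact h7 _ _ hm

theorem Valid.ov (hp : Valid ltU ltS K p) (i : Bool) : OV {k | k ∈ K} (rds p) (sd i p) :=
  hp.ov' le_rfl i fun s hs m hm => hp.body_names s hs i m hm

theorem Valid.inj (hp : Valid ltU ltS K p) {s s' : HStep S} (hs : s ∈ p) (hs' : s' ∈ p)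
    (e : s.h = s'.h) : s = s' := by
  induction p with
  | nil => simp at hs
  | cons a p ih =>
    have ha : a.h ∉ hh p := by
      cases a
      · exact hp.1.1
      · exact hp.1.1
    rcases List.mem_cons.1 hs with rfl | hm <;> rcases List.mem_cons.1 hs' with rfl | hm'
    · rfl
    · exact (ha ⟨s', hm', e.symm⟩).elim
    · exact (ha ⟨s, hm, e⟩).elim
    · exact ih hp.tail hm hm'

theorem mem_encH {x : ℕ} : x ∈ encH p ↔ ∃ n r t, HStep.enc x n r t ∈ p := by
  induction p with
  | nil => simp [encH]
  | cons s p ih =>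
    cases s with
    | enc x' n r t =>
      rw [encH, Finset.mem_insert, ih]
      constructor
      · rintro (rfl | ⟨n, r, t, h⟩)
        · exact ⟨n, r, t, by simp⟩
        · exact ⟨n, r, t, by simp [h]⟩
      · rintro ⟨n, r, t, h⟩
        rcases List.mem_cons.1 h with e | h
        · cases e; exact .inl rfl
        · exact .inr ⟨n, r, t, h⟩
    | dec z n c l => rw [encH, ih]; simp

theorem mem_decH {z : ℕ} : z ∈ decH p ↔ ∃ n c l, HStep.dec z n c l ∈ p := by
  induction p with
  | nil => simp [decH]
  | cons s p ih =>
    cases s with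
    | dec z' n c l =>
      rw [decH, Finset.mem_insert, ih]
      constructor
      · rintro (rfl | ⟨n, r, t, h⟩)
        · exact ⟨n, c, l, by simp⟩
        · exact ⟨n, r, t, by simp [h]⟩
      · rintro ⟨n, r, t, h⟩
        rcases List.mem_cons.1 h with e | h
        · cases e; exact .inl rfl
        · exact .inr ⟨n, r, t, h⟩
    | enc x n r t => rw [decH, ih]; simp

theorem mem_hh {x : ℕ} : x ∈ hh p ↔ x ∈ encH p ∨ x ∈ decH p := by
  rw [mem_encH, mem_decH]
  constructor
  · rintro ⟨s, hs, rfl⟩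
    cases s with
    | enc x n r t => exact .inl ⟨n, r, t, hs⟩
    | dec z n c l => exact .inr ⟨n, c, l, hs⟩
  · rintro (⟨n, r, t, h⟩ | ⟨n, c, l, h⟩)
    · exact ⟨_, h, rfl⟩
    · exact ⟨_, h, rfl⟩

theorem mem_hh_enc {x n : ℕ} {r t} (h : HStep.enc x n r t ∈ p) : x ∈ hh p := ⟨_, h, rfl⟩

theorem Valid.rnd_eq (hp : Valid ltU ltS K p) {x n : ℕ} {r : Bool → ℕ} {t : Bool → Term S}
    (h : HStep.enc x n r t ∈ p) (i : Bool) : rnd i p x = r i := by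
  induction p with
  | nil => simp at h
  | cons s p ih =>
    rcases List.mem_cons.1 h with rfl | hm
    · exact Function.update_self _ _ _
    · have ih' := ih hp.tail hm
      cases s with
      | enc x' n' r' t' =>
        refine (Function.update_of_ne ?_ _ _).trans ih'
        rintro rfl; exact hp.1.1 (mem_hh_enc hm)
      | dec z n c l => exact ih'

theorem Valid.call_enc (hp : Valid ltU ltS K p) {x n : ℕ} {r : Bool → ℕ} {t : Bool → Term S}
    (h : HStep.enc x n r t ∈ p) (i : Bool) :
    call i p x = enc ((t i).subst (call i p)) (pk (name n)) (name (r i)) :=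
  ((hp.ov i).scoped.ocall_eq (enc_mem_sd.2 ⟨r, t, h, rfl, rfl⟩)).2.2.2

theorem Valid.call_dec (hp : Valid ltU ltS K p) {z n : ℕ} {c : Term S} {l : Bool → List ℕ}
    (h : HStep.dec z n c l ∈ p) (i : Bool) :
    call i p z = elses ((l i).map fun y => Term.eq (c.subst (call i p)) (call i p y))
      (Term.dec (c.subst (call i p)) (sk (name n))) :=
  ((hp.ov i).scoped.ocall_eq (dec_mem_sd.2 ⟨l, h, rfl⟩)).2.2.2

theorem Valid.zcall_enc (hp : Valid ltU ltS K p) {x n : ℕ} {r : Bool → ℕ} {t : Bool → Term S}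
    (h : HStep.enc x n r t ∈ p) :
    zcall p x = enc (zero tru) (pk (name n)) (name (r false)) := by
  have := ((hp.ov false).scoped.blank.ocall_eq (List.mem_map_of_mem (f := OStep.blank)
    (enc_mem_sd.2 ⟨r, t, h, rfl, rfl⟩))).2.2.2
  change zcall p x = enc ((zero tru).subst _) _ _ at this
  rwa [subst_of_ground plain_zero_tru] at this

theorem Valid.zcall_dec (hp : Valid ltU ltS K p) {z n : ℕ} {c : Term S} {l : Bool → List ℕ}
    (h : HStep.dec z n c l ∈ p) :
    zcall p z = elses ((l false).map fun y => Term.eq (c.subst (zcall p)) (zcall p y))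
      (Term.dec (c.subst (zcall p)) (sk (name n))) :=
  ((hp.ov false).scoped.blank.ocall_eq (List.mem_map_of_mem (f := OStep.blank)
    (dec_mem_sd.2 ⟨l, h, rfl⟩))).2.2.2

theorem Valid.call_cons {s : HStep S} (hp : Valid ltU ltS K (s :: p)) (i : Bool) {x : ℕ}
    (hx : x ∈ hh p) : call i (s :: p) x = call i p x :=
  ocall_cons_of_mem (hp.ov i).scoped (by rwa [oh_sd])

theorem Valid.zcall_cons {s : HStep S} (hp : Valid ltU ltS K (s :: p)) {x : ℕ}
    (hx : x ∈ hh p) : zcall (s :: p) x = zcall p x :=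
  ocall_cons_of_mem (hp.ov false).scoped.blank (by rwa [← hh_blank] at hx)

/-- The plaintexts are visible only through the randomness of their ciphertexts. -/
theorem Valid.zcall_names (hp : Valid ltU ltS K p) : ∀ x ∈ hh p,
    ∀ m ∈ (zcall p x).names, m ∈ fn p := by
  rw [← oh_sd false]
  refine (hp.ov false).induction fun s hs' hb hg => ?_
  obtain ⟨s, hs, rfl⟩ := List.mem_map.1 hs'
  rw [HStep.side_h]
  cases s with
  | enc x n r t =>
    intro m hm
    change m ∈ (zcall p x).names at hm
    rw [hp.zcall_enc hs] at hm
    simp only [mem_names_enc, mem_names_pk, mem_names_name] at hm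
    rcases hm with hm | rfl | rfl
    · obtain ⟨i, hi⟩ := mem_names_app.1 hm
      fin_cases i
      obtain ⟨i, hi⟩ := mem_names_app.1 hi
      exact i.elim0
    · exact ⟨_, hs, .inl rfl⟩
    · exact ⟨_, hs, .inr ⟨false, .inl rfl⟩⟩
  | dec z n c l =>
    intro m hm
    change m ∈ (zcall p z).names at hm
    rw [hp.zcall_dec hs] at hm
    have hc : m ∈ (c.subst (zcall p)).names → m ∈ fn p := fun hm => by
      rcases (mem_names_subst ((hp.ov false).scoped.ocall_eq
        (dec_mem_sd.2 ⟨l, hs, rfl⟩)).1).1 hm with h | ⟨x, hx, h⟩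
      · exact ⟨_, hs, .inr h⟩
      · exact hb x hx m h
    rcases names_elses hm with hm | ⟨g, hg', hm⟩
    · simp only [mem_names_dec, mem_names_sk, mem_names_name] at hm
      rcases hm with hm | rfl
      · exact hc hm
      · exact ⟨_, hs, .inl rfl⟩
    · obtain ⟨y, hy, rfl⟩ := List.mem_map.1 hg'
      rcases mem_names_eq.1 hm with hm | hm
      · exact hc hm
      · exact hg y hy m hm

theorem Valid.zcall_plain_ws (hp : Valid ltU ltS K p) : ∀ x ∈ hh p,
    (zcall p x).Plain ∧ (zcall p x).WS := by
  intro x hx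
  rw [← oh_sd false] at hx
  refine (hp.ov false).induction (Q := fun x => (zcall p x).Plain ∧ (zcall p x).WS)
    (fun s hs' hb hg => ?_) x hx
  obtain ⟨s, hs, rfl⟩ := List.mem_map.1 hs'
  rw [HStep.side_h]
  cases s with
  | enc x n r t =>
    change (zcall p x).Plain ∧ (zcall p x).WS
    rw [hp.zcall_enc hs]
    refine ⟨plain_app.2 fun i => ?_, ws_app.2 ⟨fun i => ?_, by simp⟩⟩ <;> fin_cases i
    · exact plain_zero_tru
    · exact plain_pk_name
    · exact plain_name
    · exact ws_app.2 ⟨fun i => by fin_cases i; exact ws_app.2 ⟨fun i => i.elim0, by simp⟩, by simp⟩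
    · exact ws_pk_name
    · trivial
  | dec z n c l =>
    change (zcall p z).Plain ∧ (zcall p z).WS
    have hsd := (dec_mem_sd (i := false)).2 ⟨l, hs, rfl⟩
    have hcp := ((hp.ov false).scoped.ocall_eq hsd).1
    have hcσ : (c.subst (zcall p)).Plain ∧ (c.subst (zcall p)).WS :=
      ⟨plain_subst hcp fun x hx => (hb x hx).1,
        ws_subst hcp ((hp.ov false).body_ws hsd) fun x hx => (hb x hx).2⟩
    have hd : (dec (c.subst (zcall p)) (sk (name n))).Plain ∧
        (dec (c.subst (zcall p)) (sk (name n))).WS := by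
      refine ⟨plain_app.2 fun i => ?_, ws_app.2 ⟨fun i => ?_, by simp⟩⟩ <;> fin_cases i
      exacts [hcσ.1, plain_sk_name, hcσ.2, ws_sk_name]
    rw [hp.zcall_dec hs]
    refine elses_induction (Q := fun t => t.Plain ∧ t.WS) hd fun g hg' w hw => ?_
    obtain ⟨y, hy, rfl⟩ := List.mem_map.1 hg'
    have hy' := hg y hy
    refine ⟨plain_app.2 fun i => ?_, ws_ite.2 ⟨ws_app.2 ⟨fun i => ?_, by simp⟩, .inl rfl,
      ws_app.2 ⟨fun i => ?_, by simp⟩, hw.2⟩⟩ <;> fin_cases i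
    · exact plain_app.2 fun i => by fin_cases i; exacts [hcσ.1, hy'.1]
    · exact plain_app.2 fun i => by fin_cases i; exact hd.1
    · exact hw.1
    · exact hcσ.2
    · exact hy'.2
    · exact hd.2

/-- A later ciphertext cannot become visible: its randomness is fresh for the erased term, and
normal forms contain no new names. -/
theorem vis_cons [IsStrictTotalOrder (Term S) ltU] (hs : Valid ltU ltS K (s :: p)) {n : ℕ} {c : Term S} {R : Set ℕ} {zok : Prop}
    (hc : Sy {k | k ∈ K} R (hh p) zok c) (hws : c.WS)
    (hfn : ∀ x n r t, s = .enc x n r t → r false ∉ c.names) :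
    vis ltU (s :: p) n c = vis ltU p n c := by
  have e : c.subst (zcall (s :: p)) = c.subst (zcall p) :=
    subst_congr hc.pure fun x hx => hs.zcall_cons (hc.vars hx)
  ext x
  simp only [vis, Set.mem_ofPred_eq, e]
  constructor
  · rintro ⟨r, t, h, w, h1, h2, h3⟩
    rcases List.mem_cons.1 h with rfl | h
    · exfalso
      have hz := hs.tail.zcall_plain_ws
      have := names_rnormal (plain_subst hc.pure fun x hx => (hz x (hc.vars hx)).1)
        (ws_subst hc.pure hws fun x hx => (hz x (hc.vars hx)).2) h2 h1 h3
      rcases (mem_names_subst hc.pure).1 this with h | ⟨x, hx, h⟩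
      · exact hfn _ _ _ _ rfl h
      · exact (hs.1.2.2.2 false).2.2.1 (hs.tail.zcall_names x (hc.vars hx) _ h)
    · exact ⟨r, t, h, w, h1, h2, h3⟩
  · rintro ⟨r, t, h, w⟩
    exact ⟨r, t, by simp [h], w⟩


theorem vis_subset {n : ℕ} {c : Term S} : vis ltU p n c ⊆ hh p := by
  rintro x ⟨r, t, h, -⟩; exact mem_hh_enc h

theorem Valid.dec_spec (hp : Valid ltU ltS K p) {z n : ℕ} {c : Term S} {l : Bool → List ℕ}
    (h : HStep.dec z n c l ∈ p) : n ∈ K ∧ NLeaf c ∧ Sy {k | k ∈ K} (rds p) (hh p) False c := by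
  have h' := (hp.ov false).steps (dec_mem_sd.2 ⟨l, h, rfl⟩)
  rw [oh_sd] at h'
  obtain ⟨_, _, _, _, e, _⟩ | ⟨_, _, _, _, e, h1, h2⟩ := h'.2 <;> cases e
  exact ⟨h1, h2, h'.1⟩

/-- The guards chosen at the time of the call remain right in the longer sequence, because neither
the values of the old handles nor the visible handles of `c` change. -/
theorem Valid.sorted [IsStrictTotalOrder (Term S) ltU] (hp : Valid ltU ltS K p) {z n : ℕ} {c : Term S} {l : Bool → List ℕ}
    (h : HStep.dec z n c l ∈ p) (i : Bool) :
    IsSort ltS (call i p '' vis ltU p n c) ((l i).map (call i p)) ∧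
      ∀ y ∈ l i, (∃ n r t, HStep.enc y n r t ∈ p) ∧
        ∀ j, call j p y ∈ (c.subst (call j p)).st := by
  induction p with
  | nil => simp at h
  | cons s p ih =>
    have key : ∀ {R : Set ℕ}, Sy {k | k ∈ K} R (hh p) False c → NLeaf c →
        (∀ x n r t, s = .enc x n r t → r false ∉ c.names) → 
        (IsSort ltS (call i p '' vis ltU p n c) ((l i).map (call i p)) ∧
          ∀ y ∈ l i, (∃ n r t, HStep.enc y n r t ∈ p) ∧
            ∀ j, call j p y ∈ (c.subst (call j p)).st) →
        IsSort ltS (call i (s :: p) '' vis ltU (s :: p) n c) ((l i).map (call i (s :: p))) ∧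
        ∀ y ∈ l i, (∃ n r t, HStep.enc y n r t ∈ s :: p) ∧
          ∀ j, call j (s :: p) y ∈ (c.subst (call j (s :: p))).st := by
      rintro R hc hn hfn ⟨h1, h2⟩
      have hl : ∀ y ∈ l i, y ∈ hh p := fun y hy => by
        obtain ⟨n, r, t, h⟩ := (h2 y hy).1
        exact mem_hh_enc h
      rw [vis_cons hp hc (hc.pure.ws_of_ifFree (hn.ifFree hc.pure)) hfn,
        Set.image_congr (g := call i p) fun x hx => hp.call_cons i (vis_subset hx),
        List.map_congr_left (g := call i p) fun y hy => hp.call_cons i (hl y hy)]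
      refine ⟨h1, fun y hy => ⟨?_, fun j => ?_⟩⟩
      · obtain ⟨n, r, t, h⟩ := (h2 y hy).1
        exact ⟨n, r, t, by simp [h]⟩
      · rw [hp.call_cons j (hl y hy), subst_congr (σ' := call j p) hc.pure
          fun x hx => hp.call_cons j (hc.vars hx)]
        exact (h2 y hy).2 j
    rcases List.mem_cons.1 h with rfl | hm
    · obtain ⟨h1, h2, h3, h4, h5, h6, h7⟩ := hp.1
      exact key h5 h4 (by simp) (h6 i)
    · obtain ⟨h1, h2, h3⟩ := hp.tail.dec_spec hm
      refine key h3 h2 (fun x n r t e hr => ?_) (ih hp.tail hm)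
      subst e
      exact (hp.1.2.2.2 false).2.2.1 ⟨_, hm, .inr hr⟩

/-- The graph of the decryption handles. -/
def IsDec (p : List (HStep S)) (z : ℕ) (c : Term S) : Prop := ∃ n l, HStep.dec z n c l ∈ p

theorem isDec_iff (i : Bool) (z : ℕ) (c : Term S) :
    IsDec p z c ↔ ∃ n l, OStep.dec z n c l ∈ sd i p := by
  constructor
  · rintro ⟨n, l, h⟩; exact ⟨n, _, dec_mem_sd.2 ⟨l, h, rfl⟩⟩
  · rintro ⟨n, l, h⟩
    obtain ⟨l', h, -⟩ := dec_mem_sd.1 h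
    exact ⟨n, l', h⟩

/-- The decryption of a head ciphertext of the right key is guarded. -/
theorem Valid.head_guard [IsStrictTotalOrder (Term S) ltU] (hp : Valid ltU ltS K p) (i : Bool) : ∀ z n c l,
    OStep.dec z n c l ∈ sd i p → ∀ x r t, OStep.enc x n r t ∈ sd i p →
      Head (IsDec p) c (var x) → x ∈ l := by
  intro z n c l hz0 x r t hx0 hh
  obtain ⟨l, hz, rfl⟩ := dec_mem_sd.1 hz0
  obtain ⟨r, t, hx, rfl, rfl⟩ := enc_mem_sd.1 hx0
  obtain ⟨V⟩ := (inferInstance : Nonempty (Val S))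
  obtain ⟨hn, hc, hs⟩ := hp.dec_spec hz
  have hz' := hp.zcall_plain_ws
  have hcp : (c.subst (zcall p)).Plain := plain_subst hs.pure fun x hx => (hz' x (hs.vars hx)).1
  have hcw : (c.subst (zcall p)).WS := ws_subst hs.pure
    (hs.pure.ws_of_ifFree (hc.ifFree hs.pure)) fun x hx => (hz' x (hs.vars hx)).2
  obtain ⟨s, h1, h2, h3, -⟩ := exists_rnormal (ltU := ltU) hcp hcw
  -- A head is a subterm of the value under any valuation, so the randomness of a head handle occurs
  -- in the value of the erased ciphertext. This is also the value of its normal form, and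
  -- evaluation creates no names, so the handle is visible.
  have hm : r false ∈ (sem V (c.subst (zcall p))).names := by
    have hv : r false ∈ (sem V ((var x).subst (zcall p))).names := by
      simp only [subst]
      rw [hp.zcall_enc hx, sem_constr (by simp)]
      exact mem_names_app.2 ⟨2, mem_names_name.2 rfl⟩
    rcases hh.sem_mem (V := V) (σ := zcall p) (fun z c ⟨n, l, h⟩ => ⟨_, _, hp.zcall_dec h⟩) with
      h | ⟨_, h⟩
    · rwa [h]
    · exact names_st h hv
  rw [h1.sem_eq] at hm
  have hvis : x ∈ vis ltU p n c := ⟨r, t, hx, s, h1, h2, names_sem V h3.1 hm⟩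
  have := hp.sorted hz i
  obtain ⟨y, hy, e⟩ := List.mem_map.1 ((this.1.2 _).2 ⟨x, hvis, rfl⟩)
  obtain ⟨n, r, t, hy'⟩ := (this.2 y hy).1
  have := (hp.ov i).inj (by rw [oh_sd]; exact mem_hh_enc hy') (by rw [oh_sd]; exact mem_hh_enc hx) e
  rwa [← this]

theorem Valid.rnd_inj (hp : Valid ltU ltS K p) {x n x' n' : ℕ} {r r' : Bool → ℕ}
    {t t' : Bool → Term S} (h : HStep.enc x n r t ∈ p) (h' : HStep.enc x' n' r' t' ∈ p)
    {i j : Bool} (e : r i = r' j) : x = x' := by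
  induction p with
  | nil => simp at h
  | cons s p ih =>
    rcases List.mem_cons.1 h with rfl | hm <;> rcases List.mem_cons.1 h' with e' | hm'
    · cases e'; rfl
    · exact ((hp.1.2.2.2 i).2.2.1 ⟨_, hm', .inr ⟨j, .inl e⟩⟩).elim
    · subst e'
      exact ((hp.1.2.2.2 j).2.2.1 ⟨_, hm, .inr ⟨i, .inl e.symm⟩⟩).elim
    · exact ih hp.tail hm hm'

theorem dec_mem_st_elses {gs : List (Term S)} {x : Term S} : x ∈ (elses gs x).st := by
  induction gs with
  | nil => exact mem_st_self _
  | cons g gs ih => exact mem_st_app.2 (.inr ⟨2, ih⟩)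

/-- A ciphertext whose randomness occurs in an erased call occurs in the call. -/
theorem Valid.occurs [IsStrictTotalOrder (Term S) ltU] (hp : Valid ltU ltS K p) (hk : KeysOK p) {x n : ℕ} {r : Bool → ℕ}
    {t : Bool → Term S} (hx : HStep.enc x n r t ∈ p) : ∀ h ∈ hh p,
    r false ∈ (zcall p h).names → ∀ j, call j p x ∈ (call j p h).st := by
  rw [← oh_sd false]
  refine (hp.ov false).induction fun s hs' hb hg => ?_
  obtain ⟨s, hs, rfl⟩ := List.mem_map.1 hs'
  rw [HStep.side_h]
  have hr : r false ∈ rds p := ⟨_, _, _, _, _, hx, rfl⟩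
  intro hm j
  cases s with
  | enc y n' r' t' =>
    change call j p x ∈ (call j p y).st
    change r false ∈ (zcall p y).names at hm
    rw [hp.zcall_enc hs] at hm
    simp only [mem_names_enc, mem_names_pk, mem_names_name] at hm
    rcases hm with hm | hm | hm
    · obtain ⟨i, hi⟩ := mem_names_app.1 hm
      fin_cases i
      obtain ⟨i, hi⟩ := mem_names_app.1 hi
      exact i.elim0
    · exact (hk _ hs (hm ▸ hr)).elim
    · rw [hp.rnd_inj hx hs hm]; exact mem_st_self _
  | dec z n' c l =>
    change call j p x ∈ (call j p z).st
    change r false ∈ (zcall p z).names at hm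
    rw [hp.zcall_dec hs] at hm
    have hcs := (hp.dec_spec hs).2.2
    have hcz : ∀ {w}, w ∈ (c.subst (call j p)).st → w ∈ (call j p z).st := by
      intro w hw
      rw [hp.call_dec hs]
      exact st_trans (mem_st_app.2 (.inr ⟨0, hw⟩)) dec_mem_st_elses
    have hc : r false ∈ (c.subst (zcall p)).names → call j p x ∈ (call j p z).st := fun hm => by
      rcases (mem_names_subst hcs.pure).1 hm with h | ⟨x, hx, h⟩
      · exact (hcs.names _ h hr).elim
      · exact hcz (st_trans (hb x hx h j) (st_subst_of_mem_vars hcs.pure hx))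
    rcases names_elses hm with hm | ⟨g, hg', hm⟩
    · simp only [mem_names_dec, mem_names_sk, mem_names_name] at hm
      rcases hm with hm | hm
      · exact hc hm
      · exact (hk _ hs (hm ▸ hr)).elim
    · obtain ⟨y, hy, rfl⟩ := List.mem_map.1 hg'
      rcases mem_names_eq.1 hm with hm | hm
      · exact hc hm
      · exact hcz (st_trans (hg y hy hm j) (((hp.sorted hs false).2 y hy).2 j))

/-- The ciphertexts of one side. -/
def cts (i : Bool) (p : List (HStep S)) : Set (Term S) := {c | ∃ x ∈ encH p, call i p x = c}

theorem Valid.encSet (hp : Valid ltU ltS K p) (i : Bool) : EncSet (rds p) (cts i p) := by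
  rintro s ⟨x, hx, rfl⟩
  obtain ⟨n, r, t, h⟩ := mem_encH.1 hx
  exact ⟨_, n, r i, ⟨_, _, _, _, _, h, rfl⟩, hp.call_enc h i⟩

theorem mem_cts (i : Bool) : ∀ x n r t,
    OStep.enc x n r t ∈ sd i p → ocall (sd i p) x ∈ cts i p := by
  intro x n r t h
  obtain ⟨r, t, h, -⟩ := enc_mem_sd.1 h
  exact ⟨x, mem_encH.2 ⟨n, r, t, h⟩, rfl⟩

theorem Valid.zeroOut_subst (hp : Valid ltU ltS K p) {c : Term S} {zok : Prop}
    (hc : Sy {k | k ∈ K} (rds p) (hh p) zok c) :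
    zeroOut (cts false p) (c.subst (call false p)) = c.subst (zcall p) := by
  rw [CCSA.zeroOut_subst (hp.encSet false) (H := hh p) ?_ hc]
  · refine subst_congr hc.pure fun x hx => ?_
    exact (hp.ov false).zeroOut (hp.encSet false) (mem_cts false) x
      (by rw [oh_sd]; exact hc.vars hx)
  · rw [← oh_sd false]; exact (hp.ov false).ne_name

/-- Erasure commutes with instantiation, and the key of an encryption handle can be read off its
call; the visibility of the executions is thus the symbolic one. -/
theorem Valid.visible_eq (hp : Valid ltU ltS K p) {c : Term S} {zok : Prop}
    (hc : Sy {k | k ∈ K} (rds p) (hh p) zok c) (φ : List (Term S)) (n : ℕ) :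
    Exec.visible ltU ⟨φ, rnd false p, call false p⟩ (encH p) n (c.subst (call false p)) =
      vis ltU p n c := by
  ext x
  have e : Exec.encs ⟨φ, rnd false p, call false p⟩ (encH p) = cts false p := rfl
  simp only [Exec.visible, Set.mem_ofPred_eq, e, hp.zeroOut_subst hc, vis]
  constructor
  · rintro ⟨hx, ⟨m, r', e⟩, s, h1, h2, h3⟩
    obtain ⟨n', r, t, h⟩ := mem_encH.1 hx
    rw [hp.call_enc h false] at e
    have : n' = n := by
      simp only [enc, app.injEq, heq_eq_eq, true_and] at e
      have := congrFun e 1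
      simp only [Matrix.cons_val_one, Matrix.cons_val_zero, pk, app.injEq, heq_eq_eq,
        true_and] at this
      simpa using congrFun this 0
    subst this
    exact ⟨r, t, h, s, h1, h2, by rwa [hp.rnd_eq h] at h3⟩
  · rintro ⟨r, t, h, s, h1, h2, h3⟩
    exact ⟨mem_encH.2 ⟨_, _, _, h⟩, ⟨_, _, hp.call_enc h false⟩, s, h1, h2, by rwa [hp.rnd_eq h]⟩

-- The executions given by a valid sequence of calls.

def outs (i : Bool) : List (HStep S) → List (Term S)
  | [] => []
  | s :: p => outs i p ++ [call i (s :: p) s.h]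

theorem mem_outs (hp : Valid ltU ltS K p) {i : Bool} {w : Term S} (hw : w ∈ outs i p) :
    ∃ h ∈ hh p, w = call i p h := by
  induction p with
  | nil => simp [outs] at hw
  | cons s p ih =>
    rw [hh_cons]
    rcases List.mem_append.1 hw with hw | hw
    · obtain ⟨h, hh, e⟩ := ih hp.tail hw
      exact ⟨h, .inr hh, by rw [e, hp.call_cons i hh]⟩
    · simp at hw; exact ⟨_, .inl rfl, hw⟩

theorem Hidden.mono {R R' : Set ℕ} {C : Set (Term S)} (h : R' ⊆ R) {t : Term S}
    (ht : Hidden R C t) : Hidden R' C t := by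
  induction t with
  | name n => exact fun hn => ht (h hn)
  | var n => trivial
  | app f a ih => exact fun i => (ht i).imp (ih i) id
  | box a c b iha ihc _ => exact ⟨iha ht.1, ihc ht.2⟩
  | frz b ih => exact ih ht

theorem Valid.rk (hp : Valid ltU ltS K p) (i : Bool) : RK {k | k ∈ K} (sd i p) := by
  induction p with
  | nil => trivial
  | cons s p ih =>
    cases s with
    | enc x n r t =>
      refine ⟨fun y hy n' r' u hu => ?_, ih hp.tail⟩
      obtain ⟨r'', t', h, rfl, -⟩ := enc_mem_sd.1 hu
      exact (hp.1.2.2.2 i).2.2.2.2 y hy _ _ _ h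
    | dec z n c l => exact ih hp.tail

theorem Valid.call_names (hp : Valid ltU ltS K p) (i : Bool) :
    ∀ x ∈ hh p, (call i p x).names ⊆ fn p := by
  rw [← oh_sd i]
  refine (hp.ov i).names fun s hs' => ?_
  obtain ⟨s, hs, rfl⟩ := List.mem_map.1 hs'
  cases s with
  | enc x n r t =>
    exact ⟨⟨_, hs, .inl rfl⟩, ⟨_, hs, .inr ⟨i, .inl rfl⟩⟩, fun m hm => ⟨_, hs, .inr ⟨i, .inr hm⟩⟩⟩
  | dec z n c l => exact ⟨⟨_, hs, .inl rfl⟩, fun m hm => ⟨_, hs, .inr hm⟩⟩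

theorem Valid.hidden (hp : Valid ltU ltS K p) (hk : KeysOK p) (i : Bool) :
    ∀ x ∈ hh p, Hidden (rds p) (cts i p) (call i p x) := by
  rw [← oh_sd i]
  refine (hp.ov i).hidden (fun s hs' => ?_) (mem_cts i)
  obtain ⟨s, hs, rfl⟩ := List.mem_map.1 hs'
  cases s with
  | enc x n r t => exact hk _ hs
  | dec z n c l => exact hk _ hs

/-- The execution given by a sequence of oracle calls. -/
def exec (B : List (Term S)) (i : Bool) (p : List (HStep S)) : Exec S :=
  ⟨B ++ outs i p, rnd i p, call i p⟩

theorem Valid.exec_rands (hp : Valid ltU ltS K p) (B : List (Term S)) :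
    (exec B false p).rands (encH p) ∪ (exec B true p).rands (encH p) ⊆ rds p := by
  rintro m (⟨x, hx, rfl⟩ | ⟨x, hx, rfl⟩) <;> obtain ⟨n, r, t, h⟩ := mem_encH.1 hx
  · exact ⟨x, n, r, t, false, h, hp.rnd_eq h false⟩
  · exact ⟨x, n, r, t, true, h, hp.rnd_eq h true⟩

theorem Valid.exec_hidden (hp : Valid ltU ltS K p) (hk : KeysOK p) {B : List (Term S)}
    (hB : ∀ w ∈ B, Sy {k | k ∈ K} (rds p) ∅ True w) (i : Bool) {t : Term S} {zok : Prop}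
    (ht : Sy {k | k ∈ K} (rds p) (hh p) zok t) :
    ∀ s ∈ t.subst (call i p) :: (exec B i p).phi,
      Hidden ((exec B false p).rands (encH p) ∪ (exec B true p).rands (encH p))
        ((exec B i p).encs (encH p)) s := by
  intro s hs
  refine Hidden.mono (hp.exec_rands B) ?_
  change Hidden _ (cts i p) s
  rcases List.mem_cons.1 hs with rfl | hs
  · exact hidden_subst ht fun x hx => hp.hidden hk i x (ht.vars hx)
  · rcases List.mem_append.1 hs with hs | hs
    · have := hidden_subst (C := cts i p) (σ := var) (hB s hs) fun x hx => ((hB s hs).vars hx).elim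
      rwa [subst_var_self] at this
    · obtain ⟨h, hh, rfl⟩ := mem_outs hp hs
      exact hp.hidden hk i h hh

/-- The sequence is replayed on top of the common base `B`. Plaintexts are inlined so as to use
decryption handles only, the guards of `Valid` are those of clause 3, and the freshness and hiding
conditions follow because symbolic terms contain no randomness. -/
theorem Valid.ccaRel (hp : Valid ltU ltS K p) {B : List (Term S)}
    (hB : ∀ w ∈ B, w.WS ∧ Sy {k | k ∈ K} (rds p) ∅ True w) :
    CCARel ltU ltS K (encH p) (decH p) (exec B false p) (exec B true p) := by
  induction p with
  | nil =>
    simp only [exec, outs, List.append_nil]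
    exact .base B fun t ht => ⟨⟨(hB t ht).2.pure, Set.subset_empty_iff.1 (hB t ht).2.vars⟩,
      (hB t ht).1, (hB t ht).2.noDec⟩
  | cons s p ih =>
    have hB' : ∀ w ∈ B, Sy {k | k ∈ K} (rds p) ∅ True w := fun w hw =>
      (hB w hw).2.mono (hB w hw).2.vars
        (fun m hm hr => (hB w hw).2.names m hm (rds_cons_subset s hr)) id
    have rel := ih hp.tail fun w hw => ⟨(hB w hw).1, hB' w hw⟩
    have hov := hp.tail.ov
    have hws : ∀ i x, x ∈ hh p → (call i p x).WS := fun i x hx =>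
      ((hov i).plain_ws x (by rwa [oh_sd])).2
    cases s with
    | enc x n r t =>
      obtain ⟨⟨h1, h2, h3, h4⟩, h5⟩ := id hp
      have hstep : ∀ i, exec B i (.enc x n r t :: p) = ⟨(exec B i p).phi ++
          [Term.enc ((t i).subst (call i p)) (pk (name n)) (name (r i))],
          Function.update (exec B i p).rnd x (r i), Function.update (exec B i p).call x
          (Term.enc ((t i).subst (call i p)) (pk (name n)) (name (r i)))⟩ := by
        intro i
        simp only [exec, outs, HStep.h]
        rw [show call i (.enc x n r t :: p) x = _ from Function.update_self _ _ _,
          List.append_assoc]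
        rfl
      have harg : ∀ i, EncArg {k | k ∈ K} (decH p) ((t i).subst (inl (sd i p))) ∧
          ((t i).subst (inl (sd i p))).subst (call i p) = (t i).subst (call i p) := by
        intro i
        obtain ⟨g1, g2, g3, g4, g5⟩ := h4 i
        have hin := (hov i).inl_spec (h5.rk i)
        rw [oh_sd] at hin
        refine ⟨encArg_subst g2 fun y hy => ?_, ?_⟩
        · obtain ⟨k1, k2, k3, k4⟩ := (hin y (g2.vars hy)).2.2.2 fun n' r' u hu => by
            obtain ⟨r'', t'', h, rfl, -⟩ := enc_mem_sd.1 hu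
            exact g5 y hy _ _ _ h
          refine ⟨k1, k2, k3.trans ?_, k4⟩
          rintro z ⟨n, c, l, h⟩
          obtain ⟨l, h, -⟩ := dec_mem_sd.1 h
          exact Finset.mem_coe.2 (mem_decH.2 ⟨n, c, l, h⟩)
        · rw [subst_subst]
          exact subst_congr g2.pure fun y hy => (hin y (g2.vars hy)).2.2.1
      have hfresh : ∀ s ∈ (t false).subst (call false p) :: (t true).subst (call true p) ::
          ((exec B false p).phi ++ (exec B true p).phi), ∀ i, r i ∉ s.names := by
        intro s hs i
        have hu : ∀ j, r i ∉ ((t j).subst (call j p)).names := fun j hm => by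
          rcases (mem_names_subst (h4 j).2.1.pure).1 hm with h | ⟨y, hy, h⟩
          · exact (h4 i).2.2.2.1 j h
          · exact (h4 i).2.2.1 (h5.call_names j y ((h4 j).2.1.vars hy) h)
        have hφ : ∀ j, s ∈ (exec B j p).phi → r i ∉ s.names := fun j hs hm => by
          rcases List.mem_append.1 hs with hs | hs
          · exact (hB s hs).2.names _ hm ⟨x, n, r, t, i, by simp, rfl⟩
          · obtain ⟨h, hh, rfl⟩ := mem_outs h5 hs
            exact (h4 i).2.2.1 (h5.call_names j h hh hm)
        rcases List.mem_cons.1 hs with rfl | hs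
        · exact hu false
        rcases List.mem_cons.1 hs with rfl | hs
        · exact hu true
        rcases List.mem_append.1 hs with hs | hs
        · exact hφ _ hs
        · exact hφ _ hs
      have hw : ∀ i, ((t i).subst (call i p)).WS := fun i =>
        ws_subst (h4 i).2.1.pure ((h4 i).1.ws (h4 i).2.1.pure) fun y hy =>
          hws i y ((h4 i).2.1.vars hy)
      rw [hstep, hstep]
      exact .enc _ _ _ _ x n (r false) (r true) ((t false).subst (inl (sd false p)))
        ((t true).subst (inl (sd true p))) _ _ rel
        ⟨fun h => h1 (mem_hh.2 (.inl h)), fun h => h1 (mem_hh.2 (.inr h))⟩ h2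
        (harg false).1 (harg true).1 (harg false).2.symm (harg true).2.symm ⟨hw _, hw _⟩
        (fun s hs => ⟨hfresh s hs _, hfresh s hs _⟩)
        (h5.exec_hidden h3 hB' false (h4 false).2.1) (h5.exec_hidden h3 hB' true (h4 true).2.1)
    | dec z n c l =>
      obtain ⟨⟨h1, h2, h3, h4, h5, h6, h7⟩, h8⟩ := id hp
      have hstep : ∀ i, exec B i (.dec z n c l :: p) = ⟨(exec B i p).phi ++
          [elses (((l i).map (call i p)).map (Term.eq (c.subst (call i p))))
            (Term.dec (c.subst (call i p)) (sk (name n)))],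
          (exec B i p).rnd, Function.update (exec B i p).call z
          (elses (((l i).map (call i p)).map (Term.eq (c.subst (call i p))))
            (Term.dec (c.subst (call i p)) (sk (name n))))⟩ := by
        intro i
        simp only [exec, outs, HStep.h]
        rw [show call i (.dec z n c l :: p) z = _ from Function.update_self _ _ _,
          List.append_assoc, List.map_map]
        rfl
      have hif := h4.ifFree h5.pure
      have hw : ∀ i, (c.subst (call i p)).WS := fun i =>
        ws_subst h5.pure (h5.pure.ws_of_ifFree hif) fun y hy => hws i y (h5.vars hy)
      have hvis := h8.visible_eq h5 (B ++ outs false p) n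
      rw [hstep, hstep]
      refine .dec _ _ _ _ z n c _ _ ((l false).map (call false p)) ((l true).map (call true p)) rel
        ⟨fun h => h1 (mem_hh.2 (.inl h)), fun h => h1 (mem_hh.2 (.inr h))⟩ h2
        ⟨h5.pure, hif, h5.noZero id, fun x hx => ?_, h5.noDec⟩ rfl rfl ⟨hw _, hw _⟩ ?_ ?_
        (h8.exec_hidden h3 hB' false h5) (h8.exec_hidden h3 hB' true h5)
      · exact (mem_hh.1 (h5.vars hx)).imp Finset.mem_coe.2 Finset.mem_coe.2
      · have := (h6 false).1
        rw [← hvis] at this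
        exact this
      · have := (h6 true).1
        rw [← hvis] at this
        exact this

end CCSA

namespace CCSA
open Term
variable {S : Signature} {V : Val S} {β β' : Prop} {ltU ltS : Term S → Term S → Prop}

/-! ### From the matching executions to sequences of oracle calls -/

theorem sem_ifFree (V V' : Val S) {t : Term S} (hp : t.Pure) (h : t.IfFree) :
    sem V t = sem V' t := by
  induction t with
  | name n => rfl
  | var n => rfl
  | app f a ih =>
    have := ifFree_app.1 h
    rw [sem_app this.1, sem_app this.1]
    congr 1; funext i
    exact ih i (pure_app.1 hp i) (this.2 i)
  | box a c b => exact (not_pure_box hp).elim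
  | frz b => exact (not_pure_frz hp).elim

theorem Sy.sem {K R H : Set ℕ} {zok : Prop} {t : Term S} (h : Sy K R H zok t) (V : Val S) :
    Sy K R H zok (sem V t) := by
  rw [← dt_sem h.pure]; exact DT.sem_all h.dt

theorem tr_toTerm {D : DT S} (h : D.All (fun b => NLeaf b ∧ b.IsBool) NLeaf) : Tr D.toTerm := by
  induction D with
  | leaf t => exact .leaf _ h
  | node b l r ihl ihr => exact .node _ _ _ h.1.1 h.1.2 (ihl h.2.1) (ihr h.2.2)

theorem tr_dt {t : Term S} (hp : t.Pure) (hw : t.WS) : Tr (dt t).toTerm :=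
  tr_toTerm (((dt_all_nleaf hp).and (dt_all_srt (β := False) hp ⟨hw, False.elim⟩)).mono
    (fun _ h => ⟨h.1.1, h.2.2 trivial⟩) fun _ h => h.1)

theorem zeroOut_congr {C C' : Set (Term S)} {t : Term S} (hp : t.Pure)
    (h : ∀ s ∈ t.st, s ∈ C ↔ s ∈ C') : zeroOut C t = zeroOut C' t := by
  induction t with
  | name n => rfl
  | var n => rfl
  | app f a ih =>
    have h0 := h _ (mem_st_self _)
    simp only [zeroOut]
    congr 1; funext i
    rw [ih i (pure_app.1 hp i) fun s hs => h s (mem_st_app.2 (.inr ⟨i, hs⟩))]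
    by_cases h1 : Term.app f a ∈ C ∧ i.val = 0
    · rw [if_pos h1, if_pos ⟨h0.1 h1.1, h1.2⟩]
    · rw [if_neg h1, if_neg fun h' => h1 ⟨h0.2 h'.1, h'.2⟩]
  | box a c b => exact (not_pure_box hp).elim
  | frz b => exact (not_pure_frz hp).elim

theorem zeroOut_good {C : Set (Term S)} {R : Set ℕ} (hC : EncSet R C) {t : Term S} (hp : t.Plain)
    (hw : t.WS) : (zeroOut C t).Plain ∧ (zeroOut C t).WS ∧ (t.IsBool → (zeroOut C t).IsBool) := by
  induction t with
  | name n => exact ⟨hp, hw, id⟩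
  | var n => exact (not_plain_var hp).elim
  | app f a ih =>
    have ih' := fun i => ih i (plain_app.1 hp i) (hw.1 i)
    by_cases hm : Term.app f a ∈ C
    · obtain ⟨u, n, r, _, e⟩ := hC _ hm
      rw [e] at hm ⊢
      rw [zeroOut_enc hC hm]
      refine ⟨plain_app.2 fun i => ?_, ws_app.2 ⟨fun i => ?_, by simp⟩, fun h => ?_⟩
      · fin_cases i; exacts [plain_zero_tru, plain_pk_name, plain_name]
      · fin_cases i
        exacts [ws_app.2 ⟨fun i => by fin_cases i; exact ws_app.2 ⟨fun i => i.elim0, by simp⟩,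
          by simp⟩, ws_pk_name, trivial]
      · rw [isBool_app_of_ne (by simp)] at h; simp [Sym.retBool] at h
    · rw [zeroOut_app hm]
      exact ⟨plain_app.2 fun i => (ih' i).1, ⟨fun i => (ih' i).2.1, fun hf i hi =>
        (ih' i).2.2 (hw.2 hf i hi)⟩, fun h => h.imp id fun ⟨hf, h⟩ =>
        ⟨hf, fun i hi => (ih' i).2.2 (h i hi)⟩⟩
  | box a c b => exact (not_pure_box hp.1).elim
  | frz b => exact (not_pure_frz hp.1).elim

/-- The value of a guarded decryption depends on the set of the guards only. -/
theorem sem_guarded {u u' : Term S} {n : ℕ} {f f' : ℕ → Term S} {A : Set ℕ} {l : List (Term S)}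
    {l' : List ℕ} (hu : sem V u = sem V u') (hf : ∀ y ∈ A, sem V (f y) = sem V (f' y))
    (hl : ∀ w, w ∈ l ↔ w ∈ f '' A) (hl' : ∀ y, y ∈ l' ↔ y ∈ A) :
    sem V (elses (l.map (Term.eq u)) (dec u (sk (name n)))) =
      sem V (elses (l'.map fun y => Term.eq u' (f' y)) (dec u' (sk (name n)))) := by
  have hd : sem V (dec u (sk (name n))) = sem V (dec u' (sk (name n))) :=
    sem_congr fun i => by fin_cases i; exacts [hu, rfl]
  have hg : ∀ y ∈ A, sem V (Term.eq u (f y)) = sem V (Term.eq u' (f' y)) := fun y hy =>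
    sem_congr fun i => by fin_cases i; exacts [hu, hf y hy]
  have hiff : (∃ g ∈ l.map (Term.eq u), V.ρ (sem V g)) ↔
      ∃ g ∈ l'.map fun y => Term.eq u' (f' y), V.ρ (sem V g) := by
    constructor
    · rintro ⟨g, hg', h⟩
      obtain ⟨w, hw, rfl⟩ := List.mem_map.1 hg'
      obtain ⟨y, hy, rfl⟩ := (hl w).1 hw
      exact ⟨_, List.mem_map_of_mem ((hl' y).2 hy), hg y hy ▸ h⟩
    · rintro ⟨g, hg', h⟩
      obtain ⟨y, hy, rfl⟩ := List.mem_map.1 hg'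
      have hy := (hl' y).1 hy
      exact ⟨_, List.mem_map_of_mem ((hl _).2 ⟨y, hy, rfl⟩), (hg y hy).symm ▸ h⟩
  rw [sem_elses, sem_elses, hd]
  by_cases h : ∃ g ∈ l.map (Term.eq u), V.ρ (sem V g)
  · rw [if_pos h, if_pos (hiff.1 h)]
  · rw [if_neg h, if_neg fun h' => h (hiff.2 h')]

/-- The sequence of oracle calls `p` has the values of the executions `E`; decryption handles with
the same values are identified by `π`. -/
structure Abs (ltU ltS : Term S → Term S → Prop) (K X Z : Finset ℕ) (E : Bool → Exec S)
    (p : List (HStep S)) (π : ℕ → ℕ) : Prop where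
  valid : Valid ltU ltS K p
  encs : encH p = X
  decs : ∀ z ∈ decH p, z ∈ Z
  πX : ∀ x ∈ X, π x = x
  πZ : ∀ z ∈ Z, π z ∈ decH p
  sem : ∀ h, h ∈ X ∨ h ∈ Z → ∀ i V, sem V ((E i).call h) = sem V (call i p (π h))
  -- Erased values are tracked as well, since they determine the guards; the left side is enough
  -- because clause 3 reads visibility there.
  zsem : ∀ h, h ∈ X ∨ h ∈ Z → ∀ V,
    CCSA.sem V (zeroOut ((E false).encs X) ((E false).call h)) = CCSA.sem V (zcall p (π h))
  enc : ∀ x n r t, HStep.enc x n r t ∈ p → ∀ i, (E i).rnd x = r i ∧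
    ∃ u, (E i).call x = Term.enc u (pk (name n)) (name (r i))
  dec : ∀ z ∈ Z, ∀ i, ∃ gs u n, (E i).call z = elses gs (Term.dec u (sk (name n)))
  dec_key : ∀ z n c l, HStep.dec z n c l ∈ p →
    ∃ gs u, (E false).call z = elses gs (Term.dec u (sk (name n)))
  mem : ∀ h, h ∈ X ∨ h ∈ Z → ∀ i, (E i).call h ∈ (E i).phi
  good : ∀ i, ∀ s ∈ (E i).phi, s.Plain ∧ s.WS
  names : ∀ m ∈ fn p, ∃ i, ∃ s ∈ (E i).phi, m ∈ s.names
  length : (E false).phi.length = (E true).phi.length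
  zip : ∀ w ∈ List.zip (E false).phi (E true).phi,
    (∃ s, w = (s, s) ∧ (∀ k ∈ K, NoDec k s) ∧ ∀ m ∈ s.names, m ∉ rds p) ∨
      ∃ h, (h ∈ X ∨ h ∈ Z) ∧ w = ((E false).call h, (E true).call h)

open Classical in
/-- Replaces the ciphertexts of the oracles by their handles. -/
noncomputable def absT (p : List (HStep S)) (π : ℕ → ℕ) : Term S → Term S
  | .name n => .name n
  | .var x => .var (π x)
  | .app f a =>
    if h : ∃ x n r t i, HStep.enc x n r t ∈ p ∧
        ∃ b, Term.app f a = .app .enc b ∧ b 2 = .name (r i) then .var h.choose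
    else .app f fun i => absT p π (a i)
  | .box a c b => .box a c b
  | .frz b => .frz b

section
variable {K X Z : Finset ℕ} {E : Bool → Exec S} {p : List (HStep S)} {π : ℕ → ℕ}

theorem Abs.shape (hA : Abs ltU ltS K X Z E p π) {h : ℕ} (hh : h ∈ X ∨ h ∈ Z) (i : Bool) :
    OShape Set.univ Set.univ ((E i).call h) := by
  rcases hh with hh | hh
  · rw [← hA.encs] at hh
    obtain ⟨n, r, t, h⟩ := mem_encH.1 hh
    obtain ⟨-, u, e⟩ := hA.enc _ _ _ _ h i
    exact .inl ⟨u, n, trivial, r i, trivial, e⟩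
  · obtain ⟨gs, u, n, e⟩ := hA.dec h hh i
    exact .inr ⟨gs, u, n, trivial, e⟩

theorem Abs.ne_name (hA : Abs ltU ltS K X Z E p π) {h : ℕ} (hh : h ∈ X ∨ h ∈ Z) (i : Bool) (n : ℕ) :
    (E i).call h ≠ name n := by
  obtain ⟨f, a, e, -⟩ := (hA.shape hh i).root
  rw [e]; simp

theorem Abs.π_mem (hA : Abs ltU ltS K X Z E p π) {h : ℕ} (hh : h ∈ X ∨ h ∈ Z) : π h ∈ CCSA.hh p := by
  rcases hh with hh | hh
  · rw [hA.πX h hh]; exact mem_hh.2 (.inl (hA.encs ▸ hh))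
  · exact mem_hh.2 (.inr (hA.πZ h hh))

theorem Abs.encSet (hA : Abs ltU ltS K X Z E p π) (i : Bool) : EncSet (rds p) ((E i).encs X) := by
  rintro s ⟨x, hx, rfl⟩
  rw [← hA.encs] at hx
  obtain ⟨n, r, t, h⟩ := mem_encH.1 hx
  obtain ⟨-, u, e⟩ := hA.enc _ _ _ _ h i
  exact ⟨u, n, r i, ⟨x, n, r, t, i, h, rfl⟩, e⟩

theorem Abs.rds_subset (hA : Abs ltU ltS K X Z E p π) :
    rds p ⊆ (E false).rands X ∪ (E true).rands X := by
  rintro m ⟨x, n, r, t, i, h, rfl⟩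
  have hx : x ∈ X := hA.encs ▸ mem_encH.2 ⟨n, r, t, h⟩
  cases i
  · exact .inl ⟨x, hx, (hA.enc _ _ _ _ h _).1⟩
  · exact .inr ⟨x, hx, (hA.enc _ _ _ _ h _).1⟩

theorem hidden_elses {R : Set ℕ} {C : Set (Term S)} {gs : List (Term S)} {x : Term S}
    (h : Hidden R C (elses gs x)) : Hidden R C x := by
  induction gs with
  | nil => exact h
  | cons g gs ih =>
    rcases h 2 with h | ⟨h, -⟩
    · exact ih h
    · cases h

/-- Every key occurs in a call, under `pk` or `sk`, and hidden names cannot occur there. -/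
theorem Abs.keysOK (hA : Abs ltU ltS K X Z E p π)
    (hid : ∀ s ∈ (E false).phi, Hidden (rds p) ((E false).encs X) s) : KeysOK p := by
  intro s hs
  cases s with
  | enc x n r t =>
    have hx : x ∈ X := hA.encs ▸ mem_encH.2 ⟨n, r, t, hs⟩
    obtain ⟨-, u, e⟩ := hA.enc _ _ _ _ hs false
    have := hid _ (hA.mem x (.inl hx) false)
    rw [e] at this
    rcases this 1 with h | ⟨-, h, -⟩
    · rcases h 0 with h | ⟨h, -⟩
      · exact h
      · cases h
    · cases h
  | dec z n c l =>
    obtain ⟨gs, u, e⟩ := hA.dec_key _ _ _ _ hs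
    have := hid _ (hA.mem z (.inr (hA.decs z (mem_decH.2 ⟨n, c, l, hs⟩))) false)
    rw [e] at this
    rcases hidden_elses this 1 with h | ⟨h, -⟩
    · rcases h 0 with h | ⟨h, -⟩
      · exact h
      · cases h
    · cases h

/-- By hiding, a randomness of the sequence occurs only inside an oracle ciphertext, and it
identifies the handle of that ciphertext. Putting handles back in place of such ciphertexts
therefore keeps all values, plain and erased, and leaves a symbolic term. The last clause records
that a ciphertext written in full inside an argument without encryption handles has a randomness
outside the keys, by `nodec`; the inlining of plaintexts relies on it. -/
theorem Abs.absT_spec (hA : Abs ltU ltS K X Z E p π) (i : Bool) {t : Term S} (hp : t.Pure)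
    (hz : t.NoZero) (hv : ∀ x ∈ t.vars, x ∈ X ∨ x ∈ Z) (hK : ∀ k ∈ K, NoDec k t)
    (hid : Hidden (rds p) ((E i).encs X) (t.subst (E i).call)) :
    Sy {k | k ∈ K} (rds p) (hh p) False (absT p π t) ∧
    (∀ V, CCSA.sem V ((absT p π t).subst (call i p)) = CCSA.sem V (t.subst (E i).call)) ∧
    (i = false → ∀ V, CCSA.sem V ((absT p π t).subst (zcall p)) =
      CCSA.sem V (zeroOut ((E i).encs X) (t.subst (E i).call))) ∧
    (t.IfFree → (absT p π t).IfFree) ∧ (absT p π t).names ⊆ t.names ∧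
    ((t.subst (E i).call).IsBool → (absT p π t).IsBool) ∧
    ((t.subst (E i).call).WS → (absT p π t).WS) ∧
    ((∀ x ∈ t.vars, x ∈ Z) → ∀ y ∈ (absT p π t).vars, ∀ n r u, HStep.enc y n r u ∈ p → r i ∉ K) := by
  induction t with
  | name n =>
    refine ⟨⟨fun h => hK n h rfl, hid⟩, fun _ => rfl, fun _ _ => rfl, id, le_rfl, id, id, ?_⟩
    simp [absT, Term.vars, st]
  | var x =>
    have hx := hv x (by simp)
    refine ⟨hA.π_mem hx, fun V => (hA.sem x hx i V).symm, ?_, fun _ => ifFree_var,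
      by simp [absT, Term.names, st], fun h => ((hA.shape hx i).not_isBool h).elim,
      fun _ => trivial, ?_⟩
    · rintro rfl V; exact (hA.zsem x hx V).symm
    · intro hZ y hy n r u hu
      simp [absT] at hy
      subst hy
      obtain ⟨n', c, l, h⟩ := mem_decH.1 (hA.πZ x (hZ x (by simp)))
      have := hA.valid.inj hu h rfl
      cases this
  | app f a ih =>
    -- When an instance is an oracle ciphertext, its randomness is already written in the term,
    -- since the value of a handle is never a name.
    have key : ∀ x1, x1 ∈ X → (E i).call x1 = (Term.app f a).subst (E i).call →
        ∃ n r t, HStep.enc x1 n r t ∈ p ∧ ∃ b, Term.app f a = .app .enc b ∧ b 2 = .name (r i) := by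
      intro x1 hx1 e
      obtain ⟨n, r, t, h⟩ := mem_encH.1 (hA.encs.symm ▸ hx1)
      refine ⟨n, r, t, h, ?_⟩
      obtain ⟨-, u, e'⟩ := hA.enc _ _ _ _ h i
      rw [e'] at e
      simp only [subst, app.injEq] at e
      obtain ⟨rfl, e⟩ := e
      rw [heq_eq_eq] at e
      refine ⟨a, rfl, ?_⟩
      have e2 : name (r i) = (a 2).subst (E i).call := congrFun e 2
      have hv2 := fun x hx => hv x (mem_vars_app.2 ⟨2, hx⟩)
      generalize a 2 = w at e2 hv2
      cases w with
      | var y => exact (hA.ne_name (hv2 y (by simp)) i _ e2.symm).elim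
      | name m => simp only [subst] at e2; exact e2.symm
      | _ => simp [subst] at e2
    rw [absT]
    split_ifs with hc
    · obtain ⟨n, r, t, j, h, b, e, e2⟩ := hc.choose_spec
      generalize hc.choose = x0 at h
      simp only [app.injEq] at e
      obtain ⟨rfl, e⟩ := e
      rw [heq_eq_eq] at e
      subst e
      have hct : ∃ x1 ∈ X, (E i).call x1 = (Term.app .enc a).subst (E i).call := by
        rcases hid 2 with h' | ⟨-, -, h'⟩
        · change Hidden _ _ ((a 2).subst _) at h'
          rw [e2] at h'
          exact (h' ⟨_, _, _, _, _, h, rfl⟩).elim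
        · exact h'
      obtain ⟨x1, hx1, e1⟩ := hct
      obtain ⟨n1, r1, t1, h1, b, e, e3⟩ := key x1 hx1 e1
      simp only [app.injEq, heq_eq_eq, true_and] at e
      subst e
      have er : r1 i = r j := by rw [e2] at e3; simpa using e3.symm
      have ex : x1 = x0 := hA.valid.rnd_inj h1 h er
      subst ex
      refine ⟨mem_hh_enc h, fun V => ?_, ?_, fun _ => ifFree_var, by simp [Term.names, st], fun hb => ?_,
        fun _ => trivial, fun _ y hy n' r' u' hu => ?_⟩
      · rw [← e1, hA.sem x1 (.inl hx1), hA.πX x1 hx1]; rfl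
      · rintro rfl V
        rw [← e1, hA.zsem x1 (.inl hx1), hA.πX x1 hx1]; rfl
      · simp only [subst] at hb
        rw [isBool_app_of_ne (by simp)] at hb; simp [Sym.retBool] at hb
      · simp at hy
        subst hy
        have := hA.valid.inj hu h1 rfl
        cases this
        intro hk
        rcases hK _ hk with h | h
        · cases h
        · have := h 2
          rw [e3] at this
          exact this rfl
    · have hne : (Term.app f a).subst (E i).call ∉ (E i).encs X := by
        rintro ⟨x1, hx1, e⟩
        obtain ⟨n, r, t, h, h'⟩ := key x1 hx1 e
        exact hc ⟨x1, n, r, t, i, h, h'⟩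
      by_cases hpk : ∃ n ∈ K, Term.app f a = pk (.name n)
      · obtain ⟨n, hn, e⟩ := hpk
        cases e
        have e : Term.app .pk (fun i => absT p π (![name n] i)) = pk (.name n) := by
          congr 1; funext i; fin_cases i; rfl
        rw [e, subst_of_ground plain_pk_name, subst_of_ground plain_pk_name,
          subst_of_ground plain_pk_name]
        rw [subst_of_ground plain_pk_name] at hid
        refine ⟨.inl ⟨n, hn, ?_, rfl⟩, fun V => rfl, fun _ V => ?_, id, le_rfl, id, id, ?_⟩
        · rcases hid 0 with h | ⟨h, -⟩
          · exact h
          · cases h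
        · congr 1
          rw [Term.pk, zeroOut_app ((hA.encSet i).ne (by simp))]
          congr 1; funext i; fin_cases i; rfl
        · rw [vars_pk_name]; simp
      · have hK' : ∀ j, ∀ k ∈ K, NoDec k (a j) := fun j k hk =>
          ((hK k hk).resolve_left fun h => hpk ⟨k, hk, h⟩) j
        have ih' := fun j => ih j (pure_app.1 hp j) ((noZero_app.1 hz).2 j)
          (fun x hx => hv x (mem_vars_app.2 ⟨j, hx⟩)) (hK' j)
          ((hid j).resolve_right fun h => hne h.2.2)
        simp only [subst] at hne ⊢
        refine ⟨.inr ⟨fun h => ((noZero_app.1 hz).1 h).elim, fun j => (ih' j).1⟩,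
          fun V => sem_congr fun j => (ih' j).2.1 V, fun hi V => ?_,
          fun h => ifFree_app.2 ⟨(ifFree_app.1 h).1, fun j => (ih' j).2.2.2.1 ((ifFree_app.1 h).2 j)⟩,
          fun m hm => ?_, fun h => h.imp id fun ⟨hf, h⟩ => ⟨hf, fun j hj =>
            (ih' j).2.2.2.2.2.1 (h j hj)⟩, fun h => ⟨fun j => (ih' j).2.2.2.2.2.2.1 (h.1 j), fun hf j hj =>
            (ih' j).2.2.2.2.2.1 (h.2 hf j hj)⟩, fun hZ y hy => ?_⟩
        · rw [zeroOut_app hne]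
          exact sem_congr fun j => (ih' j).2.2.1 hi V
        · obtain ⟨j, hj⟩ := mem_names_app.1 hm
          exact mem_names_app.2 ⟨j, (ih' j).2.2.2.2.1 hj⟩
        · obtain ⟨j, hj⟩ := mem_vars_app.1 hy
          exact (ih' j).2.2.2.2.2.2.2 (fun x hx => hZ x (mem_vars_app.2 ⟨j, hx⟩)) y hj
  | box a c b => exact (not_pure_box hp).elim
  | frz b => exact (not_pure_frz hp).elim

theorem Valid.mem_guards [IsStrictTotalOrder (Term S) ltU] (hp : Valid ltU ltS K p) {z n : ℕ}
    {c : Term S} {l : Bool → List ℕ} (h : HStep.dec z n c l ∈ p) (i : Bool) (y : ℕ) :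
    y ∈ l i ↔ y ∈ vis ltU p n c := by
  have hs := hp.sorted h i
  have hinj := (hp.ov i).inj
  rw [oh_sd] at hinj
  constructor
  · intro hy
    obtain ⟨n', r, t, hy'⟩ := (hs.2 y hy).1
    obtain ⟨x, hx, e⟩ := (hs.1.2 _).1 (List.mem_map_of_mem (f := call i p) hy)
    rwa [← hinj (vis_subset hx) (mem_hh_enc hy') e]
  · intro hy
    obtain ⟨x, hx, e⟩ := List.mem_map.1 ((hs.1.2 _).2 ⟨y, hy, rfl⟩)
    obtain ⟨n', r, t, hx'⟩ := (hs.2 x hx).1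
    rwa [← hinj (mem_hh_enc hx') (vis_subset hy) e]

/-- A decryption call can be added, unless it has been done before. -/
theorem Valid.exists_dec [IsStrictTotalOrder (Term S) ltU] [IsStrictTotalOrder (Term S) ltS]
    (hp : Valid ltU ltS K p) (hk : KeysOK p) {z n : ℕ} {c : Term S} (hz : z ∉ hh p) (hn : n ∈ K)
    (hc : NLeaf c) (hs : Sy {k | k ∈ K} (rds p) (hh p) False c) :
    ∃ p' z' l', Valid ltU ltS K p' ∧ HStep.dec z' n c l' ∈ p' ∧
      (p' = p ∨ z' = z ∧ p' = .dec z n c l' :: p) := by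
  by_cases hdup : ∃ z' l', HStep.dec z' n c l' ∈ p
  · obtain ⟨z', l', h⟩ := hdup
    exact ⟨p, z', l', hp, h, .inl rfl⟩
  have hfin : (vis ltU p n c).Finite := by
    refine (encH p).finite_toSet.subset ?_
    rintro x ⟨r, t, h, -⟩; exact Finset.mem_coe.2 (mem_encH.2 ⟨n, r, t, h⟩)
  have hl : ∀ i, ∃ l : List ℕ, IsSort ltS (call i p '' vis ltU p n c) (l.map (call i p)) ∧
      ∀ y ∈ l, y ∈ vis ltU p n c := by
    intro i
    obtain ⟨L, h1, h2⟩ := exists_sort ltS (call i p '' vis ltU p n c) (hfin.image _)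
    have hg : ∀ w : Term S, ∃ y, w ∈ L → y ∈ vis ltU p n c ∧ call i p y = w := fun w => by
      by_cases hw : w ∈ L
      · obtain ⟨y, hy, e⟩ := (h2 w).1 hw
        exact ⟨y, fun _ => ⟨hy, e⟩⟩
      · exact ⟨0, fun h => (hw h).elim⟩
    choose g hg using hg
    have e : (L.map g).map (call i p) = L := by
      rw [List.map_map]
      conv_rhs => rw [← List.map_id L]
      exact List.map_congr_left fun w hw => (hg w hw).2
    refine ⟨L.map g, by rw [e]; exact ⟨h1, h2⟩, fun y hy => ?_⟩
    obtain ⟨w, hw, rfl⟩ := List.mem_map.1 hy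
    exact (hg w hw).1
  choose l hl using hl
  refine ⟨.dec z n c l :: p, z, l, ⟨⟨hz, hn, hk, hc, hs, fun i => ⟨(hl i).1, fun y hy => ?_⟩,
    fun z' l' h => hdup ⟨z', l', h⟩⟩, hp⟩, by simp, .inr ⟨rfl, rfl⟩⟩
  obtain ⟨r, t, h, s, h1, h2, h3⟩ := (hl i).2 y hy
  refine ⟨⟨n, r, t, h⟩, fun j => ?_⟩
  have hz := hp.zcall_plain_ws
  have := names_rnormal (plain_subst hs.pure fun x hx => (hz x (hs.vars hx)).1)
    (ws_subst hs.pure (hs.pure.ws_of_ifFree (hc.ifFree hs.pure)) fun x hx =>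
      (hz x (hs.vars hx)).2) h2 h1 h3
  -- The symbolic ciphertext has no randomness of its own, so a visible one comes from the erased
  -- value of an earlier handle; `Valid.occurs` turns this into an occurrence of the ciphertext on
  -- both sides.
  rcases (mem_names_subst hs.pure).1 this with h' | ⟨x, hx, h'⟩
  · exact (hs.names _ h' ⟨_, _, _, _, _, h, rfl⟩).elim
  · exact st_trans (hp.occurs hk h x (hs.vars hx) h' j) (st_subst_of_mem_vars hs.pure hx)

end

end CCSA

namespace CCSA
open Term
variable {S : Signature} {V : Val S} {β β' : Prop} {ltU ltS : Term S → Term S → Prop}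

-- Abstraction of the matching executions, one oracle call at a time.

section
variable {K X Z : Finset ℕ} {E : Bool → Exec S} {p : List (HStep S)} {π : ℕ → ℕ}

theorem Abs.not_mem_hh (hA : Abs ltU ltS K X Z E p π) {x : ℕ} (hx : x ∉ X ∧ x ∉ Z) : x ∉ CCSA.hh p :=
  fun h => (mem_hh.1 h).elim (fun h => hx.1 (hA.encs ▸ h)) fun h => hx.2 (hA.decs x h)

/-- A normalized version of the term, with the same names and variables. -/
theorem exists_tr {R H : Set ℕ} {Ks : Set ℕ} {zok : Prop} {t : Term S} (ht : Sy Ks R H zok t)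
    (hw : Srt β t) : ∃ t', Tr t' ∧ Sy Ks R H zok t' ∧ t'.names ⊆ t.names ∧ t'.vars ⊆ t.vars ∧
      (∀ V, CCSA.sem V t' = CCSA.sem V t) ∧ Srt β t' := by
  have h : Sy Ks {m | m ∉ t.names} t.vars zok t := ht.mono le_rfl (fun m hm h => h hm) id
  have h' : Sy Ks {m | m ∉ t.names} t.vars zok (dt t).toTerm := Sy.toTerm h.dt
  have hn : (dt t).toTerm.names ⊆ t.names := fun m hm => by_contra fun h => h'.names m hm h
  exact ⟨_, tr_dt ht.pure hw.1, h'.mono (h'.vars.trans ht.vars)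
    (fun m hm => ht.names m (hn hm)) id, hn, h'.vars, fun V => sem_dt_toTerm ht.pure,
    DT.toTerm_srt (dt_all_srt ht.pure hw)⟩

/-- The two plaintexts are abstracted and normalized independently, since each side has its own. The
facts on earlier calls persist because the handle is new; for the erased values one also needs that
the new ciphertext does not occur in earlier terms, which holds by freshness of its randomness. -/
theorem Abs.enc_step (hA : Abs ltU ltS K X Z E p π) {x n : ℕ} {r : Bool → ℕ} {t u : Bool → Term S}
    (hx : x ∉ X ∧ x ∉ Z) (hn : n ∈ K)
    (ht : ∀ i, (t i).Pure ∧ (t i).NoZero ∧ (t i).vars ⊆ Z ∧ ∀ k ∈ K, NoDec k (t i))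
    (hu : ∀ i, u i = (t i).subst (E i).call) (hws : ∀ i, (u i).WS)
    (fresh : ∀ i j, r i ∉ (u j).names ∧ ∀ s ∈ (E j).phi, r i ∉ s.names)
    (hid : ∀ i, ∀ s ∈ u i :: (E i).phi,
      Hidden ((E false).rands X ∪ (E true).rands X) ((E i).encs X) s) :
    ∃ p' π', Abs ltU ltS K (insert x X) Z (fun i =>
      ⟨(E i).phi ++ [Term.enc (u i) (pk (name n)) (name (r i))], Function.update (E i).rnd x (r i),
        Function.update (E i).call x (Term.enc (u i) (pk (name n)) (name (r i)))⟩) p' π' := by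
  have hid' : ∀ i, ∀ s ∈ u i :: (E i).phi, Hidden (rds p) ((E i).encs X) s := fun i s hs =>
    (hid i s hs).mono hA.rds_subset
  have hxp := hA.not_mem_hh hx
  have hspec := fun i => hA.absT_spec i (ht i).1 (ht i).2.1 (fun y hy => .inr ((ht i).2.2.1 hy))
    (ht i).2.2.2 (hu i ▸ hid' i _ (by simp))
  have htr := fun i => exists_tr (β := False) (hspec i).1
    ⟨(hspec i).2.2.2.2.2.2.1 (hu i ▸ hws i), False.elim⟩
  choose t2 h1 h2 h3 h4 h5 _ using htr
  have hk : KeysOK p := hA.keysOK fun s hs => hid' false s (by simp [hs])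
  have hnames : ∀ i, (t2 i).names ⊆ (u i).names := fun i m hm => by
    rw [hu i]
    exact (mem_names_subst (ht i).1).2 (.inl ((hspec i).2.2.2.2.1 (h3 i hm)))
  have hfn : ∀ i, r i ∉ fn p := fun i h => by
    obtain ⟨j, s, hs, hm⟩ := hA.names _ h
    exact (fresh i j).2 s hs hm
  have hval : Valid ltU ltS K (.enc x n r t2 :: p) :=
    ⟨⟨hxp, hn, hk, fun i => ⟨h1 i, h2 i, hfn i, fun j h => (fresh i j).1 (hnames j h),
      fun y hy => (hspec i).2.2.2.2.2.2.2 (fun _ h => (ht i).2.2.1 h) y (h4 i hy)⟩⟩, hA.valid⟩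
  have hXne : ∀ y ∈ X, y ≠ x := fun y hy e => hx.1 (e ▸ hy)
  have hZne : ∀ y ∈ Z, y ≠ x := fun y hy e => hx.2 (e ▸ hy)
  have hne : ∀ y, y ∈ X ∨ y ∈ Z → y ≠ x := fun y hy => hy.elim (hXne y) (hZne y)
  have hcases : ∀ y, y ∈ insert x X ∨ y ∈ Z → y = x ∨ y ∈ X ∨ y ∈ Z := by
    intro y hy; rw [Finset.mem_insert] at hy; tauto
  have hup : ∀ i, (u i).Plain := fun i => by
    rw [hu i]
    exact plain_subst (ht i).1 fun y hy =>
      (hA.good i _ (hA.mem y (.inr ((ht i).2.2.1 hy)) i)).1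
  have hgood : ∀ i, (Term.enc (u i) (pk (name n)) (name (r i))).Plain ∧
      (Term.enc (u i) (pk (name n)) (name (r i))).WS := fun i => by
    refine ⟨plain_app.2 fun j => ?_, ws_app.2 ⟨fun j => ?_, by simp⟩⟩ <;> fin_cases j
    exacts [hup i, plain_pk_name, plain_name, hws i, ws_pk_name, trivial]
  have hcall : ∀ i, call i (.enc x n r t2 :: p) x =
      Term.enc ((t2 i).subst (call i p)) (pk (name n)) (name (r i)) := fun i =>
    Function.update_self _ _ _
  refine ⟨.enc x n r t2 :: p, Function.update π x x, ?_⟩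
  constructor
  · exact hval
  · exact congrArg _ hA.encs
  · exact hA.decs
  · intro y hy
    rcases Finset.mem_insert.1 hy with rfl | hy
    · simp
    · rw [Function.update_of_ne (hXne y hy), hA.πX y hy]
  · intro y hy
    rw [Function.update_of_ne (hZne y hy)]; exact hA.πZ y hy
  · intro y hy i V
    rcases hcases y hy with rfl | hy
    · simp only [Function.update_self]
      rw [hcall]
      refine sem_congr fun j => ?_
      fin_cases j
      · change CCSA.sem V (u i) = CCSA.sem V ((t2 i).subst (call i p))
        rw [hu i, ← (hspec i).2.1 V]
        exact (sem_subst_of_eq (h2 i).pure (hspec i).1.pure (h5 i) (fun _ _ _ => rfl) V).symm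
      · rfl
      · rfl
    · simp only [Function.update_of_ne (hne y hy)]
      rw [hA.sem y hy, hval.call_cons i (hA.π_mem hy)]
  · intro y hy V
    rcases hcases y hy with rfl | hy
    · simp only [Function.update_self]
      rw [hval.zcall_enc (List.mem_cons_self ..), zeroOut_enc (R := Set.univ)]
      · rintro s ⟨y', hy', rfl⟩
        by_cases e : y' = y
        · subst e; exact ⟨_, _, _, trivial, Function.update_self _ _ _⟩
        · have hy' := (Finset.mem_insert.1 hy').resolve_left e
          obtain ⟨n', r', t', h⟩ := mem_encH.1 (hA.encs.symm ▸ hy')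
          obtain ⟨-, u', e'⟩ := hA.enc _ _ _ _ h false
          exact ⟨_, _, _, trivial, (Function.update_of_ne e _ _).trans e'⟩
      · exact ⟨y, by simp, Function.update_self _ _ _⟩
    · simp only [Function.update_of_ne (hne y hy)]
      rw [hval.zcall_cons (hA.π_mem hy), ← hA.zsem y hy]
      congr 1
      have hmem := hA.mem y hy false
      refine zeroOut_congr (hA.good false _ hmem).1.1 fun s hs => ?_
      constructor
      · rintro ⟨y', hy', rfl⟩
        rcases Finset.mem_insert.1 hy' with rfl | hy'
        · simp only [Function.update_self] at hs
          exact ((fresh false false).2 _ hmem (names_st hs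
            (mem_names_enc.2 (.inr (.inr (mem_names_name.2 rfl)))))).elim
        · exact ⟨y', hy', (Function.update_of_ne (hXne y' hy') _ _).symm⟩
      · rintro ⟨y', hy', rfl⟩
        exact ⟨y', by simp [hy'], Function.update_of_ne (hXne y' hy') _ _⟩
  · intro y n' r' t' h i
    rcases List.mem_cons.1 h with e | h
    · cases e; exact ⟨Function.update_self _ _ _, _, Function.update_self _ _ _⟩
    · have hy : y ∈ X := hA.encs ▸ mem_encH.2 ⟨_, _, _, h⟩
      simp only [Function.update_of_ne (hXne y hy)]
      exact hA.enc _ _ _ _ h i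
  · intro z hz i
    simp only [Function.update_of_ne (hZne z hz)]
    exact hA.dec z hz i
  · intro z n' c l h
    rcases List.mem_cons.1 h with e | h
    · cases e
    · simp only [Function.update_of_ne (hZne z (hA.decs z (mem_decH.2 ⟨_, _, _, h⟩)))]
      exact hA.dec_key _ _ _ _ h
  · intro y hy i
    rcases hcases y hy with rfl | hy
    · simp
    · simp only [Function.update_of_ne (hne y hy), List.mem_append]
      exact .inl (hA.mem y hy i)
  · intro i s hs
    rcases List.mem_append.1 hs with hs | hs
    · exact hA.good i s hs
    · rw [List.mem_singleton.1 hs]; exact hgood i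
  · rintro m ⟨s, hs, hm⟩
    rcases List.mem_cons.1 hs with rfl | hs
    · have key : ∃ i, m ∈ (Term.enc (u i) (pk (name n)) (name (r i))).names := by
        rcases hm with rfl | ⟨i, rfl | hm⟩
        · exact ⟨false, mem_names_enc.2 (.inr (.inl (mem_names_pk.2 (mem_names_name.2 rfl))))⟩
        · exact ⟨i, mem_names_enc.2 (.inr (.inr (mem_names_name.2 rfl)))⟩
        · exact ⟨i, mem_names_enc.2 (.inl (hnames i hm))⟩
      obtain ⟨i, hm⟩ := key
      exact ⟨i, _, by simp, hm⟩
    · obtain ⟨i, s, hs, hm⟩ := hA.names m ⟨s, hs, hm⟩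
      exact ⟨i, s, by simp [hs], hm⟩
  · simp [hA.length]
  · intro w hw
    simp only [List.zip_append hA.length] at hw
    rcases List.mem_append.1 hw with hw | hw
    · rcases hA.zip w hw with ⟨s, rfl, hs, hm⟩ | ⟨y, hy, rfl⟩
      · refine .inl ⟨s, rfl, hs, ?_⟩
        rintro m hm' ⟨x', n', r', t', j, h, rfl⟩
        rcases List.mem_cons.1 h with e | h
        · cases e; exact (fresh j false).2 s (List.of_mem_zip hw).1 hm'
        · exact hm _ hm' ⟨_, _, _, _, _, h, rfl⟩
      · refine .inr ⟨y, hy.imp (fun h => by simp [h]) id, ?_⟩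
        simp only [Function.update_of_ne (hne y hy)]
    · refine .inr ⟨x, by simp, ?_⟩
      simpa using hw

/-- Both sides decrypt instances of a single if-free term, whose abstraction does not depend on the
side and whose value does not depend on the valuation: one irreducible symbolic ciphertext `c`
serves both sides. If `c` has been decrypted before with the same key, the new handle is sent by `π`
to the old one; otherwise a call is appended. -/
theorem Abs.dec_step [IsStrictTotalOrder (Term S) ltU] [IsStrictTotalOrder (Term S) ltS]
    (hA : Abs ltU ltS K X Z E p π) {z n : ℕ} {t : Term S} {u : Bool → Term S}
    {l : Bool → List (Term S)} (hz : z ∉ X ∧ z ∉ Z) (hn : n ∈ K)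
    (ht : t.Pure ∧ t.IfFree ∧ t.NoZero ∧ t.vars ⊆ X ∪ Z ∧ ∀ k ∈ K, NoDec k t)
    (hu : ∀ i, u i = t.subst (E i).call) (hws : ∀ i, (u i).WS)
    (hl : ∀ i, IsSort ltS ((E i).call '' (E false).visible ltU X n (u false)) (l i))
    (hid : ∀ i, ∀ s ∈ u i :: (E i).phi,
      Hidden ((E false).rands X ∪ (E true).rands X) ((E i).encs X) s) :
    ∃ p' π', Abs ltU ltS K X (insert z Z) (fun i =>
      ⟨(E i).phi ++ [elses ((l i).map (Term.eq (u i))) (Term.dec (u i) (sk (name n)))], (E i).rnd,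
        Function.update (E i).call z
          (elses ((l i).map (Term.eq (u i))) (Term.dec (u i) (sk (name n))))⟩) p' π' := by
  obtain ⟨V0⟩ := (inferInstance : Nonempty (Val S))
  have hid' : ∀ i, ∀ s ∈ u i :: (E i).phi, Hidden (rds p) ((E i).encs X) s := fun i s hs =>
    (hid i s hs).mono hA.rds_subset
  have hvar : ∀ y ∈ t.vars, y ∈ X ∨ y ∈ Z := fun y hy => by
    simpa using ht.2.2.2.1 hy
  have hspec := fun i => hA.absT_spec i ht.1 ht.2.2.1 hvar
    ht.2.2.2.2 (hu i ▸ hid' i _ (by simp))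
  have hk : KeysOK p := hA.keysOK fun s hs => hid' false s (by simp [hs])
  have h1 := (hspec false).1
  have hif := (hspec false).2.2.2.1 ht.2.1
  have hc : NLeaf (CCSA.sem V0 (absT p π t)) := nleaf_sem _
  have hs := h1.sem V0
  have hsem : ∀ V, CCSA.sem V (CCSA.sem V0 (absT p π t)) = CCSA.sem V (absT p π t) := fun V => by
    rw [sem_of_nleaf hs.pure hc]; exact sem_ifFree _ _ h1.pure hif
  have hcn : (CCSA.sem V0 (absT p π t)).names ⊆ (u false).names := fun m hm => by
    rw [hu]
    exact (mem_names_subst ht.1).2 (.inl ((hspec false).2.2.2.2.1 (names_sem V0 h1.pure hm)))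
  generalize CCSA.sem V0 (absT p π t) = c at hc hs hsem hcn
  have hcall : ∀ i V, CCSA.sem V (c.subst (call i p)) = CCSA.sem V (u i) := fun i V => by
    rw [hu, ← (hspec i).2.1 V]
    exact sem_subst_of_eq hs.pure h1.pure hsem (fun _ _ _ => rfl) V
  have hzcall : ∀ V, CCSA.sem V (c.subst (zcall p)) =
      CCSA.sem V (zeroOut ((E false).encs X) (u false)) := fun V => by
    rw [hu, ← (hspec false).2.2.1 rfl V]
    exact sem_subst_of_eq hs.pure h1.pure hsem (fun _ _ _ => rfl) V
  have hup : ∀ i, (u i).Plain := fun i => by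
    rw [hu i]
    exact plain_subst ht.1 fun y hy => (hA.good i _ (hA.mem y (hvar y hy) i)).1
  have hzp := hA.valid.zcall_plain_ws
  have hcp : (c.subst (zcall p)).Plain := plain_subst hs.pure fun x hx => (hzp x (hs.vars hx)).1
  have hcw : (c.subst (zcall p)).WS := ws_subst hs.pure
    (hs.pure.ws_of_ifFree (hc.ifFree hs.pure)) fun x hx => (hzp x (hs.vars hx)).2
  have hzg := zeroOut_good (hA.encSet false) (hup false) (hws false)
  -- Visibility is read in normal forms of the erased ciphertext. The erased original and the erased
  -- instance of `c` have the same values, hence are `=_R` by completeness and share their normal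
  -- forms.
  have hvis : (E false).visible ltU X n (u false) = vis ltU p n c := by
    have e1 : REq (zeroOut ((E false).encs X) (u false)) (c.subst (zcall p)) :=
      .of_sem hzg.1 hcp hzg.2.1 hcw fun V => (hzcall V).symm
    ext x
    constructor
    · rintro ⟨hx, ⟨m, r', e⟩, s, g1, g2, g3⟩
      obtain ⟨n', r, t', h⟩ := mem_encH.1 (hA.encs.symm ▸ hx)
      obtain ⟨er, u', e'⟩ := hA.enc _ _ _ _ h false
      rw [e'] at e
      simp only [Term.enc, app.injEq, heq_eq_eq, true_and] at e
      have := congrFun e 1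
      simp only [Matrix.cons_val_one, Matrix.cons_val_zero, pk, app.injEq, heq_eq_eq,
        true_and] at this
      have : n' = n := by simpa using congrFun this 0
      subst this
      exact ⟨r, t', h, s, .trans _ _ _ (.symm _ _ e1) g1, g2, er ▸ g3⟩
    · rintro ⟨r, t', h, s, g1, g2, g3⟩
      obtain ⟨er, u', e'⟩ := hA.enc _ _ _ _ h false
      exact ⟨hA.encs ▸ mem_encH.2 ⟨_, _, _, h⟩, ⟨_, _, e'⟩, s, .trans _ _ _ e1 g1, g2, er.symm ▸ g3⟩
  have hXne : ∀ y ∈ X, y ≠ z := fun y hy e => hz.1 (e ▸ hy)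
  have hZne : ∀ y ∈ Z, y ≠ z := fun y hy e => hz.2 (e ▸ hy)
  have hne : ∀ y, y ∈ X ∨ y ∈ Z → y ≠ z := fun y hy => hy.elim (hXne y) (hZne y)
  have hcases : ∀ y, y ∈ X ∨ y ∈ insert z Z → y = z ∨ y ∈ X ∨ y ∈ Z := by
    intro y hy; rw [Finset.mem_insert] at hy; tauto
  obtain ⟨p', z', l', hp', hz', hor⟩ := hA.valid.exists_dec hk (hA.not_mem_hh hz) hn hc hs
  have henc : encH p' = encH p := by rcases hor with rfl | ⟨-, rfl⟩ <;> rfl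
  have hencm : ∀ {x n r t}, HStep.enc x n r t ∈ p' ↔ HStep.enc x n r t ∈ p := by
    rcases hor with rfl | ⟨-, rfl⟩ <;> simp
  have hrds : rds p' = rds p := by
    ext m; simp [rds, hencm]
  have hpc : ∀ i, ∀ y ∈ hh p, call i p' y = call i p y := by
    rcases hor with rfl | ⟨-, rfl⟩
    · exact fun _ _ _ => rfl
    · exact fun i y hy => hp'.call_cons i hy
  have hpz : ∀ y ∈ hh p, zcall p' y = zcall p y := by
    rcases hor with rfl | ⟨-, rfl⟩
    · exact fun _ _ => rfl
    · exact fun y hy => hp'.zcall_cons hy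
  have hpd : ∀ s ∈ p', s ∈ p ∨ s = .dec z n c l' := by
    rcases hor with rfl | ⟨-, rfl⟩
    · exact fun s h => .inl h
    · exact fun s h => (List.mem_cons.1 h).symm
  have hpsub : ∀ s ∈ p, s ∈ p' := by
    rcases hor with rfl | ⟨-, rfl⟩
    · exact fun s h => h
    · exact fun s h => by simp [h]
  have hpvis : vis ltU p' n c = vis ltU p n c := by
    rcases hor with rfl | ⟨-, rfl⟩
    · rfl
    · exact vis_cons hp' hs (hs.pure.ws_of_ifFree (hc.ifFree hs.pure)) (by simp)
  have hπz : ∀ z ∈ Z, π z ∈ decH p' := fun z hz => by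
    obtain ⟨n, c, l, h⟩ := mem_decH.1 (hA.πZ z hz)
    exact mem_decH.2 ⟨n, c, l, hpsub _ h⟩
  have hgd : ∀ i, ∀ w, w ∈ l i ↔ w ∈ (E i).call '' vis ltU p' n c := fun i w => by
    rw [hpvis, ← hvis]; exact (hl i).2 w
  have hvX : ∀ y ∈ vis ltU p' n c, y ∈ X := fun y hy => by
    rw [hpvis] at hy
    obtain ⟨r, t', h, -⟩ := hy
    exact hA.encs ▸ mem_encH.2 ⟨_, _, _, h⟩
  have hvp : ∀ y ∈ X, y ∈ hh p := fun y hy => mem_hh.2 (.inl (hA.encs.symm ▸ hy))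
  have hcp' : ∀ i, c.subst (call i p') = c.subst (call i p) := fun i =>
    subst_congr hs.pure fun y hy => hpc i y (hs.vars hy)
  have hcz' : c.subst (zcall p') = c.subst (zcall p) :=
    subst_congr hs.pure fun y hy => hpz y (hs.vars hy)
  refine ⟨p', Function.update π z z', ?_⟩
  constructor
  · exact hp'
  · exact henc.trans hA.encs
  · intro y hy
    obtain ⟨n', c', l'', h⟩ := mem_decH.1 hy
    rcases hpd _ h with h | h
    · exact Finset.mem_insert_of_mem (hA.decs y (mem_decH.2 ⟨_, _, _, h⟩))
    · cases h; simp
  · intro y hy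
    rw [Function.update_of_ne (hXne y hy), hA.πX y hy]
  · intro y hy
    rcases Finset.mem_insert.1 hy with rfl | hy
    · rw [Function.update_self]; exact mem_decH.2 ⟨_, _, _, hz'⟩
    · rw [Function.update_of_ne (hZne y hy)]; exact hπz y hy
  · intro y hy i V
    rcases hcases y hy with rfl | hy
    · simp only [Function.update_self]
      rw [hp'.call_dec hz' i]
      refine sem_guarded (f := (E i).call) (A := vis ltU p' n c) ?_ (fun y hy => ?_) (hgd i)
        (hp'.mem_guards hz' i)
      · rw [hcp', hcall]
      · rw [hA.sem y (.inl (hvX y hy)), hA.πX y (hvX y hy), hpc i y (hvp y (hvX y hy))]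
    · simp only [Function.update_of_ne (hne y hy)]
      rw [hA.sem y hy, hpc i _ (hA.π_mem hy)]
  · have hencs : Exec.encs (S := S) ⟨(E false).phi ++
        [elses ((l false).map (Term.eq (u false))) (Term.dec (u false) (sk (name n)))], (E false).rnd,
        Function.update (E false).call z (elses ((l false).map (Term.eq (u false)))
          (Term.dec (u false) (sk (name n))))⟩ X = (E false).encs X := by
      ext s
      constructor
      · rintro ⟨y, hy, rfl⟩; exact ⟨y, hy, (Function.update_of_ne (hXne y hy) _ _).symm⟩
      · rintro ⟨y, hy, rfl⟩; exact ⟨y, hy, Function.update_of_ne (hXne y hy) _ _⟩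
    intro y hy V
    rw [hencs]
    rcases hcases y hy with rfl | hy
    · simp only [Function.update_self]
      have hC := hA.encSet false
      have e : ((l false).map (Term.eq (u false))).map (zeroOut ((E false).encs X)) =
          ((l false).map (zeroOut ((E false).encs X))).map
            (Term.eq (zeroOut ((E false).encs X) (u false))) := by
        rw [List.map_map, List.map_map]
        exact List.map_congr_left fun w _ => zeroOut_eq hC _ _
      rw [hp'.zcall_dec hz', zeroOut_elses hC, zeroOut_dec hC, e]
      refine sem_guarded (f := fun y => zeroOut ((E false).encs X) ((E false).call y))
        (A := vis ltU p' n c) ?_ (fun y hy => ?_) (fun w => ?_) (hp'.mem_guards hz' false)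
      · rw [hcz', hzcall]
      · rw [hA.zsem y (.inl (hvX y hy)), hA.πX y (hvX y hy), hpz y (hvp y (hvX y hy))]
      · rw [List.mem_map]
        constructor
        · rintro ⟨w, hw, rfl⟩
          obtain ⟨y, hy, rfl⟩ := (hgd false w).1 hw
          exact ⟨y, hy, rfl⟩
        · rintro ⟨y, hy, rfl⟩
          exact ⟨_, (hgd false _).2 ⟨y, hy, rfl⟩, rfl⟩
    · simp only [Function.update_of_ne (hne y hy)]
      rw [hA.zsem y hy, hpz _ (hA.π_mem hy)]
  · intro y n' r' t' h i
    rw [hencm] at h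
    have hy : y ∈ X := hA.encs ▸ mem_encH.2 ⟨_, _, _, h⟩
    simp only [Function.update_of_ne (hXne y hy)]
    exact hA.enc _ _ _ _ h i
  · intro y hy i
    rcases Finset.mem_insert.1 hy with rfl | hy
    · exact ⟨_, _, _, Function.update_self _ _ _⟩
    · simp only [Function.update_of_ne (hZne y hy)]
      exact hA.dec y hy i
  · intro y n' c' l'' h
    rcases hpd _ h with h | h
    · simp only [Function.update_of_ne (hZne y (hA.decs y (mem_decH.2 ⟨_, _, _, h⟩)))]
      exact hA.dec_key _ _ _ _ h
    · cases h; exact ⟨_, _, Function.update_self _ _ _⟩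
  · intro y hy i
    rcases hcases y hy with rfl | hy
    · simp
    · simp only [Function.update_of_ne (hne y hy), List.mem_append]
      exact .inl (hA.mem y hy i)
  · intro i s hs'
    rcases List.mem_append.1 hs' with hs' | hs'
    · exact hA.good i s hs'
    · rw [List.mem_singleton.1 hs']
      have hd : (Term.dec (u i) (sk (name n))).Plain ∧ (Term.dec (u i) (sk (name n))).WS := by
        refine ⟨plain_app.2 fun i => ?_, ws_app.2 ⟨fun i => ?_, by simp⟩⟩ <;> fin_cases i
        exacts [hup i, plain_sk_name, hws i, ws_sk_name]
      refine elses_induction (Q := fun t => t.Plain ∧ t.WS) hd fun g hg' w hw => ?_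
      obtain ⟨w', hw', rfl⟩ := List.mem_map.1 hg'
      obtain ⟨y, hy, rfl⟩ := (hgd i w').1 hw'
      have hy' := hA.good i _ (hA.mem y (.inl (hvX y hy)) i)
      refine ⟨plain_app.2 fun j => ?_, ws_ite.2 ⟨ws_app.2 ⟨fun j => ?_, by simp⟩, .inl rfl,
        ws_app.2 ⟨fun j => ?_, by simp⟩, hw.2⟩⟩ <;> fin_cases j
      · exact plain_app.2 fun j => by fin_cases j; exacts [hup i, hy'.1]
      · exact plain_app.2 fun j => by fin_cases j; exact hd.1
      · exact hw.1
      · exact hws i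
      · exact hy'.2
      · exact hd.2
  · rintro m ⟨s, hs', hm⟩
    rcases hpd _ hs' with hs' | rfl
    · obtain ⟨i, s, hs, hm⟩ := hA.names m ⟨s, hs', hm⟩
      exact ⟨i, s, by simp [hs], hm⟩
    · refine ⟨false, _, List.mem_append_right _ (List.mem_singleton_self _),
        names_st dec_mem_st_elses (mem_names_dec.2 ?_)⟩
      rcases hm with rfl | hm
      · exact .inr (mem_names_sk.2 (mem_names_name.2 rfl))
      · exact .inl (hcn hm)
  · simp [hA.length]
  · intro w hw
    simp only [List.zip_append hA.length] at hw
    rcases List.mem_append.1 hw with hw | hw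
    · rcases hA.zip w hw with ⟨s, rfl, hs, hm⟩ | ⟨y, hy, rfl⟩
      · exact .inl ⟨s, rfl, hs, by rwa [hrds]⟩
      · refine .inr ⟨y, hy.imp id fun h => by simp [h], ?_⟩
        simp only [Function.update_of_ne (hne y hy)]
    · refine .inr ⟨z, by simp, ?_⟩
      simpa using hw

/-- The base clause gives the empty sequence; the two other clauses are `Abs.enc_step` and
`Abs.dec_step`, with the two executions indexed by the side. -/
theorem exists_abs [IsStrictTotalOrder (Term S) ltU] [IsStrictTotalOrder (Term S) ltS]
    {E E' : Exec S} (rel : CCARel ltU ltS K X Z E E') :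
    ∃ p π, Abs ltU ltS K X Z (fun i => cond i E' E) p π := by
  induction rel with
  | base φ h =>
    refine ⟨[], id, ?_⟩
    constructor
    · trivial
    · rfl
    · simp [decH]
    · simp
    · simp
    · simp
    · simp
    · simp
    · simp
    · simp
    · simp
    · intro i s hs
      have : s ∈ φ := by cases i <;> exact hs
      exact ⟨(h s this).1, (h s this).2.1⟩
    · rintro m ⟨s, hs, -⟩; simp at hs
    · rfl
    · intro w hw
      simp only [cond_false, cond_true] at hw
      rw [List.zip, List.zipWith_self, List.mem_map] at hw
      obtain ⟨s, hs, rfl⟩ := hw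
      exact .inl ⟨s, rfl, (h s hs).2.2, by simp [rds]⟩
  | enc X Z E E' x n r r' t t' u v rel hx hn ht ht' hu hv hws fresh hid hid' ih =>
    obtain ⟨p, π, hA⟩ := ih
    obtain ⟨p', π', h⟩ := hA.enc_step (r := fun i => cond i r' r) (t := fun i => cond i t' t)
      (u := fun i => cond i v u) hx hn (by rintro (_ | _); exacts [ht, ht'])
      (by rintro (_ | _); exacts [hu, hv]) (by rintro (_ | _); exacts [hws.1, hws.2])
      (fun i j => by
        have h1 : ∀ s ∈ u :: v :: (E.phi ++ E'.phi), cond i r' r ∉ s.names := fun s hs => by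
          cases i; exacts [(fresh s hs).1, (fresh s hs).2]
        cases j
        · exact ⟨h1 _ (by simp), fun s hs => h1 s (by simp [show s ∈ E.phi from hs])⟩
        · exact ⟨h1 _ (by simp), fun s hs => h1 s (by simp [show s ∈ E'.phi from hs])⟩)
      (by rintro (_ | _); exacts [hid, hid'])
    refine ⟨p', π', ?_⟩
    convert h using 1
    funext i; cases i <;> rfl
  | dec X Z E E' z n t u v l l' rel hz hn ht hu hv hws hl hl' hid hid' ih =>
    obtain ⟨p, π, hA⟩ := ih
    obtain ⟨p', π', h⟩ := hA.dec_step (u := fun i => cond i v u) (l := fun i => cond i l' l)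
      hz hn ht (by rintro (_ | _); exacts [hu, hv]) (by rintro (_ | _); exacts [hws.1, hws.2])
      (by rintro (_ | _); exacts [hl, hl']) (by rintro (_ | _); exacts [hid, hid'])
    refine ⟨p', π', ?_⟩
    convert h using 1
    funext i; cases i <;> rfl

end

end CCSA

namespace CCSA
open Term
open scoped Computability
variable {S : Signature} {V : Val S} {β β' : Prop} {ltU ltS : Term S → Term S → Prop}

/-! ### Semantic derivations -/

/-- The shape of a derivation: tests of the case distinctions, and `CCA2` instances. -/
inductive TT (S : Signature)
  | leaf (K : Finset ℕ) (p : List (HStep S)) (μ : Equiv.Perm ℕ)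
  | node (b b' : Term S) (T1 T2 : TT S)

/-- The valuations of a set that make a test true. -/
def pos (P : Set (Val S)) (b : Term S) : Set (Val S) := {V | V ∈ P ∧ V.ρ (sem V b)}

def neg (P : Set (Val S)) (b : Term S) : Set (Val S) := {V | V ∈ P ∧ ¬ V.ρ (sem V b)}

/-- For the valuations in `P` and `P'`, the terms `s` and `s'` are, in each case, instances of the
same symbolic term. -/
def Der : TT S → Set (Val S) → Set (Val S) → Term S → Term S → Prop
  | .leaf K p μ, P, P', s, s' => ∃ T : Term S, T.WS ∧ Sy {k | k ∈ K} (rds p) (hh p) True T ∧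
      (∀ V ∈ P, sem V s = sem V (T.subst (call false p))) ∧
      ∀ V ∈ P', sem V s' = sem V ((T.subst (call true p)).rename μ)
  | .node b b' T1 T2, P, P', s, s' =>
      Der T1 (pos P b) (pos P' b') s s' ∧ Der T2 (neg P b) (neg P' b') s s'

/-- Tests of case distinctions. -/
def CsTest (b : Term S) : Prop := b.Plain ∧ b.WS ∧ b.IfFree ∧ b.IsBool

/-- A test has to be derivable itself in each of the two cases, as it is in the premises of `CS`.
This is what later allows the two arguments of its box to be normalized. -/
def TT.WF (ltU ltS : Term S → Term S → Prop) : TT S → Prop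
  | .leaf K p _ => Valid ltU ltS K p
  | .node b b' T1 T2 => (CsTest b ∧ CsTest b') ∧
      (Der T1 Set.univ Set.univ b b' ∧ Der T2 Set.univ Set.univ b b') ∧
      T1.WF ltU ltS ∧ T2.WF ltU ltS

theorem Der.congr {T : TT S} {P P' Q Q' : Set (Val S)} {s s' t t' : Term S} (h : Der T Q Q' t t')
    (hP : P ⊆ Q) (hP' : P' ⊆ Q') (hs : ∀ V ∈ P, sem V s = sem V t)
    (hs' : ∀ V ∈ P', sem V s' = sem V t') : Der T P P' s s' := by
  induction T generalizing P P' Q Q' with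
  | leaf K p μ =>
    obtain ⟨T, h1, h2, h3, h4⟩ := h
    exact ⟨T, h1, h2, fun V hV => (hs V hV).trans (h3 V (hP hV)),
      fun V hV => (hs' V hV).trans (h4 V (hP' hV))⟩
  | node b b' T1 T2 ih1 ih2 =>
    exact ⟨ih1 h.1 (fun V hV => ⟨hP hV.1, hV.2⟩) (fun V hV => ⟨hP' hV.1, hV.2⟩)
      (fun V hV => hs V hV.1) (fun V hV => hs' V hV.1),
      ih2 h.2 (fun V hV => ⟨hP hV.1, hV.2⟩) (fun V hV => ⟨hP' hV.1, hV.2⟩)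
      (fun V hV => hs V hV.1) (fun V hV => hs' V hV.1)⟩

theorem sem_isBool {t : Term S} (hp : t.Pure) (hw : t.WS) (hb : t.IsBool) (V : Val S) :
    (sem V t).IsBool := by
  rw [← dt_sem hp]
  exact (DT.sem_all (dt_all_srt hp (β := True) ⟨hw, fun _ => hb⟩)).2 trivial

/-- A symbolic test may be replaced by a boolean one. -/
theorem exists_bool [IsStrictTotalOrder (Term S) ltU] {K : Finset ℕ} {p : List (HStep S)}
    (hp : Valid ltU ltS K p) {T : Term S} {zok : Prop} (hw : T.WS)
    (hT : Sy {k | k ∈ K} (rds p) (hh p) zok T) :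
    ∃ T' : Term S, T'.WS ∧ T'.IsBool ∧ Sy {k | k ∈ K} (rds p) (hh p) zok T' ∧
      ∀ i V, (sem V (T.subst (call i p))).IsBool →
        sem V (T'.subst (call i p)) = sem V (T.subst (call i p)) := by
  have hA : ∀ z c, IsDec p z c → Sy {k | k ∈ K} (rds p) (hh p) zok c ∧ c.IfFree := by
    rintro z c ⟨n, l, h⟩
    obtain ⟨-, h1, h2⟩ := hp.dec_spec h
    exact ⟨h2.mono h2.vars h2.names False.elim, h1.ifFree h2.pure⟩
  obtain ⟨h1, h2, h3⟩ := boolify_good hA hT hw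
  refine ⟨_, h2, h3, h1, fun i V hb => ?_⟩
  exact boolify_sem (hp.ov i) (isDec_iff i) (hp.head_guard i) (by rwa [oh_sd]) hb

theorem sem_rename_eq {s t : Term S} (hs : s.Pure) (ht : t.Pure) (μ : Equiv.Perm ℕ)
    (h : sem (V.ren μ) s = sem (V.ren μ) t) : sem V (s.rename μ) = sem V (t.rename μ) := by
  rw [sem_rename V μ hs, sem_rename V μ ht, h]

theorem Valid.call_pure {K : Finset ℕ} {p : List (HStep S)} (hp : Valid ltU ltS K p) {T : Term S}
    {zok : Prop} (hT : Sy {k | k ∈ K} (rds p) (hh p) zok T) (i : Bool) :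
    (T.subst (call i p)).Pure :=
  pure_subst hT.pure fun x hx => ((hp.ov i).plain_ws x (by rw [oh_sd]; exact hT.vars hx)).1.1

/-- Leaf by leaf, the symbol is applied to the symbolic terms of the arguments. For a conditional,
the symbolic term of the test has boolean values on both sides without being boolean itself, and
`exists_bool` repairs its sort. -/
theorem Der.app [IsStrictTotalOrder (Term S) ltU] {T : TT S} (hT : T.WF ltU ltS) {P P' : Set (Val S)}
    {f : Sym S} (hf : f ≠ .zero) {a a' : Fin f.arity → Term S}
    (ha : (Term.app f a).Plain ∧ (Term.app f a).WS) (ha' : (Term.app f a').Plain ∧ (Term.app f a').WS)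
    (h : ∀ i, Der T P P' (a i) (a' i)) : Der T P P' (.app f a) (.app f a') := by
  induction T generalizing P P' with
  | leaf K p μ =>
    choose Ts h1 h2 h3 h4 using h
    have hp : Valid ltU ltS K p := hT
    by_cases hite : f = .ite
    · subst hite
      obtain ⟨T0, g1, g2, g3, g4⟩ := exists_bool hp (h1 0) (h2 0)
      refine ⟨Term.ite T0 (Ts 1) (Ts 2), ws_ite.2 ⟨g1, g2, h1 1, h1 2⟩,
        .inr ⟨fun h => (hf h).elim, fun i => by fin_cases i; exacts [g3, h2 1, h2 2]⟩,
        fun V hV => sem_congr fun i => ?_, fun V hV => sem_congr fun i => ?_⟩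
      · fin_cases i
        · change sem V (a 0) = sem V (T0.subst _)
          rw [g4 false V, h3 0 V hV]
          rw [← h3 0 V hV]
          exact sem_isBool (plain_app.1 ha.1 0).1 (ha.2.1 0) (ha.2.2 rfl 0 rfl) V
        · exact h3 1 V hV
        · exact h3 2 V hV
      · fin_cases i
        · change sem V (a' 0) = sem V ((T0.subst _).rename μ)
          rw [h4 0 V hV]
          refine (sem_rename_eq (hp.call_pure g3 _) (hp.call_pure (h2 0) _) μ (g4 true _ ?_)).symm
          have := sem_isBool (plain_app.1 ha'.1 0).1 (ha'.2.1 0) (ha'.2.2 rfl 0 rfl) V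
          rw [h4 0 V hV, sem_rename V μ (hp.call_pure (h2 0) _)] at this
          exact (isBool_rename μ).1 this
        · exact h4 1 V hV
        · exact h4 2 V hV
    · exact ⟨Term.app f Ts, ⟨h1, fun h => (hite h).elim⟩, .inr ⟨fun h => (hf h).elim, h2⟩,
        fun V hV => sem_congr fun i => h3 i V hV, fun V hV => sem_congr fun i => h4 i V hV⟩
  | node b b' T1 T2 ih1 ih2 =>
    exact ⟨ih1 hT.2.2.1 fun i => (h i).1, ih2 hT.2.2.2 fun i => (h i).2⟩

/-- Rules of the initial fragment. -/
def Src (r : RuleName) : Prop := r = .cs ∨ r = .fa ∨ r = .R ∨ r = .dup ∨ r = .cca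

theorem src_of_mem {w : List RuleName} (hw : w ∈ sourceStrategy) : ∀ r ∈ w, Src r := by
  obtain ⟨L, rfl, hL⟩ := Language.mem_kstar.1 hw
  intro r hr
  obtain ⟨y, hy, hr⟩ := List.mem_flatten.1 hr
  have := hL y hy
  simp only [Language.mem_add, letter] at this
  rcases this with (((h | h) | h) | h) | h <;>
  · rw [Set.mem_singleton_iff.1 h] at hr
    simp at hr; simp [Src, hr]

theorem Prf.words_nonempty : {Γ : Formula S} → (P : Prf ltU ltS Γ) → ∃ w, w ∈ P.words
  | _, .unary r _ P => by
    obtain ⟨w, hw⟩ := P.words_nonempty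
    exact ⟨r :: w, w, hw, rfl⟩
  | _, .cs _ _ _ _ _ _ _ P Q => by
    obtain ⟨w, hw⟩ := P.words_nonempty
    exact ⟨_ :: w, w, .inl hw, rfl⟩
  | _, .csbox _ _ _ _ _ _ _ _ _ _ _ _ P Q => by
    obtain ⟨w, hw⟩ := P.words_nonempty
    exact ⟨_ :: w, w, .inl hw, rfl⟩
  | _, .cca _ _ => ⟨_, rfl⟩

/-- Every formula with a proof in the initial fragment has a semantic derivation. -/
theorem Prf.exists_der [IsStrictTotalOrder (Term S) ltU] [IsStrictTotalOrder (Term S) ltS]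
    {Γ : Formula S} (D : Prf ltU ltS Γ) (hD : ∀ w ∈ D.words, ∀ r ∈ w, Src r) :
    ∃ T : TT S, T.WF ltU ltS ∧ ∀ q ∈ Γ, q.1.Plain ∧ q.1.WS → q.2.Plain ∧ q.2.WS →
      Der T Set.univ Set.univ q.1 q.2 := by
  induction D with
  | @unary Γ Δ r h P ih =>
    obtain ⟨T, hT, hΔ⟩ := ih fun w hw r' hr => hD _ ⟨w, hw, rfl⟩ r' (by simp [hr])
    obtain ⟨w, hw⟩ := P.words_nonempty
    have hr := hD _ ⟨w, hw, rfl⟩ r (by simp)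
    refine ⟨T, hT, fun q hq h1 h2 => ?_⟩
    cases h with
    | fa f a a' Γ hf =>
      rcases Multiset.mem_cons.1 hq with rfl | hq
      · refine Der.app hT hf h1 h2 fun i => hΔ (a i, a' i) (Multiset.mem_add.2 (.inl ?_))
          ⟨plain_app.1 h1.1 i, h1.2.1 i⟩ ⟨plain_app.1 h2.1 i, h2.2.1 i⟩
        exact Multiset.mem_map.2 ⟨i, Finset.mem_univ i, rfl⟩
      · exact hΔ q (Multiset.mem_add.2 (.inr hq)) h1 h2
    | rLeft s t v Γ hst h =>
      rcases Multiset.mem_cons.1 hq with rfl | hq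
      · exact (hΔ _ (Multiset.mem_cons_self ..) ⟨hst.2, (h.ok_iff.1 ⟨hst.1.boxed, h1.2, False.elim⟩).2.1⟩
          h2).congr le_rfl le_rfl (fun V _ => h.sem_eq V) fun _ _ => rfl
      · exact hΔ q (Multiset.mem_cons_of_mem hq) h1 h2
    | rRight s t v Γ hst h =>
      rcases Multiset.mem_cons.1 hq with rfl | hq
      · exact (hΔ _ (Multiset.mem_cons_self ..) h1
          ⟨hst.2, (h.ok_iff.1 ⟨hst.1.boxed, h2.2, False.elim⟩).2.1⟩).congr
          le_rfl le_rfl (fun _ _ => rfl) fun V _ => h.sem_eq V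
      · exact hΔ q (Multiset.mem_cons_of_mem hq) h1 h2
    | dup p Γ =>
      refine hΔ q ?_ h1 h2
      simpa using hq
    | _ => rcases hr with h | h | h | h | h <;> cases h
  | @cs Γ W b b' L hb hb' h P Q ihP ihQ =>
    obtain ⟨TP, hTP, hP⟩ := ihP fun w hw r' hr => hD _ ⟨w, .inl hw, rfl⟩ r' (by simp [hr])
    obtain ⟨TQ, hTQ, hQ⟩ := ihQ fun w hw r' hr => hD _ ⟨w, .inr hw, rfl⟩ r' (by simp [hr])
    subst h
    -- Sorts are not imposed on the intermediate formulas. If no pair of the family is well sorted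
    -- on both sides, the test may be ill sorted, but there is nothing to derive for the family, and
    -- the derivation of the first premise covers `W`.
    by_cases hgood : ∃ q ∈ iteFamily b b' L, (q.1.Plain ∧ q.1.WS) ∧ q.2.Plain ∧ q.2.WS
    · have hgb : CsTest b ∧ CsTest b' := by
        obtain ⟨q, hq, h1, h2⟩ := hgood
        obtain ⟨q', -, rfl⟩ := Multiset.mem_map.1 hq
        have g1 := ws_ite.1 h1.2
        have g2 := ws_ite.1 h2.2
        exact ⟨⟨hb.1, g1.1, hb.2, g1.2.1⟩, hb'.1, g2.1, hb'.2, g2.2.1⟩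
      refine ⟨.node b b' TP TQ, ⟨hgb, ⟨hP (b, b') (by simp) ⟨hgb.1.1, hgb.1.2.1⟩
        ⟨hgb.2.1, hgb.2.2.1⟩, hQ (b, b') (by simp) ⟨hgb.1.1, hgb.1.2.1⟩ ⟨hgb.2.1, hgb.2.2.1⟩⟩,
        hTP, hTQ⟩, fun q hq h1 h2 => ?_⟩
      rcases Multiset.mem_add.1 hq with hq | hq
      · exact ⟨(hP q (by simp [hq]) h1 h2).congr (Set.subset_univ _) (Set.subset_univ _)
          (fun _ _ => rfl) fun _ _ => rfl, (hQ q (by simp [hq]) h1 h2).congr (Set.subset_univ _)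
          (Set.subset_univ _) (fun _ _ => rfl) fun _ _ => rfl⟩
      · obtain ⟨q, hqL, rfl⟩ := Multiset.mem_map.1 hq
        have g1 := ws_ite.1 h1.2
        have g2 := ws_ite.1 h2.2
        have k1 := fun i => plain_app.1 h1.1 i
        have k2 := fun i => plain_app.1 h2.1 i
        refine ⟨(hP q.1 
          (Multiset.mem_add.2 (.inr (Multiset.mem_cons_of_mem (Multiset.mem_map_of_mem _ hqL))))
          ⟨k1 1, g1.2.2.1⟩ ⟨k2 1, g2.2.2.1⟩).congr (Set.subset_univ _)
          (Set.subset_univ _) (fun V hV => ?_) (fun V hV => ?_),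
          (hQ q.2 
          (Multiset.mem_add.2 (.inr (Multiset.mem_cons_of_mem (Multiset.mem_map_of_mem _ hqL))))
          ⟨k1 2, g1.2.2.2⟩ ⟨k2 2, g2.2.2.2⟩).congr (Set.subset_univ _)
          (Set.subset_univ _) (fun V hV => ?_) (fun V hV => ?_)⟩
        · rw [sem_ite, if_pos hV.2]
        · rw [sem_ite, if_pos hV.2]
        · rw [sem_ite, if_neg hV.2]
        · rw [sem_ite, if_neg hV.2]
    · refine ⟨TP, hTP, fun q hq h1 h2 => ?_⟩
      rcases Multiset.mem_add.1 hq with hq | hq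
      · exact hP q (by simp [hq]) h1 h2
      · exact (hgood ⟨q, hq, h1, h2⟩).elim
  | @csbox Γ W b₁ b₂ b b₁' b₂' b' L hL hb hb' h P Q =>
    obtain ⟨w, hw⟩ := P.words_nonempty
    rcases hD _ ⟨w, .inl hw, rfl⟩ .csbox (by simp) with h | h | h | h | h <;> cases h
  | @cca Γ I h =>
    obtain ⟨p, π, hA⟩ := exists_abs I.rel
    refine ⟨.leaf I.K p I.μ, hA.valid, fun q hq h1 h2 => ?_⟩
    have hq := Multiset.mem_of_le h hq
    rw [CCAInst.formula, Multiset.mem_coe, List.zip_map_right, List.mem_map] at hq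
    obtain ⟨q', hq', rfl⟩ := hq
    rcases hA.zip q' hq' with ⟨s, rfl, hs, hm⟩ | ⟨y, hy, rfl⟩
    · have hs1 : s.Plain ∧ s.WS := h1
      refine ⟨s, hs1.2, .of hs1.1.1 (by rw [hs1.1.2]; exact Set.empty_subset _) hm hs
        (.inr ⟨trivial, hs1.1.2⟩), fun V _ => ?_, fun V _ => ?_⟩
      · rw [subst_of_ground hs1.1]; rfl
      · rw [subst_of_ground hs1.1]; rfl
    · have hπ := hA.π_mem hy
      refine ⟨.var (π y), trivial, hπ, fun V _ => hA.sem y hy false V, fun V _ => ?_⟩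
      refine sem_rename_eq (hA.good true _ (hA.mem y hy true)).1.1 ?_ _ (hA.sem y hy true _)
      exact ((hA.valid.ov true).plain_ws _ (by rwa [oh_sd])).1.1

end CCSA

namespace CCSA
open Term
open scoped Computability
variable {S : Signature} {V : Val S} {β β' : Prop} {ltU ltS : Term S → Term S → Prop}

/-! ### Proofs without case distinctions -/

/-- Sequences of rules with one premise. -/
inductive Steps (ltU : Term S → Term S → Prop) (Q : RuleName → Prop) : Formula S → Formula S → Prop
  | refl (Γ) : Steps ltU Q Γ Γ
  | head {Γ Δ Θ : Formula S} (r : RuleName) (hr : Q r) (h : UStep ltU r Γ Δ)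
      (hs : Steps ltU Q Δ Θ) : Steps ltU Q Γ Θ

variable {Q : RuleName → Prop} {Γ Δ Θ Γ' Δ' : Formula S}

theorem Steps.trans (h : Steps ltU Q Γ Δ) (h' : Steps ltU Q Δ Θ) : Steps ltU Q Γ Θ := by
  induction h with
  | refl => exact h'
  | head r hr h _ ih => exact .head r hr h (ih h')

theorem Steps.single {r : RuleName} (hr : Q r) (h : UStep ltU r Γ Δ) : Steps ltU Q Γ Δ :=
  .head r hr h (.refl _)

/-- The side condition of `R□` only becomes weaker when the formula grows. Unfreezing is excluded
because it acts on the whole formula. -/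
theorem UStep.add_right {r : RuleName} (hr : r ≠ .unbox) (h : UStep ltU r Γ Δ) (Θ : Formula S) :
    UStep ltU r (Γ + Θ) (Δ + Θ) := by
  cases h with
  | fa f a a' Γ hf => rw [Multiset.cons_add, add_assoc]; exact .fa f a a' _ hf
  | fas f a a' Γ hf => rw [Multiset.cons_add, add_assoc]; exact .fas f a a' _ hf
  | rLeft s t v Γ hst h => rw [Multiset.cons_add, Multiset.cons_add]; exact .rLeft s t v _ hst h
  | rRight s t v Γ hst h => rw [Multiset.cons_add, Multiset.cons_add]; exact .rRight s t v _ hst h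
  | dup p Γ => simp only [Multiset.cons_add]; exact .dup p _
  | twobox b l c d b' l' c' d' Γ hb hb' hl hl' h h' =>
    rw [Multiset.cons_add, Multiset.cons_add]; exact .twobox b l c d b' l' c' d' _ hb hb' hl hl' h h'
  | rboxLeft s t c d v Γ h hst hd side =>
    rw [Multiset.cons_add, Multiset.cons_add]
    exact .rboxLeft s t c d v _ h hst hd fun β hβ => (side β hβ).imp id fun ⟨p, hp, h⟩ =>
      ⟨p, Multiset.mem_add.2 (.inl hp), h⟩
  | rboxRight s t c d v Γ h hst hd side =>
    rw [Multiset.cons_add, Multiset.cons_add]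
    exact .rboxRight s t c d v _ h hst hd fun β hβ => (side β hβ).imp id fun ⟨p, hp, h⟩ =>
      ⟨p, Multiset.mem_add.2 (.inl hp), h⟩
  | bfa b u v b' u' v' Γ hb hb' =>
    simp only [Multiset.cons_add]; exact .bfa b u v b' u' v' _ hb hb'
  | unbox => exact (hr rfl).elim

theorem Steps.add_right (hQ : ¬ Q .unbox) (h : Steps ltU Q Γ Δ) (Θ : Formula S) :
    Steps ltU Q (Γ + Θ) (Δ + Θ) := by
  induction h with
  | refl => exact .refl _
  | head r hr h _ ih => exact .head r hr (h.add_right (fun e => hQ (e ▸ hr)) Θ) ih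

theorem Steps.add (hQ : ¬ Q .unbox) (h : Steps ltU Q Γ Δ) (h' : Steps ltU Q Γ' Δ') :
    Steps ltU Q (Γ + Γ') (Δ + Δ') := by
  refine (h.add_right hQ Γ').trans ?_
  rw [add_comm Δ, add_comm Δ]
  exact h'.add_right hQ Δ

/-- Steps on each pair of a formula. -/
theorem exists_steps (hQ : ¬ Q .unbox) {G : Term S × Term S → Prop} (Γ : Formula S)
    (h : ∀ q ∈ Γ, ∃ Δ, Steps ltU Q {q} Δ ∧ ∀ q ∈ Δ, G q) :
    ∃ Δ, Steps ltU Q Γ Δ ∧ ∀ q ∈ Δ, G q := by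
  induction Γ using Multiset.induction with
  | empty => exact ⟨0, .refl _, by simp⟩
  | cons a Γ ih =>
    obtain ⟨Δ, h1, h2⟩ := ih fun q hq => h q (Multiset.mem_cons_of_mem hq)
    obtain ⟨Δ', h3, h4⟩ := h a (Multiset.mem_cons_self ..)
    refine ⟨Δ' + Δ, ?_, fun q hq => (Multiset.mem_add.1 hq).elim (h4 q) (h2 q)⟩
    rw [← Multiset.singleton_add]
    exact h3.add hQ h1

/-- Different components may be decomposed into the same atom, while an axiom is used at most as
often as its formula lists it; duplicates are therefore merged just before the axiom. -/
theorem steps_dedup [DecidableEq (Term S × Term S)] (Γ : Formula S) :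
    Steps ltU (· = .dup) Γ Γ.dedup := by
  induction Γ using Multiset.induction with
  | empty => exact .refl _
  | cons a Γ ih =>
    by_cases ha : a ∈ Γ
    · rw [Multiset.dedup_cons_of_mem ha]
      refine .trans ?_ ih
      obtain ⟨Γ, rfl⟩ := Multiset.exists_cons_of_mem ha
      exact .single rfl (.dup a Γ)
    · rw [Multiset.dedup_cons_of_notMem ha, ← Multiset.singleton_add, ← Multiset.singleton_add]
      exact Steps.add (by simp) (.refl _) ih

theorem nil_mem_kstar_mul {A M : Language RuleName} {w : List RuleName} (hw : w ∈ M) : w ∈ A∗ * M :=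
  Language.mem_mul.2 ⟨[], Language.nil_mem_kstar _, w, hw, rfl⟩

theorem cons_mem_kstar_mul {A M : Language RuleName} {r : RuleName} {w : List RuleName}
    (hr : [r] ∈ A) (hw : w ∈ A∗ * M) : r :: w ∈ A∗ * M := by
  obtain ⟨a, ha, b, hb, rfl⟩ := Language.mem_mul.1 hw
  obtain ⟨L, rfl, hL⟩ := Language.mem_kstar.1 ha
  exact Language.mem_mul.2 ⟨_, Language.mem_kstar.2 ⟨[r] :: L, rfl,
    fun y hy => (List.mem_cons.1 hy).elim (fun h => h ▸ hr) (hL y)⟩, b, hb, rfl⟩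

theorem Steps.leads {I : CCAInst ltU ltS} {A M : Language RuleName} (hQ : ∀ r, Q r → [r] ∈ A)
    (h : Steps ltU Q Γ Δ) (hΔ : ∃ P : Prf ltU ltS Δ, P.words ≤ M ∧ P.Leads I) :
    ∃ P : Prf ltU ltS Γ, P.words ≤ A∗ * M ∧ P.Leads I := by
  induction h with
  | refl =>
    obtain ⟨P, h1, h2⟩ := hΔ
    exact ⟨P, fun w hw => nil_mem_kstar_mul (h1 hw), h2⟩
  | head r hr h _ ih =>
    obtain ⟨P, h1, h2⟩ := ih hΔ
    refine ⟨.unary r h P, ?_, .unary _ _ _ _ h2⟩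
    rintro _ ⟨w, hw, rfl⟩
    exact cons_mem_kstar_mul (hQ r hr) (h1 hw)

theorem Steps.afterUnbox {I : CCAInst ltU ltS} {M : Language RuleName}
    (h : Steps ltU (· = .bfa) Γ Δ)
    (hΔ : ∃ P : Prf ltU ltS Δ, P.words ≤ M ∧ P.Leads I ∧ P.AfterUnbox Θ) :
    ∃ P : Prf ltU ltS Γ, P.words ≤ (letter .bfa)∗ * M ∧ P.Leads I ∧ P.AfterUnbox Θ := by
  induction h with
  | refl =>
    obtain ⟨P, h1, h2⟩ := hΔ
    exact ⟨P, fun w hw => nil_mem_kstar_mul (h1 hw), h2⟩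
  | head r hr h _ ih =>
    obtain ⟨P, h1, h2, h3⟩ := ih hΔ
    subst hr
    refine ⟨.unary .bfa h P, ?_, .unary _ _ _ _ h2, .bfa _ _ h3⟩
    rintro _ ⟨w, hw, rfl⟩
    exact cons_mem_kstar_mul rfl (h1 hw)

theorem Steps.npf {M : Language RuleName} (h : Steps ltU (fun r => r = .twobox ∨ r = .rbox) Γ Δ)
    (hΔ : ∃ P : Prf ltU ltS Δ, P.words ≤ M ∧ P.NPF) :
    ∃ P : Prf ltU ltS Γ, P.words ≤ (letter .twobox + letter .rbox)∗ * M ∧ P.NPF := by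
  induction h with
  | refl =>
    obtain ⟨P, h1, h2⟩ := hΔ
    exact ⟨P, fun w hw => nil_mem_kstar_mul (h1 hw), h2⟩
  | head r hr h _ ih =>
    obtain ⟨P, h1, h2⟩ := ih hΔ
    refine ⟨.unary r h P, ?_, .rewrite r hr h P h2⟩
    rintro _ ⟨w, hw, rfl⟩
    refine cons_mem_kstar_mul ((Language.mem_add ..).2 ?_) (h1 hw)
    rcases hr with rfl | rfl
    exacts [.inl rfl, .inr rfl]

-- Decomposition of normalized instances down to a `CCA2` axiom.

section
variable {K : Finset ℕ} {p : List (HStep S)} {μ : Equiv.Perm ℕ}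

/-- The two instances of a symbolic term. -/
def inst (p : List (HStep S)) (μ : Equiv.Perm ℕ) (t : Term S) : Term S × Term S :=
  (t.subst (call false p), (t.subst (call true p)).rename μ)

/-- Symbolic terms of the `CCA2` axioms. -/
def Atom (K : Finset ℕ) (p : List (HStep S)) (t : Term S) : Prop :=
  (∃ h ∈ hh p, t = var h) ∨ t.WS ∧ Sy {k | k ∈ K} (rds p) ∅ True t

/-- Function application down to the atoms. -/
theorem steps_fas {t : Term S} (ht : Sy {k | k ∈ K} (rds p) (hh p) True t) (hi : t.IfFree) :
    ∃ Δ, Steps ltU (· = .fas) {inst p μ t} Δ ∧ ∀ q ∈ Δ, ∃ a, Atom K p a ∧ q = inst p μ a := by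
  have hw := ht.pure.ws_of_ifFree hi
  have hself : Atom K p t → ∃ Δ, Steps ltU (· = .fas) {inst p μ t} Δ ∧
      ∀ q ∈ Δ, ∃ a, Atom K p a ∧ q = inst p μ a := fun h =>
    ⟨_, .refl _, fun q hq => ⟨t, h, Multiset.mem_singleton.1 hq⟩⟩
  induction t with
  | name n => exact hself (.inr ⟨trivial, ht⟩)
  | var x => exact hself (.inl ⟨x, ht, rfl⟩)
  | app f a ih =>
    rcases id ht with ⟨n, h1, h2, e⟩ | ⟨h1, h2⟩
    · exact hself (.inr ⟨hw, .inl ⟨n, h1, h2, e⟩⟩)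
    -- Function application does not cover `zero`; its argument contains no handle, so the whole
    -- subterm is the same on both sides up to the renaming and joins the base of the axiom.
    · by_cases hf : f = .zero
      · refine hself (.inr ⟨hw, ht.mono ?_ ht.names id⟩)
        rw [(h1 hf).2]
      · have hi' := ifFree_app.1 hi
        have hstep : UStep ltU .fas {inst p μ (.app f a)}
            ((Finset.univ.val.map fun i => inst p μ (a i)) + 0) :=
          .fas f _ _ 0 ⟨hf, hi'.1⟩
        rw [add_zero] at hstep
        obtain ⟨Δ, h3, h4⟩ := exists_steps (ltU := ltU) (Q := (· = .fas)) (by simp)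
          (G := fun q => ∃ a, Atom K p a ∧ q = inst p μ a)
          (Finset.univ.val.map fun i => inst p μ (a i)) fun q hq => by
            obtain ⟨i, -, rfl⟩ := Multiset.mem_map.1 hq
            exact ih i (h2 i) (hi'.2 i) (hw.1 i) fun h =>
              ⟨_, .refl _, fun q hq => ⟨_, h, Multiset.mem_singleton.1 hq⟩⟩
        exact ⟨Δ, .head _ rfl hstep h3, h4⟩
  | box a c b => exact ht.elim
  | frz b => exact ht.elim

/-- Function application on conditionals. -/
theorem steps_bfa {t : Term S} (ht : Sy {k | k ∈ K} (rds p) (hh p) True t) (hT : Tr t) :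
    ∃ Δ, Steps ltU (· = .bfa) {inst p μ t} Δ ∧ ∀ q ∈ Δ, ∃ u,
      (Sy {k | k ∈ K} (rds p) (hh p) True u ∧ NLeaf u) ∧ q = inst p μ u := by
  induction hT with
  | leaf t h => exact ⟨_, .refl _, fun q hq => ⟨t, ⟨ht, h⟩, Multiset.mem_singleton.1 hq⟩⟩
  | node b u v hb hbool hu hv ihu ihv =>
    have hb' := ht.arg (by simp) 0
    obtain ⟨Δ1, h1, h2⟩ := ihu (ht.arg (by simp) 1)
    obtain ⟨Δ2, h3, h4⟩ := ihv (ht.arg (by simp) 2)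
    refine ⟨{inst p μ b} + (Δ1 + Δ2), .head _ rfl ?_
      (Steps.add (by simp) (.refl _) (Steps.add (by simp) h1 h3)), ?_⟩
    -- The tests of normalized terms are not conditionals, so freezing does nothing, and the later
    -- unfreezing step leaves the formula unchanged.
    · have hfr : ∀ (σ : ℕ → Term S) (ν : Equiv.Perm ℕ), (b.subst σ).freeze = b.subst σ ∧
          ((b.subst σ).rename ν).freeze = (b.subst σ).rename ν ∧
          (∀ a, b.subst σ ≠ .frz a) ∧ ∀ a, (b.subst σ).rename ν ≠ .frz a := by
        intro σ ν
        cases b with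
        | app f a =>
          have hf := (nleaf_app.1 hb).1
          have hfr : ∀ a : Fin f.arity → Term S, (Term.app f a).freeze = .app f a := by
            intro a; cases f <;> first | rfl | exact (hf rfl).elim
          exact ⟨hfr _, hfr _, by simp [subst], by simp [subst, Term.rename]⟩
        | name n => exact hbool.elim
        | var n => exact hbool.elim
        | box a c b => exact hb'.elim
        | frz b => exact hb'.elim
      have := UStep.bfa (ltU := ltU) (b.subst (call false p)) (u.subst (call false p))
        (v.subst (call false p)) ((b.subst (call true p)).rename μ)
        ((u.subst (call true p)).rename μ) ((v.subst (call true p)).rename μ) 0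
        (hfr _ μ).2.2.1 (hfr _ μ).2.2.2
      rw [(hfr _ μ).1, (hfr _ μ).2.1] at this
      rw [inst, subst_ite, subst_ite, rename_ite]
      exact this
    · intro q hq
      rcases Multiset.mem_add.1 hq with hq | hq
      · exact ⟨b, ⟨hb', hb⟩, Multiset.mem_singleton.1 hq⟩
      · exact (Multiset.mem_add.1 hq).elim (h2 q) (h4 q)

theorem unfreeze_of_pure {t : Term S} (ht : t.Pure) : t.unfreeze = t := by
  induction t with
  | name n => rfl
  | var n => rfl
  | app f a ih => simp only [unfreeze, fun i => ih i (pure_app.1 ht i)]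
  | box a c b => exact (not_pure_box ht).elim
  | frz b => exact (not_pure_frz ht).elim

/-- Validity is proved with the randomness of both sides, while oracle calls are defined with that
of one side. -/
theorem OV.mono_R {Ks R R' : Set ℕ} {q : List (OStep S)} (hq : OV Ks R q) (hR : R' ⊆ R)
    (h : ∀ x n r t, OStep.enc x n r t ∈ q → r ∈ R') : OV Ks R' q := by
  induction q with
  | nil => trivial
  | cons s q ih =>
    have ih' := ih hq.tail fun x n r t h' => h x n r t (by simp [h'])
    cases s with
    | enc x n r t =>
      obtain ⟨⟨h1, h2, h3, h4, h5, h6⟩, h7⟩ := hq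
      exact ⟨⟨h1, h2, h x n r t (by simp), h4, h5,
        h6.mono h6.vars (fun m hm hr => h6.names m hm (hR hr)) id⟩, ih'⟩
    | dec z n c l =>
      obtain ⟨⟨h1, h2, h3, h4, h5⟩, h7⟩ := hq
      exact ⟨⟨h1, h2, h3, h4.mono h4.vars (fun m hm hr => h4.names m hm (hR hr)) id, h5⟩, ih'⟩

/-- The instance of `CCA2` given by a sequence of oracle calls. -/
def Valid.cca (hp : Valid ltU ltS K p) (μ : Equiv.Perm ℕ) {B : List (Term S)}
    (hB : ∀ w ∈ B, w.WS ∧ Sy {k | k ∈ K} (rds p) ∅ True w) : CCAInst ltU ltS :=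
  ⟨K, encH p, decH p, exec B false p, exec B true p, μ, hp.ccaRel hB⟩

theorem outs_length : (outs false p).length = (outs true p).length := by
  induction p with
  | nil => rfl
  | cons s p ih => simp [outs, ih]

theorem Valid.mem_zip_outs (hp : Valid ltU ltS K p) {h : ℕ} (hh : h ∈ CCSA.hh p) :
    (call false p h, call true p h) ∈ List.zip (outs false p) (outs true p) := by
  induction p with
  | nil => obtain ⟨s, hs, -⟩ := hh; simp at hs
  | cons s p ih =>
    rw [hh_cons] at hh
    simp only [outs, List.zip_append outs_length, List.mem_append]
    by_cases e : h = s.h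
    · subst e; right; simp
    · have hh := hh.resolve_left e
      rw [hp.call_cons false hh, hp.call_cons true hh]
      exact .inl (ih hp.tail hh)

theorem Valid.mem_formula (hp : Valid ltU ltS K p) {B : List (Term S)}
    (hB : ∀ w ∈ B, w.WS ∧ Sy {k | k ∈ K} (rds p) ∅ True w) {t : Term S}
    (ht : (∃ h ∈ hh p, t = var h) ∨ t ∈ B) : inst p μ t ∈ (hp.cca μ hB).formula := by
  rw [CCAInst.formula, Multiset.mem_coe, List.zip_map_right, List.mem_map]
  change ∃ q ∈ List.zip (B ++ outs false p) (B ++ outs true p), _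
  rw [List.zip_append rfl]
  rcases ht with ⟨h, hh, rfl⟩ | ht
  · exact ⟨_, List.mem_append_right _ (hp.mem_zip_outs hh), rfl⟩
  · refine ⟨(t, t), List.mem_append_left _ ?_, ?_⟩
    · rw [List.zip, List.zipWith_self]; exact List.mem_map.2 ⟨t, ht, rfl⟩
    · have : t.Plain := ⟨(hB t ht).2.pure, Set.subset_empty_iff.1 (hB t ht).2.vars⟩
      rw [inst, subst_of_ground this, subst_of_ground this]; rfl

theorem exists_base (Δ : Formula S) (h : ∀ q ∈ Δ, ∃ a, Atom K p a ∧ q = inst p μ a) :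
    ∃ B : List (Term S), (∀ w ∈ B, w.WS ∧ Sy {k | k ∈ K} (rds p) ∅ True w) ∧
      ∀ q ∈ Δ, ∃ a, ((∃ h ∈ hh p, a = var h) ∨ a ∈ B) ∧ q = inst p μ a := by
  induction Δ using Multiset.induction with
  | empty => exact ⟨[], by simp, by simp⟩
  | cons q Δ ih =>
    obtain ⟨B, h1, h2⟩ := ih fun q hq => h q (Multiset.mem_cons_of_mem hq)
    obtain ⟨a, ha, e⟩ := h q (Multiset.mem_cons_self ..)
    rcases ha with ha | ha
    · exact ⟨B, h1, fun q' hq => (Multiset.mem_cons.1 hq).elim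
        (fun h => ⟨a, .inl ha, h.trans e⟩) (h2 q')⟩
    · refine ⟨a :: B, fun w hw => (List.mem_cons.1 hw).elim (fun h => h ▸ ha) (h1 w),
        fun q' hq => (Multiset.mem_cons.1 hq).elim (fun h => ⟨a, .inr (by simp), h.trans e⟩)
        fun hq => ?_⟩
      obtain ⟨a', h, e'⟩ := h2 q' hq
      exact ⟨a', h.imp id fun h => by simp [h], e'⟩

theorem Valid.calls_left (hp : Valid ltU ltS K p) {B : List (Term S)}
    (hB : ∀ w ∈ B, w.WS ∧ Sy {k | k ∈ K} (rds p) ∅ True w) :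
    OV (hp.cca μ hB).left.keys (hp.cca μ hB).left.rands (sd false p) ∧
      (hp.cca μ hB).left.rands ⊆ rds p ∧
    (∀ x n r t, OStep.enc x n r t ∈ sd false p →
      EncCall ltU (hp.cca μ hB).left (call false p x)) ∧
    ∀ z n c l, OStep.dec z n c l ∈ sd false p → DecCall ltU (hp.cca μ hB).left (call false p z) := by
  have hR : (hp.cca μ hB).left.rands ⊆ rds p := by
    rintro m ⟨x, hx, rfl⟩
    obtain ⟨n, r, t, h⟩ := mem_encH.1 hx
    exact ⟨x, n, r, t, false, h, hp.rnd_eq h false⟩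
  have hq : OV (hp.cca μ hB).left.keys (hp.cca μ hB).left.rands (sd false p) := by
    refine (hp.ov false).mono_R hR fun x n r t h => ?_
    obtain ⟨r, t, h', rfl, rfl⟩ := enc_mem_sd.1 h
    exact ⟨x, mem_encH.2 ⟨_, _, _, h'⟩, (hp.rnd_eq h' false).symm⟩
  refine ⟨hq, hR, hq.calls rfl rfl (fun x n r t h => ?_) fun z n c l h => ?_⟩
  · obtain ⟨r, t, h', rfl, rfl⟩ := enc_mem_sd.1 h
    exact ⟨x, mem_encH.2 ⟨_, _, _, h'⟩, rfl⟩
  · obtain ⟨l, h', rfl⟩ := dec_mem_sd.1 h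
    exact ⟨z, mem_decH.2 ⟨_, _, _, h'⟩, rfl⟩

theorem Valid.calls_right (hp : Valid ltU ltS K p) {B : List (Term S)}
    (hB : ∀ w ∈ B, w.WS ∧ Sy {k | k ∈ K} (rds p) ∅ True w) :
    OV (hp.cca μ hB).right.keys (hp.cca μ hB).right.rands ((sd true p).map (OStep.rename μ)) ∧
      (hp.cca μ hB).right.rands ⊆ μ '' rds p ∧
    (∀ x n r t, OStep.enc x n r t ∈ (sd true p).map (OStep.rename μ) →
      EncCall ltU (hp.cca μ hB).right (ocall ((sd true p).map (OStep.rename μ)) x)) ∧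
    ∀ z n c l, OStep.dec z n c l ∈ (sd true p).map (OStep.rename μ) →
      DecCall ltU (hp.cca μ hB).right (ocall ((sd true p).map (OStep.rename μ)) z) := by
  have hK : (hp.cca μ hB).right.keys = μ '' {k | k ∈ K} := by
    ext m
    exact ⟨fun ⟨k, hk, e⟩ => ⟨k, hk, e.symm⟩, fun ⟨k, hk, e⟩ => ⟨k, hk, e.symm⟩⟩
  have hR : (hp.cca μ hB).right.rands ⊆ μ '' rds p := by
    rintro m ⟨x, hx, rfl⟩
    obtain ⟨n, r, t, h⟩ := mem_encH.1 hx
    exact ⟨_, ⟨x, n, r, t, true, h, hp.rnd_eq h true⟩, rfl⟩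
  have hmem : ∀ {s}, s ∈ (sd true p).map (OStep.rename μ) → ∃ s' ∈ p, s = (s'.side true).rename μ := by
    intro s hs
    obtain ⟨s₁, hs₁, rfl⟩ := List.mem_map.1 hs
    obtain ⟨s₂, hs₂, rfl⟩ := List.mem_map.1 hs₁
    exact ⟨s₂, hs₂, rfl⟩
  have henc : ∀ {x n r t}, OStep.enc x n r t ∈ (sd true p).map (OStep.rename μ) →
      ∃ n' r' t', HStep.enc x n' r' t' ∈ p ∧ r = μ (r' true) := by
    intro x n r t h
    obtain ⟨s, hs, e⟩ := hmem h
    cases s with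
    | enc x' n' r' t' => cases e; exact ⟨n', r', t', hs, rfl⟩
    | dec => cases e
  have hdec : ∀ {z n c l}, OStep.dec z n c l ∈ (sd true p).map (OStep.rename μ) →
      ∃ n' c' l', HStep.dec z n' c' l' ∈ p := by
    intro x n r t h
    obtain ⟨s, hs, e⟩ := hmem h
    cases s with
    | enc => cases e
    | dec z' n' c' l' => cases e; exact ⟨n', c', l', hs⟩
  have hq : OV (hp.cca μ hB).right.keys (hp.cca μ hB).right.rands
      ((sd true p).map (OStep.rename μ)) := by
    rw [hK]
    refine ((hp.ov true).rename μ).mono_R hR fun x n r t h => ?_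
    obtain ⟨n', r', t', h', rfl⟩ := henc h
    exact ⟨x, mem_encH.2 ⟨_, _, _, h'⟩, congrArg μ (hp.rnd_eq h' true).symm⟩
  refine ⟨hq, hR, hq.calls rfl rfl (fun x n r t h => ?_) fun z n c l h => ?_⟩
  · obtain ⟨n', r', t', h', rfl⟩ := henc h
    exact ⟨x, mem_encH.2 ⟨_, _, _, h'⟩, ocall_rename μ _ x⟩
  · obtain ⟨n', c', l', h⟩ := hdec h
    exact ⟨z, mem_decH.2 ⟨_, _, _, h⟩, ocall_rename μ _ z⟩

theorem inst_snd (t : Term S) :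
    (inst p μ t).2 = (t.rename μ).subst (ocall ((sd true p).map (OStep.rename μ))) := by
  rw [inst, rename_subst]
  change Term.subst _ _ = _
  congr 1; funext x; exact (ocall_rename μ _ x).symm

theorem Valid.nSimple (hp : Valid ltU ltS K p) {B : List (Term S)}
    (hB : ∀ w ∈ B, w.WS ∧ Sy {k | k ∈ K} (rds p) ∅ True w) {t : Term S}
    (ht : Sy {k | k ∈ K} (rds p) (hh p) True t) (hT : Tr t) :
    NSimple ltU (hp.cca μ hB).left (inst p μ t).1 ∧
      NSimple ltU (hp.cca μ hB).right (inst p μ t).2 := by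
  obtain ⟨-, l2, l3, l4⟩ := hp.calls_left (μ := μ) hB
  obtain ⟨-, r2, r3, r4⟩ := hp.calls_right (μ := μ) hB
  refine ⟨NSimple.of_sy (hp.ov false) le_rfl l2 (by rw [oh_sd]) (fun x n r t h _ => l3 x n r t h)
    (fun x n r t h _ => l4 x n r t h) ht hT, ?_⟩
  rw [inst_snd]
  refine NSimple.of_sy ((hp.ov true).rename μ) ?_ r2 (by rw [oh_rename, oh_sd])
    (fun x n r t h _ => r3 x n r t h) (fun x n r t h _ => r4 x n r t h) (ht.rename μ)
    (tr_rename μ hT)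
  rintro m ⟨k, hk, e⟩
  exact ⟨k, hk, e.symm⟩

theorem Valid.nBasic (hp : Valid ltU ltS K p) {B : List (Term S)}
    (hB : ∀ w ∈ B, w.WS ∧ Sy {k | k ∈ K} (rds p) ∅ True w) {t : Term S}
    (ht : Sy {k | k ∈ K} (rds p) (hh p) True t) (hn : NLeaf t) :
    NBasic ltU (hp.cca μ hB).left (inst p μ t).1 ∧
      NBasic ltU (hp.cca μ hB).right (inst p μ t).2 := by
  obtain ⟨-, l2, l3, l4⟩ := hp.calls_left (μ := μ) hB
  obtain ⟨-, r2, r3, r4⟩ := hp.calls_right (μ := μ) hB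
  refine ⟨NBasic.of_sy (hp.ov false) le_rfl l2 (by rw [oh_sd]) (fun x n r t h _ => l3 x n r t h)
    (fun x n r t h _ => l4 x n r t h) ht hn, ?_⟩
  rw [inst_snd]
  refine NBasic.of_sy ((hp.ov true).rename μ) ?_ r2 (by rw [oh_rename, oh_sd])
    (fun x n r t h _ => r3 x n r t h) (fun x n r t h _ => r4 x n r t h) (ht.rename μ)
    (nleaf_rename μ hn)
  rintro m ⟨k, hk, e⟩
  exact ⟨k, hk, e.symm⟩

/-- The words of the branches, after the case distinctions. -/
def leafStrategy : Language RuleName :=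
  (letter .bfa)∗ * (letter .unbox * ((letter .fas)∗ * ((letter .dup)∗ * letter .cca)))

/-- The two components of each pair are instances of the same normalized symbolic term, so they have
the same tree of conditionals and the same function symbols. Both are opened in parallel down to
handles and handle-free atoms, which are components of a common `CCA2` instance. -/
theorem Valid.exists_prf (hp : Valid ltU ltS K p) (Γ : Formula S)
    (hΓ : ∀ q ∈ Γ, ∃ t, (Sy {k | k ∈ K} (rds p) (hh p) True t ∧ Tr t) ∧ q = inst p μ t) :
    ∃ P : Prf ltU ltS Γ, P.words ≤ leafStrategy ∧ P.NPF := by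
  classical
  obtain ⟨Θ, h1, h2⟩ := exists_steps (ltU := ltU) (Q := (· = .bfa)) (by simp) Γ (fun q hq => by
    obtain ⟨t, ⟨h, hT⟩, rfl⟩ := hΓ q hq
    exact steps_bfa (ltU := ltU) (μ := μ) h hT)
  obtain ⟨Δ, h3, h4⟩ := exists_steps (ltU := ltU) (Q := (· = .fas)) (by simp) Θ (fun q hq => by
    obtain ⟨t, ⟨h, hT⟩, rfl⟩ := h2 q hq
    exact steps_fas (ltU := ltU) (μ := μ) h (hT.ifFree h.pure))
  -- The instance is known only now: its base collects the handle-free atoms that the decomposition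
  -- has produced.
  obtain ⟨B, hB, h5⟩ := exists_base Δ h4
  have hle : Δ.dedup ≤ (hp.cca μ hB).formula := by
    refine (Multiset.le_iff_subset (Multiset.nodup_dedup Δ)).2 fun q hq => ?_
    obtain ⟨a, ha, rfl⟩ := h5 q (Multiset.mem_dedup.1 hq)
    exact hp.mem_formula hB ha
  have k1 : ∃ P : Prf ltU ltS Δ.dedup, P.words ≤ letter .cca ∧ P.Leads (hp.cca μ hB) :=
    ⟨.cca _ hle, le_rfl, .cca _ _⟩
  obtain ⟨P, g1, g2⟩ := h3.leads (A := letter .fas) (by rintro r rfl; rfl)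
    ((steps_dedup Δ).leads (A := letter .dup) (by rintro r rfl; rfl) k1)
  have hun : UStep ltU .unbox Θ Θ := by
    have := UStep.unbox (ltU := ltU) Θ
    rwa [Multiset.map_congr rfl fun q hq => ?_, Multiset.map_id] at this
    obtain ⟨t, ⟨h, -⟩, rfl⟩ := h2 q hq
    exact Prod.ext (unfreeze_of_pure (hp.call_pure h false))
      (unfreeze_of_pure (pure_rename μ (hp.call_pure h true)))
  obtain ⟨P', g3, g4, g5⟩ := h1.afterUnbox (I := hp.cca μ hB) (Θ := Θ)
    (M := letter .unbox * ((letter .fas)∗ * ((letter .dup)∗ * letter .cca)))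
    ⟨.unary .unbox hun P, by
      rintro _ ⟨w, hw, rfl⟩
      exact Language.mem_mul.2 ⟨[.unbox], rfl, w, g1 hw, rfl⟩, .unary _ _ _ _ g2, .unbox _ _⟩
  refine ⟨P', g3, .branch P' _ g4 g5 (fun q hq => ?_) fun q hq => ?_⟩
  · obtain ⟨t, ⟨h, hT⟩, rfl⟩ := hΓ q hq
    exact hp.nSimple hB h hT
  · obtain ⟨t, ⟨h, hT⟩, rfl⟩ := h2 q hq
    exact hp.nBasic hB h hT

end

end CCSA

namespace CCSA
open Term
open scoped Computability
variable {S : Signature} {V : Val S} {β β' : Prop} {ltU ltS : Term S → Term S → Prop}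

/-! ### Case distinctions on boxes -/

/-- Derivations annotated with the boxes `box b₁ b₂ b` of their case distinctions. -/
inductive BT (S : Signature)
  | leaf (K : Finset ℕ) (p : List (HStep S)) (μ : Equiv.Perm ℕ)
  | node (b₁ b₂ b : Term S × Term S) (A1 A2 : BT S)

/-- Pairs of terms that follow the case distinctions, with instances of a symbolic normalized term
in each case. -/
def BT.Fits : BT S → Term S × Term S → Prop
  | .leaf K p μ, q => ∃ t, (Sy {k | k ∈ K} (rds p) (hh p) True t ∧ Tr t) ∧ q = inst p μ t
  | .node b₁ b₂ b A1 A2, q => ∃ u v : Term S × Term S, A1.Fits u ∧ A2.Fits v ∧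
      q = (Term.ite (.box b₁.1 b₂.1 b.1) u.1 v.1, Term.ite (.box b₁.2 b₂.2 b.2) u.2 v.2)

/-- Normal forms of the tests. -/
def BoxIndex (ltU : Term S → Term S → Prop) (b₁ b₂ b : Term S) : Prop :=
  (b.Plain ∧ b.IfFree) ∧ RNormal ltU b ∧ REq b₁.erase b ∧ REq b₂.erase b

def BT.WF (ltU ltS : Term S → Term S → Prop) : BT S → Prop
  | .leaf K p _ => Valid ltU ltS K p
  | .node b₁ b₂ b A1 A2 => (BoxIndex ltU b₁.1 b₂.1 b.1 ∧ BoxIndex ltU b₁.2 b₂.2 b.2) ∧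
      (A1.Fits b₁ ∧ A2.Fits b₂) ∧ A1.WF ltU ltS ∧ A2.WF ltU ltS

/-- A formula that follows the case distinctions of a derivation has a normalized proof. -/
theorem BT.WF.exists_prf {A : BT S} (hA : A.WF ltU ltS) (Γ : Formula S)
    (hΓ : ∀ q ∈ Γ, A.Fits q) :
    ∃ P : Prf ltU ltS Γ, P.words ≤ (letter .csbox)∗ * leafStrategy ∧ P.NPF := by
  induction A generalizing Γ with
  | leaf K p μ =>
    obtain ⟨P, h1, h2⟩ := Valid.exists_prf hA Γ hΓ
    exact ⟨P, fun w hw => nil_mem_kstar_mul (h1 hw), h2⟩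
  | node b₁ b₂ b A1 A2 ih1 ih2 =>
    obtain ⟨⟨hb, hb'⟩, ⟨hb1, hb2⟩, hA1, hA2⟩ := hA
    -- The rule `CS□` needs a non-empty family; the empty formula can follow the first subtree
    -- instead.
    by_cases h0 : Γ = 0
    · exact ih1 hA1 Γ (by simp [h0])
    have hL : ∃ L : Multiset ((Term S × Term S) × (Term S × Term S)),
        Γ = iteFamily (.box b₁.1 b₂.1 b.1) (.box b₁.2 b₂.2 b.2) L ∧
          ∀ q ∈ L, A1.Fits q.1 ∧ A2.Fits q.2 := by
      clear h0
      induction Γ using Multiset.induction with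
      | empty => exact ⟨0, rfl, by simp⟩
      | cons a Γ ih =>
        obtain ⟨L, rfl, h⟩ := ih fun q hq => hΓ q (Multiset.mem_cons_of_mem hq)
        obtain ⟨u, v, hu, hv, rfl⟩ := hΓ a (Multiset.mem_cons_self ..)
        refine ⟨(u, v) ::ₘ L, by simp [iteFamily], fun q hq => ?_⟩
        rcases Multiset.mem_cons.1 hq with rfl | hq
        exacts [⟨hu, hv⟩, h q hq]
    obtain ⟨L, hΓL, hL⟩ := hL
    have hL0 : L ≠ 0 := by rintro rfl; exact h0 (by simp [hΓL, iteFamily])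
    -- All components carry the same boxes and are split at once, so the common part `W` is empty.
    obtain ⟨P, hP, hP'⟩ := ih1 hA1 (0 + ((b₁.1, b₁.2) ::ₘ L.map Prod.fst)) (by
      intro q hq
      rw [zero_add] at hq
      rcases Multiset.mem_cons.1 hq with rfl | hq
      · exact hb1
      · obtain ⟨q, hqL, rfl⟩ := Multiset.mem_map.1 hq
        exact (hL q hqL).1)
    obtain ⟨Q, hQ, hQ'⟩ := ih2 hA2 (0 + ((b₂.1, b₂.2) ::ₘ L.map Prod.snd)) (by
      intro q hq
      rw [zero_add] at hq
      rcases Multiset.mem_cons.1 hq with rfl | hq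
      · exact hb2
      · obtain ⟨q, hqL, rfl⟩ := Multiset.mem_map.1 hq
        exact (hL q hqL).2)
    refine ⟨.csbox 0 _ _ b.1 _ _ b.2 L hL0 hb.1 hb'.1 (by rw [zero_add]; exact hΓL) P Q, ?_,
      .split _ _ _ _ _ _ _ _ _ _ _ _ _ _ hb.2 hb'.2 hP' hQ'⟩
    rintro _ ⟨w, hw, rfl⟩
    exact cons_mem_kstar_mul rfl (hw.elim (fun h => hP h) fun h => hQ h)

/-! ### Introduction of the boxes -/

/-- Rewriting of the pairs, by the rules `2Box` and `R□`. -/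
inductive PStep (ltU : Term S → Term S → Prop) (β : Prop) :
    Term S × Term S → Term S × Term S → Prop
  | left (s t c d v : Term S) (h : InCtx s t c d) (hst : REq s t) (hs : s.Plain) (ht : t.Plain)
      (hd : Ok β d) : PStep ltU β (c, v) (d, v)
  | right (s t c d v : Term S) (h : InCtx s t c d) (hst : REq s t) (hs : s.Plain) (ht : t.Plain)
      (hd : Ok β d) : PStep ltU β (v, c) (v, d)
  | two (b l c d b' l' c' d' : Term S)
      (hb : b.Boxed ∧ b.IfFree ∧ b.IsBool) (hb' : b'.Boxed ∧ b'.IfFree ∧ b'.IsBool)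
      (hl : l.Plain ∧ l.IfFree ∧ REq b.erase l ∧ RNormal ltU l)
      (hl' : l'.Plain ∧ l'.IfFree ∧ REq b'.erase l' ∧ RNormal ltU l')
      (h : InCtx b (.box b b l) c d) (h' : InCtx b' (.box b' b' l') c' d') :
      PStep ltU β (c, c') (d, d')

abbrev PSteps (ltU : Term S → Term S → Prop) (β : Prop) :
    Term S × Term S → Term S × Term S → Prop :=
  Relation.ReflTransGen (PStep ltU β)

theorem Term.Plain.boxes {t : Term S} (h : t.Plain) {s : Term S} : s ∉ t.boxes := by
  rintro ⟨hs, a, c, b, rfl⟩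
  exact h.1.1 a c b hs

/-- `R□` is used between box-free terms only, so its side condition on the boxes of the new term is
vacuous. -/
theorem PSteps.steps {q q' : Term S × Term S} (h : PSteps ltU β q q') :
    Steps ltU (fun r => r = .twobox ∨ r = .rbox) {q} {q'} := by
  induction h using Relation.ReflTransGen.head_induction_on with
  | refl => exact .refl _
  | head h _ ih =>
    cases h with
    | left s t c d v h hst hs ht hd =>
      exact .head .rbox (.inr rfl) (.rboxLeft s t c d v 0 h hst ⟨hd.1, hd.2.1⟩
        fun _ hβ => (ht.boxes hβ).elim) ih
    | right s t c d v h hst hs ht hd =>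
      exact .head .rbox (.inr rfl) (.rboxRight s t c d v 0 h hst ⟨hd.1, hd.2.1⟩
        fun _ hβ => (ht.boxes hβ).elim) ih
    | two b l c d b' l' c' d' hb hb' hl hl' h h' =>
      exact .head .twobox (.inl rfl) (.twobox b l c d b' l' c' d' 0 hb hb' hl hl' h h') ih

/-- Contexts that preserve sorts. -/
structure Ctx (β γ : Prop) (C : Term S → Term S) : Prop where
  inCtx : ∀ s t c d, InCtx s t c d → InCtx s t (C c) (C d)
  ok : ∀ x, Ok β x → Ok γ (C x)

theorem PSteps.ctx {γ : Prop} {C C' : Term S → Term S} (hC : Ctx β γ C) (hC' : Ctx β γ C')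
    {q q' : Term S × Term S} (h : PSteps ltU β q q') :
    PSteps ltU γ (C q.1, C' q.2) (C q'.1, C' q'.2) := by
  refine h.lift (fun q : Term S × Term S => (C q.1, C' q.2)) fun q q' h => ?_
  cases h with
  | left s t c d v h hst hs ht hd => exact .left s t _ _ _ (hC.inCtx _ _ _ _ h) hst hs ht (hC.ok _ hd)
  | right s t c d v h hst hs ht hd =>
    exact .right s t _ _ _ (hC'.inCtx _ _ _ _ h) hst hs ht (hC'.ok _ hd)
  | two b l c d b' l' c' d' hb hb' hl hl' h h' =>
    exact .two b l _ _ b' l' _ _ hb hb' hl hl' (hC.inCtx _ _ _ _ h) (hC'.inCtx _ _ _ _ h')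

theorem InCtx.ite {s t b u v b' : Term S} (h : InCtx s t b b') :
    InCtx s t (Term.ite b u v) (Term.ite b' u v) := by
  have := InCtx.app .ite ![b, u, v] 0 b' h
  convert this using 2
  funext i; fin_cases i <;> rfl

theorem InCtx.ite_left {s t b u v u' : Term S} (h : InCtx s t u u') :
    InCtx s t (Term.ite b u v) (Term.ite b u' v) := by
  have := InCtx.app .ite ![b, u, v] 1 u' h
  convert this using 2
  funext i; fin_cases i <;> rfl

theorem InCtx.ite_right {s t b u v v' : Term S} (h : InCtx s t v v') :
    InCtx s t (Term.ite b u v) (Term.ite b u v') := by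
  have := InCtx.app .ite ![b, u, v] 2 v' h
  convert this using 2
  funext i; fin_cases i <;> rfl

theorem ok_box {a c b : Term S} : Ok β (.box a c b) ↔
    Ok True a ∧ Ok True c ∧ (b.Plain ∧ b.IfFree) ∧ b.WS ∧ b.IsBool := by
  simp only [Ok, boxed_box, WS, IsBool]
  tauto

theorem erase_of_pure {t : Term S} (h : t.Pure) : t.erase = t := by
  induction t with
  | name n => rfl
  | var n => rfl
  | app f a ih => simp only [Term.erase, fun i => ih i (pure_app.1 h i)]
  | box a c b => exact (not_pure_box h).elim
  | frz b => exact (not_pure_frz h).elim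

theorem Ok.erase {t : Term S} (h : Ok β t) : t.erase.Plain ∧ Srt β t.erase := by
  induction t generalizing β with
  | name n => exact ⟨plain_name, h.2⟩
  | var n => exact (Set.eq_empty_iff_forall_notMem.1 h.1.1 n (by simp)).elim
  | app f a ih =>
    have h' := ok_app.1 h
    exact ⟨plain_app.2 fun i => (ih i (h'.1 i)).1, srt_app.2 ⟨fun i => (ih i (h'.1 i)).2, h'.2⟩⟩
  | box a c b =>
    obtain ⟨-, -, hb, h1, h2⟩ := ok_box.1 h
    rw [Term.erase, erase_of_pure hb.1.1]
    exact ⟨hb.1, h1, fun _ => h2⟩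
  | frz b => exact (h.1.2.1 b (mem_st_self _)).elim

/-- A replacement inside a box is invisible after erasure; outside boxes the values are
compositional. -/
theorem InCtx.sem_erase {s t c d : Term S} (h : InCtx s t c d)
    (hst : sem V s.erase = sem V t.erase) : sem V c.erase = sem V d.erase := by
  induction h with
  | hole => exact hst
  | app f a i r _ ih =>
    simp only [Term.erase]
    refine sem_congr fun j => ?_
    by_cases e : j = i
    · subst e; simpa using ih
    · simp [Function.update_of_ne e]
  | boxL _ _ => rfl
  | boxR _ _ => rfl

/-- This provides the condition of the normalized form on the boxes: the arguments of a box are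
obtained by rewriting the original test, so their erasures keep its values, and the index has these
values too. -/
theorem PSteps.sem_erase {q q' : Term S × Term S} (h : PSteps ltU β q q') (V : Val S) :
    sem V q.1.erase = sem V q'.1.erase ∧ sem V q.2.erase = sem V q'.2.erase := by
  induction h with
  | refl => exact ⟨rfl, rfl⟩
  | tail _ h ih =>
    have hbox : ∀ b l : Term S, l.Plain → REq b.erase l →
        sem V b.erase = sem V (Term.box b b l).erase := fun b l hl h => by
      rw [Term.erase, erase_of_pure hl.1]; exact h.sem_eq V
    refine ⟨ih.1.trans ?_, ih.2.trans ?_⟩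
    · cases h with
      | left s t c d v h hst hs ht hd =>
        refine h.sem_erase ?_
        rw [erase_of_pure hs.1, erase_of_pure ht.1]; exact hst.sem_eq V
      | right => rfl
      | two b l c d b' l' c' d' hb hb' hl hl' h h' => exact h.sem_erase (hbox _ _ hl.1 hl.2.2.1)
    · cases h with
      | right s t c d v h hst hs ht hd =>
        refine h.sem_erase ?_
        rw [erase_of_pure hs.1, erase_of_pure ht.1]; exact hst.sem_eq V
      | left => rfl
      | two b l c d b' l' c' d' hb hb' hl hl' h h' => exact h'.sem_erase (hbox _ _ hl'.1 hl'.2.2.1)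

theorem ctx_box_left {c l u v : Term S} (h : Ok β (Term.ite (.box c c l) u v)) :
    Ctx True β fun x => Term.ite (.box x c l) u v where
  inCtx _ _ _ _ h := h.boxL.ite
  ok x hx := by
    have h1 := ok_ite.1 h
    have h2 := ok_box.1 h1.1
    exact ok_ite.2 ⟨ok_box.2 ⟨hx, h2.2⟩, h1.2⟩

theorem ctx_box_right {a c l u v : Term S} (h : Ok β (Term.ite (.box a c l) u v)) :
    Ctx True β fun x => Term.ite (.box a x l) u v where
  inCtx _ _ _ _ h := h.boxR.ite
  ok x hx := by
    have h1 := ok_ite.1 h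
    have h2 := ok_box.1 h1.1
    exact ok_ite.2 ⟨ok_box.2 ⟨h2.1, hx, h2.2.2⟩, h1.2⟩

theorem ctx_left {b u v : Term S} (h : Ok β (Term.ite b u v)) :
    Ctx β β fun x => Term.ite b x v where
  inCtx _ _ _ _ h := h.ite_left
  ok _ hx := ok_ite.2 ⟨(ok_ite.1 h).1, hx, (ok_ite.1 h).2.2⟩

theorem ctx_right {b u v : Term S} (h : Ok β (Term.ite b u v)) :
    Ctx β β fun x => Term.ite b u x where
  inCtx _ _ _ _ h := h.ite_right
  ok _ hx := ok_ite.2 ⟨(ok_ite.1 h).1, (ok_ite.1 h).2.1, hx⟩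

/-- Pairs with a semantic derivation can be rewritten, up to the values outside of `P` and `P'`, to
pairs that follow the case distinctions. -/
def Rewrites (ltU : Term S → Term S → Prop) (T : TT S) (A : BT S) : Prop :=
  ∀ (β : Prop) (P P' : Set (Val S)) (s s' : Term S), s.Plain ∧ Srt β s → s'.Plain ∧ Srt β s' →
    Der T P P' s s' → ∃ v d : Term S × Term S, ((v.1.Plain ∧ Srt β v.1) ∧ v.2.Plain ∧ Srt β v.2) ∧
      ((∀ V ∈ P, sem V s = sem V v.1) ∧ ∀ V ∈ P', sem V s' = sem V v.2) ∧
      PSteps ltU β v d ∧ A.Fits d ∧ Ok β d.1 ∧ Ok β d.2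

/-- When all valuations are allowed, agreement of the values is `=_R` by completeness, so one step
of `R□` at the root on each side replaces the pair by the intermediate one. -/
theorem Rewrites.full {T : TT S} {A : BT S} (h : Rewrites ltU T A) {s s' : Term S}
    (hs : s.Plain ∧ Srt β s) (hs' : s'.Plain ∧ Srt β s') (hd : Der T Set.univ Set.univ s s') :
    ∃ d, PSteps ltU β (s, s') d ∧ A.Fits d ∧ Ok β d.1 ∧ Ok β d.2 := by
  obtain ⟨v, d, ⟨h1, h2⟩, ⟨h3, h4⟩, h5, h6, h7⟩ := h β _ _ s s' hs hs' hd
  refine ⟨d, .head (.left s v.1 s v.1 s' .hole ?_ hs.1 h1.1 (ok_of_plain h1.1 h1.2))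
    (.head (.right s' v.2 s' v.2 v.1 .hole ?_ hs'.1 h2.1 (ok_of_plain h2.1 h2.2)) h5), h6, h7⟩
  · exact .of_sem hs.1 h1.1 hs.2.1 h1.2.1 fun V => h3 V trivial
  · exact .of_sem hs'.1 h2.1 hs'.2.1 h2.2.1 fun V => h4 V trivial

/-- The normal form of a test. -/
theorem CsTest.exists_index {b : Term S} (hb : CsTest b) : ∃ l : Term S,
    (l.Plain ∧ l.IfFree ∧ REq b.erase l ∧ RNormal ltU l) ∧ (l.WS ∧ l.IsBool) ∧
      ∀ V, sem V b = sem V l := by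
  obtain ⟨V0⟩ := (inferInstance : Nonempty (Val S))
  obtain ⟨h1, h2, h3, h4⟩ := hb
  have hl : (sem V0 b).Plain := by
    rw [← dt_sem h1.1]; exact DT.sem_all (dt_all_plain h1)
  have hn : NLeaf (sem V0 b) := nleaf_sem b
  have hi := hn.ifFree hl.1
  have hs : ∀ V, sem V b = sem V (sem V0 b) := fun V => by
    rw [sem_of_nleaf hl.1 hn]; exact sem_ifFree _ _ h1.1 h3
  have hw := hl.1.ws_of_ifFree hi
  refine ⟨_, ⟨hl, hi, ?_, hn.rnormal hl.1⟩, ⟨hw, sem_isBool h1.1 h2 h4 V0⟩, hs⟩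
  rw [erase_of_pure h1.1]
  exact .of_sem h1 hl h2 hw hs

/-- At a node, the two subderivations supply `u` for the valuations that make the test true and `v`
for the others, and `ite b u v` has the right values in both cases. The test is boxed while it is
still the original one, then the two arguments of the box are rewritten by its own derivations in
the two cases, and finally the branches. The box obtained depends on the derivation only, not on the
pair being rewritten, so all components share it, as `CS□` requires. -/
theorem TT.WF.exists_bt [IsStrictTotalOrder (Term S) ltU] {T : TT S} (hT : T.WF ltU ltS) :
    ∃ A : BT S, A.WF ltU ltS ∧ Rewrites ltU T A := by
  induction T with
  | leaf K p μ =>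
    have hp : Valid ltU ltS K p := hT
    refine ⟨.leaf K p μ, hp, fun β P P' s s' hs hs' ⟨T, h1, h2, h3, h4⟩ => ?_⟩
    -- For a pair rewritten inside a box the sort `bool` has to be preserved, so its symbolic term
    -- is replaced by a boolean one with the same values.
    have hbool : ∃ T' : Term S, Srt β T' ∧ Sy {k | k ∈ K} (rds p) (hh p) True T' ∧
        (∀ V ∈ P, sem V s = sem V (T'.subst (call false p))) ∧
        ∀ V ∈ P', sem V s' = sem V ((T'.subst (call true p)).rename μ) := by
      by_cases hβ : β
      · obtain ⟨T', g1, g2, g3, g4⟩ := exists_bool hp h1 h2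
        refine ⟨T', ⟨g1, fun _ => g2⟩, g3, fun V hV => ?_, fun V hV => ?_⟩
        · rw [g4 false V, h3 V hV]
          rw [← h3 V hV]
          exact sem_isBool hs.1.1 hs.2.1 (hs.2.2 hβ) V
        · rw [h4 V hV]
          refine (sem_rename_eq (hp.call_pure g3 _) (hp.call_pure h2 _) μ (g4 true _ ?_)).symm
          have := sem_isBool hs'.1.1 hs'.2.1 (hs'.2.2 hβ) V
          rw [h4 V hV, sem_rename V μ (hp.call_pure h2 _)] at this
          exact (isBool_rename μ).1 this
      · exact ⟨T, ⟨h1, fun h => (hβ h).elim⟩, h2, h3, h4⟩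
    obtain ⟨T', g1, g2, g3, g4⟩ := hbool
    obtain ⟨t, k1, k2, -, -, k3, k4⟩ := exists_tr g2 g1
    have hg : ∀ i, (t.subst (call i p)).Plain ∧ Srt β (t.subst (call i p)) := fun i => by
      have := (hp.ov i).plain_ws
      rw [oh_sd] at this
      exact ⟨plain_subst k2.pure fun x hx => (this x (k2.vars hx)).1,
        ws_subst k2.pure k4.1 fun x hx => (this x (k2.vars hx)).2,
        fun hβ => isBool_subst k2.pure (k4.2 hβ)⟩
    have hg1 := hg false
    have hg2 : ((t.subst (call true p)).rename μ).Plain ∧ Srt β ((t.subst (call true p)).rename μ) :=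
      ⟨plain_rename μ (hg true).1, (ws_rename μ).2 (hg true).2.1,
        fun hβ => (isBool_rename μ).2 ((hg true).2.2 hβ)⟩
    have he : ∀ i V, sem V (t.subst (call i p)) = sem V (T'.subst (call i p)) := fun i V =>
      sem_subst_of_eq k2.pure g2.pure k3 (fun _ _ _ => rfl) V
    refine ⟨inst p μ t, inst p μ t, ⟨hg1, hg2⟩, ⟨fun V hV => ?_, fun V hV => ?_⟩, .refl,
      ⟨t, ⟨k2, k1⟩, rfl⟩, ok_of_plain hg1.1 hg1.2, ok_of_plain hg2.1 hg2.2⟩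
    · rw [g3 V hV]; exact (he false V).symm
    · rw [g4 V hV]
      exact (sem_rename_eq (hg true).1.1 (hp.call_pure g2 _) μ (he true _)).symm
  | node b b' T1 T2 ih1 ih2 =>
    obtain ⟨⟨hb, hb'⟩, ⟨hd1, hd2⟩, hT1, hT2⟩ := hT
    obtain ⟨A1, hA1, hr1⟩ := ih1 hT1
    obtain ⟨A2, hA2, hr2⟩ := ih2 hT2
    have hbs : b.Plain ∧ Srt True b := ⟨hb.1, hb.2.1, fun _ => hb.2.2.2⟩
    have hbs' : b'.Plain ∧ Srt True b' := ⟨hb'.1, hb'.2.1, fun _ => hb'.2.2.2⟩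
    obtain ⟨e1, p1, f1, o1, o1'⟩ := hr1.full hbs hbs' hd1
    obtain ⟨e2, p2, f2, o2, o2'⟩ := hr2.full hbs hbs' hd2
    obtain ⟨l, hl, hlb, hls⟩ := hb.exists_index (ltU := ltU)
    obtain ⟨l', hl', hlb', hls'⟩ := hb'.exists_index (ltU := ltU)
    have hindex : ∀ {b e l : Term S}, b.Plain → l.Plain → l.WS → (∀ V, sem V b = sem V l) →
        Ok True e → (∀ V, sem V b.erase = sem V e.erase) → REq e.erase l := by
      intro b e l h1 h2 h3 h4 h5 h6
      refine .of_sem h5.erase.1 h2 h5.erase.2.1 h3 fun V => ?_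
      rw [← h6 V, erase_of_pure h1.1, h4 V]
    refine ⟨.node e1 e2 (l, l') A1 A2, ⟨⟨⟨⟨hl.1, hl.2.1⟩, hl.2.2.2,
      hindex hb.1 hl.1 hlb.1 hls o1 fun V => (p1.sem_erase V).1,
      hindex hb.1 hl.1 hlb.1 hls o2 fun V => (p2.sem_erase V).1⟩,
      ⟨⟨hl'.1, hl'.2.1⟩, hl'.2.2.2,
      hindex hb'.1 hl'.1 hlb'.1 hls' o1' fun V => (p1.sem_erase V).2,
      hindex hb'.1 hl'.1 hlb'.1 hls' o2' fun V => (p2.sem_erase V).2⟩⟩, ⟨f1, f2⟩, hA1, hA2⟩, ?_⟩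
    intro β P P' s s' hs hs' hd
    obtain ⟨u, d, ⟨u1, u2⟩, ⟨u3, u4⟩, u5, u6, u7, u8⟩ := hr1 β _ _ s s' hs hs' hd.1
    obtain ⟨v, d', ⟨v1, v2⟩, ⟨v3, v4⟩, v5, v6, v7, v8⟩ := hr2 β _ _ s s' hs hs' hd.2
    have hplain : ∀ {b u v : Term S}, b.Plain ∧ Srt True b → u.Plain ∧ Srt β u → v.Plain ∧ Srt β v →
        (Term.ite b u v).Plain ∧ Srt β (Term.ite b u v) := fun hb hu hv =>
      ⟨plain_app.2 fun i => by fin_cases i; exacts [hb.1, hu.1, hv.1],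
        srt_ite.2 ⟨hb.2, hu.2, hv.2⟩⟩
    have ob := ok_of_plain hbs.1 hbs.2
    have ob' := ok_of_plain hbs'.1 hbs'.2
    have bx : ∀ {a c : Term S}, Ok True a → Ok True c → Ok True (.box a c l) := fun ha hc =>
      ok_box.2 ⟨ha, hc, ⟨hl.1, hl.2.1⟩, hlb⟩
    have bx' : ∀ {a c : Term S}, Ok True a → Ok True c → Ok True (.box a c l') := fun ha hc =>
      ok_box.2 ⟨ha, hc, ⟨hl'.1, hl'.2.1⟩, hlb'⟩
    have ou := ok_of_plain u1.1 u1.2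
    have ou' := ok_of_plain u2.1 u2.2
    have ov := ok_of_plain v1.1 v1.2
    have ov' := ok_of_plain v2.1 v2.2
    refine ⟨(Term.ite b u.1 v.1, Term.ite b' u.2 v.2), (Term.ite (.box e1.1 e2.1 l) d.1 d'.1,
      Term.ite (.box e1.2 e2.2 l') d.2 d'.2), ⟨hplain hbs u1 v1, hplain hbs' u2 v2⟩,
      ⟨fun V hV => ?_, fun V hV => ?_⟩, ?_, ⟨d, d', u6, v6, rfl⟩,
      ok_ite.2 ⟨bx o1 o2, u7, v7⟩, ok_ite.2 ⟨bx' o1' o2', u8, v8⟩⟩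
    · rw [sem_ite]
      split_ifs with h
      · exact u3 V ⟨hV, h⟩
      · exact v3 V ⟨hV, h⟩
    · rw [sem_ite]
      split_ifs with h
      · exact u4 V ⟨hV, h⟩
      · exact v4 V ⟨hV, h⟩
    · refine .head (.two b l _ (Term.ite (.box b b l) u.1 v.1) b' l' _
        (Term.ite (.box b' b' l') u.2 v.2) ⟨hb.1.boxed, hb.2.2⟩ ⟨hb'.1.boxed, hb'.2.2⟩ hl hl'
        InCtx.hole.ite InCtx.hole.ite) ?_
      have w1 := p1.ctx (ctx_box_left (ok_ite.2 ⟨bx ob ob, ou, ov⟩))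
        (ctx_box_left (ok_ite.2 ⟨bx' ob' ob', ou', ov'⟩))
      have w2 := p2.ctx (ctx_box_right (ok_ite.2 ⟨bx o1 ob, ou, ov⟩))
        (ctx_box_right (ok_ite.2 ⟨bx' o1' ob', ou', ov'⟩))
      have w3 := u5.ctx (ctx_left (ok_ite.2 ⟨bx o1 o2, ou, ov⟩))
        (ctx_left (ok_ite.2 ⟨bx' o1' o2', ou', ov'⟩))
      have w4 := v5.ctx (ctx_right (ok_ite.2 ⟨bx o1 o2, u7, ov⟩))
        (ctx_right (ok_ite.2 ⟨bx' o1' o2', u8, ov'⟩))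
      exact w1.trans (w2.trans (w3.trans w4))

theorem orderedStrategy_eq : orderedStrategy =
    (letter .twobox + letter .rbox)∗ * ((letter .csbox)∗ * leafStrategy) := by
  simp only [orderedStrategy, leafStrategy, mul_assoc]

end CCSA

theorem mainTheorem6 (S : CCSA.Signature)
    (ltU ltS : CCSA.Term S → CCSA.Term S → Prop)
    (hU : IsStrictTotalOrder (CCSA.Term S) ltU) (hS : IsStrictTotalOrder (CCSA.Term S) ltS)
    (Γ : CCSA.Formula S)
    (hΓ : ∀ p ∈ Γ, (p.1.Plain ∧ p.1.WS) ∧ (p.2.Plain ∧ p.2.WS))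
    (h : CCSA.Fragment ltU ltS CCSA.sourceStrategy Γ) :
    ∃ P : CCSA.Prf ltU ltS Γ, P.words ≤ CCSA.orderedStrategy ∧ P.NPF := by
  obtain ⟨D, hD⟩ := h
  obtain ⟨T, hT, hTΓ⟩ := D.exists_der fun w hw => CCSA.src_of_mem (hD hw)
  obtain ⟨A, hA, hr⟩ := hT.exists_bt
  obtain ⟨Δ, h1, h2⟩ := CCSA.exists_steps (ltU := ltU)
    (Q := fun r => r = .twobox ∨ r = .rbox) (by simp) (G := A.Fits) Γ fun q hq => by
      obtain ⟨g1, g2⟩ := hΓ q hq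
      obtain ⟨d, g3, g4, -⟩ := hr.full (β := False) ⟨g1.1, g1.2, False.elim⟩
        ⟨g2.1, g2.2, False.elim⟩ (hTΓ q hq g1 g2)
      exact ⟨{d}, g3.steps, fun q hq => Multiset.mem_singleton.1 hq ▸ g4⟩
  rw [CCSA.orderedStrategy_eq]
  exact h1.npf (hA.exists_prf Δ h2)
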